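/- A \emph{bi-Lagrangian manifold} is a smooth manifold $M$ with a symplectic form $\omega$ and two transversal involutive Lagrangian distributions $D_1,D_2$. Let $F$ be the endomorphism of $TM$ equal to $+1$ on $D_1$ and $-1$ on $D_2$; the \emph{canonical neutral metric} is $g(X,Y)=\omega(FX,Y)$, so that $\omega(X,Y)=g(FX,Y)$, and $M$ is \emph{flat} if the curvature of the Levi-Civita connection of $g$ vanishes. For $p\in M$ let $N(p)\in\mathbb N\cup\{\infty\}$ be the number of common points of the two leaves through $p$, and let $L_i(p)$ be the leaf of $D_i$ through $p$. The point $p$ has the \emph{trivial intersection property} if $N(p)=1$. All manifolds in (1)--(8) and (12) are connected, Hausdorff and second countable. \textbf{(1) Independence.} For every $n\ge 1$, each of the eight combinations of truth values of "$M$ is compact", "$M$ is flat", "$N(p)=1$ for all $p\in M$" is realized by a bi-Lagrangian manifold of dimension $2n$. \textbf{Surfaces.} A surface is described by $g$ and $F$. (2) The Minkowski plane $\mathbb R^2$, $g=-dx^2+dy^2$, with the foliations by the lines parallel to the diagonals $x=y$ and $x=-y$, is non-compact and flat with $N\equiv 1$. (3) Let $T_\alpha$ be the quotient of the Minkowski plane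 by the lattice obtained from $\mathbb Z^2$ by the rotation of angle $\alpha$. It is compact and flat; $N\equiv 1$ if $\alpha=\pi/4$, $N\equiv 2$ if $\alpha=0$, and, for every $p$, $N(p)$ is finite if and only if the slope of the line $x=y$ with respect to the rotated axes is rational or infinite, i.e. $m(\cos\alpha-\sin\alpha)=k(\cos\alpha+\sin\alpha)$ for some integers $(m,k)\ne(0,0)$. (4) The Lorentz cylinder, quotient of the Minkowski plane by $(x,y)\mapsto(x+2\pi,y)$, is non-compact and flat with $N\equiv\infty$. (5) For $r>0$ the ruled hyperboloid $\{-x_1^2+x_2^2+x_3^2=r^2\}$ with the metric induced by $-dx_1^2+dx_2^2+dx_3^2$, and with $D_1$, $D_2$ spanned at $x$ by $(r^2+x_1^2,\;x_1x_2\mp r x_3,\;x_1x_3\pm r x_2)$ (upper sign for $D_1$), is a non-compact non-flat bi-Lagrangian surface with $N\equiv 1$. The leaves are the straight lines of the two rulings. If $p$, $-p$ are antipodal points of the equator $x_1=0$, then $L_1(p)\cap L_2(-p)=\emptyset$. (6) The punctured plane $P=\mathbb R^2\setminus\{0\}$ with $g=2\,dx\,dy/(x^2+y^2)$ ($2\,dx\,dy=dx\otimes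 dy+dy\otimes dx$), $D_1$ horizontal and $D_2$ vertical, is non-compact and non-flat with $N\equiv1$, and $L_1(a,0)\cap L_2(b,y)=\emptyset$ for $a>0>b$ and all $y$. The Clifton--Pohl torus $T=P/\langle x\mapsto 2x\rangle$ is compact and non-flat; $N=1$ at the classes of the points of the coordinate axes and $N=\infty$ at all other points, so $N$ is not constant; $L_1$ (resp. $L_2$) through the class of $(x,y)$ is compact if and only if $y=0$ (resp. $x=0$), and no compact leaf of $D_1$ meets a compact leaf of $D_2$. The Clifton--Pohl cylinder $C$, with polar coordinates $(\varrho,\theta)$, $\varrho>0$, $\theta\in\mathbb R$ (not modulo $2\pi$), where $(\varrho,\theta)$ is identified with $(2^k\varrho,\theta)$, $k\in\mathbb Z$, and with the structure for which $(\varrho,\theta)\mapsto[\varrho\cos\theta,\varrho\sin\theta]\in T$ is a local isomorphism, is non-compact and non-flat; $N(\varrho,\theta)=1$ if $\sin\theta\cos\theta=0$ and $N(\varrho,\theta)=\infty$ otherwise. (7) For $m>0$ the Schwarzschild half-plane $\{(t,r):r>2m\}$, $g=-h\,dt^2+h^{-1}dr^2$, $h=1-2m/r$, with its two null foliations, is non-compact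 and non-flat; any leaf of one foliation meets any leaf of the other one in exactly one point, so $N\equiv1$. \textbf{Arbitrary dimension.} (8) Let $0\le n\le d$, $d\ge1$ and $G=\mathbb T^n\times\mathbb R^{d-n}$, $\mathbb T^n=\mathbb R^n/\mathbb Z^n$. The manifold $G\times G$, which is compact if and only if $n=d$, carries a flat bi-Lagrangian structure, with the metric $g((a,b),(a',b'))=\langle a,b'\rangle+\langle b,a'\rangle$, and also a non-flat one, both with leaves $\{a\}\times G$ and $G\times\{b\}$, hence with $N\equiv1$. (9) The product of two bi-Lagrangian manifolds (connected, Hausdorff and second countable), with $g=g_1+g_2$ and $F=(F_1,F_2)$, is bi-Lagrangian; it is flat if and only if both factors are, and $N(p,q)=N(p)N(q)$. (In particular $T_{\pi/4}\times T_0$ is compact and flat with $N\equiv2$; $T\times T$ is compact, non-flat, and $\mathbb R^2\times T$ non-compact, non-flat, and they have points with $N\neq1$.) (10) Let $M=\mathbb R^n/\Gamma$ be a Hausdorff flat Riemannian manifold, $\Gamma$ a group of isometries of $\mathbb R^n$ for which $\pi:\mathbb R^n\to M$ is a local isometry. Then $TM$ carries the bi-Lagrangian structure for which $d\pi:\mathbb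 R^n\times\mathbb R^n\to TM$ is a local isomorphism, where $\mathbb R^n\times\mathbb R^n$ has the metric of (8), $D_1=\mathbb R^n\times0$ (horizontal) and $D_2=0\times\mathbb R^n$ (vertical). It is flat, non-compact if $n\ge1$, the leaves of $D_2$ are the fibres of $TM$, and $N(d\pi_x(v))$ is the number of elements of the orbit of $v$ under the group of the linear parts of the elements of $\Gamma$. (11) For $n\ge1$, (10) applies to the compact flat torus $M=\mathbb R^n/\mathbb Z^n$, and gives a non-compact flat manifold $TM$ with $N\equiv1$. For $n\ge3$ it applies to a compact manifold $M=\mathbb R^n/\Gamma$, where $\Gamma$ is generated by $\mathbb Z^n$ and by $(x,y,z,w)\mapsto(x+\frac12,-y+\frac12,-z,w)$ and $(x,y,z,w)\mapsto(-x,y+\frac12,-z+\frac12,w)$, $w\in\mathbb R^{n-3}$ (for $n=3$ the Hantzsche--Wendt manifold), and gives a non-compact flat manifold $TM$ of dimension $2n$ with $N(d\pi_x(v))=4$ whenever at least two of $v_1,v_2,v_3$ are non-zero. (12) For $n\ge1$ and $c\ne0$, the paracomplex projective space $P_n(B)=\{(u,v)\in\mathbb R^{n+1}\times\mathbb R^{n+1}:\langle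 u,u\rangle=\langle v,v\rangle,\ \langle u,v\rangle=1\}$, with the metric $$g(X,Y)=\tfrac2c\big(\langle X_u,Y_v\rangle+\langle Y_u,X_v\rangle-\langle X_u,v\rangle\langle u,Y_v\rangle-\langle Y_u,v\rangle\langle u,X_v\rangle\big),\qquad X=(X_u,X_v),\ Y=(Y_u,Y_v),$$ and $D_1=\{X: X_v\in\mathbb Rv\}$, $D_2=\{X: X_u\in\mathbb Ru\}$, is a non-compact non-flat bi-Lagrangian manifold of dimension $2n$ with $N\equiv1$. -/

import Mathlib

open scoped Manifold ContDiff
open Set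

noncomputable section

section Manifolds

variable {E : Type} [NormedAddCommGroup E] [NormedSpace ℝ E] {H : Type} [TopologicalSpace H]
  (I : ModelWithCorners ℝ E H) {M : Type} [TopologicalSpace M] [ChartedSpace H M]

/-- The tangent vector of `M` at the point with coordinates `y`, in the chart around `p₀`, whose
components in that chart are the components of `a : E`. -/
def chartVec (p₀ : M) (y : E) (a : E) : TangentSpace I ((extChartAt I p₀).symm y) :=
  mfderiv 𝓘(ℝ, E) I (extChartAt I p₀).symm y a

/-- The component `B(∂_a, ∂_b)`, in the chart around `p₀`, of a field `B` of bilinear forms, as a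
function of the coordinates `y`. -/
def coordForm (B : (p : M) → LinearMap.BilinForm ℝ (TangentSpace I p)) (p₀ : M) (y a b : E) : ℝ :=
  B ((extChartAt I p₀).symm y) (chartVec I p₀ y a) (chartVec I p₀ y b)

/-- The components `A(∂_a)`, in the chart around `p₀`, of a field `A` of endomorphisms of the
tangent spaces. -/
def coordEnd (A : (p : M) → TangentSpace I p →ₗ[ℝ] TangentSpace I p) (p₀ : M) (y a : E) : E :=
  mfderiv I 𝓘(ℝ, E) (extChartAt I p₀) ((extChartAt I p₀).symm y)
    (A ((extChartAt I p₀).symm y) (chartVec I p₀ y a))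

/-- A distribution is involutive: the Lie bracket of two smooth vector fields (given by their
components `X`, `Y` on the domain of a chart) which are tangent to the distribution is tangent
to it. -/
def IsInvolutive (D : (p : M) → Submodule ℝ (TangentSpace I p)) : Prop :=
  ∀ p₀ : M, ∀ X Y : E → E,
    ContDiffOn ℝ ∞ X (extChartAt I p₀).target → ContDiffOn ℝ ∞ Y (extChartAt I p₀).target →
    (∀ y ∈ (extChartAt I p₀).target, chartVec I p₀ y (X y) ∈ D ((extChartAt I p₀).symm y)) →
    (∀ y ∈ (extChartAt I p₀).target, chartVec I p₀ y (Y y) ∈ D ((extChartAt I p₀).symm y)) →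
    ∀ y ∈ (extChartAt I p₀).target,
      chartVec I p₀ y (VectorField.lieBracket ℝ X Y y) ∈ D ((extChartAt I p₀).symm y)

/-- The leaf through `p` of the foliation tangent to the involutive distribution `D`: the points
that can be joined to `p` by a smooth curve tangent to `D`. -/
def leaf (D : (p : M) → Submodule ℝ (TangentSpace I p)) (p : M) : Set M :=
  {q | ∃ γ : ℝ → M, ContMDiff 𝓘(ℝ, ℝ) I ∞ γ ∧ γ 0 = p ∧ γ 1 = q ∧
    ∀ t : ℝ, mfderiv 𝓘(ℝ, ℝ) I γ t (1 : ℝ) ∈ D (γ t)}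

/-- `Γ(∂_a, ∂_b) = ∇_{∂_a} ∂_b` in the chart around `p₀`, for the Levi-Civita connection `∇` of the
(nondegenerate) metric `g`, defined by the Koszul formula
`2 g(∇_{∂_a} ∂_b, ∂_c) = ∂_a g(∂_b, ∂_c) + ∂_b g(∂_a, ∂_c) - ∂_c g(∂_a, ∂_b)`. -/
def christoffel (g : (p : M) → LinearMap.BilinForm ℝ (TangentSpace I p)) (p₀ : M) (y a b : E) : E :=
  Classical.epsilon fun z : E => ∀ c : E,
    2 * coordForm I g p₀ y z c =
      fderiv ℝ (fun x => coordForm I g p₀ x b c) y a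
      + fderiv ℝ (fun x => coordForm I g p₀ x a c) y b
      - fderiv ℝ (fun x => coordForm I g p₀ x a b) y c

/-- The curvature `R(∂_a, ∂_b) ∂_c = ∇_{∂_a} ∇_{∂_b} ∂_c - ∇_{∂_b} ∇_{∂_a} ∂_c` of the Levi-Civita
connection of `g`, in the chart around `p₀`. -/
def curvature (g : (p : M) → LinearMap.BilinForm ℝ (TangentSpace I p)) (p₀ : M)
    (y a b c : E) : E :=
  fderiv ℝ (fun x => christoffel I g p₀ x b c) y a
  - fderiv ℝ (fun x => christoffel I g p₀ x a c) y b
  + christoffel I g p₀ y a (christoffel I g p₀ y b c)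
  - christoffel I g p₀ y b (christoffel I g p₀ y a c)

variable (M) in
/-- A bi-Lagrangian structure on `M`: a symplectic form `form` and two transversal involutive
Lagrangian distributions `D₁`, `D₂`. The field `F` is the associated almost product structure,
which is determined by `D₁` and `D₂`; its smoothness is that of the two distributions. -/
structure BiLagrangianStructure where
  form : (p : M) → LinearMap.BilinForm ℝ (TangentSpace I p)
  D₁ : (p : M) → Submodule ℝ (TangentSpace I p)
  D₂ : (p : M) → Submodule ℝ (TangentSpace I p)
  F : (p : M) → TangentSpace I p →ₗ[ℝ] TangentSpace I p
  alternating : ∀ p v, form p v v = 0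
  nondegenerate : ∀ p v, (∀ w, form p v w = 0) → v = 0
  smooth_form : ∀ p₀ : M, ∀ a b : E,
    ContDiffOn ℝ ∞ (fun y => coordForm I form p₀ y a b) (extChartAt I p₀).target
  /-- `dω = 0` -/
  closed : ∀ p₀ : M, ∀ y ∈ (extChartAt I p₀).target, ∀ a b c : E,
    fderiv ℝ (fun x => coordForm I form p₀ x b c) y a
    + fderiv ℝ (fun x => coordForm I form p₀ x c a) y b
    + fderiv ℝ (fun x => coordForm I form p₀ x a b) y c = 0
  transversal : ∀ p, IsCompl (D₁ p) (D₂ p)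
  lagrangian₁ : ∀ p, ∀ v ∈ D₁ p, ∀ w ∈ D₁ p, form p v w = 0
  lagrangian₂ : ∀ p, ∀ v ∈ D₂ p, ∀ w ∈ D₂ p, form p v w = 0
  F_D₁ : ∀ p, ∀ v ∈ D₁ p, F p v = v
  F_D₂ : ∀ p, ∀ v ∈ D₂ p, F p v = -v
  smooth_F : ∀ p₀ : M, ∀ a : E,
    ContDiffOn ℝ ∞ (fun y => coordEnd I F p₀ y a) (extChartAt I p₀).target
  involutive₁ : IsInvolutive I D₁
  involutive₂ : IsInvolutive I D₂

end Manifolds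

namespace BiLagrangianStructure

section

variable {E : Type} [NormedAddCommGroup E] [NormedSpace ℝ E] {H : Type} [TopologicalSpace H]
  {I : ModelWithCorners ℝ E H} {M : Type} [TopologicalSpace M] [ChartedSpace H M]
  {E' : Type} [NormedAddCommGroup E'] [NormedSpace ℝ E'] {H' : Type} [TopologicalSpace H']
  {I' : ModelWithCorners ℝ E' H'} {M' : Type} [TopologicalSpace M'] [ChartedSpace H' M']

/-- The canonical neutral metric `g(X, Y) = ω(F X, Y)`. -/
def g (B : BiLagrangianStructure I M) (p : M) : LinearMap.BilinForm ℝ (TangentSpace I p) :=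
  (B.form p).comp (B.F p) LinearMap.id

/-- The curvature tensor of the Levi-Civita connection of the canonical metric vanishes. -/
def IsFlat (B : BiLagrangianStructure I M) : Prop :=
  ∀ p₀ : M, ∀ y ∈ (extChartAt I p₀).target, ∀ a b c : E, curvature I B.g p₀ y a b c = 0

/-- The leaf through `p` of the first foliation. -/
def leaf₁ (B : BiLagrangianStructure I M) (p : M) : Set M := leaf I B.D₁ p

/-- The leaf through `p` of the second foliation. -/
def leaf₂ (B : BiLagrangianStructure I M) (p : M) : Set M := leaf I B.D₂ p

/-- The number `N(p) ∈ ℕ ∪ {∞}` of common points of the two leaves through `p`. -/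
def N (B : BiLagrangianStructure I M) (p : M) : ℕ∞ := (B.leaf₁ p ∩ B.leaf₂ p).encard

/-- `ψ` exhibits the bi-Lagrangian manifold `(M, B)` as the quotient of the open set `U`, endowed
with the metric `G` and the almost product structure `Φ` (which determine the symplectic form
`G(Φ ·, ·)`), by the equivalence relation `r`. If `r` is equality, then `ψ` is an isomorphism
from `(U, G, Φ)` to `(M, B)`. -/
structure IsQuotientOf (B : BiLagrangianStructure I M) {V : Type} [NormedAddCommGroup V]
    [NormedSpace ℝ V] (U : Set V) (G : V → V → V → ℝ) (Φ : V → V → V) (r : V → V → Prop)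
    (ψ : V → M) : Prop where
  isOpen : IsOpen U
  localDiffeo : IsLocalDiffeomorphOn 𝓘(ℝ, V) I ∞ ψ U
  surjective : ψ '' U = univ
  fibers : ∀ x ∈ U, ∀ y ∈ U, ψ x = ψ y ↔ r x y
  metric : ∀ x ∈ U, ∀ a b : V,
    B.g (ψ x) (mfderiv 𝓘(ℝ, V) I ψ x a) (mfderiv 𝓘(ℝ, V) I ψ x b) = G x a b
  product : ∀ x ∈ U, ∀ a : V,
    B.F (ψ x) (mfderiv 𝓘(ℝ, V) I ψ x a) = mfderiv 𝓘(ℝ, V) I ψ x (Φ x a)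

/-- `f` is a local isomorphism of bi-Lagrangian manifolds. -/
structure IsLocalIso (B : BiLagrangianStructure I M) (B' : BiLagrangianStructure I' M')
    (f : M → M') : Prop where
  localDiffeo : IsLocalDiffeomorph I I' ∞ f
  metric : ∀ p v w, B'.g (f p) (mfderiv I I' f p v) (mfderiv I I' f p w) = B.g p v w
  product : ∀ p v, B'.F (f p) (mfderiv I I' f p v) = mfderiv I I' f p (B.F p v)

/-- `ι` identifies `M` with the embedded submanifold `S` of `V`. -/
structure _root_.IsEmbeddedOnto (I : ModelWithCorners ℝ E H) {V : Type} [NormedAddCommGroup V]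
    [NormedSpace ℝ V] (S : Set V) (ι : M → V) : Prop where
  smooth : ContMDiff I 𝓘(ℝ, V) ∞ ι
  immersion : ∀ p, Function.Injective (mfderiv I 𝓘(ℝ, V) ι p)
  embedding : Topology.IsEmbedding ι
  range_eq : range ι = S

end

end BiLagrangianStructure

/-- A connected bi-Lagrangian manifold of dimension `d`, without boundary, Hausdorff and second
countable. -/
structure BiLagrangianManifold (d : ℕ) where
  E : Type
  [normedAddCommGroup : NormedAddCommGroup E]
  [normedSpace : NormedSpace ℝ E]
  [finiteDimensional : FiniteDimensional ℝ E]
  dim_eq : Module.finrank ℝ E = d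
  H : Type
  [topH : TopologicalSpace H]
  I : ModelWithCorners ℝ E H
  [boundaryless : I.Boundaryless]
  M : Type
  [topM : TopologicalSpace M]
  [charted : ChartedSpace H M]
  [isManifold : IsManifold I ∞ M]
  [t2 : T2Space M]
  [secondCountable : SecondCountableTopology M]
  [connected : ConnectedSpace M]
  str : BiLagrangianStructure I M

attribute [instance] BiLagrangianManifold.normedAddCommGroup BiLagrangianManifold.normedSpace
  BiLagrangianManifold.finiteDimensional BiLagrangianManifold.topH
  BiLagrangianManifold.boundaryless BiLagrangianManifold.topM BiLagrangianManifold.charted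
  BiLagrangianManifold.isManifold BiLagrangianManifold.t2 BiLagrangianManifold.secondCountable
  BiLagrangianManifold.connected

/-! ### Surfaces -/

/-- The Minkowski metric `-dx² + dy²`. Its almost product structure is the interchange of the
coordinates, with eigenspaces the diagonals `x = y` and `x = -y`. -/
def minkowskiMetric (_ a b : ℝ × ℝ) : ℝ := -(a.1 * b.1) + a.2 * b.2

/-- The almost product structure of the Minkowski plane. -/
def minkowskiProduct (_ a : ℝ × ℝ) : ℝ × ℝ := (a.2, a.1)

/-- Congruence modulo the lattice obtained from `ℤ²` by the rotation of angle `α`. -/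
def rotatedLatticeRel (α : ℝ) (x y : ℝ × ℝ) : Prop :=
  ∃ m k : ℤ, y = x + (m * Real.cos α - k * Real.sin α, m * Real.sin α + k * Real.cos α)

/-- `x = (s, t)` and `y = (s + 2 k π, t)`. -/
def cylinderRel (x y : ℝ × ℝ) : Prop := ∃ k : ℤ, y = x + (2 * Real.pi * k, 0)

/-- The metric `2 dx dy / (x² + y²)` of the punctured plane, with `2 dx dy = dx ⊗ dy + dy ⊗ dx`. -/
def puncturedMetric (x a b : ℝ × ℝ) : ℝ := (a.1 * b.2 + a.2 * b.1) / (x.1 ^ 2 + x.2 ^ 2)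

/-- The almost product structure with eigenspaces the horizontal (`+1`) and vertical (`-1`)
lines. -/
def puncturedProduct (_ a : ℝ × ℝ) : ℝ × ℝ := (a.1, -a.2)

/-- `y` is the image of `x` under a power of the homothety of ratio `2`. -/
def homothetyRel (x y : ℝ × ℝ) : Prop := ∃ k : ℤ, y = ((2 : ℝ) ^ k) • x

/-- In polar coordinates `(r, θ)`, with `θ ∈ ℝ` not taken modulo `2π`: the homotheties of ratio a
power of `2`. -/
def polarHomothetyRel (x y : ℝ × ℝ) : Prop := ∃ k : ℤ, y = ((2 : ℝ) ^ k * x.1, x.2)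

/-- The Schwarzschild metric `-h dt² + h⁻¹ dr²`, `h = 1 - 2m/r`, at the point `x = (t, r)`. -/
def schwarzschildMetric (m : ℝ) (x a b : ℝ × ℝ) : ℝ :=
  -(1 - 2 * m / x.2) * (a.1 * b.1) + (1 - 2 * m / x.2)⁻¹ * (a.2 * b.2)

/-- The almost product structure whose eigenspaces are the null directions of the Schwarzschild
metric. -/
def schwarzschildProduct (m : ℝ) (x a : ℝ × ℝ) : ℝ × ℝ :=
  ((1 - 2 * m / x.2)⁻¹ * a.2, (1 - 2 * m / x.2) * a.1)

/-- The Lorentzian inner product of `ℝ³₁`. -/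
def lorentz3 (a b : Fin 3 → ℝ) : ℝ := -(a 0 * b 0) + a 1 * b 1 + a 2 * b 2

/-- For `ε = 1` and `ε = -1`, the directions of the straight lines of the two rulings of the
hyperboloid `-x₀² + x₁² + x₂² = r²` at the point `x`. -/
def rulingDirection (r ε : ℝ) (x : Fin 3 → ℝ) : Fin 3 → ℝ :=
  ![r ^ 2 + x 0 ^ 2, x 0 * x 1 - ε * r * x 2, x 0 * x 2 + ε * r * x 1]

/-! ### Higher dimension -/

/-- `G((a, b), (a', b')) = ⟨a, b'⟩ + ⟨b, a'⟩` on `ℝᵈ × ℝᵈ`. -/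
def neutralMetric {d : ℕ} (_ a b : EuclideanSpace ℝ (Fin d) × EuclideanSpace ℝ (Fin d)) : ℝ :=
  inner ℝ a.1 b.2 + inner ℝ a.2 b.1

/-- The almost product structure with eigenspaces `ℝᵈ × 0` (`+1`) and `0 × ℝᵈ` (`-1`). -/
def horizontalProduct {d : ℕ} (_ a : EuclideanSpace ℝ (Fin d) × EuclideanSpace ℝ (Fin d)) :
    EuclideanSpace ℝ (Fin d) × EuclideanSpace ℝ (Fin d) := (a.1, -a.2)

/-- The almost product structure with eigenspaces `0 × ℝᵈ` (`+1`) and `ℝᵈ × 0` (`-1`), whose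
leaves are the sets `{a} × ℝᵈ` and `ℝᵈ × {b}`. -/
def squareProduct {d : ℕ} (_ a : EuclideanSpace ℝ (Fin d) × EuclideanSpace ℝ (Fin d)) :
    EuclideanSpace ℝ (Fin d) × EuclideanSpace ℝ (Fin d) := (-a.1, a.2)

/-- The equivalence relation on `ℝᵈ` with quotient `𝕋ⁿ × ℝᵈ⁻ⁿ` (for `n ≤ d`): the first `n`
coordinates are congruent modulo `ℤ`, the other ones are equal. -/
def torusCylinderRel (n : ℕ) {d : ℕ} (x y : EuclideanSpace ℝ (Fin d)) : Prop :=
  ∃ k : Fin d → ℤ, ∀ i, y i = x i + k i ∧ (n ≤ i.val → k i = 0)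

/-- `(M, π)` is the flat Riemannian manifold `ℝⁿ / Γ`, for a group `Γ` of isometries of `ℝⁿ`; its
metric is the one for which `π` is a local isometry. -/
structure IsFlatQuotient {n : ℕ}
    (Γ : Subgroup (EuclideanSpace ℝ (Fin n) ≃ᵃⁱ[ℝ] EuclideanSpace ℝ (Fin n)))
    {M : Type} [TopologicalSpace M] [ChartedSpace (EuclideanSpace ℝ (Fin n)) M]
    (π : EuclideanSpace ℝ (Fin n) → M) : Prop where
  localDiffeo : IsLocalDiffeomorph (𝓡 n) (𝓡 n) ∞ π
  surjective : Function.Surjective π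
  fibers : ∀ x y, π x = π y ↔ ∃ γ ∈ Γ, γ x = y

/-- The map `(x, v) ↦ dπ_x(v)` from `Tℝⁿ = ℝⁿ × ℝⁿ` to `TM`. -/
def tangentParam {n : ℕ} {M : Type} [TopologicalSpace M]
    [ChartedSpace (EuclideanSpace ℝ (Fin n)) M] (π : EuclideanSpace ℝ (Fin n) → M)
    (z : EuclideanSpace ℝ (Fin n) × EuclideanSpace ℝ (Fin n)) : TangentBundle (𝓡 n) M :=
  ⟨π z.1, mfderiv (𝓡 n) (𝓡 n) π z.1 z.2⟩

/-- The equivalence relation on `Tℝⁿ = ℝⁿ × ℝⁿ` given by the action of `Γ` through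
differentials. -/
def tangentRel {n : ℕ} (Γ : Subgroup (EuclideanSpace ℝ (Fin n) ≃ᵃⁱ[ℝ] EuclideanSpace ℝ (Fin n)))
    (z w : EuclideanSpace ℝ (Fin n) × EuclideanSpace ℝ (Fin n)) : Prop :=
  ∃ γ ∈ Γ, γ z.1 = w.1 ∧ γ.linearIsometryEquiv z.2 = w.2

/-- The group of the translations by vectors of `ℤⁿ`. -/
def latticeGroup (n : ℕ) :
    Subgroup (EuclideanSpace ℝ (Fin n) ≃ᵃⁱ[ℝ] EuclideanSpace ℝ (Fin n)) :=
  Subgroup.closure {γ | ∃ k : Fin n → ℤ, ∀ x i, γ x i = x i + k i}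

/-- The signs and the translation parts of the first generator
`(x, y, z) ↦ (x + 1/2, -y + 1/2, -z)`. -/
def hwSignA : ℕ → ℝ
  | 1 => -1
  | 2 => -1
  | _ => 1

/-- See `hwSignA`. -/
def hwShiftA : ℕ → ℝ
  | 0 => 1 / 2
  | 1 => 1 / 2
  | _ => 0

/-- The signs and the translation parts of the second generator
`(x, y, z) ↦ (-x, y + 1/2, -z + 1/2)`. -/
def hwSignB : ℕ → ℝ
  | 0 => -1
  | 2 => -1
  | _ => 1

/-- See `hwSignB`. -/
def hwShiftB : ℕ → ℝ
  | 1 => 1 / 2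
  | 2 => 1 / 2
  | _ => 0

/-- For `n = 3`, the fundamental group of the Hantzsche-Wendt manifold, generated by `ℤ³` and the
two screw motions above. For `n ≥ 3`, the fundamental group of the product of the Hantzsche-Wendt
manifold and the flat torus `ℝⁿ⁻³/ℤⁿ⁻³`. -/
def hantzscheWendtGroup (n : ℕ) :
    Subgroup (EuclideanSpace ℝ (Fin n) ≃ᵃⁱ[ℝ] EuclideanSpace ℝ (Fin n)) :=
  Subgroup.closure ({γ | ∃ k : Fin n → ℤ, ∀ x i, γ x i = x i + k i} ∪
    {γ | ∀ x i, γ x i = hwSignA i.val * x i + hwShiftA i.val} ∪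
    {γ | ∀ x i, γ x i = hwSignB i.val * x i + hwShiftB i.val})

/-- The paracomplex projective space, as a subset of `ℝⁿ⁺¹ × ℝⁿ⁺¹`. -/
def paracomplexProjective (n : ℕ) :
    Set (EuclideanSpace ℝ (Fin (n + 1)) × EuclideanSpace ℝ (Fin (n + 1))) :=
  {z | (inner ℝ z.1 z.1 : ℝ) = inner ℝ z.2 z.2 ∧ (inner ℝ z.1 z.2 : ℝ) = 1}

/-- The metric of the paracomplex projective space at `z = (u, v)`; in the local coordinates
`xⁱ = uⁱ/u^α`, `yⁱ = vⁱ/v^α` (`i ≠ α`) it is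
`(2/c) (Σᵢ (dxⁱ dyⁱ + dyⁱ dxⁱ)/(1 + ⟨x,y⟩) - Σᵢⱼ xⁱ yʲ (dyⁱ dxʲ + dxʲ dyⁱ)/(1 + ⟨x,y⟩)²)`. -/
def paracomplexMetric {n : ℕ} (c : ℝ)
    (z a b : EuclideanSpace ℝ (Fin (n + 1)) × EuclideanSpace ℝ (Fin (n + 1))) : ℝ :=
  2 / c * ((inner ℝ a.1 b.2 : ℝ) + inner ℝ b.1 a.2
    - (inner ℝ a.1 z.2 : ℝ) * inner ℝ z.1 b.2 - (inner ℝ b.1 z.2 : ℝ) * inner ℝ z.1 a.2)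

end

open scoped Manifold ContDiff
open Set Filter Topology ContinuousLinearMap
open Real (sin cos)

noncomputable section

set_option maxSynthPendingDepth 3
set_option linter.unusedSectionVars false

variable {V : Type} [NormedAddCommGroup V] [NormedSpace ℝ V]
  {E : Type} [NormedAddCommGroup E] [NormedSpace ℝ E] {H : Type} [TopologicalSpace H]
  {I : ModelWithCorners ℝ E H} {M : Type} [TopologicalSpace M] [ChartedSpace H M]
  {E' : Type} [NormedAddCommGroup E'] [NormedSpace ℝ E'] {H' : Type} [TopologicalSpace H']
  {I' : ModelWithCorners ℝ E' H'} {M' : Type} [TopologicalSpace M'] [ChartedSpace H' M']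

notation:max "𝔼" n:max => EuclideanSpace ℝ (Fin n)

notation:max "ℝ²" => ℝ × ℝ

notation:max "𝓥" V:max => modelWithCornersSelf ℝ V

notation:max "𝔅" V:max => V →L[ℝ] V →L[ℝ] ℝ

notation:max "𝐃" => fderiv ℝ

section Fields

variable (I M)

/-- The fields of bilinear forms on the tangent spaces of `M`. -/
abbrev FormField := (p : M) → LinearMap.BilinForm ℝ (TangentSpace I p)

/-- The fields of endomorphisms of the tangent spaces of `M`. -/
abbrev EndField := (p : M) → TangentSpace I p →ₗ[ℝ] TangentSpace I p

/-- The distributions on `M`. -/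
abbrev DistField := (p : M) → Submodule ℝ (TangentSpace I p)

end Fields

section Calculus

lemma ContDiffAt.diffAt {f : V → E} {x : V} (h : ContDiffAt ℝ ∞ f x) : DifferentiableAt ℝ f x :=
  h.differentiableAt (by simp)

lemma ContDiffAt.eventually_diffAt {f : V → E} {x : V} (h : ContDiffAt ℝ ∞ f x) :
    ∀ᶠ y in 𝓝 x, DifferentiableAt ℝ f y := by
  filter_upwards [(h.of_le (m := 1) (by simp)).eventually (by simp)] with y hy
    using hy.differentiableAt (by simp)

lemma ContDiffAt.smooth_fderiv {f : V → E} {x : V} (h : ContDiffAt ℝ ∞ f x) :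
    ContDiffAt ℝ ∞ (𝐃 f) x :=
  h.fderiv_right (m := ∞) (by simp)

lemma HasFDerivAt.eval {A : V → E →L[ℝ] E'} {A' : V →L[ℝ] E →L[ℝ] E'} {x : V}
    (h : HasFDerivAt A A' x) (b : E) : HasFDerivAt (fun y => A y b) (A'.flip b) x := by
  simpa using h.clm_apply (hasFDerivAt_const b x)

lemma DifferentiableAt.eval {A : V → E →L[ℝ] E'} {x : V} (h : DifferentiableAt ℝ A x) (b : E) :
    DifferentiableAt ℝ (fun y => A y b) x :=
  (h.hasFDerivAt.eval b).differentiableAt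

/-- The Koszul formula for `z = ∇_a b`, for a field `G` of bilinear forms on a vector space. -/
def IsChristoffel (G : V → V → V → ℝ) (y a b z : V) : Prop :=
  ∀ c : V, 2 * G y z c = 𝐃 (fun x => G x b c) y a + 𝐃 (fun x => G x a c) y b
    - 𝐃 (fun x => G x a b) y c

/-- The Christoffel symbols of a field `G` of bilinear forms on a vector space. -/
def chris (G : V → V → V → ℝ) (y a b : V) : V := Classical.epsilon (IsChristoffel G y a b)

/-- The curvature tensor of a field `G` of bilinear forms on a vector space. -/
def curv (G : V → V → V → ℝ) (y a b c : V) : V :=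
  𝐃 (fun x => chris G x b c) y a - 𝐃 (fun x => chris G x a c) y b
  + chris G y a (chris G y b c) - chris G y b (chris G y a c)

/-- Nondegeneracy of a bilinear form. -/
def Nondeg (β : 𝔅 V) : Prop := ∀ v, (∀ w, β v w = 0) → v = 0

lemma chris_congr {G G' : V → V → V → ℝ} {y : V} (h : ∀ᶠ x in 𝓝 y, ∀ a b, G x a b = G' x a b)
    (a b : V) : chris G y a b = chris G' y a b := by
  have key : ∀ a b, 𝐃 (fun x => G x a b) y = 𝐃 (fun x => G' x a b) y := fun a b =>
    Filter.EventuallyEq.fderiv_eq (h.mono fun x hx => hx a b)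
  have : IsChristoffel G y a b = IsChristoffel G' y a b := by
    funext z
    simp only [IsChristoffel, key, h.self_of_nhds]
  rw [chris, this, chris]

lemma curv_congr {G G' : V → V → V → ℝ} {y : V} (h : ∀ᶠ x in 𝓝 y, ∀ a b, G x a b = G' x a b)
    (a b c : V) : curv G y a b c = curv G' y a b c := by
  have key : ∀ b c, 𝐃 (fun x => chris G x b c) y = 𝐃 (fun x => chris G' x b c) y :=
    fun b c => Filter.EventuallyEq.fderiv_eq (h.eventually_nhds.mono fun x hx => chris_congr hx b c)
  simp only [curv, key, chris_congr h]

lemma fderiv_clm_apply₂ {β : E → 𝔅 V} {y : E} (h : DifferentiableAt ℝ β y)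
    (a : E) (b c : V) : 𝐃 (fun x => β x b c) y a = 𝐃 β y a b c := by
  rw [((h.hasFDerivAt.eval b).eval c).fderiv]
  rfl

/-- The map `(a, b, c) ↦ D_a G(b, c) + D_b G(a, c) - D_c G(a, b)`, for `D = DG`. -/
def koszul (D : V →L[ℝ] 𝔅 V) : V →L[ℝ] 𝔅 V :=
  D + D.flip - (flipₗᵢ ℝ V V ℝ : (𝔅 V) →L[ℝ] (𝔅 V)) ∘L D.flip

lemma koszul_apply (D : V →L[ℝ] 𝔅 V) (a b c : V) :
    koszul D a b c = D a b c + D b a c - D c a b := by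
  simp [koszul]

/-- The Christoffel symbols as a field of bilinear maps. -/
def chrisL (G : V → 𝔅 V) (y : V) : V →L[ℝ] V →L[ℝ] V :=
  (1 / 2 : ℝ) • ((compL ℝ V (V →L[ℝ] ℝ) V (inverse (G y))) ∘L koszul (𝐃 G y))

lemma Nondeg.isInvertible [FiniteDimensional ℝ V] {β : 𝔅 V} (h : Nondeg β) : β.IsInvertible := by
  have hinj : Function.Injective β := by
    rw [injective_iff_map_eq_zero]
    exact fun v hv => h v fun w => by simp [hv]
  have hfr : Module.finrank ℝ V = Module.finrank ℝ (V →L[ℝ] ℝ) := by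
    rw [← (LinearMap.toContinuousLinearMap (𝕜 := ℝ) (E := V) (F' := ℝ)).finrank_eq]
    exact (Subspace.dual_finrank_eq (K := ℝ) (V := V)).symm
  refine ⟨(LinearEquiv.ofInjectiveOfFinrankEq (β : V →ₗ[ℝ] _) hinj hfr).toContinuousLinearEquiv, ?_⟩
  ext v w
  rfl

lemma Nondeg.eq_of_forall {β : 𝔅 V} (h : Nondeg β) {v v' : V} (hv : ∀ w, β v w = β v' w) : v = v' :=
  sub_eq_zero.1 (h _ fun w => by simp [hv])

variable [FiniteDimensional ℝ V] [FiniteDimensional ℝ E]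

lemma chrisL_spec {G : V → 𝔅 V} {y : V} (hn : Nondeg (G y)) (a b c : V) :
    2 * G y (chrisL G y a b) c = koszul (𝐃 G y) a b c := by
  obtain ⟨e, he⟩ := hn.isInvertible
  have : G y (inverse (G y) (koszul (𝐃 G y) a b)) = koszul (𝐃 G y) a b := by rw [← he]; simp
  simp only [chrisL, smul_apply, coe_comp, Function.comp_apply, compL_apply, map_smul, this]
  simp

lemma isChristoffel_iff {G : V → 𝔅 V} {y : V} (hd : DifferentiableAt ℝ G y)
    (a b z : V) : IsChristoffel (fun x a b => G x a b) y a b z ↔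
      ∀ c, 2 * G y z c = koszul (𝐃 G y) a b c := by
  simp only [IsChristoffel, fderiv_clm_apply₂ hd, koszul_apply]

lemma chris_eq_of {G : V → 𝔅 V} {y : V} (hd : DifferentiableAt ℝ G y)
    (hn : Nondeg (G y)) {a b z : V} (h : ∀ c, 2 * G y z c = koszul (𝐃 G y) a b c) :
    chris (fun x a b => G x a b) y a b = z := by
  have h1 : IsChristoffel (fun x a b => G x a b) y a b z := (isChristoffel_iff hd a b z).2 h
  have h2 := (isChristoffel_iff hd a b _).1 (Classical.epsilon_spec ⟨z, h1⟩)
  refine hn.eq_of_forall fun w => ?_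
  have h3 := h2 w
  have h4 := h w
  rw [← h4] at h3
  exact mul_left_cancel₀ two_ne_zero h3

lemma chris_eq_chrisL {G : V → 𝔅 V} {y : V} (hd : DifferentiableAt ℝ G y)
    (hn : Nondeg (G y)) (a b : V) : chris (fun x a b => G x a b) y a b = chrisL G y a b :=
  chris_eq_of hd hn (chrisL_spec hn a b)

lemma contDiffAt_chrisL {G : V → 𝔅 V} {y : V} (hG : ContDiffAt ℝ ∞ G y)
    (hn : Nondeg (G y)) : ContDiffAt ℝ ∞ (chrisL G) y := by
  have h1 : ContDiffAt ℝ ∞ (𝐃 G) y := hG.smooth_fderiv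
  have h2 : ContDiffAt ℝ ∞ (fun y => inverse (G y)) y :=
    (hn.isInvertible.contDiffAt_map_inverse).comp y hG
  have h3 : ContDiffAt ℝ ∞ (fun y => koszul (𝐃 G y)) y := by
    have hf : ContDiffAt ℝ ∞ (fun y => (𝐃 G y).flip) y :=
      (flipₗᵢ ℝ V V (V →L[ℝ] ℝ)).contDiff.contDiffAt.comp y h1
    exact (h1.add hf).sub (contDiffAt_const.clm_comp hf)
  unfold chrisL
  exact ContDiffAt.const_smul _
    (((compL ℝ V (V →L[ℝ] ℝ) V).contDiff.contDiffAt.comp y h2).clm_comp h3)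

lemma curv_eq_chrisL {G : V → 𝔅 V} {y : V} (hG : ContDiffAt ℝ ∞ G y)
    (hn : ∀ᶠ x in 𝓝 y, Nondeg (G x)) (a b c : V) :
    curv (fun x a b => G x a b) y a b c = 𝐃 (chrisL G) y a b c - 𝐃 (chrisL G) y b a c
      + chrisL G y a (chrisL G y b c) - chrisL G y b (chrisL G y a c) := by
  have key : ∀ᶠ x in 𝓝 y, ∀ a b, chris (fun x a b => G x a b) x a b = chrisL G x a b := by
    filter_upwards [hG.eventually_diffAt, hn] with x hx hx' a b using chris_eq_chrisL hx hx' a b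
  have hΓ := (contDiffAt_chrisL hG hn.self_of_nhds).diffAt
  have key2 : ∀ a b c, 𝐃 (fun x => chris (fun x a b => G x a b) x b c) y a
      = 𝐃 (chrisL G) y a b c := by
    intro a b c
    rw [Filter.EventuallyEq.fderiv_eq (key.mono fun x hx => hx b c)]
    exact congrArg (fun L => L a) ((hΓ.hasFDerivAt.eval b).eval c).fderiv
  simp only [curv, key2, key.self_of_nhds]

/-- The pullback of a bilinear form by a linear map. -/
def pullForm (β : 𝔅 V) (A : E →L[ℝ] V) : 𝔅 E := ((compL ℝ E V ℝ).flip A) ∘L β ∘L A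

@[simp] lemma pullForm_apply (β : 𝔅 V) (A : E →L[ℝ] V) (a b : E) :
    pullForm β A a b = β (A a) (A b) := by
  simp [pullForm]

lemma ContDiffAt.pullForm {β : E → 𝔅 V} {A : E → E →L[ℝ] V} {y : E}
    (hβ : ContDiffAt ℝ ∞ β y) (hA : ContDiffAt ℝ ∞ A y) :
    ContDiffAt ℝ ∞ (fun y => pullForm (β y) (A y)) y :=
  ((compL ℝ E V ℝ).flip.contDiff.contDiffAt.comp y hA).clm_comp (hβ.clm_comp hA)

lemma fderiv_pullback {f : E → V} {y : E} (hf : ContDiffAt ℝ 2 f y)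
    {G : V → 𝔅 V} (hG : DifferentiableAt ℝ G (f y)) (a b c : E) :
    𝐃 (fun y => pullForm (G (f y)) (𝐃 f y)) y a b c = 𝐃 G (f y) (𝐃 f y a) (𝐃 f y b) (𝐃 f y c)
      + G (f y) (𝐃 (𝐃 f) y a b) (𝐃 f y c)
      + G (f y) (𝐃 f y b) (𝐃 (𝐃 f) y a c) := by
  have h1 : DifferentiableAt ℝ (𝐃 f) y :=
    (hf.fderiv_right (m := 1) (by norm_num)).differentiableAt (by simp)
  have hf' : DifferentiableAt ℝ f y := hf.differentiableAt (by simp)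
  have hGf : HasFDerivAt (fun y => G (f y)) (𝐃 G (f y) ∘L 𝐃 f y) y :=
    hG.hasFDerivAt.comp y hf'.hasFDerivAt
  have hd : DifferentiableAt ℝ (fun y => pullForm (G (f y)) (𝐃 f y)) y := by
    have h2 := ((compL ℝ E V ℝ).flip.differentiable.differentiableAt (x := 𝐃 f y)).comp y h1
    exact h2.clm_comp (hGf.differentiableAt.clm_comp h1)
  rw [← fderiv_clm_apply₂ hd]
  simp only [pullForm_apply]
  have hb : HasFDerivAt (fun y => 𝐃 f y b) _ y := h1.hasFDerivAt.eval b
  have hc : HasFDerivAt (fun y => 𝐃 f y c) _ y := h1.hasFDerivAt.eval c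
  have := (hGf.clm_apply hb).clm_apply hc
  rw [this.fderiv]
  simp
  ring

/-- Transformation of the Christoffel symbols under pullback. -/
lemma fderiv_chrisL_pullback {f : E → V} {y : E} (hf : ContDiffAt ℝ 2 f y)
    (hi : (𝐃 f y).IsInvertible)
    {G : V → 𝔅 V} (hG : DifferentiableAt ℝ G (f y)) (hn : Nondeg (G (f y)))
    (hs : ∀ a b, G (f y) a b = G (f y) b a)
    (hn' : Nondeg (pullForm (G (f y)) (𝐃 f y))) (a b : E) :
    𝐃 f y (chrisL (fun y => pullForm (G (f y)) (𝐃 f y)) y a b) =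
      chrisL G (f y) (𝐃 f y a) (𝐃 f y b) + 𝐃 (𝐃 f) y a b := by
  obtain ⟨e, he⟩ := hi
  have hsf : IsSymmSndFDerivAt ℝ f y := hf.isSymmSndFDerivAt (by simp)
  refine hn.eq_of_forall fun w => ?_
  obtain ⟨c, rfl⟩ : ∃ c, 𝐃 f y c = w := ⟨e.symm w, by rw [← he]; simp⟩
  have h1 := chrisL_spec (G := fun y => pullForm (G (f y)) (𝐃 f y)) hn' a b c
  have h2 := chrisL_spec hn (𝐃 f y a) (𝐃 f y b) (𝐃 f y c)
  rw [koszul_apply] at h1 h2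
  simp only [fderiv_pullback hf hG, pullForm_apply] at h1
  simp only [map_add, add_apply]
  rw [hsf b a, hsf c a, hsf c b] at h1
  have s1 := hs (𝐃 f y b) (𝐃 (𝐃 f) y a c)
  have s2 := hs (𝐃 f y a) (𝐃 (𝐃 f) y b c)
  linarith

lemma Nondeg.pullForm {β : 𝔅 V} (h : Nondeg β) {A : E →L[ℝ] V}
    (hA : A.IsInvertible) : Nondeg (pullForm β A) := by
  obtain ⟨e, rfl⟩ := hA
  intro v hv
  have : e v = 0 := h _ fun w => by simpa using hv (e.symm w)
  simpa using this

lemma eventually_isInvertible_fderiv {f : E → V} {y : E} (hf : ContDiffAt ℝ ∞ f y)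
    (hi : (𝐃 f y).IsInvertible) : ∀ᶠ x in 𝓝 y, (𝐃 f x).IsInvertible := by
  have h1 : ContinuousAt (𝐃 f) y := hf.smooth_fderiv.continuousAt
  obtain ⟨e, he⟩ := hi
  have : ∀ᶠ A in 𝓝 (𝐃 f y), ContinuousLinearMap.IsInvertible A := by
    rw [← he]
    filter_upwards [ContinuousLinearEquiv.nhds e] with A hA
    exact hA
  exact h1.eventually this

/-- The curvature is a tensor. -/
theorem fderiv_curv_pullback {f : E → V} {y : E} (hf : ContDiffAt ℝ ∞ f y)
    (hi : (𝐃 f y).IsInvertible)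
    {G : V → 𝔅 V} (hG : ContDiffAt ℝ ∞ G (f y))
    (hn : ∀ᶠ x in 𝓝 (f y), Nondeg (G x)) (hs : ∀ᶠ x in 𝓝 (f y), ∀ a b, G x a b = G x b a)
    (a b c : E) :
    𝐃 f y (curv (fun y a b => G (f y) (𝐃 f y a) (𝐃 f y b)) y a b c) =
      curv (fun x a b => G x a b) (f y) (𝐃 f y a) (𝐃 f y b) (𝐃 f y c) := by
  set G' : E → 𝔅 E := fun y => pullForm (G (f y)) (𝐃 f y) with hG'
  have hfc : ContinuousAt f y := hf.continuousAt
  have hf1 : ContDiffAt ℝ ∞ (𝐃 f) y := hf.smooth_fderiv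
  have hf2 := hf1.smooth_fderiv
  have hGf : ContDiffAt ℝ ∞ (fun y => G (f y)) y := hG.comp y hf
  have hG's : ContDiffAt ℝ ∞ G' y := hGf.pullForm hf1
  have hie := eventually_isInvertible_fderiv hf hi
  have hn' : ∀ᶠ x in 𝓝 y, Nondeg (G' x) := by
    filter_upwards [hie, hfc.eventually hn] with x hx hx' using hx'.pullForm hx
  have h2top : (2 : WithTop ℕ∞) ≤ ∞ := WithTop.coe_le_coe.2 (le_top : (2 : ℕ∞) ≤ ⊤)
  have hfe : ∀ᶠ x in 𝓝 y, ContDiffAt ℝ 2 f x := (hf.of_le h2top).eventually (by simp)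
  have key : ∀ᶠ x in 𝓝 y, ∀ a b, 𝐃 f x (chrisL G' x a b) =
      chrisL G (f x) (𝐃 f x a) (𝐃 f x b) + 𝐃 (𝐃 f) x a b := by
    filter_upwards [hfe, hie, hfc.eventually hn, hn', hfc.eventually hG.eventually_diffAt,
        hfc.eventually hs] with
      x h1 h2 h3 h4 h5 h6 a b using fderiv_chrisL_pullback h1 h2 h5 h3 h6 h4 a b
  have hΓ := (contDiffAt_chrisL hG hn.self_of_nhds).diffAt
  have hΓ' := (contDiffAt_chrisL hG's hn'.self_of_nhds).diffAt
  have hΓf : HasFDerivAt (fun y => chrisL G (f y)) (𝐃 (chrisL G) (f y) ∘L 𝐃 f y) y :=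
    hΓ.hasFDerivAt.comp y hf.diffAt.hasFDerivAt
  have hD : ∀ b, HasFDerivAt (fun y => 𝐃 f y b) _ y := fun b => hf1.diffAt.hasFDerivAt.eval b
  have hD2 : ∀ b c, HasFDerivAt (fun y => 𝐃 (𝐃 f) y b c) _ y := fun b c =>
    (hf2.diffAt.hasFDerivAt.eval b).eval c
  have hL : ∀ b c, HasFDerivAt (fun y => 𝐃 f y (chrisL G' y b c)) _ y := fun b c =>
    hf1.diffAt.hasFDerivAt.clm_apply ((hΓ'.hasFDerivAt.eval b).eval c)
  have hR : ∀ b c, HasFDerivAt (fun y => chrisL G (f y) (𝐃 f y b) (𝐃 f y c)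
      + 𝐃 (𝐃 f) y b c) _ y := fun b c =>
    (((hΓf.clm_apply (hD b)).clm_apply (hD c)).add (hD2 b c))
  have key2 : ∀ a b c, 𝐃 f y (𝐃 (chrisL G') y a b c) + 𝐃 (𝐃 f) y a (chrisL G' y b c) =
      𝐃 (chrisL G) (f y) (𝐃 f y a) (𝐃 f y b) (𝐃 f y c)
      + chrisL G (f y) (𝐃 (𝐃 f) y a b) (𝐃 f y c)
      + chrisL G (f y) (𝐃 f y b) (𝐃 (𝐃 f) y a c)
      + 𝐃 (𝐃 (𝐃 f)) y a b c := by
    intro a b c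
    have h1 := (Filter.EventuallyEq.fderiv_eq (key.mono fun x hx => hx b c) :
      𝐃 (fun y => 𝐃 f y (chrisL G' y b c)) y = _)
    rw [(hL b c).fderiv, (hR b c).fderiv] at h1
    have h2 := congrArg (fun A => A a) h1
    simp at h2
    rw [h2]
    abel
  have k0 := key.self_of_nhds
  have s2 : IsSymmSndFDerivAt ℝ f y := hf.isSymmSndFDerivAt (by simpa using h2top)
  have s3 : IsSymmSndFDerivAt ℝ (𝐃 f) y := hf1.isSymmSndFDerivAt (by simpa using h2top)
  have hcurv : curv (fun y a b => G (f y) (𝐃 f y a) (𝐃 f y b)) y a b c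
      = curv (fun y a b => G' y a b) y a b c :=
    curv_congr (Eventually.of_forall fun x a b => by simp [hG']) a b c
  rw [hcurv, curv_eq_chrisL hG's hn', curv_eq_chrisL hG hn]
  simp only [map_sub, map_add]
  have e1 := key2 a b c
  have e2 := key2 b a c
  rw [k0 a (chrisL G' y b c), k0 b (chrisL G' y a c), k0 b c, k0 a c]
  rw [← eq_sub_iff_add_eq] at e1 e2
  rw [e1, e2, s2 b a, s3 b a]
  simp only [map_add]
  abel

end Calculus

section Models

/-- A bi-Lagrangian structure on an open subset `U` of a vector space, in coordinates adapted to the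
two foliations: the almost product structure `F` is constant. -/
structure AdaptedModel (V : Type) [NormedAddCommGroup V] [NormedSpace ℝ V] where
  U : Set V
  isOpen : IsOpen U
  form : V → 𝔅 V
  F : V →L[ℝ] V
  smooth : ContDiffOn ℝ ∞ form U
  F_F : ∀ a, F (F a) = a
  alt : ∀ x ∈ U, ∀ a, form x a a = 0
  nondeg : ∀ x ∈ U, Nondeg (form x)
  anti : ∀ x ∈ U, ∀ a b, form x (F a) (F b) = -form x a b
  closed : ∀ x ∈ U, ∀ a b c, 𝐃 form x a b c + 𝐃 form x b c a + 𝐃 form x c a b = 0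

namespace AdaptedModel

variable (A : AdaptedModel V)

/-- The metric of a model. -/
def metric (x : V) : 𝔅 V := A.form x ∘L A.F

lemma metric_apply (x a b : V) : A.metric x a b = A.form x (A.F a) b := rfl

variable {A}

lemma form_swap {x : V} (hx : x ∈ A.U) (a b : V) : A.form x a b = -A.form x b a := by
  have h := A.alt x hx (a + b)
  simp only [map_add, add_apply, A.alt x hx] at h
  linarith

lemma metric_symm {x : V} (hx : x ∈ A.U) (a b : V) : A.metric x a b = A.metric x b a := by
  have h := A.anti x hx a (A.F b)
  rw [A.F_F] at h
  rw [metric_apply, metric_apply, h, form_swap hx a]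
  ring

lemma metric_anti {x : V} (hx : x ∈ A.U) (a b : V) :
    A.metric x (A.F a) (A.F b) = -A.metric x a b := by
  rw [metric_apply, metric_apply, A.anti x hx]

lemma metric_nondeg {x : V} (hx : x ∈ A.U) : Nondeg (A.metric x) := by
  intro v hv
  have : A.F v = 0 := A.nondeg x hx _ hv
  rw [← A.F_F v, this, map_zero]

lemma contDiffAt_form {x : V} (hx : x ∈ A.U) : ContDiffAt ℝ ∞ A.form x :=
  A.smooth.contDiffAt (A.isOpen.mem_nhds hx)

lemma contDiffAt_metric {x : V} (hx : x ∈ A.U) : ContDiffAt ℝ ∞ A.metric x :=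
  (contDiffAt_form hx).clm_comp contDiffAt_const

lemma fderiv_metric {x : V} (hx : x ∈ A.U) (a b c : V) :
    𝐃 A.metric x a b c = 𝐃 A.form x a (A.F b) c := by
  have h := (((contDiffAt_form hx).differentiableAt (by simp)).hasFDerivAt).clm_comp
    (hasFDerivAt_const A.F x)
  have : 𝐃 A.metric x = _ := h.fderiv
  rw [this]
  simp

lemma fderiv_metric_symm {x : V} (hx : x ∈ A.U) (a b c : V) :
    𝐃 A.metric x a b c = 𝐃 A.metric x a c b := by
  have hd := (contDiffAt_metric hx).differentiableAt (by simp)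
  rw [← fderiv_clm_apply₂ hd, ← fderiv_clm_apply₂ hd]
  congr 1
  apply Filter.EventuallyEq.fderiv_eq
  filter_upwards [A.isOpen.mem_nhds hx] with z hz using metric_symm hz b c

lemma fderiv_metric_anti {x : V} (hx : x ∈ A.U) (a b c : V) :
    𝐃 A.metric x a (A.F b) (A.F c) = -𝐃 A.metric x a b c := by
  have hd := (contDiffAt_metric hx).differentiableAt (by simp)
  rw [← fderiv_clm_apply₂ hd, ← fderiv_clm_apply₂ hd]
  have : (fun x => A.metric x (A.F b) (A.F c)) =ᶠ[𝓝 x] fun x => -A.metric x b c := by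
    filter_upwards [A.isOpen.mem_nhds hx] with z hz using metric_anti hz b c
  rw [this.fderiv_eq, fderiv_fun_neg]
  rfl

/-- The restriction of a model to an open set. -/
def restrict (A : AdaptedModel V) (W : Set V) (hW : IsOpen W) : AdaptedModel V where
  U := A.U ∩ W
  isOpen := A.isOpen.inter hW
  form := A.form
  F := A.F
  smooth := A.smooth.mono inter_subset_left
  F_F := A.F_F
  alt x hx := A.alt x hx.1
  nondeg x hx := A.nondeg x hx.1
  anti x hx := A.anti x hx.1
  closed x hx := A.closed x hx.1

variable [FiniteDimensional ℝ V]

lemma metric_chrisL_pos {x : V} (hx : x ∈ A.U) {a c : V} (ha : A.F a = a) (hc : A.F c = c) (e : V) :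
    A.metric x (chrisL A.metric x a c) e = 𝐃 A.metric x a c e := by
  have h := chrisL_spec (metric_nondeg hx) a c e
  rw [koszul_apply] at h
  have h1 := A.closed x hx a c e
  have h2 := fderiv_metric_anti hx e a c
  have h3 := fderiv_metric_anti hx c e a
  have h4 := fderiv_metric_symm hx c e a
  rw [ha] at h3
  rw [ha, hc] at h2
  have e1 := fderiv_metric hx a c e
  have e2 := fderiv_metric hx c (A.F e) a
  have e3 := fderiv_metric hx e a c
  rw [hc] at e1
  rw [A.F_F] at e2
  rw [ha] at e3
  linarith

lemma chrisL_mixed {x : V} (hx : x ∈ A.U) {b c : V} (hb : A.F b = -b) (hc : A.F c = c) :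
    chrisL A.metric x b c = 0 := by
  refine metric_nondeg hx _ fun e => ?_
  have h := chrisL_spec (metric_nondeg hx) b c e
  rw [koszul_apply] at h
  have h1 := A.closed x hx b c e
  have h3 := fderiv_metric_anti hx c e b
  have h4 := fderiv_metric_symm hx c e b
  have e1 := fderiv_metric hx b c e
  have e2 := fderiv_metric hx c (A.F e) b
  have e3 := fderiv_metric hx e b c
  rw [hc] at e1
  rw [A.F_F] at e2
  rw [hb] at e3 h3
  simp only [map_neg, neg_apply] at e3 h3
  linarith

lemma F_chrisL_pos {x : V} (hx : x ∈ A.U) {a c : V} (ha : A.F a = a) (hc : A.F c = c) :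
    A.F (chrisL A.metric x a c) = chrisL A.metric x a c := by
  refine (metric_nondeg hx).eq_of_forall fun e => ?_
  have h1 := metric_anti hx (chrisL A.metric x a c) (A.F e)
  rw [A.F_F, metric_chrisL_pos hx ha hc] at h1
  have h2 := fderiv_metric_anti hx a c (A.F e)
  rw [A.F_F, hc] at h2
  rw [h1, metric_chrisL_pos hx ha hc, h2]

/-- The components `R(a, b)c`, for `a`, `c` tangent to the first foliation and `b` tangent to the
second one. -/
lemma curv_mixed {x : V} (hx : x ∈ A.U) {a b c : V} (ha : A.F a = a) (hb : A.F b = -b)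
    (hc : A.F c = c) : curv (fun x a b => A.metric x a b) x a b c =
      -𝐃 (chrisL A.metric) x b a c := by
  have hev := A.isOpen.mem_nhds hx
  rw [curv_eq_chrisL (contDiffAt_metric hx)
    (by filter_upwards [hev] with z hz using metric_nondeg hz),
    chrisL_mixed hx hb hc, chrisL_mixed hx hb (F_chrisL_pos hx ha hc)]
  have hΓ : DifferentiableAt ℝ (chrisL A.metric) x :=
    (contDiffAt_chrisL (contDiffAt_metric hx) (metric_nondeg hx)).differentiableAt (by simp)
  have h1 : HasFDerivAt (fun x => chrisL A.metric x b c) _ x := ((hΓ.hasFDerivAt.eval b).eval c)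
  have h2 : (fun x => chrisL A.metric x b c) =ᶠ[𝓝 x] fun _ => 0 := by
    filter_upwards [hev] with z hz using chrisL_mixed hz hb hc
  have h3 := h1.fderiv
  rw [h2.fderiv_eq, fderiv_const_apply] at h3
  have h4 := congrArg (fun L => L a) h3
  simp at h4
  rw [← h4]
  simp

/-- If the curvature vanishes at `x`, then so does `∂_b ∂_a g(c, d) - ∂_b g(Γ(a, c), d)`, for `a`,
`c` tangent to the first foliation and `b` tangent to the second one. -/
theorem exists_of_curv_eq_zero {x : V} (hx : x ∈ A.U)
    (hR : ∀ a b c, curv (fun x a b => A.metric x a b) x a b c = 0) {a b c : V} (ha : A.F a = a)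
    (hb : A.F b = -b) (hc : A.F c = c) :
    ∃ w, (∀ e, A.metric x w e = 𝐃 A.metric x a c e) ∧
      ∀ d, 𝐃 (𝐃 A.metric) x b a c d = 𝐃 A.metric x b w d := by
  refine ⟨chrisL A.metric x a c, metric_chrisL_pos hx ha hc, fun d => ?_⟩
  have h0 : 𝐃 (chrisL A.metric) x b a c = 0 := by
    exact neg_eq_zero.1 ((curv_mixed hx ha hb hc).symm.trans (hR a b c))
  have hg := contDiffAt_metric hx
  have hΓ : DifferentiableAt ℝ (chrisL A.metric) x :=
    (contDiffAt_chrisL hg (metric_nondeg hx)).differentiableAt (by simp)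
  have hg' : DifferentiableAt ℝ (𝐃 A.metric) x := hg.smooth_fderiv.diffAt
  have h1 : HasFDerivAt (fun x => chrisL A.metric x a c) _ x := ((hΓ.hasFDerivAt.eval a).eval c)
  have h2 : HasFDerivAt (fun x => A.metric x (chrisL A.metric x a c) d) _ x :=
    (hg.diffAt.hasFDerivAt.clm_apply h1).eval d
  have h3 : HasFDerivAt (fun x => 𝐃 A.metric x a c d) _ x :=
    ((hg'.hasFDerivAt.eval a).eval c).eval d
  have h4 : (fun x => A.metric x (chrisL A.metric x a c) d) =ᶠ[𝓝 x]
      fun x => 𝐃 A.metric x a c d := by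
    filter_upwards [A.isOpen.mem_nhds hx] with z hz using metric_chrisL_pos hz ha hc d
  have h5 := h4.fderiv_eq (𝕜 := ℝ)
  rw [h2.fderiv, h3.fderiv] at h5
  have h6 := congrArg (fun L : V →L[ℝ] ℝ => L b) h5
  simp [h0] at h6
  rw [← h6]

/-- A model with constant coefficients is flat. -/
lemma curv_eq_zero_of_const {x : V} (hx : x ∈ A.U) {β : 𝔅 V}
    (h : ∀ z ∈ A.U, A.form z = β) (a b c : V) :
    curv (fun x a b => A.metric x a b) x a b c = 0 := by
  have hev := A.isOpen.mem_nhds hx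
  have hz : ∀ z ∈ A.U, chrisL A.metric z = 0 := by
    intro z hz
    have : A.metric =ᶠ[𝓝 z] fun _ => β ∘L A.F := by
      filter_upwards [A.isOpen.mem_nhds hz] with z hz
      rw [metric, h z hz]
    have h1 : koszul (𝐃 A.metric z) = 0 := by
      rw [this.fderiv_eq]
      ext; simp [koszul_apply]
    rw [chrisL, h1]
    simp
  rw [curv_eq_chrisL (contDiffAt_metric hx)
    (by filter_upwards [hev] with z hz using metric_nondeg hz), hz x hx]
  have : chrisL A.metric =ᶠ[𝓝 x] fun _ => 0 := by filter_upwards [hev] with z hz' using hz z hz'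
  rw [this.fderiv_eq]
  simp

end AdaptedModel

end Models

section ModelsOnManifolds

lemma chartVec_eq_mfderivWithin [I.Boundaryless] (p₀ : M) (y : E) (a : E) : chartVec I p₀ y a =
    mfderivWithin 𝓥 E I (extChartAt I p₀).symm (range I) y a := by
  rw [chartVec, I.range_eq_univ, mfderivWithin_univ]

lemma mfderiv_extChartAt_chartVec [I.Boundaryless] [IsManifold I ∞ M] {p₀ : M} {y : E}
    (hy : y ∈ (extChartAt I p₀).target) (a : E) :
    mfderiv I 𝓥 E (extChartAt I p₀) ((extChartAt I p₀).symm y) (chartVec I p₀ y a) = a := by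
  have := mfderiv_extChartAt_comp_mfderivWithin_extChartAt_symm (I := I) hy
  have h := congrArg (fun L => L a) this
  rw [chartVec_eq_mfderivWithin]
  exact h

lemma chartVec_mfderiv_extChartAt [I.Boundaryless] [IsManifold I ∞ M] {p₀ : M} {y : E}
    (hy : y ∈ (extChartAt I p₀).target) (v : TangentSpace I ((extChartAt I p₀).symm y)) :
    chartVec I p₀ y (mfderiv I 𝓥 E (extChartAt I p₀) ((extChartAt I p₀).symm y) v) = v := by
  have := mfderivWithin_extChartAt_symm_comp_mfderiv_extChartAt (I := I) hy
  exact (chartVec_eq_mfderivWithin p₀ y _).trans (congrArg (fun L => L v) this)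

lemma isInvertible_chartVec [I.Boundaryless] [IsManifold I ∞ M] {p₀ : M} {y : E}
    (hy : y ∈ (extChartAt I p₀).target) :
    (mfderiv 𝓥 E I (extChartAt I p₀).symm y).IsInvertible := by
  have := isInvertible_mfderivWithin_extChartAt_symm (I := I) hy
  rwa [I.range_eq_univ, mfderivWithin_univ] at this

lemma mdifferentiableAt_extChartAt_symm [I.Boundaryless] [IsManifold I ∞ M] {p₀ : M} {y : E}
    (hy : y ∈ (extChartAt I p₀).target) :
    MDifferentiableAt 𝓥 E I (extChartAt I p₀).symm y := by
  have := mdifferentiableWithinAt_extChartAt_symm (I := I) hy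
  rwa [I.range_eq_univ, mdifferentiableWithinAt_univ] at this

/-- A local diffeomorphism from a vector space, read in a chart of the target. -/
lemma exists_coord [I.Boundaryless] [IsManifold I ∞ M] {ψ : V → M} {x : V}
    (hψ : IsLocalDiffeomorphAt 𝓥 V I ∞ ψ x) {p₀ : M} {y : E}
    (hy : y ∈ (extChartAt I p₀).target) (hp : (extChartAt I p₀).symm y = ψ x) :
    ∃ f : E → V, f y = x ∧ ContDiffAt ℝ ∞ f y ∧ (𝐃 f y).IsInvertible ∧
      ∀ᶠ z in 𝓝 y, z ∈ (extChartAt I p₀).target ∧ ψ (f z) = (extChartAt I p₀).symm z ∧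
        ∀ a, (mfderiv 𝓥 V I ψ (f z) (𝐃 f z a) : E) = chartVec I p₀ z a := by
  have htn := (isOpen_extChartAt_target (I := I) p₀).mem_nhds hy
  have hsm : ContMDiffAt 𝓥 E I ∞ (extChartAt I p₀).symm y :=
    (contMDiffOn_extChartAt_symm p₀).contMDiffAt htn
  obtain ⟨Φ, hx, hΦ⟩ := hψ
  have hψx : ψ x = Φ x := hΦ hx
  have hsrc : (extChartAt I p₀).symm y ∈ Φ.target := by rw [hp, hψx]; exact Φ.map_source hx
  have hinv : ContMDiffAt I 𝓥 V ∞ Φ.symm ((extChartAt I p₀).symm y) :=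
    Φ.symm.contMDiffOn.contMDiffAt (Φ.open_target.mem_nhds hsrc)
  set f : E → V := fun z => Φ.symm ((extChartAt I p₀).symm z) with hf
  have hfM : ContMDiffAt 𝓥 E 𝓥 V ∞ f y := hinv.comp y hsm
  have hfs : ContDiffAt ℝ ∞ f y := hfM.contDiffAt
  have hfy : f y = x := by rw [hf]; simp only [hp, hψx]; exact Φ.left_inv hx
  have hev : ∀ᶠ z in 𝓝 y, z ∈ (extChartAt I p₀).target ∧ f z ∈ Φ.source ∧
      ψ (f z) = (extChartAt I p₀).symm z := by
    filter_upwards [htn, hsm.continuousAt (Φ.open_target.mem_nhds hsrc)] with z hz hz'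
    have h1 : f z ∈ Φ.source := Φ.map_target hz'
    exact ⟨hz, h1, by rw [hΦ h1]; exact Φ.right_inv hz'⟩
  have hder : ∀ᶠ z in 𝓝 y, ∀ a, (mfderiv 𝓥 V I ψ (f z) (𝐃 f z a) : E) = chartVec I p₀ z a := by
    filter_upwards [hev.eventually_nhds, (hfs.of_le (m := 1) (by simp)).eventually (by simp)]
      with z hz hfz a
    have h1 : MDifferentiableAt 𝓥 V I ψ (f z) :=
      IsLocalDiffeomorphAt.mdifferentiableAt (n := ∞) ⟨Φ, hz.self_of_nhds.2.1, hΦ⟩ (by simp)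
    have h2 : MDifferentiableAt 𝓥 E 𝓥 V f z := (hfz.differentiableAt (by simp)).mdifferentiableAt
    have h3 := mfderiv_comp z h1 h2
    have h4 : ψ ∘ f =ᶠ[𝓝 z] (extChartAt I p₀).symm := hz.mono fun w hw => hw.2.2
    rw [h4.mfderiv_eq, mfderiv_eq_fderiv] at h3
    have h5 := congrArg (fun L => (L a : E)) h3
    exact h5.symm
  refine ⟨f, hfy, hfs, ?_, ?_⟩
  · have hψd : IsLocalDiffeomorphAt 𝓥 V I ∞ ψ (f y) := ⟨Φ, hfy ▸ hx, hΦ⟩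
    obtain ⟨e, he⟩ := isInvertible_chartVec hy
    have h1 := hder.self_of_nhds
    let e' := hψd.mfderivToContinuousLinearEquiv (by simp)
    let e1 : V ≃L[ℝ] E := e'
    let e2 : E ≃L[ℝ] E := e
    refine ⟨e2.trans e1.symm, ?_⟩
    ext a
    have h2 : e1 (𝐃 f y a) = e2 a := by
      have h3 : e2 a = chartVec I p₀ y a := by rw [chartVec, ← he]; rfl
      rw [h3]
      exact h1 a
    have : e1.symm (e2 a) = 𝐃 f y a := by rw [← h2, e1.symm_apply_apply]
    exact this
  · filter_upwards [hev, hder] with z hz hz'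
    exact ⟨hz.1, hz.2.2, hz'⟩

/-- `ψ` is, at `x`, a local isomorphism from the model `A` to the manifold `M` endowed with the
fields `form` and `F`. -/
structure AdaptedModel.ModelsAt (A : AdaptedModel V) (I : ModelWithCorners ℝ E H)
    (form : FormField I M)
    (F : EndField I M) (ψ : V → M) (x : V) : Prop where
  localDiffeo : IsLocalDiffeomorphAt 𝓥 V I ∞ ψ x
  form_eq : ∀ a b : V, form (ψ x) (mfderiv 𝓥 V I ψ x a) (mfderiv 𝓥 V I ψ x b) = A.form x a b
  F_eq : ∀ a : V, F (ψ x) (mfderiv 𝓥 V I ψ x a) = mfderiv 𝓥 V I ψ x (A.F a)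

/-- The manifold `M`, endowed with the fields `form` and `F`, is locally isomorphic to models. -/
def HasModels (V : Type) [NormedAddCommGroup V] [NormedSpace ℝ V] (I : ModelWithCorners ℝ E H)
    (form : FormField I M)
    (F : EndField I M) : Prop :=
  ∀ p : M, ∃ (A : AdaptedModel V) (ψ : V → M) (x : V), x ∈ A.U ∧ ψ x = p ∧
    ∀ z ∈ A.U, A.ModelsAt I form F ψ z

lemma form_congr (form : FormField I M) {p q : M} (h : p = q)
    {v w : TangentSpace I p} {v' w' : TangentSpace I q} (hv : (v : E) = v') (hw : (w : E) = w') :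
    form p v w = form q v' w' := by
  subst h
  exact congrArg₂ (fun v w => form p v w) hv hw

lemma end_congr (F : EndField I M) {p q : M} (h : p = q)
    {v : TangentSpace I p} {v' : TangentSpace I q} (hv : (v : E) = v') :
    (F p v : E) = F q v' := by
  subst h
  exact congrArg (fun v => F p v) hv

namespace AdaptedModel

variable {A : AdaptedModel V} {form : FormField I M} {F : EndField I M} {ψ : V → M} {x : V}

/-- The differential of a local isomorphism from a model. -/
def ModelsAt.equiv (h : A.ModelsAt I form F ψ x) : V ≃L[ℝ] TangentSpace I (ψ x) :=
  h.localDiffeo.mfderivToContinuousLinearEquiv (by simp)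

lemma ModelsAt.equiv_apply (h : A.ModelsAt I form F ψ x) (a : V) :
    h.equiv a = mfderiv 𝓥 V I ψ x a := rfl

lemma ModelsAt.F_F (h : A.ModelsAt I form F ψ x) (v : TangentSpace I (ψ x)) :
    F (ψ x) (F (ψ x) v) = v := by
  obtain ⟨a, rfl⟩ := h.equiv.surjective v
  rw [h.equiv_apply, h.F_eq, h.F_eq, A.F_F]

lemma ModelsAt.anti (h : A.ModelsAt I form F ψ x) (hx : x ∈ A.U) (v w : TangentSpace I (ψ x)) :
    form (ψ x) (F (ψ x) v) (F (ψ x) w) = -form (ψ x) v w := by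
  obtain ⟨a, rfl⟩ := h.equiv.surjective v
  obtain ⟨b, rfl⟩ := h.equiv.surjective w
  simp only [h.equiv_apply, h.F_eq, h.form_eq, A.anti x hx]

lemma ModelsAt.alt (h : A.ModelsAt I form F ψ x) (hx : x ∈ A.U) (v : TangentSpace I (ψ x)) :
    form (ψ x) v v = 0 := by
  obtain ⟨a, rfl⟩ := h.equiv.surjective v
  simp only [h.equiv_apply, h.form_eq, A.alt x hx]

lemma ModelsAt.nondeg (h : A.ModelsAt I form F ψ x) (hx : x ∈ A.U) (v : TangentSpace I (ψ x))
    (hv : ∀ w, form (ψ x) v w = 0) : v = 0 := by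
  obtain ⟨a, rfl⟩ := h.equiv.surjective v
  have : a = 0 := A.nondeg x hx a fun b => by rw [← h.form_eq]; exact hv _
  rw [this, map_zero]

variable [I.Boundaryless] [IsManifold I ∞ M] [FiniteDimensional ℝ V] [FiniteDimensional ℝ E]

/-- A manifold with a local isomorphism from a model, read in a chart. -/
lemma exists_coord_model (hA : ∀ z ∈ A.U, A.ModelsAt I form F ψ z) (hx : x ∈ A.U) {p₀ : M} {y : E}
    (hy : y ∈ (extChartAt I p₀).target) (hp : (extChartAt I p₀).symm y = ψ x) :
    ∃ f : E → V, f y = x ∧ ContDiffAt ℝ ∞ f y ∧ (𝐃 f y).IsInvertible ∧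
      ∀ᶠ z in 𝓝 y, f z ∈ A.U ∧ (𝐃 f z).IsInvertible ∧
        (∀ a b, coordForm I form p₀ z a b = A.form (f z) (𝐃 f z a) (𝐃 f z b)) ∧
        (∀ a, 𝐃 f z (coordEnd I F p₀ z a) = A.F (𝐃 f z a)) := by
  obtain ⟨f, hfy, hfs, hfi, hev⟩ := exists_coord (hA x hx).localDiffeo hy hp
  refine ⟨f, hfy, hfs, hfi, ?_⟩
  have hU : ∀ᶠ z in 𝓝 y, f z ∈ A.U := hfs.continuousAt (A.isOpen.mem_nhds (by rwa [hfy]))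
  filter_upwards [hU, eventually_isInvertible_fderiv hfs hfi, hev] with z hzU hzi hz
  obtain ⟨hzt, hzψ, hzd⟩ := hz
  refine ⟨hzU, hzi, fun a b => ?_, fun a => ?_⟩
  · exact (form_congr form hzψ (hzd a) (hzd b)).symm.trans ((hA (f z) hzU).form_eq _ _)
  · have hinj : Function.Injective (mfderiv 𝓥 V I ψ (f z)) := (hA (f z) hzU).equiv.injective
    have h1 : (chartVec I p₀ z (coordEnd I F p₀ z a) : E) =
        F (ψ (f z)) (mfderiv 𝓥 V I ψ (f z) (𝐃 f z a)) :=
      (chartVec_mfderiv_extChartAt hzt (F _ (chartVec I p₀ z a))).trans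
        (end_congr F hzψ (hzd a)).symm
    exact hinj (((hzd (coordEnd I F p₀ z a)).trans h1).trans ((hA (f z) hzU).F_eq _))

end AdaptedModel

lemma isInvolutive_of_models {D : DistField I M} {form : FormField I M} {F : EndField I M}
    [I.Boundaryless] [IsManifold I ∞ M] [FiniteDimensional ℝ V] [FiniteDimensional ℝ E]
    (h : HasModels V I form F) (ε : ℝ) (hD : ∀ p v, v ∈ D p ↔ F p v = ε • v) :
    IsInvolutive I D := by
  intro p₀ X Y hX hY hXD hYD y hy
  obtain ⟨A, ψ, x, hx, hψ, hA⟩ := h ((extChartAt I p₀).symm y)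
  obtain ⟨f, hfy, hfs, hfi, hev⟩ := AdaptedModel.exists_coord_model hA hx hy hψ.symm
  have htn := (isOpen_extChartAt_target (I := I) p₀).mem_nhds hy
  have hiff : ∀ᶠ z in 𝓝 y, ∀ a, chartVec I p₀ z a ∈ D ((extChartAt I p₀).symm z) ↔
      A.F (𝐃 f z a) = ε • 𝐃 f z a := by
    filter_upwards [hev, htn] with z hz hzt a
    obtain ⟨-, ⟨e, he⟩, -, hF⟩ := hz
    rw [hD, ← hF, ← map_smul]
    have hinj : Function.Injective (𝐃 f z) := by rw [← he]; exact e.injective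
    rw [hinj.eq_iff]
    constructor
    · intro h1
      exact (congrArg (mfderiv I 𝓥 E (extChartAt I p₀) ((extChartAt I p₀).symm z)) h1).trans
        ((map_smul _ _ _).trans (congrArg (ε • ·) (mfderiv_extChartAt_chartVec hzt a)))
    · intro h1
      exact (chartVec_mfderiv_extChartAt hzt (F _ (chartVec I p₀ z a))).symm.trans
        ((congrArg (chartVec I p₀ z) h1).trans
          (map_smul (mfderiv 𝓥 E I (extChartAt I p₀).symm z) _ _))
  have key : ∀ X : E → E, ContDiffOn ℝ ∞ X (extChartAt I p₀).target →
      (∀ y ∈ (extChartAt I p₀).target, chartVec I p₀ y (X y) ∈ D ((extChartAt I p₀).symm y)) →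
      ∀ v, A.F (𝐃 (𝐃 f) y v (X y) + 𝐃 f y (𝐃 X y v)) =
        ε • (𝐃 (𝐃 f) y v (X y) + 𝐃 f y (𝐃 X y v)) := by
    intro X hX hXD v
    have hd1 : HasFDerivAt (𝐃 f) _ y := hfs.smooth_fderiv.diffAt.hasFDerivAt
    have hd2 : HasFDerivAt X _ y := ((hX.contDiffAt htn).differentiableAt (by simp)).hasFDerivAt
    have hd3 := hd1.clm_apply hd2
    have hd4 := A.F.hasFDerivAt.comp y hd3
    have hd5 := hd3.const_smul ε
    have heq : (A.F ∘ fun z => 𝐃 f z (X z)) =ᶠ[𝓝 y] ε • fun z => 𝐃 f z (X z) := by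
      filter_upwards [hiff, htn] with z hz hzt
      exact (hz (X z)).1 (hXD z hzt)
    have h1 := heq.fderiv_eq (𝕜 := ℝ)
    rw [hd4.fderiv, hd5.fderiv] at h1
    have h2 := congrArg (fun L : E →L[ℝ] V => L v) h1
    simp only [coe_comp, Function.comp_apply, add_apply, flip_apply, smul_apply] at h2
    rw [add_comm]
    exact h2
  have hs : IsSymmSndFDerivAt ℝ f y := hfs.isSymmSndFDerivAt
    (by simpa using WithTop.coe_le_coe.2 (le_top : (2 : ℕ∞) ≤ ⊤))
  rw [(hiff.self_of_nhds) _, VectorField.lieBracket]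
  have k1 := key X hX hXD (Y y)
  have k2 := key Y hY hYD (X y)
  rw [hs] at k1
  simp only [map_add, smul_add, map_sub, smul_sub] at k1 k2 ⊢
  rw [← sub_eq_zero] at k1 k2 ⊢
  have := congrArg₂ (· - ·) k2 k1
  simp only [sub_zero] at this
  rw [← this]
  abel

variable [I.Boundaryless] [IsManifold I ∞ M] [FiniteDimensional ℝ V] [FiniteDimensional ℝ E]
  (form : FormField I M)
  (F : EndField I M)

/-- The bi-Lagrangian structure of a manifold which is locally isomorphic to models. -/
def BiLagrangianStructure.ofModels (h : HasModels V I form F) : BiLagrangianStructure I M where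
  form := form
  D₁ p := LinearMap.ker (F p - LinearMap.id)
  D₂ p := LinearMap.ker (F p + LinearMap.id)
  F := F
  alternating p v := by
    obtain ⟨A, ψ, x, hx, rfl, hA⟩ := h p
    exact (hA x hx).alt hx v
  nondegenerate p v := by
    obtain ⟨A, ψ, x, hx, rfl, hA⟩ := h p
    exact (hA x hx).nondeg hx v
  smooth_form p₀ a b y hy := by
    obtain ⟨A, ψ, x, hx, hψ, hA⟩ := h ((extChartAt I p₀).symm y)
    obtain ⟨f, hfy, hfs, hfi, hev⟩ := AdaptedModel.exists_coord_model hA hx hy hψ.symm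
    refine ContDiffAt.contDiffWithinAt ?_
    have h1 : ContDiffAt ℝ ∞ (𝐃 f) y := hfs.smooth_fderiv
    have h2 : ContDiffAt ℝ ∞ (fun z => A.form (f z)) y :=
      ContDiffAt.comp y (by rw [hfy]; exact AdaptedModel.contDiffAt_form hx) hfs
    refine ContDiffAt.congr_of_eventuallyEq ((h2.clm_apply (h1.clm_apply
      (contDiffAt_const (c := a)))).clm_apply (h1.clm_apply (contDiffAt_const (c := b))))
      (hev.mono fun z hz => hz.2.2.1 a b)
  closed p₀ y hy a b c := by
    obtain ⟨A, ψ, x, hx, hψ, hA⟩ := h ((extChartAt I p₀).symm y)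
    obtain ⟨f, hfy, hfs, hfi, hev⟩ := AdaptedModel.exists_coord_model hA hx hy hψ.symm
    have key : ∀ a b c, 𝐃 (fun x => coordForm I form p₀ x b c) y a =
        𝐃 A.form (f y) (𝐃 f y a) (𝐃 f y b) (𝐃 f y c)
        + A.form (f y) (𝐃 (𝐃 f) y a b) (𝐃 f y c)
        + A.form (f y) (𝐃 f y b) (𝐃 (𝐃 f) y a c) := by
      intro a b c
      have hd : DifferentiableAt ℝ A.form (f y) := by
        rw [hfy]; exact (AdaptedModel.contDiffAt_form hx).differentiableAt (by simp)
      have h1 : ContDiffAt ℝ ∞ (𝐃 f) y := hfs.smooth_fderiv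
      have h2 : ContDiffAt ℝ ∞ (fun z => A.form (f z)) y :=
        ContDiffAt.comp y (by rw [hfy]; exact AdaptedModel.contDiffAt_form hx) hfs
      rw [← fderiv_pullback (hfs.of_le (WithTop.coe_le_coe.2 (le_top : (2 : ℕ∞) ≤ ⊤))) hd,
        ← fderiv_clm_apply₂ ((h2.pullForm h1).differentiableAt (by simp))]
      congr 1
      exact Filter.EventuallyEq.fderiv_eq (hev.mono fun z hz =>
        (hz.2.2.1 b c).trans (pullForm_apply _ _ _ _).symm)
    have hs : IsSymmSndFDerivAt ℝ f y := hfs.isSymmSndFDerivAt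
      (by simpa using WithTop.coe_le_coe.2 (le_top : (2 : ℕ∞) ≤ ⊤))
    have hxU : f y ∈ A.U := by rwa [hfy]
    have h1 := A.closed (f y) hxU (𝐃 f y a) (𝐃 f y b) (𝐃 f y c)
    rw [key, key, key, hs b a, hs c a, hs c b]
    have s1 := AdaptedModel.form_swap hxU (𝐃 (𝐃 f) y a b) (𝐃 f y c)
    have s2 := AdaptedModel.form_swap hxU (𝐃 (𝐃 f) y a c) (𝐃 f y b)
    have s3 := AdaptedModel.form_swap hxU (𝐃 (𝐃 f) y b c) (𝐃 f y a)
    linarith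
  transversal p := by
    obtain ⟨A, ψ, x, hx, rfl, hA⟩ := h p
    have hFF := (hA x hx).F_F
    constructor
    · rw [Submodule.disjoint_def]
      intro v h1 h2
      have h3 : F (ψ x) v = v := sub_eq_zero.1 h1
      have h4 : F (ψ x) v = -v := eq_neg_of_add_eq_zero_left h2
      have h5 : v + v = 0 := by nth_rewrite 2 [h3.symm.trans h4]; exact add_neg_cancel v
      rw [← two_smul ℝ] at h5
      simpa [smul_smul] using congrArg ((1 / 2 : ℝ) • ·) h5
    · rw [codisjoint_iff_le_sup]
      intro v _
      rw [Submodule.mem_sup]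
      refine ⟨(1 / 2 : ℝ) • (v + F (ψ x) v), ?_, (1 / 2 : ℝ) • (v - F (ψ x) v), ?_, ?_⟩
      · rw [LinearMap.mem_ker, LinearMap.sub_apply, map_smul, map_add, hFF, LinearMap.id_apply,
          add_comm, sub_self]
      · rw [LinearMap.mem_ker, LinearMap.add_apply, map_smul, map_sub, hFF, LinearMap.id_apply,
          ← smul_add]
        simp
      · rw [← smul_add]
        simp only [add_add_sub_cancel]
        rw [← two_smul ℝ v, smul_smul]
        norm_num
  lagrangian₁ p v hv w hw := by
    obtain ⟨A, ψ, x, hx, rfl, hA⟩ := h p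
    have h1 := (hA x hx).anti hx v w
    rw [sub_eq_zero.1 (LinearMap.mem_ker.1 hv), sub_eq_zero.1 (LinearMap.mem_ker.1 hw)] at h1
    exact self_eq_neg.1 h1
  lagrangian₂ p v hv w hw := by
    obtain ⟨A, ψ, x, hx, rfl, hA⟩ := h p
    have h1 := (hA x hx).anti hx v w
    rw [eq_neg_of_add_eq_zero_left (LinearMap.mem_ker.1 hv),
      eq_neg_of_add_eq_zero_left (LinearMap.mem_ker.1 hw)] at h1
    simp only [map_neg, LinearMap.neg_apply, neg_neg] at h1
    exact self_eq_neg.1 h1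
  F_D₁ p v hv := sub_eq_zero.1 (LinearMap.mem_ker.1 hv)
  F_D₂ p v hv := eq_neg_of_add_eq_zero_left (LinearMap.mem_ker.1 hv)
  smooth_F p₀ a y hy := by
    obtain ⟨A, ψ, x, hx, hψ, hA⟩ := h ((extChartAt I p₀).symm y)
    obtain ⟨f, hfy, hfs, hfi, hev⟩ := AdaptedModel.exists_coord_model hA hx hy hψ.symm
    refine ContDiffAt.contDiffWithinAt ?_
    have h1 : ContDiffAt ℝ ∞ (𝐃 f) y := hfs.smooth_fderiv
    have h2 : ContDiffAt ℝ ∞ (fun z => inverse (𝐃 f z)) y := (hfi.contDiffAt_map_inverse).comp y h1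
    refine ContDiffAt.congr_of_eventuallyEq (h2.clm_apply ((contDiffAt_const (c := A.F)).clm_apply
      (h1.clm_apply (contDiffAt_const (c := a))))) (hev.mono fun z hz => ?_)
    obtain ⟨-, ⟨e, he⟩, -, hF⟩ := hz
    have hFa := hF a
    simp only [← he] at hFa ⊢
    simpa using (e.eq_symm_apply).2 hFa
  involutive₁ := isInvolutive_of_models h 1 fun p v => by
    rw [LinearMap.mem_ker, LinearMap.sub_apply, sub_eq_zero, LinearMap.id_apply, one_smul]
  involutive₂ := isInvolutive_of_models h (-1) fun p v => by
    rw [LinearMap.mem_ker, LinearMap.add_apply, LinearMap.id_apply, neg_smul, one_smul,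
      eq_neg_iff_add_eq_zero]

variable {form F}

/-- The curvature in a chart is that of the model. -/
lemma BiLagrangianStructure.curvature_eq (B : BiLagrangianStructure I M) {A : AdaptedModel V}
    {ψ : V → M} {x : V} (hA : ∀ z ∈ A.U, A.ModelsAt I B.form B.F ψ z) (hx : x ∈ A.U) {p₀ : M}
    {y : E} (hy : y ∈ (extChartAt I p₀).target) (hp : (extChartAt I p₀).symm y = ψ x) :
    ∃ L : E ≃L[ℝ] V, ∀ a b c, L (curvature I B.g p₀ y a b c) =
      curv (fun x a b => A.metric x a b) x (L a) (L b) (L c) := by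
  obtain ⟨f, hfy, hfs, hfi, hev⟩ := AdaptedModel.exists_coord_model hA hx hy hp
  obtain ⟨L, hL⟩ := id hfi
  refine ⟨L, fun a b c => ?_⟩
  have hU := A.isOpen.mem_nhds hx
  have htn := (isOpen_extChartAt_target (I := I) p₀).mem_nhds hy
  have h1 := fderiv_curv_pullback hfs hfi (G := A.metric)
    (by rw [hfy]; exact AdaptedModel.contDiffAt_metric hx)
    (by rw [hfy]; filter_upwards [hU] with z hz using AdaptedModel.metric_nondeg hz)
    (by rw [hfy]; filter_upwards [hU] with z hz using AdaptedModel.metric_symm hz) a b c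
  have h2 : curvature I B.g p₀ y a b c = curv (coordForm I B.g p₀) y a b c := rfl
  have h3 : ∀ᶠ z in 𝓝 y, ∀ a b, coordForm I B.g p₀ z a b = A.metric (f z) (𝐃 f z a) (𝐃 f z b) := by
    filter_upwards [hev, htn] with z hz hzt a b
    rw [AdaptedModel.metric_apply, ← hz.2.2.2, ← hz.2.2.1]
    exact congrArg (fun v => B.form _ v (chartVec I p₀ z b))
      (chartVec_mfderiv_extChartAt hzt (B.F _ (chartVec I p₀ z a))).symm
  rw [h2, curv_congr h3]
  rw [hfy, ← hL] at h1
  exact h1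

lemma BiLagrangianStructure.isFlat_of_models (B : BiLagrangianStructure I M)
    (h : ∀ p, ∃ (A : AdaptedModel V) (ψ : V → M) (x : V), x ∈ A.U ∧ ψ x = p ∧
      (∀ z ∈ A.U, A.ModelsAt I B.form B.F ψ z) ∧
      ∀ a b c, curv (fun x a b => A.metric x a b) x a b c = 0) : B.IsFlat := by
  intro p₀ y hy a b c
  obtain ⟨A, ψ, x, hx, hψ, hA, hc⟩ := h ((extChartAt I p₀).symm y)
  obtain ⟨L, hL⟩ := B.curvature_eq hA hx hy hψ.symm
  exact L.map_eq_zero_iff.1 ((hL a b c).trans (hc _ _ _))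

lemma BiLagrangianStructure.IsFlat.curv_eq_zero {B : BiLagrangianStructure I M} (hB : B.IsFlat)
    {A : AdaptedModel V} {ψ : V → M} {x : V} (hA : ∀ z ∈ A.U, A.ModelsAt I B.form B.F ψ z)
    (hx : x ∈ A.U) (a b c : V) : curv (fun x a b => A.metric x a b) x a b c = 0 := by
  have hy := mem_extChartAt_target (I := I) (ψ x)
  obtain ⟨L, hL⟩ := B.curvature_eq hA hx hy (by simp)
  have := hL (L.symm a) (L.symm b) (L.symm c)
  simp only [L.apply_symm_apply] at this
  rw [← this, hB _ _ hy, map_zero]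

end ModelsOnManifolds

section LocalDiffeomorphisms

/-- The restriction of a partial diffeomorphism to an open set. -/
def PartialDiffeomorph.restrOpen' (Φ : PartialDiffeomorph I I' M M' ∞) (s : Set M)
    (hs : IsOpen s) : PartialDiffeomorph I I' M M' ∞ where
  toPartialEquiv := (Φ.toOpenPartialHomeomorph.restrOpen s hs).toPartialEquiv
  open_source := (Φ.toOpenPartialHomeomorph.restrOpen s hs).open_source
  open_target := (Φ.toOpenPartialHomeomorph.restrOpen s hs).open_target
  contMDiffOn_toFun := Φ.contMDiffOn_toFun.mono fun x hx => by
    have : x ∈ Φ.source ∩ s := hx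
    exact this.1
  contMDiffOn_invFun := Φ.contMDiffOn_invFun.mono fun x hx => by
    have : x ∈ Φ.target ∩ _ := hx
    exact this.1

lemma IsLocalDiffeomorphAt.congr' {f g : M → M'} {x : M} (hf : IsLocalDiffeomorphAt I I' ∞ f x)
    (h : g =ᶠ[𝓝 x] f) : IsLocalDiffeomorphAt I I' ∞ g x := by
  obtain ⟨Φ, hx, hΦ⟩ := hf
  obtain ⟨s, hs, hso, hxs⟩ := eventually_nhds_iff.1 h
  refine ⟨Φ.restrOpen' s hso, ⟨hx, hxs⟩, fun z hz => ?_⟩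
  have hz' : z ∈ Φ.source ∩ s := hz
  exact (hs z hz'.2).trans (hΦ hz'.1)

/-- The inverse function theorem. -/
lemma isLocalDiffeomorphAt_of_isInvertible_fderiv [CompleteSpace V] {f : V → E} {U : Set V}
    (hU : IsOpen U) (hf : ContDiffOn ℝ ∞ f U) {x : V} (hx : x ∈ U)
    (hi : (𝐃 f x).IsInvertible) :
    IsLocalDiffeomorphAt 𝓥 V 𝓥 E ∞ f x := by
  have hfx : ContDiffAt ℝ ∞ f x := hf.contDiffAt (hU.mem_nhds hx)
  have h1 : ContinuousAt (𝐃 f) x := hfx.smooth_fderiv.continuousAt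
  have hev : ∀ᶠ z in 𝓝 x, (𝐃 f z).IsInvertible := by
    obtain ⟨e, he⟩ := hi
    refine h1.eventually ?_
    rw [← he]
    filter_upwards [ContinuousLinearEquiv.nhds e] with A hA using hA
  obtain ⟨s, hs, hso, hxs⟩ := eventually_nhds_iff.1 hev
  obtain ⟨e, he⟩ := hi
  have hf' : HasFDerivAt f (e : V →L[ℝ] E) x := by rw [he]; exact hfx.diffAt.hasFDerivAt
  let Φ₀ := hfx.toOpenPartialHomeomorph f hf' (by simp)
  let Φ := Φ₀.restrOpen (U ∩ s) (hU.inter hso)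
  have hsrc : ∀ z ∈ Φ.source, z ∈ U ∧ z ∈ s := by
    intro z hz
    rw [OpenPartialHomeomorph.restrOpen_source] at hz
    exact hz.2
  have hΦf : ∀ z, Φ z = f z := fun z => rfl
  refine ⟨{ toPartialEquiv := Φ.toPartialEquiv, open_source := Φ.open_source
            open_target := Φ.open_target
            contMDiffOn_toFun := fun z hz => ?_
            contMDiffOn_invFun := fun z hz => ?_ }, ?_, fun z _ => rfl⟩
  · exact (hf.contDiffAt (hU.mem_nhds (hsrc z hz).1)).contMDiffAt.contMDiffWithinAt
  · have hz' : Φ.symm z ∈ Φ.source := Φ.map_target hz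
    obtain ⟨e', he'⟩ := hs _ (hsrc _ hz').2
    have hc : ContDiffAt ℝ ∞ f (Φ.symm z) := hf.contDiffAt (hU.mem_nhds (hsrc _ hz').1)
    have : ContDiffAt ℝ ∞ Φ.symm z := Φ.contDiffAt_symm (f₀' := e') hz
      (by rw [he']; exact hc.diffAt.hasFDerivAt) hc
    exact this.contMDiffAt.contMDiffWithinAt
  · change x ∈ Φ.source
    rw [OpenPartialHomeomorph.restrOpen_source]
    exact ⟨hfx.mem_toOpenPartialHomeomorph_source hf' (by simp), hx, hxs⟩

lemma isLocalDiffeomorphAt_extChartAt_symm [I.Boundaryless] [IsManifold I ∞ M] {p₀ : M} {y : E}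
    (hy : y ∈ (extChartAt I p₀).target) :
    IsLocalDiffeomorphAt 𝓥 E I ∞ (extChartAt I p₀).symm y :=
  ⟨{ toPartialEquiv := (extChartAt I p₀).symm, open_source := isOpen_extChartAt_target p₀
     open_target := isOpen_extChartAt_source p₀
     contMDiffOn_toFun := contMDiffOn_extChartAt_symm p₀
     contMDiffOn_invFun := by
      have := contMDiffOn_extChartAt (I := I) (n := ∞) (x := p₀)
      rwa [← extChartAt_source I] at this }, hy, fun _ _ => rfl⟩

lemma isLocalDiffeomorphAt_of_injective_mfderiv [FiniteDimensional ℝ V] [FiniteDimensional ℝ E]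
    [I.Boundaryless] [IsManifold I ∞ M]
    (hdim : Module.finrank ℝ V = Module.finrank ℝ E) {f : V → M} {U : Set V} (hU : IsOpen U)
    (hf : ContMDiffOn 𝓥 V I ∞ f U) {x : V} (hx : x ∈ U)
    (hi : Function.Injective (mfderiv 𝓥 V I f x)) :
    IsLocalDiffeomorphAt 𝓥 V I ∞ f x := by
  set φ := extChartAt I (f x) with hφ
  have hfx := hf.contMDiffAt (hU.mem_nhds hx)
  have hsrc : φ.source ∈ 𝓝 (f x) := extChartAt_source_mem_nhds (f x)
  obtain ⟨s, hs, hso, hxs⟩ := eventually_nhds_iff.1 (hfx.continuousAt hsrc)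
  have hh : ContDiffOn ℝ ∞ (φ ∘ f) (U ∩ s) := by
    intro z hz
    have h1 : ContMDiffAt I 𝓥 E ∞ φ (f z) := by
      have h2 := contMDiffOn_extChartAt (I := I) (n := ∞) (x := f x)
      rw [← extChartAt_source I] at h2
      exact h2.contMDiffAt ((isOpen_extChartAt_source (I := I) (f x)).mem_nhds (hs z hz.2))
    exact (h1.comp z (hf.contMDiffAt (hU.mem_nhds hz.1))).contDiffAt.contDiffWithinAt
  have hder : 𝐃 (φ ∘ f) x = (mfderiv I 𝓥 E φ (f x)).comp (mfderiv 𝓥 V I f x) := by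
    rw [← mfderiv_eq_fderiv]
    exact mfderiv_comp x (mdifferentiableAt_extChartAt (mem_chart_source H (f x)))
      (hfx.mdifferentiableAt (by simp))
  have hinj : Function.Injective (𝐃 (φ ∘ f) x) := by
    have hinv := isInvertible_mfderiv_extChartAt (I := I) (mem_extChartAt_source (I := I) (f x))
    obtain ⟨e, he⟩ := hinv
    have h2 : Function.Injective (mfderiv I 𝓥 E φ (f x)) := by rw [hφ, ← he]; exact e.injective
    rw [hder]
    exact h2.comp hi
  have hinv : (𝐃 (φ ∘ f) x).IsInvertible :=
    ⟨(LinearEquiv.ofInjectiveOfFinrankEq (𝐃 (φ ∘ f) x : V →ₗ[ℝ] E) hinj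
      hdim).toContinuousLinearEquiv, by ext v; rfl⟩
  have h1 := isLocalDiffeomorphAt_of_isInvertible_fderiv (hU.inter hso) hh ⟨hx, hxs⟩ hinv
  have h2 := IsLocalDiffeomorphAt.comp (hf := h1) (hg := isLocalDiffeomorphAt_extChartAt_symm
    (I := I) (p₀ := f x) (φ.map_source (hs x hxs)))
  refine h2.congr' ?_
  filter_upwards [hso.mem_nhds hxs] with z hz
  exact (φ.left_inv (hs z hz)).symm

end LocalDiffeomorphisms

section Leaves

lemma BiLagrangianStructure.mem_D₁_iff (B : BiLagrangianStructure I M) (p : M)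
    (v : TangentSpace I p) : v ∈ B.D₁ p ↔ B.F p v = v := by
  refine ⟨B.F_D₁ p v, fun h => ?_⟩
  obtain ⟨a, ha, b, hb, rfl⟩ := Submodule.mem_sup.1
    (show v ∈ B.D₁ p ⊔ B.D₂ p by rw [(B.transversal p).sup_eq_top]; trivial)
  rw [map_add, B.F_D₁ p a ha, B.F_D₂ p b hb] at h
  have h2 : -b = b := add_left_cancel h
  have h5 : b + b = 0 := by nth_rewrite 2 [← h2]; exact add_neg_cancel b
  rw [← two_smul ℝ] at h5
  have h6 : b = 0 := by simpa [smul_smul] using congrArg ((1 / 2 : ℝ) • ·) h5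
  rw [h6, add_zero]
  exact ha

lemma BiLagrangianStructure.mem_D₂_iff (B : BiLagrangianStructure I M) (p : M)
    (v : TangentSpace I p) : v ∈ B.D₂ p ↔ B.F p v = -v := by
  refine ⟨B.F_D₂ p v, fun h => ?_⟩
  obtain ⟨a, ha, b, hb, rfl⟩ := Submodule.mem_sup.1
    (show v ∈ B.D₁ p ⊔ B.D₂ p by rw [(B.transversal p).sup_eq_top]; trivial)
  rw [map_add, B.F_D₁ p a ha, B.F_D₂ p b hb, neg_add] at h
  have h2 : a = -a := add_right_cancel h
  have h5 : a + a = 0 := by nth_rewrite 2 [h2]; exact add_neg_cancel a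
  rw [← two_smul ℝ] at h5
  have h6 : a = 0 := by simpa [smul_smul] using congrArg ((1 / 2 : ℝ) • ·) h5
  rw [h6, zero_add]
  exact hb

lemma BiLagrangianStructure.F_F (B : BiLagrangianStructure I M) (p : M)
    (v : TangentSpace I p) : B.F p (B.F p v) = v := by
  obtain ⟨a, ha, b, hb, rfl⟩ := Submodule.mem_sup.1
    (show v ∈ B.D₁ p ⊔ B.D₂ p by rw [(B.transversal p).sup_eq_top]; trivial)
  simp only [map_add, map_neg, B.F_D₁ p a ha, B.F_D₂ p b hb, neg_neg]

/-- The leaves of a foliation, described in a parametrization `ψ` of the manifold in which the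
foliation consists of the kernels of the differential of `u`. -/
theorem leaf_eq_image {W : Type} [NormedAddCommGroup W] [NormedSpace ℝ W]
    {D : DistField I M} {ψ : V → M} {U : Set V} (hU : IsOpen U)
    (hψ : IsLocalDiffeomorphOn 𝓥 V I ∞ ψ U) (hsurj : ψ '' U = univ)
    {u : V → W} (hu : DifferentiableOn ℝ u U)
    (hD : ∀ z ∈ U, ∀ a, mfderiv 𝓥 V I ψ z a ∈ D (ψ z) ↔ 𝐃 u z a = 0)
    {ℓ : V → V → Prop} (hloc : ∀ x ∈ U, ∀ᶠ y in 𝓝 x, u y = u x → ℓ x y)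
    (hsymm : ∀ x ∈ U, ∀ y ∈ U, ℓ x y → ℓ y x)
    (htrans : ∀ x ∈ U, ∀ y ∈ U, ∀ z ∈ U, ℓ x y → ℓ y z → ℓ x z)
    (hcompat : ∀ x ∈ U, ∀ x' ∈ U, ∀ y ∈ U, ψ x = ψ x' → ℓ x y → ∃ y' ∈ U, ψ y' = ψ y ∧ ℓ x' y')
    (hcurve : ∀ x ∈ U, ∀ y ∈ U, ℓ x y → ∃ c : ℝ → V, ContDiff ℝ ∞ c ∧ c 0 = x ∧ c 1 = y ∧
      ∀ t, c t ∈ U ∧ u (c t) = u x) {x : V} (hx : x ∈ U) :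
    leaf I D (ψ x) = ψ '' {y | y ∈ U ∧ ℓ x y} := by
  apply Subset.antisymm
  · rintro q ⟨γ, hγ, hγ0, hγ1, hγD⟩
    have hloc' : ∀ t₀, ∀ᶠ s in 𝓝 t₀, (∃ y ∈ U, ℓ x y ∧ ψ y = γ s) ↔
        ∃ y ∈ U, ℓ x y ∧ ψ y = γ t₀ := by
      intro t₀
      obtain ⟨z₀, hz₀, hψz₀⟩ : γ t₀ ∈ ψ '' U := by rw [hsurj]; trivial
      obtain ⟨Φ, hzΦ, hΦ⟩ := hψ ⟨z₀, hz₀⟩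
      have ht₀ : γ t₀ ∈ Φ.target := by
        rw [← hψz₀]
        exact (hΦ hzΦ) ▸ Φ.map_source hzΦ
      set c : ℝ → V := fun s => Φ.symm (γ s) with hc
      have hct : c t₀ = z₀ := by
        have : γ t₀ = Φ z₀ := hψz₀.symm.trans (hΦ hzΦ)
        rw [hc]; simp only [this]; exact Φ.left_inv hzΦ
      have hcM : ∀ s, γ s ∈ Φ.target → MDifferentiableAt 𝓥 ℝ 𝓥 V c s := fun s hs =>
        (Φ.symm.mdifferentiableAt (by simp) hs).comp s ((hγ s).mdifferentiableAt (by simp))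
      have hcc : ContinuousAt c t₀ := (hcM t₀ ht₀).continuousAt
      have hev : ∀ᶠ s in 𝓝 t₀, γ s ∈ Φ.target ∧ c s ∈ U ∧ c s ∈ Φ.source ∧ ψ (c s) = γ s := by
        filter_upwards [(hγ t₀).continuousAt (Φ.open_target.mem_nhds ht₀),
          hcc (hU.mem_nhds (by rwa [hct]))] with s hs hs'
        have h1 : c s ∈ Φ.source := Φ.map_target hs
        exact ⟨hs, hs', h1, by rw [hΦ h1]; exact Φ.right_inv hs⟩
      have hder : ∀ᶠ s in 𝓝 t₀, HasFDerivAt (u ∘ c) (0 : ℝ →L[ℝ] W) s := by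
        filter_upwards [hev.eventually_nhds] with s hs
        obtain ⟨h1, h2, h3, h4⟩ := hs.self_of_nhds
        have hcd : DifferentiableAt ℝ c s := (hcM s h1).differentiableAt
        have hψd : MDifferentiableAt 𝓥 V I ψ (c s) :=
          IsLocalDiffeomorphAt.mdifferentiableAt (n := ∞) ⟨Φ, h3, hΦ⟩ (by simp)
        have h5 := mfderiv_comp s hψd (hcM s h1)
        have h6 : ψ ∘ c =ᶠ[𝓝 s] γ := hs.mono fun w hw => hw.2.2.2
        rw [h6.mfderiv_eq, mfderiv_eq_fderiv] at h5
        have h7 : mfderiv 𝓥 V I ψ (c s) (𝐃 c s 1) ∈ D (ψ (c s)) := by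
          have h8 := hγD s
          have h9 : (mfderiv 𝓥 ℝ I γ s (1 : ℝ) : E) = mfderiv 𝓥 V I ψ (c s) (𝐃 c s 1) :=
              congrArg (fun L => (L (1 : ℝ) : E)) h5
          have h10 : ∀ (p q : M) (v : E), p = q → (v : TangentSpace I p) ∈ D p →
              (v : TangentSpace I q) ∈ D q := by
            rintro p _ v rfl h; exact h
          have h11 := h10 _ _ _ h4.symm h8
          rw [h9] at h11
          exact h11
        have h8 := (hD _ h2 _).1 h7
        have h9 : HasFDerivAt (u ∘ c) ((𝐃 u (c s)).comp (𝐃 c s)) s :=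
          ((hu _ h2).differentiableAt (hU.mem_nhds h2)).hasFDerivAt.comp s hcd.hasFDerivAt
        have h10 : (𝐃 u (c s)).comp (𝐃 c s) = 0 := by ext; exact h8
        rwa [h10] at h9
      have hconst : ∀ᶠ s in 𝓝 t₀, u (c s) = u z₀ := by
        obtain ⟨ε, hε, hball⟩ := Metric.eventually_nhds_iff_ball.1 hder
        filter_upwards [Metric.ball_mem_nhds t₀ hε] with s hs
        have := (convex_ball t₀ ε).is_const_of_fderivWithin_eq_zero (𝕜 := ℝ) (f := u ∘ c)
          (fun z hz => (hball z hz).differentiableAt.differentiableWithinAt)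
          (fun z hz => by
            rw [fderivWithin_of_isOpen Metric.isOpen_ball hz]; exact (hball z hz).fderiv)
          hs (Metric.mem_ball_self hε)
        rw [← hct]
        exact this
      have hℓ : ∀ᶠ s in 𝓝 t₀, ℓ z₀ (c s) := by
        have h1 : ∀ᶠ y in 𝓝 (c t₀), u y = u z₀ → ℓ z₀ y := by rw [hct]; exact hloc z₀ hz₀
        filter_upwards [hcc.eventually h1, hconst] with s h1 h2 using h1 h2
      filter_upwards [hℓ, hev] with s hs ⟨_, hsU, _, hsψ⟩
      constructor
      · rintro ⟨y, hy, hxy, hyψ⟩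
        obtain ⟨y', hy', h1, h2⟩ := hcompat (c s) hsU y hy z₀ hz₀ (hsψ.trans hyψ.symm)
          (hsymm _ hz₀ _ hsU hs)
        exact ⟨y', hy', htrans _ hx _ hy _ hy' hxy h2, h1.trans hψz₀⟩
      · rintro ⟨y, hy, hxy, hyψ⟩
        obtain ⟨y', hy', h1, h2⟩ := hcompat z₀ hz₀ y hy (c s) hsU (hψz₀.trans hyψ.symm) hs
        exact ⟨y', hy', htrans _ hx _ hy _ hy' hxy h2, h1.trans hsψ⟩
    have hlc : IsLocallyConstant fun s => ∃ y ∈ U, ℓ x y ∧ ψ y = γ s := by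
      rw [IsLocallyConstant.iff_eventually_eq]
      intro t₀
      filter_upwards [hloc' t₀] with s hs using propext hs
    have h01 := hlc.apply_eq_of_preconnectedSpace 0 1
    have h0 : ∃ y ∈ U, ℓ x y ∧ ψ y = γ 0 := ⟨x, hx, (hloc x hx).self_of_nhds rfl, hγ0.symm⟩
    obtain ⟨y, hy, hxy, hyψ⟩ := h01 ▸ h0
    exact ⟨y, ⟨hy, hxy⟩, hyψ.trans hγ1⟩
  · rintro _ ⟨y, ⟨hy, hxy⟩, rfl⟩
    obtain ⟨c, hc, hc0, hc1, hcU⟩ := hcurve x hx y hy hxy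
    refine ⟨ψ ∘ c, fun t => ?_, by simp [hc0], by simp [hc1], fun t => ?_⟩
    · exact (hψ ⟨c t, (hcU t).1⟩).contMDiffAt.comp t hc.contDiffAt.contMDiffAt
    · have hcd : DifferentiableAt ℝ c t := hc.differentiable (by simp) t
      have h1 := mfderiv_comp t ((hψ ⟨c t, (hcU t).1⟩).mdifferentiableAt (by simp))
        hcd.mdifferentiableAt
      rw [mfderiv_eq_fderiv] at h1
      have h2 : 𝐃 u (c t) (𝐃 c t 1) = 0 := by
        have h3 : HasFDerivAt (u ∘ c) ((𝐃 u (c t)).comp (𝐃 c t)) t :=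
          ((hu _ (hcU t).1).differentiableAt (hU.mem_nhds (hcU t).1)).hasFDerivAt.comp t
            hcd.hasFDerivAt
        have h4 : u ∘ c = fun _ => u x := funext fun s => (hcU s).2
        rw [h4] at h3
        exact congrArg (fun L : ℝ →L[ℝ] W => L 1) (h3.unique (hasFDerivAt_const (u x) t))
      have h3 := (hD _ (hcU t).1 _).2 h2
      rw [h1]
      exact h3

/-- A smooth curve in a segment, joining its end points. -/
lemma exists_curve_segment (x y : V) : ∃ c : ℝ → V, ContDiff ℝ ∞ c ∧ c 0 = x ∧ c 1 = y ∧
    ∀ t, ∃ s ∈ Icc (0 : ℝ) 1, c t = x + s • (y - x) :=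
  ⟨fun t => x + Real.smoothTransition t • (y - x),
    contDiff_const.add (Real.smoothTransition.contDiff.smul contDiff_const), by simp, by simp,
    fun t => ⟨_, ⟨Real.smoothTransition.nonneg t, Real.smoothTransition.le_one t⟩, rfl⟩⟩

end Leaves

section Quotients

/-- A parametrization `ψ` of a manifold by a model, such that the structure of the model descends
to the manifold. -/
structure AdaptedModel.Descends (A : AdaptedModel V) (I : ModelWithCorners ℝ E H) (ψ : V → M) :
    Prop where
  localDiffeo : IsLocalDiffeomorphOn 𝓥 V I ∞ ψ A.U
  surjective : ψ '' A.U = univ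
  invariant : ∀ x ∈ A.U, ∀ y ∈ A.U, ψ x = ψ y → ∃ L : V →L[ℝ] V,
    (∀ a : V, (mfderiv 𝓥 V I ψ y (L a) : E) = mfderiv 𝓥 V I ψ x a) ∧
    (∀ a b, A.form y (L a) (L b) = A.form x a b) ∧ ∀ a, A.F (L a) = L (A.F a)

namespace AdaptedModel.Descends

variable {A : AdaptedModel V} {ψ : V → M} (h : A.Descends I ψ)

include h in
lemma exists_rep (p : M) : ∃ x ∈ A.U, ψ x = p := by
  have : p ∈ ψ '' A.U := by rw [h.surjective]; trivial
  exact this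

/-- A point of the model over a point of the manifold. -/
def rep (p : M) : V := (h.exists_rep p).choose

lemma rep_mem (p : M) : h.rep p ∈ A.U := (h.exists_rep p).choose_spec.1

lemma map_rep (p : M) : ψ (h.rep p) = p := (h.exists_rep p).choose_spec.2

/-- The differential of the parametrization at the chosen point over `p`. -/
def frame (p : M) : V ≃L[ℝ] E :=
  (h.localDiffeo ⟨h.rep p, h.rep_mem p⟩).mfderivToContinuousLinearEquiv (by simp)

/-- The symplectic form on the quotient. -/
def formQ (p : M) : LinearMap.BilinForm ℝ (TangentSpace I p) := show LinearMap.BilinForm ℝ E from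
    LinearMap.mk₂ ℝ (fun v w => A.form (h.rep p) ((h.frame p).symm v) ((h.frame p).symm w))
      (by simp) (by simp) (by simp) (by simp)

/-- The almost product structure on the quotient. -/
def FQ (p : M) : TangentSpace I p →ₗ[ℝ] TangentSpace I p := show E →ₗ[ℝ] E from
    ((h.frame p : V →L[ℝ] E).comp (A.F.comp ((h.frame p).symm : E →L[ℝ] V)) : E →ₗ[ℝ] E)

lemma modelsAt {x : V} (hx : x ∈ A.U) : A.ModelsAt I h.formQ h.FQ ψ x := by
  obtain ⟨L, hL, hform, hF⟩ := h.invariant x hx (h.rep (ψ x)) (h.rep_mem _) (h.map_rep _).symm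
  have key : ∀ a : V, (h.frame (ψ x)).symm (mfderiv 𝓥 V I ψ x a : E) = L a := fun a =>
    (h.frame (ψ x)).symm_apply_eq.2 (hL a).symm
  refine ⟨h.localDiffeo ⟨x, hx⟩, fun a b => ?_, fun a => ?_⟩
  · have h1 : h.formQ (ψ x) (mfderiv 𝓥 V I ψ x a) (mfderiv 𝓥 V I ψ x b) =
      A.form (h.rep (ψ x)) ((h.frame (ψ x)).symm (mfderiv 𝓥 V I ψ x a : E))
        ((h.frame (ψ x)).symm (mfderiv 𝓥 V I ψ x b : E)) := rfl
    rw [h1, key, key, hform]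
  · have h1 : (h.FQ (ψ x) (mfderiv 𝓥 V I ψ x a) : E) =
      h.frame (ψ x) (A.F ((h.frame (ψ x)).symm (mfderiv 𝓥 V I ψ x a : E))) := rfl
    refine h1.trans ?_
    rw [key, hF]
    exact hL _

variable [I.Boundaryless] [IsManifold I ∞ M] [FiniteDimensional ℝ V] [FiniteDimensional ℝ E]

include h in
lemma hasModels : HasModels V I h.formQ h.FQ := fun p =>
  ⟨A, ψ, h.rep p, h.rep_mem p, h.map_rep p, fun _ hz => h.modelsAt hz⟩

/-- The bi-Lagrangian structure induced by a parametrization. -/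
def str : BiLagrangianStructure I M := BiLagrangianStructure.ofModels h.formQ h.FQ h.hasModels

lemma str_modelsAt : ∀ z ∈ A.U, A.ModelsAt I h.str.form h.str.F ψ z := fun _ hz => h.modelsAt hz

end AdaptedModel.Descends

lemma AdaptedModel.ModelsAt.g_eq {B : BiLagrangianStructure I M} {A : AdaptedModel V} {ψ : V → M}
    {x : V} (h : A.ModelsAt I B.form B.F ψ x) (a b : V) :
    B.g (ψ x) (mfderiv 𝓥 V I ψ x a) (mfderiv 𝓥 V I ψ x b) = A.metric x a b :=
  (congrArg (fun v => B.form (ψ x) v (mfderiv 𝓥 V I ψ x b)) (h.F_eq a)).trans (h.form_eq _ b)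

lemma AdaptedModel.ModelsAt.mem_D₁ {B : BiLagrangianStructure I M} {A : AdaptedModel V} {ψ : V → M}
    {x : V} (h : A.ModelsAt I B.form B.F ψ x) (a : V) :
    mfderiv 𝓥 V I ψ x a ∈ B.D₁ (ψ x) ↔ A.F a = a := by
  rw [B.mem_D₁_iff, h.F_eq]
  exact h.equiv.injective.eq_iff

lemma AdaptedModel.ModelsAt.mem_D₂ {B : BiLagrangianStructure I M} {A : AdaptedModel V} {ψ : V → M}
    {x : V} (h : A.ModelsAt I B.form B.F ψ x) (a : V) :
    mfderiv 𝓥 V I ψ x a ∈ B.D₂ (ψ x) ↔ A.F a = -a := by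
  rw [B.mem_D₂_iff, h.F_eq, ← h.equiv.injective.eq_iff, map_neg]
  rfl

lemma AdaptedModel.isQuotientOf {B : BiLagrangianStructure I M} {A : AdaptedModel V} {ψ : V → M}
    (h : ∀ z ∈ A.U, A.ModelsAt I B.form B.F ψ z) (hsurj : ψ '' A.U = univ)
    {r : V → V → Prop} (hr : ∀ x ∈ A.U, ∀ y ∈ A.U, ψ x = ψ y ↔ r x y) {G : V → V → V → ℝ}
    (hG : ∀ x ∈ A.U, ∀ a b, A.metric x a b = G x a b) {Φ : V → V → V}
    (hΦ : ∀ x ∈ A.U, ∀ a, A.F a = Φ x a) : B.IsQuotientOf A.U G Φ r ψ where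
  isOpen := A.isOpen
  localDiffeo z := (h z z.2).localDiffeo
  surjective := hsurj
  fibers := hr
  metric x hx a b := ((h x hx).g_eq a b).trans (hG x hx a b)
  product x hx a := by rw [(h x hx).F_eq, hΦ x hx]

/-- The leaves of a foliation of a manifold parametrized by a model. -/
theorem AdaptedModel.leaf_eq {D : DistField I M} {A : AdaptedModel V} {ψ : V → M} {K : V →L[ℝ] V}
    (hψ : IsLocalDiffeomorphOn 𝓥 V I ∞ ψ A.U) (hsurj : ψ '' A.U = univ)
    (hD : ∀ z ∈ A.U, ∀ a : V, mfderiv 𝓥 V I ψ z a ∈ D (ψ z) ↔ A.F a = K a)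
    {ℓ : V → V → Prop} (hloc : ∀ x ∈ A.U, ∀ᶠ y in 𝓝 x, A.F (y - x) = K (y - x) → ℓ x y)
    (hsymm : ∀ x ∈ A.U, ∀ y ∈ A.U, ℓ x y → ℓ y x)
    (htrans : ∀ x ∈ A.U, ∀ y ∈ A.U, ∀ z ∈ A.U, ℓ x y → ℓ y z → ℓ x z)
    (hcompat : ∀ x ∈ A.U, ∀ x' ∈ A.U, ∀ y ∈ A.U, ψ x = ψ x' → ℓ x y →
      ∃ y' ∈ A.U, ψ y' = ψ y ∧ ℓ x' y')
    (hseg : ∀ x ∈ A.U, ∀ y ∈ A.U, ℓ x y → A.F (y - x) = K (y - x) ∧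
      ∀ s ∈ Icc (0 : ℝ) 1, x + s • (y - x) ∈ A.U) {x : V} (hx : x ∈ A.U) :
    leaf I D (ψ x) = ψ '' {y | y ∈ A.U ∧ ℓ x y} := by
  have hu : ∀ z a, 𝐃 (A.F - K) z a = A.F a - K a := fun z a => by
    rw [ContinuousLinearMap.fderiv]; rfl
  refine leaf_eq_image A.isOpen hψ hsurj (A.F - K).differentiable.differentiableOn
    (fun z hz a => ?_) (fun x hx => ?_) hsymm htrans hcompat (fun x hx y hy hxy => ?_) hx
  · exact (hD z hz a).trans (sub_eq_zero.symm.trans (Eq.congr_left (hu z a).symm))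
  · filter_upwards [hloc x hx] with y hy hy'
    exact hy (sub_eq_zero.1 (show (A.F - K) (y - x) = 0 by rw [map_sub, hy', sub_self]))
  · obtain ⟨c, hc, h0, h1, ht⟩ := exists_curve_segment x y
    obtain ⟨hF, hU⟩ := hseg x hx y hy hxy
    refine ⟨c, hc, h0, h1, fun t => ?_⟩
    obtain ⟨s, hs, hcs⟩ := ht t
    rw [hcs, map_add, map_smul, show (A.F - K) (y - x) = 0 from sub_eq_zero.2 hF, smul_zero,
      add_zero]
    exact ⟨hU s hs, rfl⟩

/-- The fibres of `ψ` are related by affine maps which preserve the almost product structure. -/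
def AdaptedModel.AffineFibers (A : AdaptedModel V) (ψ : V → M) : Prop :=
  ∀ x ∈ A.U, ∀ x' ∈ A.U, ψ x = ψ x' → ∃ L : V →L[ℝ] V, (∀ a, A.F (L a) = L (A.F a)) ∧
    ∀ v, x + v ∈ A.U → x' + L v ∈ A.U ∧ ψ (x' + L v) = ψ (x + v)

theorem AdaptedModel.leaf_eq_univ {D : DistField I M} {A : AdaptedModel V} {ψ : V → M}
    {K : V →L[ℝ] V} (hK : ∀ (L : V →L[ℝ] V) a, K (L a) = L (K a)) (hU : A.U = univ)
    (hψ : IsLocalDiffeomorphOn 𝓥 V I ∞ ψ A.U) (hsurj : ψ '' univ = univ)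
    (hD : ∀ z ∈ A.U, ∀ a : V, mfderiv 𝓥 V I ψ z a ∈ D (ψ z) ↔ A.F a = K a)
    (hfib : A.AffineFibers ψ) (x : V) :
    leaf I D (ψ x) = {q | ∃ v, A.F v = K v ∧ ψ (x + v) = q} := by
  have hmem : ∀ x, x ∈ A.U := fun x => hU ▸ mem_univ x
  rw [A.leaf_eq hψ (by rwa [hU]) hD (ℓ := fun x y => A.F (y - x) = K (y - x))
    (fun x _ => Eventually.of_forall fun y h => h) (fun x _ y _ hxy => ?_)
    (fun x _ y _ z _ hxy hyz => ?_) (fun x hx x' hx' y hy hψ hxy => ?_)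
    (fun x _ y _ hxy => ⟨hxy, fun s _ => hmem _⟩) (hmem x)]
  · ext q
    constructor
    · rintro ⟨y, ⟨-, hy⟩, rfl⟩
      exact ⟨y - x, hy, by simp⟩
    · rintro ⟨v, hv, rfl⟩
      exact ⟨x + v, ⟨hmem _, by simpa using hv⟩, rfl⟩
  · rw [← neg_sub, map_neg, hxy, map_neg]
  · rw [← sub_add_sub_cancel z y x, map_add, hxy, hyz, map_add]
  · obtain ⟨L, hL, hLψ⟩ := hfib x hx x' hx' hψ
    refine ⟨x' + L (y - x), hmem _, ?_, ?_⟩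
    · rw [(hLψ (y - x) (hmem _)).2, add_sub_cancel]
    · rw [add_sub_cancel_left, hL, hxy, hK]

theorem AdaptedModel.leaf₁_eq_univ {B : BiLagrangianStructure I M} {A : AdaptedModel V}
    {ψ : V → M} (hU : A.U = univ) (h : ∀ z ∈ A.U, A.ModelsAt I B.form B.F ψ z)
    (hsurj : ψ '' univ = univ) (hfib : A.AffineFibers ψ) (x : V) :
    B.leaf₁ (ψ x) = {q | ∃ v, A.F v = v ∧ ψ (x + v) = q} :=
  A.leaf_eq_univ (K := .id ℝ V) (fun _ _ => rfl) hU (fun z => (h z z.2).localDiffeo) hsurj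
    (fun z hz => (h z hz).mem_D₁) hfib x

theorem AdaptedModel.leaf₂_eq_univ {B : BiLagrangianStructure I M} {A : AdaptedModel V}
    {ψ : V → M} (hU : A.U = univ) (h : ∀ z ∈ A.U, A.ModelsAt I B.form B.F ψ z)
    (hsurj : ψ '' univ = univ) (hfib : A.AffineFibers ψ) (x : V) :
    B.leaf₂ (ψ x) = {q | ∃ v, A.F v = -v ∧ ψ (x + v) = q} :=
  A.leaf_eq_univ (K := -ContinuousLinearMap.id ℝ V) (fun L a => (map_neg L a).symm) hU
    (fun z => (h z z.2).localDiffeo) hsurj (fun z hz => (h z hz).mem_D₂) hfib x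

end Quotients

section Decks

/-- A group of affine transformations of an open subset `U` of a vector space, acting freely and
properly discontinuously. -/
structure AffineDeck (V : Type) [NormedAddCommGroup V] [NormedSpace ℝ V] where
  U : Set V
  isOpen : IsOpen U
  nonempty : U.Nonempty
  ι : Type
  lin : ι → V →L[ℝ] V
  shift : ι → V
  one : ∃ i, ∀ x, lin i x + shift i = x
  mul : ∀ i j, ∃ k, ∀ x, lin i (lin j x + shift j) + shift i = lin k x + shift k
  inv : ∀ i, ∃ j, ∀ x, lin j (lin i x + shift i) + shift j = x
  maps : ∀ i, ∀ x ∈ U, lin i x + shift i ∈ U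
  sep : ∀ x ∈ U, ∀ y ∈ U, ∃ W ∈ 𝓝 x, ∃ W' ∈ 𝓝 y, ∀ i j, (∃ z ∈ W, lin i z + shift i ∈ W') →
    (∃ z ∈ W, lin j z + shift j ∈ W') → ∀ z, lin i z + shift i = lin j z + shift j

namespace AffineDeck

variable (D : AffineDeck V)

/-- The action of the transformations. -/
def act (i : D.ι) (x : V) : V := D.lin i x + D.shift i

/-- Two points are equivalent if they are in the same orbit. -/
def Rel (x y : V) : Prop := ∃ i, y = D.act i x

lemma rel_refl (x : V) : D.Rel x x := by
  obtain ⟨i, hi⟩ := D.one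
  exact ⟨i, (hi x).symm⟩

variable {D}

lemma Rel.symm {x y : V} (h : D.Rel x y) : D.Rel y x := by
  obtain ⟨i, rfl⟩ := h
  obtain ⟨j, hj⟩ := D.inv i
  exact ⟨j, (hj x).symm⟩

lemma Rel.trans {x y z : V} (h : D.Rel x y) (h' : D.Rel y z) : D.Rel x z := by
  obtain ⟨i, rfl⟩ := h
  obtain ⟨j, rfl⟩ := h'
  obtain ⟨k, hk⟩ := D.mul j i
  exact ⟨k, hk x⟩

variable (D)

/-- The orbit equivalence relation. -/
def setoid : Setoid D.U where
  r x y := D.Rel x y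
  iseqv := ⟨fun x => D.rel_refl x, fun h => h.symm, fun h h' => h.trans h'⟩

/-- The quotient of `U` by the group of transformations. -/
def Q : Type := Quotient D.setoid

instance : TopologicalSpace D.Q := inferInstanceAs (TopologicalSpace (Quotient D.setoid))

/-- The projection of a point of `U`. -/
def toQ (x : D.U) : D.Q := Quotient.mk D.setoid x

open Classical in
/-- The projection, with an arbitrary value outside `U`. -/
def proj (x : V) : D.Q := if h : x ∈ D.U then D.toQ ⟨x, h⟩ else D.toQ ⟨_, D.nonempty.choose_spec⟩

variable {D}

lemma proj_of_mem {x : V} (h : x ∈ D.U) : D.proj x = D.toQ ⟨x, h⟩ := dif_pos h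

lemma proj_eq_iff {x y : V} (hx : x ∈ D.U) (hy : y ∈ D.U) : D.proj x = D.proj y ↔ D.Rel x y := by
  rw [proj_of_mem hx, proj_of_mem hy]
  exact Quotient.eq (r := D.setoid)

variable (D)

lemma image_proj : D.proj '' D.U = univ := by
  refine eq_univ_of_forall fun q => ?_
  obtain ⟨x, rfl⟩ := Quotient.exists_rep q
  exact ⟨x, x.2, proj_of_mem x.2⟩

lemma exists_rep (q : D.Q) : ∃ x ∈ D.U, D.proj x = q :=
  (D.image_proj.symm ▸ mem_univ q : q ∈ D.proj '' D.U)

lemma proj_act {i : D.ι} {x : V} (hx : x ∈ D.U) : D.proj (D.act i x) = D.proj x :=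
  ((proj_eq_iff hx (D.maps i x hx)).2 ⟨i, rfl⟩).symm

lemma continuous_toQ : Continuous D.toQ := continuous_quotient_mk'

lemma continuousOn_proj : ContinuousOn D.proj D.U := by
  rw [continuousOn_iff_continuous_domRestrict]
  have : domRestrict D.U D.proj = D.toQ := funext fun x => proj_of_mem x.2
  rw [this]
  exact D.continuous_toQ

lemma continuous_act (i : D.ι) : Continuous (D.act i) := (D.lin i).continuous.add continuous_const

lemma isOpenMap_toQ : IsOpenMap D.toQ := by
  intro O hO
  have : IsOpen (D.toQ ⁻¹' (D.toQ '' O)) := by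
    obtain ⟨O', hO', rfl⟩ := isOpen_induced_iff.1 hO
    have : D.toQ ⁻¹' (D.toQ '' (Subtype.val ⁻¹' O')) = Subtype.val ⁻¹' ⋃ i, (D.act i) ⁻¹' O' := by
      ext x
      simp only [mem_preimage, mem_image, mem_iUnion]
      constructor
      · rintro ⟨y, hy, hxy⟩
        obtain ⟨i, hi⟩ := (Quotient.eq (r := D.setoid)).1 hxy.symm
        exact ⟨i, hi ▸ hy⟩
      · rintro ⟨i, hi⟩
        refine ⟨⟨D.act i x, D.maps i x x.2⟩, hi, ?_⟩
        exact ((Quotient.eq (r := D.setoid)).2 ⟨i, rfl⟩).symm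
    rw [this]
    exact (isOpen_iUnion fun i => hO'.preimage (D.continuous_act i)).preimage continuous_subtype_val
  exact isQuotientMap_quot_mk.isOpen_preimage.1 this

lemma isOpen_image_proj {O : Set V} (hO : IsOpen O) (h : O ⊆ D.U) : IsOpen (D.proj '' O) := by
  have : D.proj '' O = D.toQ '' (Subtype.val ⁻¹' O) := by
    ext q
    constructor
    · rintro ⟨x, hx, rfl⟩
      exact ⟨⟨x, h hx⟩, hx, (proj_of_mem (h hx)).symm⟩
    · rintro ⟨x, hx, rfl⟩
      exact ⟨x, hx, proj_of_mem x.2⟩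
  rw [this]
  exact D.isOpenMap_toQ _ (hO.preimage continuous_subtype_val)

lemma exists_injOn (x : D.U) : ∃ W : Set V, IsOpen W ∧ (x : V) ∈ W ∧ W ⊆ D.U ∧ InjOn D.proj W := by
  obtain ⟨W, hW, W', hW', h⟩ := D.sep x x.2 x x.2
  obtain ⟨i₀, h₀⟩ := D.one
  refine ⟨interior W ∩ interior W' ∩ D.U, (isOpen_interior.inter isOpen_interior).inter D.isOpen,
    ⟨⟨mem_interior_iff_mem_nhds.2 hW, mem_interior_iff_mem_nhds.2 hW'⟩, x.2⟩, inter_subset_right,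
    ?_⟩
  rintro y ⟨⟨hy, hy'⟩, hyU⟩ z ⟨⟨hz, hz'⟩, hzU⟩ hyz
  obtain ⟨i, rfl⟩ := (proj_eq_iff hyU hzU).1 hyz
  have := h i i₀ ⟨y, interior_subset hy, interior_subset hz'⟩
    ⟨y, interior_subset hy, by rw [h₀]; exact interior_subset hy'⟩ y
  rw [h₀] at this
  exact this.symm

/-- An open set containing `x` on which the projection is injective. -/
def nbhd (x : D.U) : Set V := (D.exists_injOn x).choose

/-- The restriction of the projection to `D.nbhd x`. -/
def localProj (x : D.U) : OpenPartialHomeomorph V D.Q :=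
  OpenPartialHomeomorph.ofContinuousOpenRestrict
    ((D.exists_injOn x).choose_spec.2.2.2.toPartialEquiv D.proj (D.nbhd x))
    (D.continuousOn_proj.mono (D.exists_injOn x).choose_spec.2.2.1)
    (by
      intro O hO
      obtain ⟨O', hO', rfl⟩ := isOpen_induced_iff.1 hO
      have : domRestrict (D.nbhd x) D.proj '' (Subtype.val ⁻¹' O') = D.proj '' (O' ∩ D.nbhd x) := by
        ext q
        constructor
        · rintro ⟨y, hy, rfl⟩
          exact ⟨y, ⟨hy, y.2⟩, rfl⟩
        · rintro ⟨y, hy, rfl⟩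
          exact ⟨⟨y, hy.2⟩, hy.1, rfl⟩
      change IsOpen (domRestrict (D.nbhd x) D.proj '' (Subtype.val ⁻¹' O'))
      rw [this]
      exact D.isOpen_image_proj (hO'.inter (D.exists_injOn x).choose_spec.1)
        (inter_subset_right.trans (D.exists_injOn x).choose_spec.2.2.1))
    (D.exists_injOn x).choose_spec.1

lemma mem_localProj_source (x : D.U) : (x : V) ∈ (D.localProj x).source :=
  (D.exists_injOn x).choose_spec.2.1

lemma localProj_source_subset (x : D.U) : (D.localProj x).source ⊆ D.U :=
  (D.exists_injOn x).choose_spec.2.2.1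

lemma localProj_apply (x : D.U) (z : V) : D.localProj x z = D.proj z := rfl

/-- A representative of a point of the quotient. -/
def rep (q : D.Q) : D.U := (Quotient.exists_rep q).choose

lemma toQ_rep (q : D.Q) : D.toQ (D.rep q) = q := (Quotient.exists_rep q).choose_spec

instance : ChartedSpace V D.Q where
  atlas := range fun x : D.U => (D.localProj x).symm
  chartAt q := (D.localProj (D.rep q)).symm
  mem_chart_source q := by
    rw [OpenPartialHomeomorph.symm_source]
    have h := (D.localProj (D.rep q)).map_source (D.mem_localProj_source (D.rep q))
    rwa [localProj_apply, proj_of_mem (D.rep q).2, toQ_rep] at h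
  chart_mem_atlas q := mem_range_self _

instance : IsManifold 𝓥 V ∞ D.Q := by
  refine isManifold_of_contDiffOn 𝓥 V ∞ D.Q ?_
  rintro _ _ ⟨x, rfl⟩ ⟨y, rfl⟩ z hz
  simp only [modelWithCornersSelf_coe_symm, preimage_id, modelWithCornersSelf_coe, range_id,
    inter_univ, OpenPartialHomeomorph.trans_source, OpenPartialHomeomorph.symm_source,
    OpenPartialHomeomorph.symm_symm, mem_inter_iff, mem_preimage] at hz
  obtain ⟨hzx, hzy⟩ := hz
  set w := (D.localProj y).symm (D.localProj x z) with hw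
  have hwy : w ∈ (D.localProj y).source := (D.localProj y).map_target hzy
  have hzU := D.localProj_source_subset x hzx
  have hzw : D.proj z = D.proj w := by
    have := (D.localProj y).right_inv hzy
    rw [← hw, localProj_apply, localProj_apply] at this
    exact this.symm
  obtain ⟨i, hi⟩ := (proj_eq_iff hzU (D.localProj_source_subset y hwy)).1 hzw
  refine ContDiffAt.contDiffWithinAt ?_
  have hs : ContDiffAt ℝ ∞ (D.act i) z := (D.lin i).contDiff.contDiffAt.add contDiffAt_const
  refine hs.congr_of_eventuallyEq ?_
  have h1 : ∀ᶠ v in 𝓝 z, D.act i v ∈ (D.localProj y).source :=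
    (D.continuous_act i).continuousAt ((D.localProj y).open_source.mem_nhds (hi ▸ hwy))
  filter_upwards [h1, D.isOpen.mem_nhds hzU] with v hv hvU
  have h2 := (D.localProj y).left_inv hv
  rw [localProj_apply, D.proj_act hvU] at h2
  exact h2

lemma isLocalDiffeomorphOn_proj : IsLocalDiffeomorphOn 𝓥 V 𝓥 V ∞ D.proj D.U := by
  intro x
  have hmem : (D.localProj x).symm ∈ IsManifold.maximalAtlas 𝓥 V ∞ D.Q :=
    IsManifold.subset_maximalAtlas ⟨x, rfl⟩
  exact ⟨{ toPartialEquiv := (D.localProj x).toPartialEquiv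
           open_source := (D.localProj x).open_source
           open_target := (D.localProj x).open_target
           contMDiffOn_toFun := contMDiffOn_symm_of_mem_maximalAtlas hmem
           contMDiffOn_invFun := contMDiffOn_of_mem_maximalAtlas hmem },
    D.mem_localProj_source x, fun z _ => rfl⟩

instance : T2Space D.Q := by
  refine ⟨fun p q hpq => ?_⟩
  have hx := (D.rep p).2
  have hy := (D.rep q).2
  set x : V := ((D.rep p : D.U) : V) with hxdef
  set y : V := ((D.rep q : D.U) : V) with hydef
  have hp : D.proj x = p := (proj_of_mem hx).trans (D.toQ_rep p)
  have hq : D.proj y = q := (proj_of_mem hy).trans (D.toQ_rep q)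
  have hr : ¬ D.Rel x y := by rwa [← proj_eq_iff hx hy, hp, hq]
  obtain ⟨W, hW, W', hW', h⟩ := D.sep x hx y hy
  have key : ∃ W₁ ∈ 𝓝 x, ∃ W₂ ∈ 𝓝 y, ∀ i, ∀ z ∈ W₁, D.act i z ∉ W₂ := by
    by_cases h0 : ∃ i, ∃ z ∈ W, D.act i z ∈ W'
    · obtain ⟨i₀, h0⟩ := h0
      have hne : D.act i₀ x ≠ y := fun h => hr ⟨i₀, h.symm⟩
      obtain ⟨A, B, hA, hB, hxA, hyB, hAB⟩ := t2_separation hne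
      refine ⟨W ∩ D.act i₀ ⁻¹' A, inter_mem hW ((D.continuous_act i₀).continuousAt
        (hA.mem_nhds hxA)), W' ∩ B, inter_mem hW' (hB.mem_nhds hyB), fun i z hz hz' => ?_⟩
      have : D.act i z = D.act i₀ z := h i i₀ ⟨z, hz.1, hz'.1⟩ h0 z
      exact disjoint_left.1 hAB hz.2 (this ▸ hz'.2)
    · push Not at h0
      exact ⟨W, hW, W', hW', h0⟩
  obtain ⟨W₁, hW₁, W₂, hW₂, h12⟩ := key
  refine ⟨D.proj '' (interior W₁ ∩ D.U), D.proj '' (interior W₂ ∩ D.U),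
    D.isOpen_image_proj (isOpen_interior.inter D.isOpen) inter_subset_right,
    D.isOpen_image_proj (isOpen_interior.inter D.isOpen) inter_subset_right,
    ⟨x, ⟨mem_interior_iff_mem_nhds.2 hW₁, hx⟩, hp⟩,
    ⟨y, ⟨mem_interior_iff_mem_nhds.2 hW₂, hy⟩, hq⟩, ?_⟩
  rw [disjoint_left]
  rintro _ ⟨z, ⟨hz, hzU⟩, rfl⟩ ⟨w, ⟨hw, hwU⟩, hzw⟩
  obtain ⟨i, rfl⟩ := (proj_eq_iff hzU hwU).1 hzw.symm
  exact h12 i z (interior_subset hz) (interior_subset hw)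

instance [SecondCountableTopology V] : SecondCountableTopology D.Q :=
  (isQuotientMap_quot_mk (r := D.setoid.r)).secondCountableTopology D.isOpenMap_toQ

lemma connectedSpace (h : IsConnected D.U) : ConnectedSpace D.Q := by
  rw [connectedSpace_iff_univ, ← D.image_proj]
  exact h.image _ D.continuousOn_proj

lemma mfderiv_proj_act {i : D.ι} {x : V} (hx : x ∈ D.U) (a : V) :
    mfderiv 𝓥 V 𝓥 V D.proj (D.act i x) (D.lin i a) = (mfderiv 𝓥 V 𝓥 V D.proj x a : V) := by
  have h1 : D.proj ∘ D.act i =ᶠ[𝓝 x] D.proj := by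
    filter_upwards [D.isOpen.mem_nhds hx] with z hz using D.proj_act hz
  have hd : HasFDerivAt (D.act i) (D.lin i) x := (D.lin i).hasFDerivAt.add_const _
  have h2 := mfderiv_comp x ((D.isLocalDiffeomorphOn_proj ⟨_, D.maps i x hx⟩).mdifferentiableAt
    (by simp)) hd.differentiableAt.mdifferentiableAt
  rw [h1.mfderiv_eq, mfderiv_eq_fderiv] at h2
  have h3 := congrArg (fun L => (L a : V)) h2
  have h4 : 𝐃 (D.act i) x a = D.lin i a := by rw [hd.fderiv]
  rw [← h4]
  exact h3.symm

/-- A model which is invariant under the deck transformations descends to the quotient. -/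
lemma descends {A : AdaptedModel V} (hU : A.U = D.U)
    (hform : ∀ i, ∀ x ∈ A.U, ∀ a b, A.form (D.act i x) (D.lin i a) (D.lin i b) = A.form x a b)
    (hF : ∀ i a, A.F (D.lin i a) = D.lin i (A.F a)) : A.Descends 𝓥 V D.proj where
  localDiffeo := by rw [hU]; exact D.isLocalDiffeomorphOn_proj
  surjective := by rw [hU]; exact D.image_proj
  invariant x hx y hy hxy := by
    have hxU : x ∈ D.U := hU ▸ hx
    obtain ⟨i, rfl⟩ := (proj_eq_iff hxU (hU ▸ hy)).1 hxy
    exact ⟨D.lin i, D.mfderiv_proj_act hxU, hform i x hx, hF i⟩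

lemma affineFibers {A : AdaptedModel V} (hU : A.U = D.U)
    (hF : ∀ i a, A.F (D.lin i a) = D.lin i (A.F a)) : A.AffineFibers D.proj := by
  rw [AdaptedModel.AffineFibers, hU]
  intro x hx x' hx' hxx'
  obtain ⟨i, rfl⟩ := (proj_eq_iff hx hx').1 hxx'
  refine ⟨D.lin i, hF i, fun v hv => ?_⟩
  have : D.act i x + D.lin i v = D.act i (x + v) := by rw [act, act, map_add]; abel
  rw [this]
  exact ⟨D.maps i _ hv, D.proj_act hv⟩

/-- The deck group is trivial. -/
def trivial (U : Set V) (hU : IsOpen U) (hne : U.Nonempty) : AffineDeck V where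
  U := U
  isOpen := hU
  nonempty := hne
  ι := Unit
  lin _ := ContinuousLinearMap.id ℝ V
  shift _ := 0
  one := ⟨(), by simp⟩
  mul _ _ := ⟨(), by simp⟩
  inv _ := ⟨(), by simp⟩
  maps _ x hx := by simpa using hx
  sep x _ y _ := ⟨univ, univ_mem, univ, univ_mem, fun _ _ _ _ _ => rfl⟩

lemma trivial_rel (U : Set V) (hU : IsOpen U) (hne : U.Nonempty) (x y : V) :
    (trivial U hU hne).Rel x y ↔ x = y := by
  constructor
  · rintro ⟨i, rfl⟩
    simp [act, trivial]
  · rintro rfl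
    exact rel_refl _ _

/-- A discrete group of translations. -/
def translations (L : AddSubgroup V) (ε : ℝ) (hε : 0 < ε) (hL : ∀ v ∈ L, v ≠ 0 → ε ≤ ‖v‖) :
    AffineDeck V where
  U := univ
  isOpen := isOpen_univ
  nonempty := ⟨0, mem_univ _⟩
  ι := L
  lin _ := ContinuousLinearMap.id ℝ V
  shift v := v
  one := ⟨0, by simp⟩
  mul v w := ⟨v + w, fun x => by
    simp only [ContinuousLinearMap.id_apply, AddSubgroup.coe_add]; abel⟩
  inv v := ⟨-v, by simp⟩
  maps _ _ _ := mem_univ _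
  sep x _ y _ := by
    refine ⟨Metric.ball x (ε / 4), Metric.ball_mem_nhds x (by linarith), Metric.ball y (ε / 4),
      Metric.ball_mem_nhds y (by linarith), ?_⟩
    rintro i j ⟨z, hz, hiz⟩ ⟨w, hw, hjw⟩ v
    have : (i : V) - j = 0 := by
      by_contra hne
      have h1 := hL _ (L.sub_mem i.2 j.2) hne
      rw [mem_ball_iff_norm] at hz hw hiz hjw
      simp only [ContinuousLinearMap.id_apply] at hiz hjw
      have h2 : (i : V) - j = (z + i - y) - (w + j - y) - ((z - x) - (w - x)) := by abel
      rw [h2] at h1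
      have h3 := norm_sub_le ((z + i - y) - (w + j - y)) ((z - x) - (w - x))
      have h4 := norm_sub_le (z + i - y) (w + j - y)
      have h5 := norm_sub_le (z - x) (w - x)
      linarith
    rw [sub_eq_zero.1 this]

lemma translations_rel {L : AddSubgroup V} {ε : ℝ} {hε : 0 < ε}
    {hL : ∀ v ∈ L, v ≠ 0 → ε ≤ ‖v‖} {x y : V} :
    (translations L ε hε hL).Rel x y ↔ ∃ v ∈ L, y = x + v := by
  constructor
  · rintro ⟨⟨v, hv⟩, rfl⟩
    exact ⟨v, hv, rfl⟩
  · rintro ⟨v, hv, rfl⟩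
    exact ⟨⟨v, hv⟩, rfl⟩

/-- A group of linear transformations which multiply a positive function by powers of `2`. -/
def scaling (U : Set V) (hU : IsOpen U) (hne : U.Nonempty) (L : ℤ → V →L[ℝ] V) (h0 : L 0 = .id ℝ V)
    (hadd : ∀ i j, L i ∘L L j = L (i + j)) (hmaps : ∀ i, ∀ x ∈ U, L i x ∈ U) (f : V → ℝ)
    (hf : Continuous f) (hpos : ∀ x ∈ U, 0 < f x) (hscale : ∀ i x, f (L i x) = 2 ^ i * f x) :
    AffineDeck V where
  U := U
  isOpen := hU
  nonempty := hne
  ι := ℤ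
  lin := L
  shift _ := 0
  one := ⟨0, by simp [h0]⟩
  mul i j := ⟨i + j, fun x => by simp [← hadd]⟩
  inv i := ⟨-i, fun x => by
    have := congrArg (fun T : V →L[ℝ] V => T x) (hadd (-i) i)
    simpa [h0] using this⟩
  maps i x hx := by simpa using hmaps i x hx
  sep x hx y hy := by
    have key : ∀ x ∈ U, {z | 5 / 6 * f x < f z ∧ f z < 7 / 6 * f x} ∈ 𝓝 x := fun x hx =>
      ((isOpen_lt continuous_const hf).inter (isOpen_lt hf continuous_const)).mem_nhds
        (by have := hpos x hx; constructor <;> simp only [mem_ofPred_eq] <;> linarith)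
    refine ⟨_, key x hx, _, key y hy, ?_⟩
    have hx0 := hpos x hx
    have hy0 := hpos y hy
    have hle : ∀ i j : ℤ, ∀ z w : V, 5 / 6 * f x < f z → f w < 7 / 6 * f x →
        2 ^ i * f z < 7 / 6 * f y → 5 / 6 * f y < 2 ^ j * f w → i ≤ j := by
      intro i j z w hz hw hiz hjw
      by_contra hlt
      push Not at hlt
      have h2 : (2 : ℝ) ^ (j + 1) ≤ 2 ^ i := zpow_le_zpow_right₀ (by norm_num) (by lia)
      rw [zpow_add₀ (by norm_num), zpow_one] at h2
      have hj : (0 : ℝ) < 2 ^ j := by positivity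
      have h3 : (2 : ℝ) ^ j * 2 * (5 / 6 * f x) < 7 / 6 * f y :=
        (mul_le_mul h2 hz.le (by positivity) (by positivity)).trans_lt hiz
      have h4 : 5 / 6 * f y < 2 ^ j * (7 / 6 * f x) := hjw.trans (mul_lt_mul_of_pos_left hw hj)
      have h5 : 0 < (2 : ℝ) ^ j * f x := by positivity
      linarith
    rintro i j ⟨z, ⟨hz, hz'⟩, hiz, hiz'⟩ ⟨w, ⟨hw, hw'⟩, hjw, hjw'⟩ v
    rw [add_zero, hscale] at hiz hiz' hjw hjw'
    rw [le_antisymm (hle i j z w hz hw' hiz' hjw) (hle j i w z hw hz' hjw' hiz)]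

/-- A group of isometries whose orbits are uniformly discrete. -/
def isometries (Γ : Subgroup (V ≃ᵃⁱ[ℝ] V)) (ε : ℝ) (hε : 0 < ε)
    (hΓ : ∀ γ ∈ Γ, ∀ δ ∈ Γ, γ = δ ∨ ∀ x, ε ≤ dist (γ x) (δ x)) : AffineDeck V where
  U := univ
  isOpen := isOpen_univ
  nonempty := ⟨0, mem_univ _⟩
  ι := Γ
  lin γ := (γ.1.linearIsometryEquiv : V →L[ℝ] V)
  shift γ := γ.1 0
  one := ⟨1, fun x => by
    have := (1 : V ≃ᵃⁱ[ℝ] V).map_vadd 0 x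
    simpa using this.symm⟩
  mul γ δ := ⟨γ * δ, fun x => by
    have h1 := δ.1.map_vadd 0 x
    have h2 := γ.1.map_vadd 0 (δ.1 x)
    have h3 := (γ.1 * δ.1).map_vadd 0 x
    simp only [vadd_eq_add, add_zero] at h1 h2 h3
    refine (?_ : _ = γ.1 (δ.1 x)).trans (h3.trans rfl)
    rw [h2, h1]; rfl⟩
  inv γ := ⟨γ⁻¹, fun x => by
    have h1 := γ.1.map_vadd 0 x
    have h2 := (γ.1⁻¹).map_vadd 0 (γ.1 x)
    simp only [vadd_eq_add, add_zero] at h1 h2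
    have h3 : (γ.1⁻¹) (γ.1 x) = x := γ.1.symm_apply_apply x
    refine Eq.trans ?_ (h2.symm.trans h3)
    rw [h1]; rfl⟩
  maps _ _ _ := mem_univ _
  sep x _ y _ := by
    have happ : ∀ (γ : V ≃ᵃⁱ[ℝ] V) (z : V), γ.linearIsometryEquiv z + γ 0 = γ z := fun γ z => by
      simpa using (γ.map_vadd 0 z).symm
    refine ⟨Metric.ball x (ε / 4), Metric.ball_mem_nhds x (by linarith), Metric.ball y (ε / 4),
      Metric.ball_mem_nhds y (by linarith), ?_⟩
    rintro ⟨γ, hγ⟩ ⟨δ, hδ⟩ ⟨z, hz, hiz⟩ ⟨w, hw, hjw⟩ v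
    have hiz' : dist (γ z) y < ε / 4 := by rw [← happ]; exact hiz
    have hjw' : dist (δ w) y < ε / 4 := by rw [← happ]; exact hjw
    have heq : γ = δ := by
      refine (hΓ γ hγ δ hδ).resolve_right fun h => ?_
      have h1 := h x
      have h2 : dist (γ x) (γ z) < ε / 4 := by rw [γ.dist_map, dist_comm]; exact hz
      have h3 : dist (δ x) (δ w) < ε / 4 := by rw [δ.dist_map, dist_comm]; exact hw
      have h4 := dist_triangle4 (γ x) (γ z) y (δ x)
      have h5 := dist_triangle_right y (δ x) (δ w)
      rw [dist_comm y (δ w)] at h5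
      linarith
    subst heq
    rfl

lemma isometries_act {Γ : Subgroup (V ≃ᵃⁱ[ℝ] V)} {ε : ℝ} {hε : 0 < ε}
    {hΓ : ∀ γ ∈ Γ, ∀ δ ∈ Γ, γ = δ ∨ ∀ x, ε ≤ dist (γ x) (δ x)} (γ : Γ) (x : V) :
    (isometries Γ ε hε hΓ).act γ x = γ.1 x := by
  have := (γ.1.map_vadd 0 x).symm
  simp only [vadd_eq_add, add_zero] at this
  exact this

lemma isometries_rel {Γ : Subgroup (V ≃ᵃⁱ[ℝ] V)} {ε : ℝ} {hε : 0 < ε}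
    {hΓ : ∀ γ ∈ Γ, ∀ δ ∈ Γ, γ = δ ∨ ∀ x, ε ≤ dist (γ x) (δ x)} {x y : V} :
    (isometries Γ ε hε hΓ).Rel x y ↔ ∃ γ ∈ Γ, γ x = y := by
  constructor
  · rintro ⟨γ, rfl⟩
    exact ⟨γ.1, γ.2, (isometries_act γ x).symm⟩
  · rintro ⟨γ, hγ, rfl⟩
    exact ⟨⟨γ, hγ⟩, (isometries_act ⟨γ, hγ⟩ x).symm⟩

lemma compactSpace {K : Set V} (hK : IsCompact K) (hKU : K ⊆ D.U)
    (h : ∀ x ∈ D.U, ∃ y ∈ K, D.Rel y x) : CompactSpace D.Q := by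
  refine ⟨?_⟩
  have : D.proj '' K = univ := by
    refine eq_univ_of_forall fun q => ?_
    obtain ⟨x, hx, rfl⟩ := (D.image_proj.symm ▸ mem_univ q : q ∈ D.proj '' D.U)
    obtain ⟨y, hy, hyx⟩ := h x hx
    exact ⟨y, hy, (proj_eq_iff (hKU hy) hx).2 hyx⟩
  rw [← this]
  exact hK.image_of_continuousOn (D.continuousOn_proj.mono hKU)

lemma not_compactSpace {f : V → ℝ} (hf : ContinuousOn f D.U)
    (hinv : ∀ i, ∀ x ∈ D.U, f (D.act i x) = f x) (hunb : ∀ C, ∃ x ∈ D.U, C < f x) :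
    ¬ CompactSpace D.Q := by
  intro hc
  have hlift : ∀ x y : D.U, D.setoid x y → f x = f y := by
    rintro x y ⟨i, hi⟩
    rw [hi, hinv i x x.2]
  have hcont : Continuous (Quotient.lift (fun x : D.U => f x) hlift) :=
    (continuousOn_iff_continuous_domRestrict.1 hf).quotient_lift hlift
  have : CompactSpace (Quotient D.setoid) := hc
  obtain ⟨C, hC⟩ := (isCompact_range hcont).bddAbove
  obtain ⟨x, hx, hlt⟩ := hunb C
  exact absurd (hC ⟨D.toQ ⟨x, hx⟩, rfl⟩) (not_le.2 hlt)

end AffineDeck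

end Decks

section Products

variable [FiniteDimensional ℝ E] [FiniteDimensional ℝ E']

/-- The orthogonal sum of two bilinear forms. -/
def sumForm (β : 𝔅 E) (β' : 𝔅 E') : 𝔅 (E × E') := pullForm β (fst ℝ E E') + pullForm β' (snd ℝ E E')

@[simp] lemma sumForm_apply (β : 𝔅 E) (β' : 𝔅 E') (a b : E × E') :
    sumForm β β' a b = β a.1 b.1 + β' a.2 b.2 := by
  simp [sumForm]

lemma Nondeg.sumForm {β : 𝔅 E} {β' : 𝔅 E'} (h : Nondeg β)
    (h' : Nondeg β') : Nondeg (sumForm β β') := by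
  intro v hv
  refine Prod.ext (h _ fun w => ?_) (h' _ fun w => ?_)
  · simpa using hv (w, 0)
  · simpa using hv (0, w)

lemma fderiv_add_prod {f : E → ℝ} {f' : E' → ℝ} {y : E × E'} (hf : DifferentiableAt ℝ f y.1)
    (hf' : DifferentiableAt ℝ f' y.2) (a : E × E') :
    𝐃 (fun x : E × E' => f x.1 + f' x.2) y a = 𝐃 f y.1 a.1 + 𝐃 f' y.2 a.2 := by
  have h : HasFDerivAt (fun x : E × E' => f x.1 + f' x.2)
      (𝐃 f y.1 ∘L fst ℝ E E' + 𝐃 f' y.2 ∘L snd ℝ E E') y :=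
    (HasFDerivAt.comp y hf.hasFDerivAt hasFDerivAt_fst).add
      (HasFDerivAt.comp y hf'.hasFDerivAt hasFDerivAt_snd)
  rw [h.fderiv]
  rfl

lemma fderiv_prodMap {F F' : Type} [NormedAddCommGroup F] [NormedSpace ℝ F]
    [NormedAddCommGroup F'] [NormedSpace ℝ F'] {f : E → F} {f' : E' → F'} {y : E × E'}
    (hf : DifferentiableAt ℝ f y.1) (hf' : DifferentiableAt ℝ f' y.2) (a : E × E') :
    𝐃 (fun x : E × E' => (f x.1, f' x.2)) y a = (𝐃 f y.1 a.1, 𝐃 f' y.2 a.2) := by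
  have h : HasFDerivAt (fun x : E × E' => (f x.1, f' x.2))
      ((𝐃 f y.1 ∘L fst ℝ E E').prod (𝐃 f' y.2 ∘L snd ℝ E E')) y :=
    (HasFDerivAt.comp y hf.hasFDerivAt hasFDerivAt_fst).prodMk
      (HasFDerivAt.comp y hf'.hasFDerivAt hasFDerivAt_snd)
  rw [h.fderiv]
  rfl

lemma chris_sum {G : E → 𝔅 E} {G' : E' → 𝔅 E'} {y : E × E'}
    (hd : DifferentiableAt ℝ G y.1) (hd' : DifferentiableAt ℝ G' y.2) (hn : Nondeg (G y.1))
    (hn' : Nondeg (G' y.2)) (a b : E × E') :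
    chris (fun x a b => sumForm (G x.1) (G' x.2) a b) y a b =
      (chris (fun x a b => G x a b) y.1 a.1 b.1, chris (fun x a b => G' x a b) y.2 a.2 b.2) := by
  have hD : DifferentiableAt ℝ (fun x : E × E' => sumForm (G x.1) (G' x.2)) y := by
    refine DifferentiableAt.add ?_ ?_
    · exact ((differentiableAt_const _).clm_comp
        ((DifferentiableAt.comp y hd differentiableAt_fst).clm_comp (differentiableAt_const _)))
    · exact ((differentiableAt_const _).clm_comp
        ((DifferentiableAt.comp y hd' differentiableAt_snd).clm_comp (differentiableAt_const _)))
  have hder : ∀ a b c, 𝐃 (fun x : E × E' => sumForm (G x.1) (G' x.2)) y a b c =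
      𝐃 G y.1 a.1 b.1 c.1 + 𝐃 G' y.2 a.2 b.2 c.2 := by
    intro a b c
    rw [← fderiv_clm_apply₂ hD, ← fderiv_clm_apply₂ hd, ← fderiv_clm_apply₂ hd']
    simp only [sumForm_apply]
    exact fderiv_add_prod (f := fun x => G x b.1 c.1) (f' := fun x => G' x b.2 c.2)
      ((hd.eval _).eval _) ((hd'.eval _).eval _) a
  refine chris_eq_of (G := fun x : E × E' => sumForm (G x.1) (G' x.2)) hD (hn.sumForm hn')
    fun c => ?_
  have h1 := chrisL_spec hn a.1 b.1 c.1
  have h2 := chrisL_spec hn' a.2 b.2 c.2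
  rw [chris_eq_chrisL hd hn, chris_eq_chrisL hd' hn']
  rw [koszul_apply] at h1 h2 ⊢
  simp only [hder, sumForm_apply]
  linarith

lemma differentiableAt_chris {G : E → 𝔅 E} {y : E} (hG : ContDiffAt ℝ ∞ G y)
    (hn : ∀ᶠ x in 𝓝 y, Nondeg (G x)) (b c : E) :
    DifferentiableAt ℝ (fun x => chris (fun x a b => G x a b) x b c) y := by
  refine (((contDiffAt_chrisL hG hn.self_of_nhds).diffAt.eval b).eval c).congr_of_eventuallyEq ?_
  filter_upwards [hG.eventually_diffAt, hn] with x h h' using chris_eq_chrisL h h' b c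

lemma curv_sum {G : E → 𝔅 E} {G' : E' → 𝔅 E'} {y : E × E'}
    (hG : ContDiffAt ℝ ∞ G y.1) (hG' : ContDiffAt ℝ ∞ G' y.2) (hn : ∀ᶠ x in 𝓝 y.1, Nondeg (G x))
    (hn' : ∀ᶠ x in 𝓝 y.2, Nondeg (G' x)) (a b c : E × E') :
    curv (fun x a b => sumForm (G x.1) (G' x.2) a b) y a b c =
      (curv (fun x a b => G x a b) y.1 a.1 b.1 c.1,
        curv (fun x a b => G' x a b) y.2 a.2 b.2 c.2) := by
  have hev : ∀ᶠ x in 𝓝 y, ∀ a b, chris (fun x a b => sumForm (G x.1) (G' x.2) a b) x a b =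
      (chris (fun x a b => G x a b) x.1 a.1 b.1, chris (fun x a b => G' x a b) x.2 a.2 b.2) := by
    have h1 : Tendsto Prod.fst (𝓝 y) (𝓝 y.1) := continuous_fst.continuousAt
    have h2 : Tendsto Prod.snd (𝓝 y) (𝓝 y.2) := continuous_snd.continuousAt
    filter_upwards [h1.eventually hG.eventually_diffAt, h1.eventually hn,
      h2.eventually hG'.eventually_diffAt, h2.eventually hn'] with x k1 k2 k3 k4 a b using chris_sum
          k1 k3 k2 k4 a b
  have hder : ∀ a b c, 𝐃 (fun x => chris (fun x a b => sumForm (G x.1) (G' x.2) a b) x b c) y a =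
      (𝐃 (fun x => chris (fun x a b => G x a b) x b.1 c.1) y.1 a.1,
        𝐃 (fun x => chris (fun x a b => G' x a b) x b.2 c.2) y.2 a.2) := by
    intro a b c
    rw [Filter.EventuallyEq.fderiv_eq (𝕜 := ℝ) (hev.mono fun x hx => hx b c)]
    exact fderiv_prodMap (f := fun x => chris (fun x a b => G x a b) x b.1 c.1)
      (f' := fun x => chris (fun x a b => G' x a b) x b.2 c.2) (differentiableAt_chris hG hn _ _)
      (differentiableAt_chris hG' hn' _ _) a
  simp only [curv, hder, hev.self_of_nhds]
  rfl

/-- The coordinate expression of a field of bilinear forms, with values in the continuous bilinear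
forms. -/
def coordCLM (I : ModelWithCorners ℝ E H) (f : FormField I M) (p₀ : M) (y : E) : 𝔅 E :=
  LinearMap.toContinuousLinearMap ((LinearMap.toContinuousLinearMap :
    (E →ₗ[ℝ] ℝ) ≃ₗ[ℝ] (E →L[ℝ] ℝ)).toLinearMap ∘ₗ ((f ((extChartAt I p₀).symm y)).compl₁₂
        (mfderiv 𝓥 E I (extChartAt I p₀).symm y).toLinearMap
        (mfderiv 𝓥 E I (extChartAt I p₀).symm y).toLinearMap))

lemma contDiffOn_coordCLM {f : FormField I M} {p₀ : M}
    {s : Set E} (h : ∀ a b, ContDiffOn ℝ ∞ (fun y => coordForm I f p₀ y a b) s) :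
    ContDiffOn ℝ ∞ (coordCLM I f p₀) s :=
  contDiffOn_clm_apply.2 fun a => contDiffOn_clm_apply.2 fun b => h a b

namespace BiLagrangianStructure

variable [I.Boundaryless] [IsManifold I ∞ M] [I'.Boundaryless] [IsManifold I' ∞ M']
  (B : BiLagrangianStructure I M) (B' : BiLagrangianStructure I' M')

lemma coordForm_g {p₀ : M} {y : E} (hy : y ∈ (extChartAt I p₀).target) (a b : E) :
    coordForm I B.g p₀ y a b = coordCLM I B.form p₀ y (coordEnd I B.F p₀ y a) b :=
  congrArg (fun v => B.form _ v (chartVec I p₀ y b))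
    (chartVec_mfderiv_extChartAt hy (B.F _ (chartVec I p₀ y a))).symm

lemma contDiffOn_coordCLM_g (p₀ : M) :
    ContDiffOn ℝ ∞ (coordCLM I B.g p₀) (extChartAt I p₀).target :=
  contDiffOn_coordCLM fun a b =>
    (((contDiffOn_coordCLM (B.smooth_form p₀)).clm_apply (B.smooth_F p₀ a)).clm_apply
      contDiffOn_const).congr fun _ hy => B.coordForm_g hy a b

lemma g_nondeg (p : M) (v : TangentSpace I p) (h : ∀ w, B.g p v w = 0) : v = 0 := by
  have h1 : B.F p v = 0 := B.nondegenerate p _ h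
  rw [← B.F_F p v, h1, map_zero]

lemma nondeg_coordCLM_g {p₀ : M} {y : E} (hy : y ∈ (extChartAt I p₀).target) :
    Nondeg (coordCLM I B.g p₀ y) := by
  intro a ha
  have h1 : chartVec I p₀ y a = 0 := B.g_nondeg _ _ fun w =>
    (congrArg (B.g _ (chartVec I p₀ y a)) (chartVec_mfderiv_extChartAt hy w)).symm.trans (ha _)
  rw [← mfderiv_extChartAt_chartVec hy a, h1]
  exact map_zero _

lemma target_prod (p₀ : M × M') : (extChartAt (I.prod I') p₀).target =
    (extChartAt I p₀.1).target ×ˢ (extChartAt I' p₀.2).target := by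
  rw [extChartAt_prod]; rfl

lemma chartVec_prod {p₀ : M × M'} {y : E × E'} (h : y.1 ∈ (extChartAt I p₀.1).target)
    (h' : y.2 ∈ (extChartAt I' p₀.2).target) (a : E × E') :
    (chartVec (I.prod I') p₀ y a : E × E') =
      ((chartVec I p₀.1 y.1 a.1 : E), (chartVec I' p₀.2 y.2 a.2 : E')) := by
  have h1 : HasMFDerivAt 𝓘(ℝ, E × E') I ((extChartAt I p₀.1).symm ∘ Prod.fst) y
      ((mfderiv 𝓥 E I (extChartAt I p₀.1).symm y.1) ∘L (fst ℝ E E' : E × E' →L[ℝ] E)) :=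
    (mdifferentiableAt_extChartAt_symm h).hasMFDerivAt.comp y
      (hasFDerivAt_fst (𝕜 := ℝ) (p := y)).hasMFDerivAt
  have h2 : HasMFDerivAt 𝓘(ℝ, E × E') I' ((extChartAt I' p₀.2).symm ∘ Prod.snd) y
      ((mfderiv 𝓥 E' I' (extChartAt I' p₀.2).symm y.2) ∘L (snd ℝ E E' : E × E' →L[ℝ] E')) :=
    (mdifferentiableAt_extChartAt_symm h').hasMFDerivAt.comp y
      (hasFDerivAt_snd (𝕜 := ℝ) (p := y)).hasMFDerivAt
  have h3 := (h1.prodMk h2).mfderiv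
  have h4 : (fun y : E × E' => (((extChartAt I p₀.1).symm ∘ Prod.fst) y,
      ((extChartAt I' p₀.2).symm ∘ Prod.snd) y)) = (extChartAt (I.prod I') p₀).symm := by
    rw [extChartAt_prod]; rfl
  rw [h4] at h3
  exact congrArg (fun L : E × E' →L[ℝ] E × E' => L a) h3

/-- The orthogonal sum of two fields of bilinear forms, on a product. -/
def prodForm (f : FormField I M) (f' : FormField I' M') (p : M × M') :
    LinearMap.BilinForm ℝ (TangentSpace (I.prod I') p) :=
  ((f p.1 : LinearMap.BilinForm ℝ E).compl₁₂ (LinearMap.fst ℝ E E') (LinearMap.fst ℝ E E') +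
    (f' p.2 : LinearMap.BilinForm ℝ E').compl₁₂ (LinearMap.snd ℝ E E') (LinearMap.snd ℝ E E') :
      LinearMap.BilinForm ℝ (E × E'))

/-- The product of two fields of endomorphisms. -/
def prodEnd (F : EndField I M) (F' : EndField I' M') (p : M × M') :
    TangentSpace (I.prod I') p →ₗ[ℝ] TangentSpace (I.prod I') p :=
  (LinearMap.prodMap (F p.1 : E →ₗ[ℝ] E) (F' p.2 : E' →ₗ[ℝ] E') : E × E' →ₗ[ℝ] E × E')

/-- The product of two distributions. -/
def prodDist (D : DistField I M) (D' : DistField I' M') (p : M × M') :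
    Submodule ℝ (TangentSpace (I.prod I') p) :=
  (Submodule.prod (D p.1 : Submodule ℝ E) (D' p.2 : Submodule ℝ E') : Submodule ℝ (E × E'))

lemma coordForm_prodForm (f : FormField I M) (f' : FormField I' M') {p₀ : M × M'} {y : E × E'}
    (h : y ∈ (extChartAt (I.prod I') p₀).target) (a b : E × E') :
    coordForm (I.prod I') (prodForm f f') p₀ y a b =
      coordForm I f p₀.1 y.1 a.1 b.1 + coordForm I' f' p₀.2 y.2 a.2 b.2 := by
  rw [target_prod] at h
  exact congrArg₂ (fun v w : E × E' =>
    (prodForm f f' ((extChartAt I p₀.1).symm y.1, (extChartAt I' p₀.2).symm y.2) v w : ℝ))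
    (chartVec_prod h.1 h.2 a) (chartVec_prod h.1 h.2 b)

lemma coordEnd_prodEnd (F : EndField I M) (F' : EndField I' M') {p₀ : M × M'} {y : E × E'}
    (h : y ∈ (extChartAt (I.prod I') p₀).target) (a : E × E') :
    coordEnd (I.prod I') (prodEnd F F') p₀ y a =
      (coordEnd I F p₀.1 y.1 a.1, coordEnd I' F' p₀.2 y.2 a.2) := by
  have h' := h
  rw [target_prod] at h'
  have h1 : (chartVec (I.prod I') p₀ y (coordEnd I F p₀.1 y.1 a.1, coordEnd I' F' p₀.2 y.2 a.2) :
      E × E') = prodEnd F F' ((extChartAt I p₀.1).symm y.1, (extChartAt I' p₀.2).symm y.2)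
        (chartVec (I.prod I') p₀ y a : E × E') := by
    refine (chartVec_prod h'.1 h'.2 _).trans ?_
    refine Eq.trans ?_ (congrArg (fun v : E × E' => (prodEnd F F' ((extChartAt I p₀.1).symm y.1,
      (extChartAt I' p₀.2).symm y.2) v : E × E')) (chartVec_prod h'.1 h'.2 a)).symm
    exact Prod.ext (chartVec_mfderiv_extChartAt h'.1 _) (chartVec_mfderiv_extChartAt h'.2 _)
  exact (congrArg (fun v : E × E' => (mfderiv (I.prod I') 𝓘(ℝ, E × E')
    (extChartAt (I.prod I') p₀) ((extChartAt (I.prod I') p₀).symm y) v : E × E')) h1).symm.trans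
    (mfderiv_extChartAt_chartVec h _)

lemma fderiv_mem_of_eventually {f : E' → E} {x : E'} (hf : DifferentiableAt ℝ f x)
    {S : Submodule ℝ E} (h : ∀ᶠ z in 𝓝 x, f z ∈ S) (v : E') : 𝐃 f x v ∈ S := by
  by_contra hv
  obtain ⟨l, hl, hS⟩ := S.exists_le_ker_of_notMem hv
  have h1 := (LinearMap.toContinuousLinearMap l).hasFDerivAt.comp x hf.hasFDerivAt
  have h2 : (LinearMap.toContinuousLinearMap l) ∘ f =ᶠ[𝓝 x] fun _ => 0 := by
    filter_upwards [h] with z hz using hS hz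
  have h3 := (h1.congr_of_eventuallyEq h2.symm).unique (hasFDerivAt_const (0 : ℝ) x)
  exact hl (congrArg (fun L : E' →L[ℝ] ℝ => L v) h3)

lemma lieBracket_mem_of_split {W : Type} [NormedAddCommGroup W] [NormedSpace ℝ W]
    {j : E → W} {k : E' → W} {i : E →L[ℝ] W} {l : E' →L[ℝ] W} (p : W →L[ℝ] E) (p' : W →L[ℝ] E')
    {y : W} (hj : HasFDerivAt j i (p y)) (hk : HasFDerivAt k l (p' y)) (ej : j (p y) = y)
    (ek : k (p' y) = y) (hsum : ∀ w, i (p w) + l (p' w) = w) {X Y : W → W}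
    (hX : DifferentiableAt ℝ X y) (hY : DifferentiableAt ℝ Y y) {S : Submodule ℝ E}
    (h : VectorField.lieBracket ℝ (fun x => p (X (j x))) (fun x => p (Y (j x))) (p y) ∈ S)
    (hXS : ∀ᶠ z in 𝓝 (p' y), p (X (k z)) ∈ S) (hYS : ∀ᶠ z in 𝓝 (p' y), p (Y (k z)) ∈ S) :
    p (VectorField.lieBracket ℝ X Y y) ∈ S := by
  have d1 : ∀ X : W → W, DifferentiableAt ℝ X y →
      HasFDerivAt (fun x => p (X (j x))) (p ∘L 𝐃 X y ∘L i) (p y) := fun X hX =>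
    p.hasFDerivAt.comp (p y) (HasFDerivAt.comp (p y) (ej.symm ▸ hX.hasFDerivAt) hj)
  have d2 : ∀ X : W → W, DifferentiableAt ℝ X y →
      HasFDerivAt (fun z => p (X (k z))) (p ∘L 𝐃 X y ∘L l) (p' y) := fun X hX =>
    p.hasFDerivAt.comp (p' y) (HasFDerivAt.comp (p' y) (ek.symm ▸ hX.hasFDerivAt) hk)
  have m1 := fderiv_mem_of_eventually (d2 X hX).differentiableAt hXS (p' (Y y))
  have m2 := fderiv_mem_of_eventually (d2 Y hY).differentiableAt hYS (p' (X y))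
  rw [(d2 X hX).fderiv] at m1
  rw [(d2 Y hY).fderiv] at m2
  rw [VectorField.lieBracket, (d1 X hX).fderiv, (d1 Y hY).fderiv] at h
  simp only [ej, coe_comp, Function.comp_apply] at h m1 m2
  have e : ∀ X Y : W → W, p (𝐃 Y y (X y)) =
      p (𝐃 Y y (i (p (X y)))) + p (𝐃 Y y (l (p' (X y)))) := fun X Y => by
    rw [← map_add, ← map_add, hsum]
  rw [VectorField.lieBracket, map_sub, e X Y, e Y X, add_sub_add_comm]
  exact S.add_mem h (S.sub_mem m2 m1)

lemma isInvolutive_prodDist {D : DistField I M} {D' : DistField I' M'} (h : IsInvolutive I D)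
    (h' : IsInvolutive I' D') : IsInvolutive (I.prod I') (prodDist D D') := by
  intro p₀ X Y hX hY hXD hYD y hy
  have hiff : ∀ z ∈ (extChartAt (I.prod I') p₀).target, ∀ a : E × E',
      chartVec (I.prod I') p₀ z a ∈ prodDist D D' ((extChartAt (I.prod I') p₀).symm z) ↔
      chartVec I p₀.1 z.1 a.1 ∈ D ((extChartAt I p₀.1).symm z.1) ∧
      chartVec I' p₀.2 z.2 a.2 ∈ D' ((extChartAt I' p₀.2).symm z.2) := by
    intro z hz a
    rw [target_prod] at hz
    exact iff_of_eq (congrArg (fun v : E × E' => v ∈ prodDist D D' ((extChartAt I p₀.1).symm z.1,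
      (extChartAt I' p₀.2).symm z.2)) (chartVec_prod hz.1 hz.2 a))
  have hy' := hy
  rw [target_prod] at hy'
  have h1 : ∀ x ∈ (extChartAt I p₀.1).target, (x, y.2) ∈ (extChartAt (I.prod I') p₀).target :=
    fun x hx => by rw [target_prod]; exact ⟨hx, hy'.2⟩
  have h2 : ∀ z ∈ (extChartAt I' p₀.2).target, (y.1, z) ∈ (extChartAt (I.prod I') p₀).target :=
    fun z hz => by rw [target_prod]; exact ⟨hy'.1, hz⟩
  have key : ∀ Z : E × E' → E × E', ContDiffOn ℝ ∞ Z (extChartAt (I.prod I') p₀).target →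
      ContDiffOn ℝ ∞ (fun x => (Z (x, y.2)).1) (extChartAt I p₀.1).target ∧
      ContDiffOn ℝ ∞ (fun z => (Z (y.1, z)).2) (extChartAt I' p₀.2).target ∧
      DifferentiableAt ℝ Z y := fun Z hZ =>
    ⟨contDiff_fst.comp_contDiffOn (hZ.comp (contDiff_prodMk_left _).contDiffOn h1),
      contDiff_snd.comp_contDiffOn (hZ.comp (contDiff_prodMk_right _).contDiffOn h2),
      (hZ.contDiffAt ((isOpen_extChartAt_target p₀).mem_nhds hy)).diffAt⟩
  obtain ⟨X1, X2, Xd⟩ := key X hX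
  obtain ⟨Y1, Y2, Yd⟩ := key Y hY
  have hX' := fun z hz => (hiff z hz _).1 (hXD z hz)
  have hY' := fun z hz => (hiff z hz _).1 (hYD z hz)
  have n1 := (isOpen_extChartAt_target (I := I) p₀.1).mem_nhds hy'.1
  have n2 := (isOpen_extChartAt_target (I := I') p₀.2).mem_nhds hy'.2
  rw [hiff y hy]
  constructor
  · exact lieBracket_mem_of_split (S := (D ((extChartAt I p₀.1).symm y.1)).comap
      (mfderiv 𝓥 E I (extChartAt I p₀.1).symm y.1).toLinearMap) (fst ℝ E E') (snd ℝ E E')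
      (hasFDerivAt_prodMk_left _ _) (hasFDerivAt_prodMk_right _ _) rfl rfl (by simp) Xd Yd
      (h p₀.1 _ _ X1 Y1 (fun x hx => (hX' _ (h1 x hx)).1) (fun x hx => (hY' _ (h1 x hx)).1) _ hy'.1)
      (by filter_upwards [n2] with z hz using (hX' _ (h2 z hz)).1)
      (by filter_upwards [n2] with z hz using (hY' _ (h2 z hz)).1)
  · exact lieBracket_mem_of_split (S := (D' ((extChartAt I' p₀.2).symm y.2)).comap
      (mfderiv 𝓥 E' I' (extChartAt I' p₀.2).symm y.2).toLinearMap) (snd ℝ E E') (fst ℝ E E')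
      (hasFDerivAt_prodMk_right _ _) (hasFDerivAt_prodMk_left _ _) rfl rfl (by simp) Xd Yd
      (h' p₀.2 _ _ X2 Y2 (fun x hx => (hX' _ (h2 x hx)).2) (fun x hx => (hY' _ (h2 x hx)).2) _
          hy'.2)
      (by filter_upwards [n1] with z hz using (hX' _ (h1 z hz)).2)
      (by filter_upwards [n1] with z hz using (hY' _ (h1 z hz)).2)

lemma isCompl_prodDist {D₁ D₂ : DistField I M}
    {D₁' D₂' : DistField I' M'} (h : ∀ p, IsCompl (D₁ p) (D₂ p))
    (h' : ∀ p, IsCompl (D₁' p) (D₂' p)) (p : M × M') :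
    IsCompl (prodDist D₁ D₁' p) (prodDist D₂ D₂' p) := by
  constructor
  · rw [Submodule.disjoint_def]
    intro v h1 h2
    exact Prod.ext (Submodule.disjoint_def.1 (h p.1).disjoint _ h1.1 h2.1)
      (Submodule.disjoint_def.1 (h' p.2).disjoint _ h1.2 h2.2)
  · rw [codisjoint_iff_le_sup]
    intro v _
    obtain ⟨a, ha, b, hb, hab⟩ := Submodule.mem_sup.1
      ((codisjoint_iff_le_sup.1 (h p.1).codisjoint) (Submodule.mem_top
          (x := (v.1 : TangentSpace I p.1))))
    obtain ⟨a', ha', b', hb', hab'⟩ := Submodule.mem_sup.1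
      ((codisjoint_iff_le_sup.1 (h' p.2).codisjoint) (Submodule.mem_top
          (x := (v.2 : TangentSpace I' p.2))))
    exact Submodule.mem_sup.2 ⟨(a, a'), ⟨ha, ha'⟩, (b, b'), ⟨hb, hb'⟩, Prod.ext hab hab'⟩

lemma fderiv_coordForm_prodForm {f : FormField I M} {f' : FormField I' M'}
    (hf : ∀ p₀ : M, ∀ a b : E,
      ContDiffOn ℝ ∞ (fun y => coordForm I f p₀ y a b) (extChartAt I p₀).target)
    (hf' : ∀ p₀ : M', ∀ a b : E',
      ContDiffOn ℝ ∞ (fun y => coordForm I' f' p₀ y a b) (extChartAt I' p₀).target)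
    {p₀ : M × M'} {y : E × E'}
    (hy : y ∈ (extChartAt (I.prod I') p₀).target) (a b c : E × E') :
    𝐃 (fun x => coordForm (I.prod I') (prodForm f f') p₀ x b c) y a =
      𝐃 (fun x => coordForm I f p₀.1 x b.1 c.1) y.1 a.1 +
      𝐃 (fun x => coordForm I' f' p₀.2 x b.2 c.2) y.2 a.2 := by
  have hev : (fun x => coordForm (I.prod I') (prodForm f f') p₀ x b c) =ᶠ[𝓝 y] fun x =>
      coordForm I f p₀.1 x.1 b.1 c.1 + coordForm I' f' p₀.2 x.2 b.2 c.2 := by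
    filter_upwards [(isOpen_extChartAt_target (I := I.prod I') p₀).mem_nhds hy] with x hx
      using coordForm_prodForm f f' hx b c
  rw [hev.fderiv_eq]
  rw [target_prod] at hy
  exact fderiv_add_prod (f := fun x => coordForm I f p₀.1 x b.1 c.1)
    (f' := fun x => coordForm I' f' p₀.2 x b.2 c.2)
    ((hf p₀.1 b.1 c.1).contDiffAt ((isOpen_extChartAt_target p₀.1).mem_nhds hy.1)).diffAt
    ((hf' p₀.2 b.2 c.2).contDiffAt ((isOpen_extChartAt_target p₀.2).mem_nhds hy.2)).diffAt a

/-- The product of two bi-Lagrangian structures. -/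
def prod : BiLagrangianStructure (I.prod I') (M × M') where
  form := prodForm B.form B'.form
  D₁ := prodDist B.D₁ B'.D₁
  D₂ := prodDist B.D₂ B'.D₂
  F := prodEnd B.F B'.F
  alternating p v := by
    have h1 := B.alternating p.1 v.1
    have h2 := B'.alternating p.2 v.2
    exact (congrArg₂ (· + ·) h1 h2).trans (add_zero 0)
  nondegenerate p v h := by
    refine Prod.ext (B.nondegenerate p.1 v.1 fun w => ?_) (B'.nondegenerate p.2 v.2 fun w => ?_)
    · have h1 := h (w, (0 : E'))
      have h2 : B'.form p.2 v.2 0 = 0 := map_zero _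
      exact (add_zero _).symm.trans ((congrArg (B.form p.1 v.1 w + ·) h2).symm.trans h1)
    · have h1 := h ((0 : E), w)
      have h2 : B.form p.1 v.1 0 = 0 := map_zero _
      exact (zero_add _).symm.trans ((congrArg (· + B'.form p.2 v.2 w) h2).symm.trans h1)
  smooth_form p₀ a b := by
    refine ContDiffOn.congr ?_ fun y hy => coordForm_prodForm B.form B'.form hy a b
    rw [target_prod]
    exact ((B.smooth_form p₀.1 a.1 b.1).comp contDiff_fst.contDiffOn fun x hx => hx.1).add
      ((B'.smooth_form p₀.2 a.2 b.2).comp contDiff_snd.contDiffOn fun x hx => hx.2)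
  closed p₀ y hy a b c := by
    rw [fderiv_coordForm_prodForm B.smooth_form B'.smooth_form hy,
      fderiv_coordForm_prodForm B.smooth_form B'.smooth_form hy,
      fderiv_coordForm_prodForm B.smooth_form B'.smooth_form hy]
    rw [target_prod] at hy
    have h1 := B.closed p₀.1 y.1 hy.1 a.1 b.1 c.1
    have h2 := B'.closed p₀.2 y.2 hy.2 a.2 b.2 c.2
    linarith
  transversal := isCompl_prodDist B.transversal B'.transversal
  lagrangian₁ p v hv w hw := (congrArg₂ (· + ·) (B.lagrangian₁ p.1 _ hv.1 _ hw.1)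
    (B'.lagrangian₁ p.2 _ hv.2 _ hw.2)).trans (add_zero 0)
  lagrangian₂ p v hv w hw := (congrArg₂ (· + ·) (B.lagrangian₂ p.1 _ hv.1 _ hw.1)
    (B'.lagrangian₂ p.2 _ hv.2 _ hw.2)).trans (add_zero 0)
  F_D₁ p v hv := Prod.ext (B.F_D₁ p.1 _ hv.1) (B'.F_D₁ p.2 _ hv.2)
  F_D₂ p v hv := Prod.ext (B.F_D₂ p.1 _ hv.1) (B'.F_D₂ p.2 _ hv.2)
  smooth_F p₀ a := by
    refine ContDiffOn.congr ?_ fun y hy => coordEnd_prodEnd B.F B'.F hy a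
    rw [target_prod]
    exact ((B.smooth_F p₀.1 a.1).comp contDiff_fst.contDiffOn fun x hx => hx.1).prodMk
      ((B'.smooth_F p₀.2 a.2).comp contDiff_snd.contDiffOn fun x hx => hx.2)
  involutive₁ := isInvolutive_prodDist B.involutive₁ B'.involutive₁
  involutive₂ := isInvolutive_prodDist B.involutive₂ B'.involutive₂

lemma curvature_prod {p₀ : M × M'} {y : E × E'} (hy : y ∈ (extChartAt (I.prod I') p₀).target)
    (a b c : E × E') : curvature (I.prod I') (B.prod B').g p₀ y a b c =
      (curvature I B.g p₀.1 y.1 a.1 b.1 c.1, curvature I' B'.g p₀.2 y.2 a.2 b.2 c.2) := by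
  have h1 : ∀ᶠ x in 𝓝 y, ∀ a b, coordForm (I.prod I') (B.prod B').g p₀ x a b =
      sumForm (coordCLM I B.g p₀.1 x.1) (coordCLM I' B'.g p₀.2 x.2) a b := by
    filter_upwards [(isOpen_extChartAt_target (I := I.prod I') p₀).mem_nhds hy] with x hx a b
    rw [sumForm_apply]
    exact coordForm_prodForm B.g B'.g hx a b
  have hy' := hy
  rw [target_prod] at hy'
  have hn := (isOpen_extChartAt_target (I := I) p₀.1).mem_nhds hy'.1
  have hn' := (isOpen_extChartAt_target (I := I') p₀.2).mem_nhds hy'.2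
  refine (curv_congr h1 a b c).trans ?_
  exact curv_sum ((B.contDiffOn_coordCLM_g p₀.1).contDiffAt hn)
    ((B'.contDiffOn_coordCLM_g p₀.2).contDiffAt hn')
    (by filter_upwards [hn] with x hx using B.nondeg_coordCLM_g hx)
    (by filter_upwards [hn'] with x hx using B'.nondeg_coordCLM_g hx) a b c

lemma prod_isFlat_iff [Nonempty M] [Nonempty M'] : (B.prod B').IsFlat ↔ B.IsFlat ∧ B'.IsFlat := by
  constructor
  · intro h
    have key : ∀ p p' y y', y ∈ (extChartAt I p).target → y' ∈ (extChartAt I' p').target →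
        ∀ a b c : E × E', (curvature I B.g p y a.1 b.1 c.1,
          curvature I' B'.g p' y' a.2 b.2 c.2) = (0 : E × E') := fun p p' y y' hy hy' a b c => by
      have hmem : (y, y') ∈ (extChartAt (I.prod I') (p, p')).target := by
        rw [target_prod]; exact ⟨hy, hy'⟩
      exact (curvature_prod B B' hmem a b c).symm.trans (h (p, p') _ hmem a b c)
    obtain ⟨p₀⟩ := ‹Nonempty M›
    obtain ⟨p₁⟩ := ‹Nonempty M'›
    exact ⟨fun p y hy a b c => congrArg Prod.fst
        (key p p₁ y _ hy (mem_extChartAt_target p₁) (a, 0) (b, 0) (c, 0)),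
      fun p y hy a b c => congrArg Prod.snd
        (key p₀ p _ y (mem_extChartAt_target p₀) hy (0, a) (0, b) (0, c))⟩
  · rintro ⟨h, h'⟩ p y hy a b c
    rw [curvature_prod B B' hy]
    rw [target_prod] at hy
    exact Prod.ext (h _ _ hy.1 _ _ _) (h' _ _ hy.2 _ _ _)

lemma leaf_prodDist (D : DistField I M) (D' : DistField I' M') (p : M × M') :
    leaf (I.prod I') (prodDist D D') p = leaf I D p.1 ×ˢ leaf I' D' p.2 := by
  have hd : ∀ {γ : ℝ → M} {γ' : ℝ → M'}, ContMDiff 𝓥 ℝ I ∞ γ → ContMDiff 𝓥 ℝ I' ∞ γ' → ∀ t,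
      (mfderiv 𝓥 ℝ (I.prod I') (fun t => (γ t, γ' t)) t (1 : ℝ) ∈ prodDist D D' (γ t, γ' t) ↔
        mfderiv 𝓥 ℝ I γ t (1 : ℝ) ∈ D (γ t) ∧ mfderiv 𝓥 ℝ I' γ' t (1 : ℝ) ∈ D' (γ' t)) :=
    fun {γ γ'} h h' t => iff_of_eq (congrArg (fun L : ℝ →L[ℝ] E × E' =>
      L 1 ∈ (prodDist D D' (γ t, γ' t) : Submodule ℝ (E × E')))
      (((h.mdifferentiableAt (by simp)).hasMFDerivAt (x := t)).prodMk
        ((h'.mdifferentiableAt (by simp)).hasMFDerivAt)).mfderiv)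
  ext q
  constructor
  · rintro ⟨γ, hγ, h0, h1, hD⟩
    have hs : ContMDiff 𝓥 ℝ I ∞ fun t => (γ t).1 := contMDiff_fst.comp hγ
    have hs' : ContMDiff 𝓥 ℝ I' ∞ fun t => (γ t).2 := contMDiff_snd.comp hγ
    have hD' := fun t => (hd hs hs' t).1 (hD t)
    exact ⟨⟨_, hs, congrArg Prod.fst h0, congrArg Prod.fst h1, fun t => (hD' t).1⟩,
      ⟨_, hs', congrArg Prod.snd h0, congrArg Prod.snd h1, fun t => (hD' t).2⟩⟩
  · rintro ⟨⟨γ, hγ, h0, h1, hD⟩, ⟨γ', hγ', h0', h1', hD'⟩⟩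
    exact ⟨fun t => (γ t, γ' t), hγ.prodMk hγ', Prod.ext h0 h0', Prod.ext h1 h1',
      fun t => (hd hγ hγ' t).2 ⟨hD t, hD' t⟩⟩

lemma prod_N (p : M × M') : (B.prod B').N p = B.N p.1 * B'.N p.2 := by
  have h : (B.prod B').leaf₁ p ∩ (B.prod B').leaf₂ p =
      (B.leaf₁ p.1 ∩ B.leaf₂ p.1) ×ˢ (B'.leaf₁ p.2 ∩ B'.leaf₂ p.2) := by
    rw [← prod_inter_prod]
    exact congrArg₂ (· ∩ ·) (leaf_prodDist B.D₁ B'.D₁ p) (leaf_prodDist B.D₂ B'.D₂ p)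
  rw [N, h, encard_prod, N, N]

end BiLagrangianStructure

/-- The product of two bi-Lagrangian manifolds. -/
def BiLagrangianManifold.prod {d d' : ℕ} (X : BiLagrangianManifold d)
    (Y : BiLagrangianManifold d') : BiLagrangianManifold (d + d') where
  E := X.E × Y.E
  dim_eq := by rw [Module.finrank_prod, X.dim_eq, Y.dim_eq]
  H := ModelProd X.H Y.H
  I := X.I.prod Y.I
  M := X.M × Y.M
  str := X.str.prod Y.str

end Products

section Presentations

/-- A model together with a group of affine transformations which preserve its structure. -/
structure InvariantModel (V : Type) [NormedAddCommGroup V] [NormedSpace ℝ V] where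
  A : AdaptedModel V
  D : AffineDeck V
  U_eq : A.U = D.U
  form_act : ∀ i, ∀ x ∈ A.U, ∀ a b, A.form (D.act i x) (D.lin i a) (D.lin i b) = A.form x a b
  F_lin : ∀ i a, A.F (D.lin i a) = D.lin i (A.F a)

namespace InvariantModel

variable [FiniteDimensional ℝ V] (P : InvariantModel V)

/-- The bi-Lagrangian structure of the quotient. -/
def str : BiLagrangianStructure 𝓥 V P.D.Q := (P.D.descends P.U_eq P.form_act P.F_lin).str

lemma modelsAt : ∀ z ∈ P.A.U, P.A.ModelsAt 𝓥 V P.str.form P.str.F P.D.proj z :=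
  (P.D.descends P.U_eq P.form_act P.F_lin).str_modelsAt

lemma surjective : P.D.proj '' P.A.U = univ := by rw [P.U_eq]; exact P.D.image_proj

/-- The quotient as a bi-Lagrangian manifold. -/
def manifold {d : ℕ} (hd : Module.finrank ℝ V = d) (hc : IsConnected P.D.U) :
    BiLagrangianManifold d :=
  have := P.D.connectedSpace hc
  have : SecondCountableTopology V := inferInstance
  { E := V, dim_eq := hd, H := V, I := 𝓥 V, M := P.D.Q, str := P.str }

lemma isQuotientOf {U : Set V} (hU : P.A.U = U) {r : V → V → Prop}
    (hr : ∀ x ∈ U, ∀ y ∈ U, P.D.Rel x y ↔ r x y) {G : V → V → V → ℝ}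
    (hG : ∀ x ∈ U, ∀ a b, P.A.metric x a b = G x a b) {Φ : V → V → V}
    (hΦ : ∀ x ∈ U, ∀ a, P.A.F a = Φ x a) : P.str.IsQuotientOf U G Φ r P.D.proj := by
  subst hU
  refine AdaptedModel.isQuotientOf P.modelsAt P.surjective (fun x hx y hy => ?_) hG hΦ
  rw [AffineDeck.proj_eq_iff (P.U_eq ▸ hx) (P.U_eq ▸ hy), hr x hx y hy]

lemma isFlat {β : 𝔅 V} (h : ∀ z ∈ P.A.U, P.A.form z = β) : P.str.IsFlat := by
  refine P.str.isFlat_of_models (V := V) fun p => ?_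
  obtain ⟨x, hx, rfl⟩ := (P.surjective.symm ▸ mem_univ p : p ∈ P.D.proj '' P.A.U)
  exact ⟨P.A, P.D.proj, x, hx, rfl, P.modelsAt, AdaptedModel.curv_eq_zero_of_const hx h⟩

lemma leaf₁_univ (hU : P.A.U = univ) (x : V) :
    P.str.leaf₁ (P.D.proj x) = {q | ∃ v, P.A.F v = v ∧ P.D.proj (x + v) = q} :=
  P.A.leaf₁_eq_univ hU P.modelsAt (hU ▸ P.surjective) (P.D.affineFibers P.U_eq P.F_lin) x

lemma leaf₂_univ (hU : P.A.U = univ) (x : V) :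
    P.str.leaf₂ (P.D.proj x) = {q | ∃ v, P.A.F v = -v ∧ P.D.proj (x + v) = q} :=
  P.A.leaf₂_eq_univ hU P.modelsAt (hU ▸ P.surjective) (P.D.affineFibers P.U_eq P.F_lin) x

lemma compat {ℓ : V → V → Prop} (hinv : ∀ i, ∀ x ∈ P.A.U, ∀ y ∈ P.A.U, ℓ x y →
      ℓ (P.D.act i x) (P.D.act i y)) : ∀ x ∈ P.A.U, ∀ x' ∈ P.A.U, ∀ y ∈ P.A.U,
      P.D.proj x = P.D.proj x' → ℓ x y → ∃ y' ∈ P.A.U, P.D.proj y' = P.D.proj y ∧ ℓ x' y' := by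
  intro x hx x' hx' y hy hxx' hxy
  obtain ⟨i, rfl⟩ := (AffineDeck.proj_eq_iff (P.U_eq ▸ hx) (P.U_eq ▸ hx')).1 hxx'
  have hyU : y ∈ P.D.U := P.U_eq ▸ hy
  exact ⟨P.D.act i y, by rw [P.U_eq]; exact P.D.maps i y hyU, P.D.proj_act hyU,
    hinv i x hx y hy hxy⟩

lemma leaf_eq {D : DistField 𝓥 V P.D.Q} {K : V →L[ℝ] V} (hD : ∀ z ∈ P.A.U, ∀ a : V,
      mfderiv 𝓥 V 𝓥 V P.D.proj z a ∈ D (P.D.proj z) ↔ P.A.F a = K a) {ℓ : V → V → Prop}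
    (hloc : ∀ x ∈ P.A.U, ∀ᶠ y in 𝓝 x, P.A.F (y - x) = K (y - x) → ℓ x y)
    (hsymm : ∀ x ∈ P.A.U, ∀ y ∈ P.A.U, ℓ x y → ℓ y x)
    (htrans : ∀ x ∈ P.A.U, ∀ y ∈ P.A.U, ∀ z ∈ P.A.U, ℓ x y → ℓ y z → ℓ x z)
    (hinv : ∀ i, ∀ x ∈ P.A.U, ∀ y ∈ P.A.U, ℓ x y → ℓ (P.D.act i x) (P.D.act i y))
    (hseg : ∀ x ∈ P.A.U, ∀ y ∈ P.A.U, ℓ x y → P.A.F (y - x) = K (y - x) ∧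
      ∀ s ∈ Icc (0 : ℝ) 1, x + s • (y - x) ∈ P.A.U) {x : V} (hx : x ∈ P.A.U) :
    leaf 𝓥 V D (P.D.proj x) = P.D.proj '' {y | y ∈ P.A.U ∧ ℓ x y} :=
  P.A.leaf_eq (fun z => (P.modelsAt z z.2).localDiffeo) P.surjective hD hloc hsymm htrans
    (P.compat hinv) hseg hx

lemma mem_D₁ : ∀ z ∈ P.A.U, ∀ a : V, mfderiv 𝓥 V 𝓥 V P.D.proj z a ∈ P.str.D₁ (P.D.proj z) ↔
    P.A.F a = ContinuousLinearMap.id ℝ V a := fun z hz => (P.modelsAt z hz).mem_D₁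

lemma mem_D₂ : ∀ z ∈ P.A.U, ∀ a : V, mfderiv 𝓥 V 𝓥 V P.D.proj z a ∈ P.str.D₂ (P.D.proj z) ↔
    P.A.F a = (-ContinuousLinearMap.id ℝ V) a := fun z hz => (P.modelsAt z hz).mem_D₂

end InvariantModel

lemma BiLagrangianStructure.not_isFlat_of_modelsAt [FiniteDimensional ℝ V]
    [FiniteDimensional ℝ E] [I.Boundaryless] [IsManifold I ∞ M]
    (B : BiLagrangianStructure I M) {A : AdaptedModel V} {ψ : V → M} {x : V}
    (hA : ∀ z ∈ A.U, A.ModelsAt I B.form B.F ψ z) (hx : x ∈ A.U) {a b c d : V} (ha : A.F a = a)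
    (hb : A.F b = -b) (hc : A.F c = c) (h1 : 𝐃 A.metric x a c = 0)
    (h2 : 𝐃 (𝐃 A.metric) x b a c d ≠ 0) : ¬ B.IsFlat := by
  intro hflat
  obtain ⟨w, hw, hd⟩ := AdaptedModel.exists_of_curv_eq_zero hx (hflat.curv_eq_zero hA hx) ha hb hc
  have hw0 : w = 0 := AdaptedModel.metric_nondeg hx w fun e => by rw [hw, h1]; rfl
  apply h2
  rw [hd, hw0, map_zero]
  rfl

/-- The determinant of two vectors of the plane. -/
def planeForm : ℝ² →L[ℝ] ℝ² →L[ℝ] ℝ :=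
  (ContinuousLinearMap.mul ℝ ℝ).bilinearComp (fst ℝ ℝ ℝ) (snd ℝ ℝ ℝ) -
    (ContinuousLinearMap.mul ℝ ℝ).bilinearComp (snd ℝ ℝ ℝ) (fst ℝ ℝ ℝ)

lemma planeForm_apply (a b : ℝ²) : planeForm a b = a.1 * b.2 - a.2 * b.1 := by simp [planeForm]

lemma nondeg_planeForm : Nondeg planeForm := by
  intro v hv
  have h1 := hv (0, 1)
  have h2 := hv (1, 0)
  simp only [planeForm_apply] at h1 h2
  exact Prod.ext (by simpa using h1) (by simpa using h2)

/-- The interchange of the coordinates of the plane. -/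
def swapF : ℝ² →L[ℝ] ℝ² := (snd ℝ ℝ ℝ).prod (fst ℝ ℝ ℝ)

/-- The symmetry of the plane with respect to the horizontal axis. -/
def diagF : ℝ² →L[ℝ] ℝ² := (fst ℝ ℝ ℝ).prod (-(snd ℝ ℝ ℝ))

@[simp] lemma swapF_apply (a : ℝ²) : swapF a = (a.2, a.1) := rfl

@[simp] lemma diagF_apply (a : ℝ²) : diagF a = (a.1, -a.2) := rfl

lemma diagF_diagF (a : ℝ²) : diagF (diagF a) = a := by simp

lemma planeForm_diagF (a b : ℝ²) : planeForm (diagF a) (diagF b) = -planeForm a b := by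
  simp only [planeForm_apply, diagF_apply]
  ring

lemma diagF_eq_self_iff (a : ℝ²) : diagF a = a ↔ a.2 = 0 := by simp [Prod.ext_iff, neg_eq_self]

lemma diagF_eq_neg_iff (a : ℝ²) : diagF a = -a ↔ a.1 = 0 := by simp [Prod.ext_iff, self_eq_neg]

lemma apply_eq_plane (L : ℝ² →L[ℝ] ℝ) (v : ℝ²) : L v = v.1 * L (1, 0) + v.2 * L (0, 1) := by
  have : v = v.1 • ((1, 0) : ℝ²) + v.2 • ((0, 1) : ℝ²) := by ext <;> simp
  conv_lhs => rw [this]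
  rw [map_add, map_smul, map_smul, smul_eq_mul, smul_eq_mul]

/-- The model of a surface, whose symplectic form is `h` times the determinant. -/
def planeModel (U : Set ℝ²) (hU : IsOpen U) (h : ℝ² → ℝ) (hs : ContDiffOn ℝ ∞ h U)
    (h0 : ∀ x ∈ U, h x ≠ 0) (F : ℝ² →L[ℝ] ℝ²) (hF : ∀ a, F (F a) = a)
    (hdet : ∀ a b, planeForm (F a) (F b) = -planeForm a b) : AdaptedModel ℝ² where
  U := U
  isOpen := hU
  form x := h x • planeForm
  F := F
  smooth := hs.smul contDiffOn_const
  F_F := hF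
  alt x _ a := by simp [planeForm_apply, mul_comm]
  nondeg x hx v hv := nondeg_planeForm v fun w => by
    have := hv w
    simpa [h0 x hx] using this
  anti x _ a b := by simp [hdet]
  closed x hx a b c := by
    have hd : HasFDerivAt h (𝐃 h x) x :=
      ((hs.contDiffAt (hU.mem_nhds hx)).differentiableAt (by simp)).hasFDerivAt
    have hd' := hd.smul_const planeForm
    rw [hd'.fderiv]
    simp only [smulRight_apply, smul_apply, planeForm_apply, smul_eq_mul,
      apply_eq_plane _ a, apply_eq_plane _ b, apply_eq_plane _ c]
    ring

section

variable {U : Set ℝ²} {hU : IsOpen U} {h : ℝ² → ℝ} {hs : ContDiffOn ℝ ∞ h U}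
    {h0 : ∀ x ∈ U, h x ≠ 0} {F : ℝ² →L[ℝ] ℝ²} {hF : ∀ a, F (F a) = a}
    {hdet : ∀ a b, planeForm (F a) (F b) = -planeForm a b}

lemma planeModel_metric (x a b : ℝ²) :
    (planeModel U hU h hs h0 F hF hdet).metric x a b = h x * planeForm (F a) b := rfl

lemma hasDerivAt_mixed {h k : ℝ² → ℝ} {x : ℝ²} (hs : ContDiffAt ℝ ∞ h x)
    (hk : ∀ᶠ z in 𝓝 x, HasDerivAt (fun s => h (s, z.2)) (k z) z.1) {m : ℝ}
    (hm : HasDerivAt (fun s => k (x.1, s)) m x.2) :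
    𝐃 (𝐃 h) x (0, 1) (1, 0) = m := by
  have hfst : ∀ z : ℝ², HasDerivAt (fun s : ℝ => (s, z.2)) ((1, 0) : ℝ²) z.1 := fun z =>
    (hasDerivAt_id z.1).prodMk (hasDerivAt_const z.1 z.2)
  have hsnd : HasDerivAt (fun s : ℝ => (x.1, s)) ((0, 1) : ℝ²) x.2 :=
    (hasDerivAt_const x.2 x.1).prodMk (hasDerivAt_id x.2)
  have h1 : ∀ᶠ z in 𝓝 x, 𝐃 h z (1, 0) = k z := by
    filter_upwards [hk, hs.eventually_diffAt] with z hz hz'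
    have hd := hz'.hasFDerivAt (x := (z.1, z.2))
    exact (HasFDerivAt.comp_hasDerivAt z.1 hd (hfst z)).unique hz
  have h2 : HasFDerivAt (𝐃 h) (𝐃 (𝐃 h) x) x := hs.smooth_fderiv.diffAt.hasFDerivAt
  have h3 : HasFDerivAt k ((𝐃 (𝐃 h) x).flip (1, 0)) x := by
    have := h2.eval ((1, 0) : ℝ²)
    refine (this.congr_of_eventuallyEq (h1.mono fun z hz => hz.symm)).congr_fderiv ?_
    ext <;> simp
  exact (HasFDerivAt.comp_hasDerivAt x.2 (show HasFDerivAt k _ (x.1, x.2) from h3) hsnd).unique hm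

lemma planeModel_curv_ne_zero (hs : ContDiffOn ℝ ∞ h U) (h0 : ∀ x ∈ U, h x ≠ 0)
    (hF : ∀ a, diagF (diagF a) = a)
    (hdet : ∀ a b, planeForm (diagF a) (diagF b) = -planeForm a b) {x : ℝ²}
    (hx : x ∈ U) {k : ℝ² → ℝ} (hk : ∀ᶠ z in 𝓝 x, HasDerivAt (fun s => h (s, z.2)) (k z) z.1)
    {n m : ℝ} (hn : HasDerivAt (fun s => h (x.1, s)) n x.2)
    (hm : HasDerivAt (fun s => k (x.1, s)) m x.2) (hne : h x * m ≠ k x * n) :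
    ¬ ∀ a b c, curv (fun x a b => (planeModel U hU h hs h0 diagF hF hdet).metric x a b) x a b c
      = 0 := by
  intro hR
  obtain ⟨w, hw, hd⟩ := AdaptedModel.exists_of_curv_eq_zero
    (A := planeModel U hU h hs h0 diagF hF hdet) hx hR (a := (1, 0)) (b := (0, 1)) (c := (1, 0))
    (by simp [planeModel]) (by simp [planeModel]) (by simp [planeModel])
  have hsx := hs.contDiffAt (hU.mem_nhds hx)
  have e0 : (planeModel U hU h hs h0 diagF hF hdet).metric =
      fun x => h x • (planeForm ∘L diagF) := rfl
  have hder : ∀ᶠ z in 𝓝 x, HasFDerivAt (planeModel U hU h hs h0 diagF hF hdet).metric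
      ((𝐃 h z).smulRight (planeForm ∘L diagF)) z := by
    filter_upwards [hsx.eventually_diffAt] with z hz
    rw [e0]
    exact hz.hasFDerivAt.smul_const _
  have h2 : HasFDerivAt (𝐃 h) (𝐃 (𝐃 h) x) x := hsx.smooth_fderiv.diffAt.hasFDerivAt
  have hder2 : ∀ a b c d, 𝐃 (𝐃 (planeModel U hU h hs h0 diagF hF hdet).metric) x
      a b c d = 𝐃 (𝐃 h) x a b * planeForm (diagF c) d := by
    intro a b c d
    have h3 : HasFDerivAt (fun z => (𝐃 h z).smulRight (planeForm ∘L diagF))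
        (((smulRightL ℝ (ℝ²) (ℝ² →L[ℝ] ℝ² →L[ℝ] ℝ)).flip (planeForm ∘L diagF)) ∘L 𝐃 (𝐃 h) x) x :=
      (((smulRightL ℝ (ℝ²) (ℝ² →L[ℝ] ℝ² →L[ℝ] ℝ)).flip (planeForm ∘L diagF)).hasFDerivAt).comp x h2
    rw [(h3.congr_of_eventuallyEq (hder.mono fun z hz => hz.fderiv)).fderiv]
    rfl
  have h1 := hder.self_of_nhds
  have w1 := hw (0, 1)
  have w2 := hw (1, 0)
  have d1 := hd (0, 1)
  rw [hder2, hasDerivAt_mixed hsx hk hm, h1.fderiv] at d1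
  rw [h1.fderiv] at w1 w2
  have ex : 𝐃 h x (1, 0) = k x := by
    have hfst : HasDerivAt (fun s : ℝ => (s, x.2)) ((1, 0) : ℝ²) x.1 :=
      (hasDerivAt_id x.1).prodMk (hasDerivAt_const x.1 x.2)
    exact (HasFDerivAt.comp_hasDerivAt x.1 hsx.diffAt.hasFDerivAt hfst).unique hk.self_of_nhds
  have ey : 𝐃 h x (0, 1) = n := by
    have hsnd : HasDerivAt (fun s : ℝ => (x.1, s)) ((0, 1) : ℝ²) x.2 :=
      (hasDerivAt_const x.2 x.1).prodMk (hasDerivAt_id x.2)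
    exact (HasFDerivAt.comp_hasDerivAt x.2 hsx.diffAt.hasFDerivAt hsnd).unique hn
  simp [planeModel_metric, planeForm_apply, ex, ey] at w1 w2 d1
  have hhx := h0 x hx
  apply hne
  rw [d1]
  linear_combination n * w1

end

end Presentations

section MinkowskiQuotients

variable (L : AddSubgroup (ℝ²)) (ε : ℝ) (hε : 0 < ε) (hL : ∀ v ∈ L, v ≠ 0 → ε ≤ ‖v‖)

/-- The Minkowski plane with a discrete group of translations. -/
def minkowskiQuotient : InvariantModel ℝ² where
  A := planeModel univ isOpen_univ (fun _ => 1) contDiffOn_const (fun _ _ => one_ne_zero) swapF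
    (fun a => rfl) (fun a b => by simp only [planeForm_apply, swapF_apply]; ring)
  D := AffineDeck.translations L ε hε hL
  U_eq := rfl
  form_act _ _ _ _ _ := rfl
  F_lin _ _ := rfl

/-- The quotient of the Minkowski plane by a discrete group of translations. -/
def minkowskiManifold : BiLagrangianManifold 2 :=
  (minkowskiQuotient L ε hε hL).manifold (by simp) (isConnected_univ)

/-- The projection to the quotient of the Minkowski plane. -/
def minkowskiProj : ℝ² → (minkowskiManifold L ε hε hL).M := (minkowskiQuotient L ε hε hL).D.proj

local notation "𝓜" => minkowskiManifold L ε hε hL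
local notation "𝔮" => minkowskiProj L ε hε hL
local notation "𝒬" => minkowskiQuotient L ε hε hL

lemma minkowski_isQuotientOf {r : ℝ² → ℝ² → Prop} (hr : ∀ x y, (∃ v ∈ L, y = x + v) ↔ r x y) :
    (𝓜).str.IsQuotientOf univ minkowskiMetric minkowskiProduct r (𝔮) := by
  refine (𝒬).isQuotientOf rfl
    (fun x _ y _ => (AffineDeck.translations_rel (hε := hε) (hL := hL)).trans (hr x y))
        (fun x _ a b => ?_)
    (fun x _ a => rfl)
  change (1 : ℝ) * planeForm (swapF a) b = _
  simp only [planeForm_apply, swapF_apply, minkowskiMetric]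
  ring

lemma minkowski_isFlat : (𝓜).str.IsFlat := (𝒬).isFlat (β := planeForm) fun _ _ => one_smul _ _

lemma minkowskiProj_eq_iff (x y : ℝ²) : 𝔮 x = 𝔮 y ↔ y - x ∈ L := by
  refine (AffineDeck.proj_eq_iff (mem_univ _) (mem_univ _)).trans
    ((AffineDeck.translations_rel (hε := hε) (hL := hL)).trans ⟨?_, fun h => ⟨_, h, by simp⟩⟩)
  rintro ⟨v, hv, rfl⟩
  simpa using hv

lemma minkowski_N (x : ℝ²) : (𝓜).str.N (𝔮 x) = ((fun s : ℝ => 𝔮 (x + (s, s))) ''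
        {s | ∃ v ∈ L, v.1 + v.2 = 2 * s}).encard := by
  rw [BiLagrangianStructure.N]
  congr 1
  have h1 : (𝓜).str.leaf₁ (𝔮 x) = {q | ∃ v : ℝ², swapF v = v ∧ 𝔮 (x + v) = q} :=
    (𝒬).leaf₁_univ rfl x
  have h2 : (𝓜).str.leaf₂ (𝔮 x) = {q | ∃ v : ℝ², swapF v = -v ∧ 𝔮 (x + v) = q} :=
    (𝒬).leaf₂_univ rfl x
  rw [h1, h2]
  ext q
  constructor
  · rintro ⟨⟨⟨s, s'⟩, hs, rfl⟩, ⟨⟨t, t'⟩, ht, hq⟩⟩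
    simp only [swapF_apply, Prod.mk.injEq, Prod.neg_mk] at hs ht
    obtain ⟨rfl, -⟩ := hs
    obtain ⟨rfl, -⟩ := ht
    rw [minkowskiProj_eq_iff] at hq
    refine ⟨s', ⟨_, hq, ?_⟩, rfl⟩
    simp only [Prod.fst_sub, Prod.snd_sub, Prod.fst_add, Prod.snd_add]
    ring
  · rintro ⟨s, ⟨v, hv, hvs⟩, rfl⟩
    refine ⟨⟨(s, s), rfl, rfl⟩, ⟨(s - v.1, -(s - v.1)), by simp, ?_⟩⟩
    rw [minkowskiProj_eq_iff]
    convert hv using 1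
    ext
    · simp
    · simp only [Prod.snd_sub, Prod.snd_add]
      linarith

lemma exists_minkowskiProj (p : (𝓜).M) : ∃ x, 𝔮 x = p := by
  obtain ⟨x, -, hx⟩ := (𝒬).D.exists_rep p
  exact ⟨x, hx⟩

lemma minkowski_not_compactSpace (h : ∀ v ∈ L, v.2 = 0) : ¬ CompactSpace (𝓜).M := by
  refine (𝒬).D.not_compactSpace (f := Prod.snd) continuous_snd.continuousOn
    ?_ fun C => ⟨(0, C + 1), trivial, lt_add_one C⟩
  rintro ⟨v, hv⟩ x _
  have : (x + v).2 = x.2 := by rw [Prod.snd_add, h v hv, add_zero]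
  exact this

/-- The group of translations of the Lorentz cylinder. -/
def cylinderLattice : AddSubgroup (ℝ²) where
  carrier := {v | ∃ k : ℤ, v = (2 * Real.pi * k, 0)}
  add_mem' := by
    rintro _ _ ⟨k, rfl⟩ ⟨l, rfl⟩
    exact ⟨k + l, by push_cast; ext <;> simp; ring⟩
  zero_mem' := ⟨0, by simp; rfl⟩
  neg_mem' := by
    rintro _ ⟨k, rfl⟩
    exact ⟨-k, by push_cast; ext <;> simp⟩

lemma cylinderLattice_sep : ∀ v ∈ cylinderLattice, v ≠ 0 → 1 ≤ ‖v‖ := by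
  rintro _ ⟨k, rfl⟩ hv
  have hk : k ≠ 0 := by rintro rfl; simp at hv
  have h1 : (1 : ℝ) ≤ |(k : ℝ)| := by exact_mod_cast Int.one_le_abs hk
  have hpi := Real.pi_gt_three
  refine le_trans ?_ (_root_.norm_fst_le _)
  rw [Real.norm_eq_abs, abs_mul, abs_of_pos (by positivity)]
  nlinarith

/-- The lattice obtained from `ℤ²` by the rotation of angle `α`. -/
def rotatedLattice (α : ℝ) : AddSubgroup (ℝ²) where
  carrier := {v | ∃ m k : ℤ, v = (m * cos α - k * sin α, m * sin α + k * cos α)}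
  add_mem' := by
    rintro _ _ ⟨m, k, rfl⟩ ⟨m', k', rfl⟩
    exact ⟨m + m', k + k', by push_cast; ext <;> simp <;> ring⟩
  zero_mem' := ⟨0, 0, by simp; rfl⟩
  neg_mem' := by
    rintro _ ⟨m, k, rfl⟩
    exact ⟨-m, -k, by push_cast; ext <;> simp <;> ring⟩

lemma rotatedLattice_sep (α : ℝ) : ∀ v ∈ rotatedLattice α, v ≠ 0 → 1 / 2 ≤ ‖v‖ := by
  rintro _ ⟨m, k, rfl⟩ hv
  have h0 : m ≠ 0 ∨ k ≠ 0 := by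
    by_contra! h
    obtain ⟨rfl, rfl⟩ := h
    simp at hv
  have h1 : (1 : ℝ) ≤ (m : ℝ) ^ 2 + (k : ℝ) ^ 2 := by
    have : (1 : ℤ) ≤ m ^ 2 + k ^ 2 := by
      rcases h0 with h | h
      · have := sq_nonneg k; have : 0 < m ^ 2 := by positivity
        lia
      · have := sq_nonneg m; have : 0 < k ^ 2 := by positivity
        lia
    exact_mod_cast this
  by_contra! hlt
  have ha := (_root_.norm_fst_le _).trans_lt hlt
  have hb := (_root_.norm_snd_le _).trans_lt hlt
  simp only [Real.norm_eq_abs] at ha hb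
  have ha' := abs_lt.1 ha
  have hb' := abs_lt.1 hb
  have hcs := Real.sin_sq_add_cos_sq α
  have h2 : (m * cos α - k * sin α) ^ 2 + (m * sin α + k * cos α) ^ 2 =
      (m : ℝ) ^ 2 + (k : ℝ) ^ 2 := by
    linear_combination ((m : ℝ) ^ 2 + (k : ℝ) ^ 2) * hcs
  nlinarith

/-- The torus `T_α`. -/
def rotatedTorus (α : ℝ) : BiLagrangianManifold 2 :=
  minkowskiManifold (rotatedLattice α) (1 / 2) one_half_pos (rotatedLattice_sep α)

/-- The projection of the plane to `T_α`. -/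
def rotatedTorusProj (α : ℝ) : ℝ² → (rotatedTorus α).M :=
  minkowskiProj (rotatedLattice α) (1 / 2) one_half_pos (rotatedLattice_sep α)

lemma compactSpace_rotatedTorus (α : ℝ) : CompactSpace (rotatedTorus α).M := by
  have hcont : Continuous fun u : ℝ² =>
      (u.1 * cos α - u.2 * sin α, u.1 * sin α + u.2 * cos α) := by fun_prop
  refine (minkowskiQuotient (rotatedLattice α) (1 / 2) one_half_pos
    (rotatedLattice_sep α)).D.compactSpace
    (((isCompact_Icc (a := (0 : ℝ)) (b := 1)).prod (isCompact_Icc (a := (0 : ℝ)) (b := 1))).image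
      hcont) (subset_univ _) fun x _ => ?_
  have hcs := Real.sin_sq_add_cos_sq α
  set a := x.1 * cos α + x.2 * sin α with ha
  set b := -x.1 * sin α + x.2 * cos α with hb
  refine ⟨_, ⟨(Int.fract a, Int.fract b), ⟨⟨Int.fract_nonneg _, (Int.fract_lt_one _).le⟩,
    ⟨Int.fract_nonneg _, (Int.fract_lt_one _).le⟩⟩, rfl⟩, ?_⟩
  refine (AffineDeck.translations_rel (hε := one_half_pos) (hL := rotatedLattice_sep α)).2
      ⟨_, ⟨⌊a⌋, ⌊b⌋, rfl⟩, ?_⟩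
  simp only [Int.fract]
  ext
  · simp only [Prod.fst_add, ha, hb]
    linear_combination -x.1 * hcs
  · simp only [Prod.snd_add, ha, hb]
    linear_combination -x.2 * hcs

lemma rotatedTorus_N (α : ℝ) (x : ℝ²) : (rotatedTorus α).str.N (rotatedTorusProj α x) =
      ((fun s : ℝ => rotatedTorusProj α (x + (s, s))) '' {s | ∃ m k : ℤ,
        m * (cos α + sin α) + k * (cos α - sin α) = 2 * s}).encard := by
  refine (minkowski_N _ _ _ _ x).trans ?_
  have : {s : ℝ | ∃ v ∈ rotatedLattice α, v.1 + v.2 = 2 * s} = {s | ∃ m k : ℤ,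
        m * (cos α + sin α) + k * (cos α - sin α) = 2 * s} := by
    ext s
    constructor
    · rintro ⟨_, ⟨m, k, rfl⟩, h⟩
      exact ⟨m, k, by rw [← h]; ring⟩
    · rintro ⟨m, k, h⟩
      exact ⟨_, ⟨m, k, rfl⟩, by rw [← h]; ring⟩
  rw [this]
  rfl

lemma rotatedTorusProj_diag_eq_iff (α : ℝ) (x : ℝ²) (s t : ℝ) :
    rotatedTorusProj α (x + (s, s)) = rotatedTorusProj α (x + (t, t)) ↔
      ∃ m k : ℤ, (t - s) * (cos α + sin α) = m ∧ (t - s) * (cos α - sin α) = k := by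
  have hcs := Real.sin_sq_add_cos_sq α
  refine (minkowskiProj_eq_iff _ _ _ _ _ _).trans ?_
  rw [add_sub_add_left_eq_sub]
  constructor
  · rintro ⟨m, k, h⟩
    simp only [Prod.mk_sub_mk, Prod.mk.injEq] at h
    refine ⟨m, k, ?_, ?_⟩
    · linear_combination cos α * h.1 + sin α * h.2 + m * hcs
    · linear_combination (-sin α) * h.1 + cos α * h.2 + k * hcs
  · rintro ⟨m, k, hm, hk⟩
    refine ⟨m, k, ?_⟩
    simp only [Prod.mk_sub_mk, Prod.mk.injEq]
    constructor
    · linear_combination cos α * hm - sin α * hk - (t - s) * hcs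
    · linear_combination sin α * hm + cos α * hk - (t - s) * hcs

lemma rotatedTorus_N_pi_div_four (x : ℝ²) :
    (rotatedTorus (Real.pi / 4)).str.N (rotatedTorusProj (Real.pi / 4) x) = 1 := by
  have h2 : √2 * √2 = 2 := Real.mul_self_sqrt (by norm_num)
  rw [rotatedTorus_N, encard_eq_one]
  refine ⟨rotatedTorusProj (Real.pi / 4) (x + (0, 0)), Subset.antisymm ?_ ?_⟩
  · rintro _ ⟨s, ⟨m, k, h⟩, rfl⟩
    rw [Real.cos_pi_div_four, Real.sin_pi_div_four] at h
    refine (rotatedTorusProj_diag_eq_iff _ _ _ _).2 ⟨-m, 0, ?_, ?_⟩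
    · rw [Real.cos_pi_div_four, Real.sin_pi_div_four]
      push_cast
      have : s = m * √2 / 2 := by linarith
      rw [this]
      linear_combination (-(m : ℝ) / 2) * h2
    · rw [Real.cos_pi_div_four, Real.sin_pi_div_four]
      simp
  · rintro _ rfl
    exact ⟨0, ⟨0, 0, by simp⟩, rfl⟩

lemma rotatedTorus_N_zero (x : ℝ²) : (rotatedTorus 0).str.N (rotatedTorusProj 0 x) = 2 := by
  rw [rotatedTorus_N, encard_eq_two]
  refine ⟨rotatedTorusProj 0 (x + (0, 0)), rotatedTorusProj 0 (x + (1 / 2, 1 / 2)), ?_,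
    Subset.antisymm ?_ ?_⟩
  · rw [Ne, rotatedTorusProj_diag_eq_iff]
    rintro ⟨m, k, h, -⟩
    simp only [Real.cos_zero, Real.sin_zero] at h
    have h1 : (1 : ℝ) = ((2 * m : ℤ) : ℝ) := by push_cast; linarith
    have h2 : (1 : ℤ) = 2 * m := by exact_mod_cast h1
    lia
  · rintro _ ⟨s, ⟨m, k, h⟩, rfl⟩
    simp only [Real.cos_zero, Real.sin_zero] at h
    rcases Int.even_or_odd' (m + k) with ⟨j, hj | hj⟩
    · left
      have hj' : (m : ℝ) + k = 2 * j := by exact_mod_cast hj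
      refine (rotatedTorusProj_diag_eq_iff _ _ _ _).2 ⟨-j, -j, ?_, ?_⟩ <;>
      · simp only [Real.cos_zero, Real.sin_zero]
        push_cast
        linarith
    · right
      have hj' : (m : ℝ) + k = 2 * j + 1 := by exact_mod_cast hj
      refine (rotatedTorusProj_diag_eq_iff _ _ _ _).2 ⟨-j, -j, ?_, ?_⟩ <;>
      · simp only [Real.cos_zero, Real.sin_zero]
        push_cast
        linarith
  · rintro _ (rfl | rfl)
    · exact ⟨0, ⟨0, 0, by simp⟩, rfl⟩
    · exact ⟨1 / 2, ⟨1, 0, by simp⟩, rfl⟩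

lemma rotatedTorus_N_ne_top_iff (α : ℝ) (x : ℝ²) :
    (rotatedTorus α).str.N (rotatedTorusProj α x) ≠ ⊤ ↔ ∃ m k : ℤ, (m ≠ 0 ∨ k ≠ 0) ∧
        m * (cos α - sin α) = k * (cos α + sin α) := by
  rw [rotatedTorus_N, encard_ne_top_iff]
  have hcs := Real.sin_sq_add_cos_sq α
  have hpq : (cos α + sin α) ^ 2 + (cos α - sin α) ^ 2 = 2 := by linear_combination 2 * hcs
  have hiff := fun s t => rotatedTorusProj_diag_eq_iff α x s t
  generalize cos α + sin α = p at hpq hiff ⊢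
  generalize cos α - sin α = q at hpq hiff ⊢
  constructor
  · intro hfin
    have hmaps : MapsTo (fun j : ℕ => rotatedTorusProj α (x + (j * p / 2, j * p / 2))) univ
        ((fun s : ℝ => rotatedTorusProj α (x + (s, s))) ''
          {s | ∃ m k : ℤ, m * p + k * q = 2 * s}) := fun j _ =>
      ⟨j * p / 2, ⟨j, 0, by push_cast; ring⟩, rfl⟩
    obtain ⟨i, -, j, -, hij, h⟩ := infinite_univ.exists_ne_map_eq_of_mapsTo hmaps hfin
    obtain ⟨a, b, ha, hb⟩ := (hiff _ _).1 h
    have hn : ((j : ℝ) - i) ≠ 0 := by rw [sub_ne_zero]; exact_mod_cast hij.symm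
    by_cases hab : a = 0 ∧ b = 0
    · obtain ⟨rfl, rfl⟩ := hab
      have hp : p = 0 := by
        have : ((j : ℝ) - i) * p ^ 2 = 0 := by push_cast at ha; linarith
        rcases mul_eq_zero.1 this with h | h
        · exact absurd h hn
        · exact pow_eq_zero_iff (two_ne_zero) |>.1 h
      exact ⟨0, 1, by simp, by simp [hp]⟩
    · refine ⟨a, b, by tauto, ?_⟩
      rw [← ha, ← hb]
      ring
  · rintro ⟨m, k, hmk, h⟩
    set D : ℤ := m ^ 2 + k ^ 2 with hD
    have hDpos : 0 < D := by
      rcases hmk with h | h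
      · have := sq_nonneg k; have : 0 < m ^ 2 := by positivity
        lia
      · have := sq_nonneg m; have : 0 < k ^ 2 := by positivity
        lia
    have hDr : (0 : ℝ) < D := by exact_mod_cast hDpos
    have hDm : (D : ℝ) = (m : ℝ) ^ 2 + (k : ℝ) ^ 2 := by rw [hD]; push_cast; ring
    set μ : ℝ := (p * m + q * k) / D with hμ
    have hp : p = μ * m := by rw [hμ]; field_simp; rw [hDm]; linear_combination -k * h
    have hq : q = μ * k := by rw [hμ]; field_simp; rw [hDm]; linear_combination m * h
    have hμD : μ ^ 2 * D = 2 := by rw [hDm, ← hpq, hp, hq]; ring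
    refine ((Finset.range D.toNat).finite_toSet.image
      fun j : ℕ => rotatedTorusProj α (x + (j * μ / 2, j * μ / 2))).subset ?_
    rintro _ ⟨s, ⟨m', k', hs⟩, rfl⟩
    set j := m' * m + k' * k with hj
    have hs' : s = j * μ / 2 := by
      rw [hj]; push_cast
      have : (m' : ℝ) * (μ * m) + k' * (μ * k) = 2 * s := by rw [← hp, ← hq]; exact hs
      linarith
    have hmod := Int.emod_nonneg j hDpos.ne'
    refine ⟨(j % D).toNat, ?_, ?_⟩
    · have := Int.emod_lt_of_pos j hDpos
      simp only [Finset.coe_range, mem_Iio]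
      lia
    · have hc : (((j % D).toNat : ℕ) : ℝ) = ((j % D : ℤ) : ℝ) := by
        have : (((j % D).toNat : ℕ) : ℤ) = j % D := Int.toNat_of_nonneg hmod
        exact_mod_cast this
      have hdiv : (j : ℝ) = ((j % D : ℤ) : ℝ) + D * ((j / D : ℤ) : ℝ) := by
        exact_mod_cast (Int.emod_add_mul_ediv j D).symm
      refine (hiff _ _).2 ⟨(j / D) * m, (j / D) * k, ?_, ?_⟩
      · rw [hc, hs', hdiv, hp]; push_cast
        linear_combination ((j / D : ℤ) : ℝ) * m / 2 * hμD
      · rw [hc, hs', hdiv, hq]; push_cast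
        linear_combination ((j / D : ℤ) : ℝ) * k / 2 * hμD

end MinkowskiQuotients

section SquareModels

/-- The inner product of a real inner product space, as a continuous bilinear form. -/
def realInner (W : Type) [NormedAddCommGroup W] [InnerProductSpace ℝ W] : 𝔅 W := innerSL ℝ

/-- The symplectic form `⟨a, b'⟩ - ⟨b, a'⟩` of `W × W`. -/
def pairForm (W : Type) [NormedAddCommGroup W] [InnerProductSpace ℝ W] :
    (W × W) →L[ℝ] (W × W) →L[ℝ] ℝ :=
  (realInner W).bilinearComp (fst ℝ W W) (snd ℝ W W) -
    (realInner W).bilinearComp (snd ℝ W W) (fst ℝ W W)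

/-- The almost product structure of `W × W` with eigenspaces `W × 0` and `0 × W`. -/
def pairF (W : Type) [NormedAddCommGroup W] [NormedSpace ℝ W] : (W × W) →L[ℝ] (W × W) :=
  (fst ℝ W W).prod (-(snd ℝ W W))

section

variable {W : Type} [NormedAddCommGroup W] [InnerProductSpace ℝ W]

lemma pairForm_apply (a b : W × W) : pairForm W a b = inner ℝ a.1 b.2 - inner ℝ a.2 b.1 := rfl

@[simp] lemma pairF_apply (a : W × W) : pairF W a = (a.1, -a.2) := rfl

lemma nondeg_pairForm : Nondeg (pairForm W) := by
  intro v hv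
  have h1 := hv (0, v.1)
  have h2 := hv (v.2, 0)
  simp only [pairForm_apply, inner_zero_right, sub_zero, zero_sub, neg_eq_zero,
    inner_self_eq_zero] at h1 h2
  exact Prod.ext h1 h2

end

variable (d : ℕ)

/-- The projection of `ℝᵈ × ℝᵈ` to the plane given by a coordinate of each factor. -/
def coordPlane {d : ℕ} (i : Fin d) : (𝔼 d × 𝔼 d) →L[ℝ] ℝ² :=
  ((EuclideanSpace.proj i : 𝔼 d →L[ℝ] ℝ) ∘L fst ℝ _ _).prod
    ((EuclideanSpace.proj i : 𝔼 d →L[ℝ] ℝ) ∘L snd ℝ _ _)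

@[simp] lemma coordPlane_apply {d : ℕ} (i : Fin d) (a : 𝔼 d × 𝔼 d) :
    coordPlane i a = (a.1 i, a.2 i) := rfl

/-- A perturbation, in the plane of the `i`-th coordinates, of the flat structure of
`ℝᵈ × ℝᵈ`. -/
def squareModel {d : ℕ} (i : Fin d) (κ : ℝ² → ℝ) (hκ : ContDiff ℝ ∞ κ) (h0 : ∀ x, 1 + κ x ≠ 0) :
    AdaptedModel (𝔼 d × 𝔼 d) where
  U := univ
  isOpen := isOpen_univ
  form x := -pairForm _ - κ (coordPlane i x) • pullForm planeForm (coordPlane i)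
  F := -pairF _
  smooth := (contDiff_const.sub ((hκ.comp (coordPlane i).contDiff).smul contDiff_const)).contDiffOn
  F_F a := by simp
  alt x _ a := by simp [pairForm_apply, planeForm_apply, real_inner_comm, mul_comm]
  nondeg x _ v hv := by
    have h1 : ∀ j, v.1 j = 0 := fun j => by
      have h := hv (0, EuclideanSpace.single j 1)
      simp [pairForm_apply, planeForm_apply, EuclideanSpace.inner_single_right] at h
      by_cases hj : i = j
      · subst hj
        have : (1 + κ (coordPlane i x)) * v.1 i = 0 := by
          simp at h
          rw [coordPlane_apply]
          linarith
        exact (mul_eq_zero.1 this).resolve_left (h0 _)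
      · simpa [hj] using h
    have h2 : ∀ j, v.2 j = 0 := fun j => by
      have h := hv (EuclideanSpace.single j 1, 0)
      simp [pairForm_apply, planeForm_apply, EuclideanSpace.inner_single_right] at h
      by_cases hj : i = j
      · subst hj
        have : (1 + κ (coordPlane i x)) * v.2 i = 0 := by
          simp at h
          rw [coordPlane_apply]
          linarith
        exact (mul_eq_zero.1 this).resolve_left (h0 _)
      · simpa [hj] using h
    exact Prod.ext (by ext j; exact h1 j) (by ext j; exact h2 j)
  anti x _ a b := by
    simp [pairForm_apply, planeForm_apply]
    ring
  closed x _ a b c := by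
    have hd : HasFDerivAt κ (𝐃 κ (coordPlane i x)) (coordPlane i x) :=
      (hκ.contDiffAt.differentiableAt (by simp)).hasFDerivAt
    have hd' := (((hd.comp x (coordPlane i).hasFDerivAt)).smul_const
      (pullForm planeForm (coordPlane i))).const_sub (-pairForm (𝔼 d))
    have hd'' : 𝐃 (fun x => -pairForm (𝔼 d) -
        κ (coordPlane i x) • pullForm planeForm (coordPlane i)) x = _ := hd'.fderiv
    rw [hd'']
    simp only [neg_apply, smulRight_apply, smul_apply, pullForm_apply, planeForm_apply, smul_eq_mul,
      coe_comp, Function.comp_apply, apply_eq_plane _ (coordPlane i a),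
      apply_eq_plane _ (coordPlane i b), apply_eq_plane _ (coordPlane i c)]
    ring

lemma squareModel_metric_eq {d : ℕ} (i : Fin d) (κ : ℝ² → ℝ) (hκ : ContDiff ℝ ∞ κ)
    (h0 : ∀ x, 1 + κ x ≠ 0) : (squareModel i κ hκ h0).metric = fun x => pairForm _ ∘L pairF _ +
      κ (coordPlane i x) • (pullForm planeForm (coordPlane i) ∘L pairF _) := by
  funext x
  ext a b <;> simp [squareModel, AdaptedModel.metric] <;> ring

/-- The lattice of `ℝᵈ` with quotient `𝕋ⁿ × ℝᵈ⁻ⁿ`. -/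
def torusLattice (n d : ℕ) : AddSubgroup (𝔼 d) where
  carrier := {v | ∃ k : Fin d → ℤ, ∀ i, v i = k i ∧ (n ≤ i.val → k i = 0)}
  add_mem' := by
    rintro v w ⟨k, hk⟩ ⟨l, hl⟩
    exact ⟨k + l, fun i => ⟨by simp [(hk i).1, (hl i).1], fun h => by simp
        [(hk i).2 h, (hl i).2 h]⟩⟩
  zero_mem' := ⟨0, by simp⟩
  neg_mem' := by
    rintro v ⟨k, hk⟩
    exact ⟨-k, fun i => ⟨by simp [(hk i).1], fun h => by simp [(hk i).2 h]⟩⟩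

/-- The lattice of `ℝᵈ × ℝᵈ` with quotient `(𝕋ⁿ × ℝᵈ⁻ⁿ) × (𝕋ⁿ × ℝᵈ⁻ⁿ)`. -/
def squareLattice (n d : ℕ) : AddSubgroup (𝔼 d × 𝔼 d) := (torusLattice n d).prod (torusLattice n d)

lemma one_le_norm_of_int {d : ℕ} {v : 𝔼 d} {k : Fin d → ℤ}
    (hk : ∀ i, v i = k i) (hv : v ≠ 0) : 1 ≤ ‖v‖ := by
  obtain ⟨i, hi⟩ : ∃ i, k i ≠ 0 := by
    by_contra! h
    exact hv (by ext i; simp [hk, h])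
  refine le_trans ?_ (PiLp.norm_apply_le v i)
  rw [hk, Real.norm_eq_abs]
  exact_mod_cast Int.one_le_abs hi

lemma squareLattice_sep (n d : ℕ) : ∀ v ∈ squareLattice n d, v ≠ 0 → 1 ≤ ‖v‖ := by
  rintro v ⟨⟨k, hk⟩, ⟨l, hl⟩⟩ hv
  by_cases h1 : v.1 = 0
  · have h2 : v.2 ≠ 0 := fun h2 => hv (Prod.ext h1 h2)
    exact (one_le_norm_of_int (fun i => (hl i).1) h2).trans (_root_.norm_snd_le v)
  · exact (one_le_norm_of_int (fun i => (hk i).1) h1).trans (_root_.norm_fst_le v)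

variable {d} (n : ℕ) (i : Fin d) (κ : ℝ² → ℝ) (hκ : ContDiff ℝ ∞ κ) (h0 : ∀ x, 1 + κ x ≠ 0)
  (hper : ∀ x : ℝ², ∀ k l : ℤ, κ (x.1 + k, x.2 + l) = κ x)

/-- The group of translations acts on the models given by periodic functions. -/
def squareQuotient : InvariantModel (𝔼 d × 𝔼 d) where
  A := squareModel i κ hκ h0
  D := AffineDeck.translations (squareLattice n d) 1 one_pos (squareLattice_sep n d)
  U_eq := rfl
  form_act := by
    rintro ⟨v, ⟨k, hk⟩, ⟨l, hl⟩⟩ x _ a b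
    have h1 : coordPlane i (x + v) = ((coordPlane i x).1 + k i, (coordPlane i x).2 + l i) := by
      simp [(hk i).1, (hl i).1]
    have h2 : κ (coordPlane i (x + v)) = κ (coordPlane i x) := by rw [h1, hper]
    change (-pairForm (𝔼 d) a b -
      κ (coordPlane i (x + v)) * pullForm planeForm (coordPlane i) a b) = _
    rw [h2]
    rfl
  F_lin _ _ := rfl

/-- The quotient as a manifold. -/
def squareManifold : BiLagrangianManifold (2 * d) :=
  (squareQuotient n i κ hκ h0 hper).manifold (by simp [two_mul]) isConnected_univ

/-- The projection to the quotient. -/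
def squareProj : 𝔼 d × 𝔼 d →
    (squareManifold n i κ hκ h0 hper).M := (squareQuotient n i κ hκ h0 hper).D.proj

local notation "𝓜" => squareManifold n i κ hκ h0 hper
local notation "𝔮" => squareProj n i κ hκ h0 hper
local notation "𝒬" => squareQuotient n i κ hκ h0 hper

lemma squareProj_eq_iff (x y : 𝔼 d × 𝔼 d) : 𝔮 x = 𝔮 y ↔ y - x ∈ squareLattice n d := by
  refine (AffineDeck.proj_eq_iff (mem_univ _) (mem_univ _)).trans
    ((AffineDeck.translations_rel (hε := one_pos) (hL := squareLattice_sep n d)).trans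
      ⟨?_, fun h => ⟨_, h, by simp⟩⟩)
  rintro ⟨v, hv, rfl⟩
  simpa using hv

lemma squareManifold_isQuotientOf {G : 𝔼 d × 𝔼 d → 𝔼 d × 𝔼 d → 𝔼 d × 𝔼 d → ℝ}
    (hG : ∀ x a b, (squareModel i κ hκ h0).metric x a b = G x a b) :
    (𝓜).str.IsQuotientOf univ G squareProduct
      (fun z w => torusCylinderRel n z.1 w.1 ∧ torusCylinderRel n z.2 w.2)
      (𝔮) := by
  refine (𝒬).isQuotientOf rfl (fun x _ y _ =>
    (AffineDeck.translations_rel (hε := one_pos) (hL := squareLattice_sep n d)).trans ⟨?_, ?_⟩)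
    (fun x _ a b => hG x a b) (fun x _ a => ?_)
  · rintro ⟨v, ⟨⟨k, hk⟩, ⟨l, hl⟩⟩, rfl⟩
    exact ⟨⟨k, fun i => ⟨by simp [(hk i).1], (hk i).2⟩⟩,
        ⟨l, fun i => ⟨by simp [(hl i).1], (hl i).2⟩⟩⟩
  · rintro ⟨⟨k, hk⟩, ⟨l, hl⟩⟩
    exact ⟨y - x, ⟨⟨k, fun i => ⟨by simp [(hk i).1], (hk i).2⟩⟩,
      ⟨l, fun i => ⟨by simp [(hl i).1], (hl i).2⟩⟩⟩, by simp⟩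
  · change -pairF _ a = _
    simp [squareProduct]

lemma squareManifold_N (p : (𝓜).M) : (𝓜).str.N p = 1 := by
  obtain ⟨x, -, rfl⟩ := (𝒬).D.exists_rep p
  change (𝓜).str.N (𝔮 x) = 1
  have h1 : (𝓜).str.leaf₁ (𝔮 x) = {q | ∃ v, (-pairF _) v = v ∧ 𝔮 (x + v) = q} :=
    (𝒬).leaf₁_univ rfl x
  have h2 : (𝓜).str.leaf₂ (𝔮 x) = {q | ∃ v, (-pairF _) v = -v ∧ 𝔮 (x + v) = q} :=
    (𝒬).leaf₂_univ rfl x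
  rw [BiLagrangianStructure.N, encard_eq_one, h1, h2]
  refine ⟨𝔮 x, Subset.antisymm ?_ ?_⟩
  · rintro _ ⟨⟨⟨v, v'⟩, hv, rfl⟩, ⟨⟨w, w'⟩, hw, h⟩⟩
    have hv0 : v = 0 := by
      have := congrArg Prod.fst hv
      simpa [neg_eq_iff_add_eq_zero, ← two_smul ℝ] using this
    have hw0 : w' = 0 := by
      have := congrArg Prod.snd hw
      simp only [neg_apply, pairF_apply, Prod.snd_neg, neg_neg] at this
      have h3 : w' + w' = 0 := by nth_rewrite 1 [this]; exact neg_add_cancel w'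
      simpa [← two_smul ℝ] using h3
    subst hv0 hw0
    obtain ⟨-, l, hl⟩ := (squareProj_eq_iff n i κ hκ h0 hper _ _).1 h
    refine ((squareProj_eq_iff n i κ hκ h0 hper _ _).2 ⟨⟨0, by simp⟩, ⟨l, fun j => ?_⟩⟩).symm
    simpa using hl j
  · rintro _ rfl
    exact ⟨⟨0, by simp, by simp⟩, ⟨0, by simp, by simp⟩⟩

lemma squareManifold_compactSpace_iff (hn : n ≤ d) : CompactSpace (𝓜).M ↔ n = d := by
  constructor
  · intro hc
    by_contra hne
    have hlt : n < d := lt_of_le_of_ne hn hne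
    refine (𝒬).D.not_compactSpace (f := fun x => x.1 (⟨n, hlt⟩ : Fin d)) ?_ ?_ ?_ hc
    · exact ((EuclideanSpace.proj (⟨n, hlt⟩ : Fin d) :
        𝔼 d →L[ℝ] ℝ).continuous.comp continuous_fst).continuousOn
    · rintro ⟨v, ⟨k, hk⟩, -⟩ x _
      have h1 := hk ⟨n, hlt⟩
      have h2 : (x + v).1 (⟨n, hlt⟩ : Fin d) = x.1 ⟨n, hlt⟩ := by simp [h1.1, h1.2 le_rfl]
      exact h2
    · intro C
      exact ⟨(EuclideanSpace.single ⟨n, hlt⟩ (C + 1), 0), trivial, by simp⟩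
  · rintro rfl
    have hcont : Continuous fun u : (Fin n → ℝ) × (Fin n → ℝ) =>
        ((WithLp.toLp 2 u.1, WithLp.toLp 2 u.2) : 𝔼 n × 𝔼 n) :=
      ((PiLp.continuous_toLp 2 _).comp continuous_fst).prodMk
        ((PiLp.continuous_toLp 2 _).comp continuous_snd)
    have hcube : IsCompact (univ.pi fun _ : Fin n => Icc (0 : ℝ) 1) :=
      isCompact_univ_pi fun _ => isCompact_Icc
    refine (squareQuotient n i κ hκ h0 hper).D.compactSpace ((hcube.prod hcube).image hcont)
      (subset_univ _) fun x _ => ?_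
    refine ⟨_, ⟨(fun j => Int.fract (x.1 j), fun j => Int.fract (x.2 j)),
      ⟨fun j _ => ⟨Int.fract_nonneg _, (Int.fract_lt_one _).le⟩,
        fun j _ => ⟨Int.fract_nonneg _, (Int.fract_lt_one _).le⟩⟩, rfl⟩, ?_⟩
    refine (AffineDeck.translations_rel (hε := one_pos) (hL := squareLattice_sep n n)).2
      ⟨(WithLp.toLp 2 fun j => (⌊x.1 j⌋ : ℝ), WithLp.toLp 2 fun j => (⌊x.2 j⌋ : ℝ)),
        ⟨⟨fun j => ⌊x.1 j⌋, fun j => ⟨rfl, fun h => absurd j.2 (not_lt.2 h)⟩⟩,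
          ⟨fun j => ⌊x.2 j⌋, fun j => ⟨rfl, fun h => absurd j.2 (not_lt.2 h)⟩⟩⟩, ?_⟩
    refine Prod.ext ?_ ?_
    · ext j; simp
    · ext j; simp

lemma squareManifold_isFlat (hz : ∀ x, κ x = 0) : (𝓜).str.IsFlat :=
  (𝒬).isFlat (β := -pairForm _) fun z _ => by
    change -pairForm _ - κ (coordPlane i z) • pullForm planeForm (coordPlane i) = _
    rw [hz, zero_smul, sub_zero]

lemma squareManifold_not_isFlat (h1 : 𝐃 κ 0 = 0) (h2 : 𝐃 (𝐃 κ) 0 (0, 1) (1, 0) ≠ 0) :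
    ¬ (𝓜).str.IsFlat := by
  have hder : ∀ x, HasFDerivAt (squareModel i κ hκ h0).metric
      ((𝐃 κ (coordPlane i x) ∘L coordPlane i).smulRight
        (pullForm planeForm (coordPlane i) ∘L pairF _)) x := by
    intro x
    rw [squareModel_metric_eq]
    exact (((hκ.contDiffAt.differentiableAt (by simp)).hasFDerivAt.comp x
      (coordPlane i).hasFDerivAt).smul_const _).const_add _
  have hκ2 : HasFDerivAt (𝐃 κ) (𝐃 (𝐃 κ) 0) 0 := hκ.contDiffAt.smooth_fderiv.diffAt.hasFDerivAt
  have hsymm : IsSymmSndFDerivAt ℝ κ 0 := hκ.contDiffAt.isSymmSndFDerivAt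
    (by simpa using WithTop.coe_le_coe.2 (le_top : (2 : ℕ∞) ≤ ⊤))
  have e0 : coordPlane i (0 : 𝔼 d × 𝔼 d) = 0 := map_zero _
  have hder2 : ∀ a b c v, 𝐃 (𝐃 (squareModel i κ hκ h0).metric) 0 a b c v =
      𝐃 (𝐃 κ) 0 (coordPlane i a) (coordPlane i b) *
        planeForm (coordPlane i (pairF _ c)) (coordPlane i v) := by
    intro a b c v
    have hfun : (fun x => 𝐃 (squareModel i κ hκ h0).metric x b c v) =
        fun x => 𝐃 κ (coordPlane i x) (coordPlane i b) *
          planeForm (coordPlane i (pairF _ c)) (coordPlane i v) := by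
      funext x
      rw [(hder x).fderiv]
      simp
    have hκ2' : HasFDerivAt (𝐃 κ) (𝐃 (𝐃 κ) 0) (coordPlane i 0) := by rw [e0]; exact hκ2
    have hR := ((hκ2'.comp 0 (coordPlane i).hasFDerivAt).clm_apply
      (hasFDerivAt_const (coordPlane i b) 0)).mul_const
        (planeForm (coordPlane i (pairF _ c)) (coordPlane i v))
    have hm : DifferentiableAt ℝ (𝐃 (squareModel i κ hκ h0).metric) 0 :=
      ((AdaptedModel.contDiffAt_metric (A := squareModel i κ hκ h0) (mem_univ 0)).fderiv_right
        (m := ∞) (by simp)).differentiableAt (by simp)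
    have hL : HasFDerivAt (fun x => 𝐃 (squareModel i κ hκ h0).metric x b c v) _ 0 :=
      ((hm.hasFDerivAt.eval b).eval c).eval v
    have hR' := hR.congr_of_eventuallyEq (Eventually.of_forall fun x => congrFun hfun x)
    have := congrArg (fun T : (𝔼 d × 𝔼 d) →L[ℝ] ℝ => T a) (hL.unique hR')
    simp [-coordPlane_apply, -pairF_apply] at this
    rw [this, mul_comm]
  refine (𝒬).str.not_isFlat_of_modelsAt (𝒬).modelsAt (x := 0) (mem_univ _)
    (a := (0, EuclideanSpace.single i 1)) (b := (EuclideanSpace.single i 1, 0))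
    (c := (0, EuclideanSpace.single i 1)) (d := (EuclideanSpace.single i 1, 0)) ?_ ?_ ?_ ?_ ?_
  · change -pairF _ _ = _
    simp
  · change -pairF _ _ = _
    simp
  · change -pairF _ _ = _
    simp
  · change 𝐃 (squareModel i κ hκ h0).metric 0 _ _ = 0
    rw [(hder 0).fderiv, e0, h1]
    simp
  · change 𝐃 (𝐃 (squareModel i κ hκ h0).metric) 0 _ _ _ _ ≠ 0
    rw [hder2]
    simpa [planeForm_apply, hsymm (1, 0) (0, 1)] using h2

/-- A doubly periodic function with a saddle at the origin. -/
def sineProduct (x : ℝ²) : ℝ := sin (2 * Real.pi * x.1) * sin (2 * Real.pi * x.2) / 2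

lemma contDiff_sineProduct : ContDiff ℝ ∞ sineProduct := by
  unfold sineProduct
  fun_prop

lemma one_add_sineProduct_ne_zero (x : ℝ²) : 1 + sineProduct x ≠ 0 := by
  have h1 : |sin (2 * Real.pi * x.1) * sin (2 * Real.pi * x.2)| ≤ 1 := by
    rw [abs_mul]
    exact mul_le_one₀ (Real.abs_sin_le_one _) (abs_nonneg _) (Real.abs_sin_le_one _)
  have h2 := (abs_le.1 h1).1
  rw [sineProduct]
  linarith

lemma sineProduct_periodic (x : ℝ²) (k l : ℤ) : sineProduct (x.1 + k, x.2 + l) = sineProduct x := by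
  have h : ∀ (s : ℝ) (k : ℤ), sin (2 * Real.pi * (s + k)) = sin (2 * Real.pi * s) := by
    intro s k
    rw [← Real.sin_add_int_mul_two_pi (2 * Real.pi * s) k]
    congr 1
    ring
  simp only [sineProduct, h]

lemma hasDerivAt_sin_two_pi (s : ℝ) : HasDerivAt (fun s : ℝ => sin (2 * Real.pi * s))
    (2 * Real.pi * cos (2 * Real.pi * s)) s := by
  have := ((hasDerivAt_id s).const_mul (2 * Real.pi)).sin
  simpa [mul_comm] using this

lemma fderiv_sineProduct_zero : 𝐃 sineProduct 0 = 0 := by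
  have h1 : HasFDerivAt (fun x : ℝ² => sin (2 * Real.pi * x.1)) _ 0 :=
    (hasDerivAt_sin_two_pi (0 : ℝ²).1).hasFDerivAt.comp (0 : ℝ²) hasFDerivAt_fst
  have h2 : HasFDerivAt (fun x : ℝ² => sin (2 * Real.pi * x.2)) _ 0 :=
    (hasDerivAt_sin_two_pi (0 : ℝ²).2).hasFDerivAt.comp (0 : ℝ²) hasFDerivAt_snd
  have h3 := (h1.mul h2).mul_const (2 : ℝ)⁻¹
  have h4 : HasFDerivAt sineProduct _ 0 := h3
  rw [h4.fderiv]
  simp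

lemma fderiv_fderiv_sineProduct_zero : 𝐃 (𝐃 sineProduct) 0 (0, 1) (1, 0) ≠ 0 := by
  rw [hasDerivAt_mixed (h := sineProduct) (x := 0) contDiff_sineProduct.contDiffAt
    (k := fun z => 2 * Real.pi * cos (2 * Real.pi * z.1) * sin (2 * Real.pi * z.2) / 2)
    (Eventually.of_forall fun z => ((hasDerivAt_sin_two_pi z.1).mul_const
        (sin (2 * Real.pi * z.2))).div_const 2)
    (((hasDerivAt_sin_two_pi (0 : ℝ²).2).const_mul
      (2 * Real.pi * cos (2 * Real.pi * (0 : ℝ²).1))).div_const 2)]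
  have := Real.pi_ne_zero
  simp [this]

theorem exists_square (n d : ℕ) (hn : n ≤ d) (hd : 1 ≤ d) : (∃ X : BiLagrangianManifold (2 * d),
        ∃ ψ : 𝔼 d × 𝔼 d → X.M,
        X.str.IsQuotientOf univ neutralMetric squareProduct
          (fun z w => torusCylinderRel n z.1 w.1 ∧ torusCylinderRel n z.2 w.2) ψ ∧
        (CompactSpace X.M ↔ n = d) ∧ X.str.IsFlat ∧ ∀ p, X.str.N p = 1) ∧
      (∃ X : BiLagrangianManifold (2 * d), ∃ ψ : 𝔼 d × 𝔼 d → X.M, ∃ G,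
        X.str.IsQuotientOf univ G squareProduct
          (fun z w => torusCylinderRel n z.1 w.1 ∧ torusCylinderRel n z.2 w.2) ψ ∧
        (CompactSpace X.M ↔ n = d) ∧ ¬ X.str.IsFlat ∧ ∀ p, X.str.N p = 1) := by
  set i : Fin d := ⟨0, hd⟩
  constructor
  · refine ⟨squareManifold n i (fun _ => 0) contDiff_const (by simp) (by simp),
      squareProj n i (fun _ => 0) contDiff_const (by simp) (by simp),
      squareManifold_isQuotientOf _ _ _ _ _ _ fun x a b => ?_,
      squareManifold_compactSpace_iff _ _ _ _ _ _ hn,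
      squareManifold_isFlat _ _ _ _ _ _ fun _ => rfl, squareManifold_N _ _ _ _ _ _⟩
    rw [squareModel_metric_eq]
    simp [pairForm_apply, neutralMetric]
  · exact ⟨squareManifold n i sineProduct contDiff_sineProduct one_add_sineProduct_ne_zero
        sineProduct_periodic, squareProj _ _ _ _ _ _, _,
      squareManifold_isQuotientOf _ _ _ _ _ _ fun x a b => rfl,
      squareManifold_compactSpace_iff _ _ _ _ _ _ hn,
      squareManifold_not_isFlat _ _ _ _ _ _ fderiv_sineProduct_zero
        fderiv_fderiv_sineProduct_zero, squareManifold_N _ _ _ _ _ _⟩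

end SquareModels

section PuncturedPlane

lemma isOpen_punctured : IsOpen {x : ℝ² | x ≠ 0} := isOpen_ne

lemma sq_add_sq_pos {x : ℝ²} (hx : x ≠ 0) : 0 < x.1 ^ 2 + x.2 ^ 2 := by
  by_contra! h
  have h1 : x.1 = 0 := by nlinarith [sq_nonneg x.1, sq_nonneg x.2]
  have h2 : x.2 = 0 := by nlinarith [sq_nonneg x.1, sq_nonneg x.2]
  exact hx (Prod.ext h1 h2)

/-- The model of the punctured plane. -/
def puncturedModel : AdaptedModel ℝ² :=
  planeModel {x | x ≠ 0} isOpen_punctured (fun x => (x.1 ^ 2 + x.2 ^ 2)⁻¹)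
    (ContDiffOn.inv (by fun_prop) fun _ hx => (sq_add_sq_pos hx).ne')
    (fun _ hx => inv_ne_zero (sq_add_sq_pos hx).ne') diagF
    diagF_diagF planeForm_diagF

/-- The punctured plane, with a group of homotheties. -/
def puncturedQuotient (D : AffineDeck ℝ²) (hU : {x | x ≠ 0} = D.U) (c : D.ι → ℝ)
    (hc : ∀ i, 0 < c i) (hlin : ∀ i, D.lin i = c i • ContinuousLinearMap.id ℝ ℝ²)
        (hshift : ∀ i, D.shift i = 0) :
    InvariantModel ℝ² where
  A := puncturedModel
  D := D
  U_eq := hU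
  form_act i x hx a b := by
    have h1 : D.act i x = c i • x := by rw [AffineDeck.act, hlin, hshift, add_zero]; rfl
    have h2 := sq_add_sq_pos hx
    have h3 := (hc i).ne'
    change ((D.act i x).1 ^ 2 + (D.act i x).2 ^ 2)⁻¹ * planeForm (D.lin i a) (D.lin i b) =
      (x.1 ^ 2 + x.2 ^ 2)⁻¹ * planeForm a b
    rw [h1, hlin]
    simp only [planeForm_apply, Prod.smul_fst, Prod.smul_snd, smul_eq_mul, smul_apply, id_apply,
      mul_pow, ← mul_add, mul_inv]
    field_simp
  F_lin i a := by
    rw [hlin]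
    change diagF (c i • a) = c i • diagF a
    simp

section

variable (D : AffineDeck ℝ²) (hU : {x | x ≠ 0} = D.U) (c : D.ι → ℝ)
    (hc : ∀ i, 0 < c i) (hlin : ∀ i, D.lin i = c i • ContinuousLinearMap.id ℝ ℝ²)
    (hshift : ∀ i, D.shift i = 0)

local notation "𝒫" => puncturedQuotient D hU c hc hlin hshift

include hlin hshift in
lemma act_eq_smul (i : D.ι) (x : ℝ²) : D.act i x = c i • x := by simp [AffineDeck.act, hlin, hshift]

lemma puncturedQuotient_metric (x a b : ℝ²) : (𝒫).A.metric x a b = puncturedMetric x a b := by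
  change (x.1 ^ 2 + x.2 ^ 2)⁻¹ * planeForm (diagF a) b = _
  simp only [planeForm_apply, diagF_apply, puncturedMetric]
  ring

/-- Two points are on the same half-line or line where the second coordinate of `m` is constant. -/
def levelRel (m : ℝ² ≃L[ℝ] ℝ²) (x y : ℝ²) : Prop :=
  (m y).2 = (m x).2 ∧ ((m x).2 = 0 → 0 < (m x).1 * (m y).1)

variable (m : ℝ² ≃L[ℝ] ℝ²)

lemma fst_ne_zero_of_snd_eq_zero {x : ℝ²} (hx : x ≠ 0) (h : (m x).2 = 0) : (m x).1 ≠ 0 :=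
  fun h1 => hx (m.map_eq_zero_iff.1 (Prod.ext h1 h))

lemma levelRel_self {x : ℝ²} (hx : x ≠ 0) : levelRel m x x :=
  ⟨rfl, fun h => mul_self_pos.2 (fst_ne_zero_of_snd_eq_zero m hx h)⟩

lemma puncturedQuotient_leaf {Δ : DistField 𝓥 ℝ² D.Q} {K : ℝ² →L[ℝ] ℝ²}
    (hK : ∀ v, diagF v = K v ↔ (m v).2 = 0) (hD : ∀ z ∈ (𝒫).A.U, ∀ a : ℝ²,
      mfderiv 𝓥 ℝ² 𝓥 ℝ² D.proj z a ∈ Δ (D.proj z) ↔ diagF a = K a) {x : ℝ²} (hx : x ≠ 0) :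
    leaf 𝓥 ℝ² Δ (D.proj x) = D.proj '' {y | y ≠ 0 ∧ levelRel m x y} := by
  refine (𝒫).leaf_eq hD (fun x hx => ?_) ?_ ?_ ?_ ?_ hx
  · have hev : ∀ᶠ y : ℝ² in 𝓝 x, (m x).2 = 0 → 0 < (m x).1 * (m y).1 := by
      by_cases h2 : (m x).2 = 0
      · have hm : Continuous fun y => (m x).1 * (m y).1 := by fun_prop
        exact (hm.continuousAt.eventually (lt_mem_nhds (mul_self_pos.2
          (fst_ne_zero_of_snd_eq_zero m hx h2)))).mono fun y hy _ => hy
      · exact Eventually.of_forall fun y h => absurd h h2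
    filter_upwards [hev] with y hy hF
    refine ⟨sub_eq_zero.1 ?_, hy⟩
    simpa using (hK _).1 hF
  · rintro x - y - ⟨h, h'⟩
    exact ⟨h.symm, fun h0 => by rw [mul_comm]; exact h' (h ▸ h0)⟩
  · rintro x - y - z - ⟨h1, h1'⟩ ⟨h2, h2'⟩
    refine ⟨h2.trans h1, fun h0 => ?_⟩
    have k1 := h1' h0
    have k2 := h2' (h1.trans h0)
    have k3 : 0 < (m x).1 * (m z).1 * ((m y).1 * (m y).1) := by nlinarith
    exact pos_of_mul_pos_left k3 (mul_self_nonneg _)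
  · intro (i : D.ι) x _ y _ ⟨h, h'⟩
    change levelRel m (D.act i x) (D.act i y)
    rw [act_eq_smul D c hlin hshift, act_eq_smul D c hlin hshift]
    simp only [levelRel, map_smul, Prod.smul_snd, Prod.smul_fst, smul_eq_mul, mul_eq_zero]
    refine ⟨by rw [h], fun h0 => ?_⟩
    have h1 := h' (h0.resolve_left (hc i).ne')
    rw [mul_mul_mul_comm]
    exact mul_pos (mul_pos (hc i) (hc i)) h1
  · rintro x hx y hy ⟨h, h'⟩
    refine ⟨(hK _).2 (by simp [h]), fun s hs h0 => ?_⟩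
    have e : m x + s • (m y - m x) = 0 := by rw [← map_sub, ← map_smul, ← map_add, h0, map_zero]
    have e1 : (m x).1 + s * ((m y).1 - (m x).1) = 0 := congrArg Prod.fst e
    have e2 : (m x).2 + s * ((m y).2 - (m x).2) = 0 := congrArg Prod.snd e
    have hx2 : (m x).2 = 0 := by rw [h] at e2; linarith
    have h3 := h' hx2
    have h4 := mul_self_pos.2 (fst_ne_zero_of_snd_eq_zero m hx hx2)
    obtain ⟨hs0, hs1⟩ := hs
    have : (1 - s) * ((m x).1 * (m x).1) + s * ((m x).1 * (m y).1) = 0 := by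
      linear_combination (m x).1 * e1
    rcases hs0.eq_or_lt with rfl | hs0
    · linarith
    · have := mul_pos hs0 h3
      have := mul_nonneg (sub_nonneg.2 hs1) h4.le
      linarith

lemma puncturedQuotient_leaf₁ {x : ℝ²} (hx : x ≠ 0) :
    (𝒫).str.leaf₁ (D.proj x) = D.proj '' {y | y ≠ 0 ∧ levelRel (.refl ℝ ℝ²) x y} :=
  puncturedQuotient_leaf D hU c hc hlin hshift _ diagF_eq_self_iff (𝒫).mem_D₁ hx

lemma puncturedQuotient_leaf₂ {x : ℝ²} (hx : x ≠ 0) :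
    (𝒫).str.leaf₂ (D.proj x) = D.proj '' {y | y ≠ 0 ∧ levelRel (.prodComm ℝ ℝ ℝ) x y} :=
  puncturedQuotient_leaf D hU c hc hlin hshift _ diagF_eq_neg_iff (𝒫).mem_D₂ hx

lemma puncturedQuotient_N {x : ℝ²} (hx : x ≠ 0) (h : (∀ i, c i = 1) ∨ x.1 * x.2 = 0) :
    (𝒫).str.N (D.proj x) = 1 := by
  have h12 := congrArg₂ (fun s t : Set D.Q => (s ∩ t).encard)
    (puncturedQuotient_leaf₁ D hU c hc hlin hshift hx)
    (puncturedQuotient_leaf₂ D hU c hc hlin hshift hx)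
  refine h12.trans (encard_eq_one.2 ?_)
  refine ⟨D.proj x, Subset.antisymm ?_ ?_⟩
  · rintro _ ⟨⟨y, ⟨hy, hy2 : y.2 = x.2, -⟩, rfl⟩, ⟨z, ⟨hz, hz1 : z.1 = x.1, -⟩, hzy⟩⟩
    obtain ⟨k, hk⟩ := (AffineDeck.proj_eq_iff (D := D) (hU ▸ hz) (hU ▸ hy)).1 hzy
    rw [act_eq_smul D c hlin hshift] at hk
    have k1 : y.1 = c k * z.1 := by rw [hk]; rfl
    have k2 : y.2 = c k * z.2 := by rw [hk]; rfl
    obtain h1 | h2 : c k * x.1 = x.1 ∨ x.2 = 0 := by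
      rcases h with h | h
      · exact .inl (by rw [h, one_mul])
      · exact (mul_eq_zero.1 h).imp_left fun h => by rw [h, mul_zero]
    · rw [show y = x from Prod.ext (by rw [k1, hz1, h1]) hy2]; rfl
    · rw [hy2, h2] at k2
      rw [← hzy, show z = x from Prod.ext hz1
        (((mul_eq_zero.1 k2.symm).resolve_left (hc k).ne').trans h2.symm)]
      rfl
  · rintro _ rfl
    exact ⟨⟨x, ⟨hx, levelRel_self _ hx⟩, rfl⟩, ⟨x, ⟨hx, levelRel_self _ hx⟩, rfl⟩⟩

end

lemma puncturedModel_curv_ne_zero :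
    ¬ ∀ a b c, curv (fun x a b => puncturedModel.metric x a b) (1, 1) a b c = 0 := by
  have hsq : ∀ s : ℝ, HasDerivAt (fun s : ℝ => s ^ 2) (2 * s) s := fun s => by
    simpa using hasDerivAt_pow 2 s
  have h11 : ((1, 1) : ℝ²) ≠ 0 := by simp
  refine planeModel_curv_ne_zero _ _ _ _ (x := (1, 1)) h11
    (k := fun z => -(2 * z.1) / (z.1 ^ 2 + z.2 ^ 2) ^ 2) (n := -(2 * 1) / (1 ^ 2 + 1 ^ 2) ^ 2)
    (m := 1) ?_ ?_ ?_ ?_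
  · filter_upwards [isOpen_punctured.mem_nhds h11] with z hz
    exact ((hsq z.1).add_const (z.2 ^ 2)).inv (sq_add_sq_pos hz).ne'
  · exact ((hsq 1).const_add ((1 : ℝ) ^ 2)).inv (by norm_num)
  · have h1 : HasDerivAt (fun s : ℝ => (1 : ℝ) ^ 2 + s ^ 2) (2 * 1) 1 := (hsq 1).const_add _
    have h2 := ((h1.fun_pow 2).fun_inv (by norm_num)).const_mul (-(2 * (1 : ℝ)))
    simp only [div_eq_mul_inv]
    exact h2.congr_deriv (by norm_num)
  · norm_num

lemma puncturedQuotient_not_isFlat (D : AffineDeck ℝ²) (hU : {x | x ≠ 0} = D.U) (c : D.ι → ℝ)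
    (hc : ∀ i, 0 < c i) (hlin : ∀ i, D.lin i = c i • ContinuousLinearMap.id ℝ ℝ²)
    (hshift : ∀ i, D.shift i = 0) :
    ¬ (puncturedQuotient D hU c hc hlin hshift).str.IsFlat := fun h =>
  puncturedModel_curv_ne_zero (h.curv_eq_zero
    (puncturedQuotient D hU c hc hlin hshift).modelsAt (x := (1, 1))
    (by change ((1, 1) : ℝ²) ≠ 0; simp))

lemma isConnected_punctured : IsConnected {x : ℝ² | x ≠ 0} := by
  have h : 1 < Module.rank ℝ ℝ² := by
    rw [← Module.finrank_eq_rank]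
    simp
  exact isConnected_compl_singleton_of_one_lt_rank h 0

/-- The punctured plane. -/
def puncturedPlane : InvariantModel ℝ² :=
  puncturedQuotient (.trivial {x | x ≠ 0} isOpen_punctured ⟨(1, 1), by simp⟩) rfl (fun _ => 1)
    (fun _ => one_pos) (fun _ => (one_smul _ _).symm) (fun _ => rfl)

/-- The Clifton-Pohl torus, as a quotient of the punctured plane. -/
def cliftonPohl : InvariantModel ℝ² :=
  puncturedQuotient (.scaling {x | x ≠ 0} isOpen_punctured ⟨(1, 1), by simp⟩
      (fun k : ℤ => (2 : ℝ) ^ k • ContinuousLinearMap.id ℝ ℝ²) (by simp)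
      (fun i j => by ext <;> simp [zpow_add₀, mul_comm]) (fun i x hx => by
        have h2 : (2 : ℝ) ^ i ≠ 0 := by positivity
        simpa [smul_eq_zero, h2] using hx) norm continuous_norm (fun x hx => norm_pos_iff.2 hx)
      (fun i x => by rw [smul_apply, id_apply, norm_smul, Real.norm_of_nonneg (by positivity)]))
    rfl (fun k : ℤ => (2 : ℝ) ^ k) (fun k : ℤ => zpow_pos two_pos k) (fun _ => rfl) (fun _ => rfl)

lemma puncturedPlane_proj_eq_iff {x y : ℝ²} (hx : x ≠ 0) (hy : y ≠ 0) :
    puncturedPlane.D.proj x = puncturedPlane.D.proj y ↔ x = y :=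
  (AffineDeck.proj_eq_iff (D := puncturedPlane.D) hx hy).trans (AffineDeck.trivial_rel _ _ _ _ _)

lemma cliftonPohl_rel_iff {x y : ℝ²} : cliftonPohl.D.Rel x y ↔ homothetyRel x y :=
  ⟨fun ⟨k, h⟩ => ⟨k, h.trans (act_eq_smul cliftonPohl.D (fun k : ℤ => (2 : ℝ) ^ k)
      (fun _ => rfl) (fun _ => rfl) k x)⟩,
    fun ⟨k, h⟩ => ⟨k, h.trans (act_eq_smul cliftonPohl.D (fun k : ℤ => (2 : ℝ) ^ k)
      (fun _ => rfl) (fun _ => rfl) k x).symm⟩⟩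

lemma cliftonPohl_proj_eq_iff {x y : ℝ²} (hx : x ≠ 0) (hy : y ≠ 0) :
    cliftonPohl.D.proj x = cliftonPohl.D.proj y ↔ homothetyRel x y :=
  (AffineDeck.proj_eq_iff (D := cliftonPohl.D) hx hy).trans cliftonPohl_rel_iff

lemma puncturedPlane_leaf₁ {x : ℝ²} (hx : x ≠ 0) : puncturedPlane.str.leaf₁
    (puncturedPlane.D.proj x) =
    puncturedPlane.D.proj '' {y | y ≠ 0 ∧ levelRel (.refl ℝ ℝ²) x y} :=
  puncturedQuotient_leaf₁ _ _ _ _ _ _ hx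

lemma puncturedPlane_leaf₂ {x : ℝ²} (hx : x ≠ 0) : puncturedPlane.str.leaf₂
    (puncturedPlane.D.proj x) =
    puncturedPlane.D.proj '' {y | y ≠ 0 ∧ levelRel (.prodComm ℝ ℝ ℝ) x y} :=
  puncturedQuotient_leaf₂ _ _ _ _ _ _ hx

lemma cliftonPohl_leaf₁ {x : ℝ²} (hx : x ≠ 0) : cliftonPohl.str.leaf₁ (cliftonPohl.D.proj x) =
    cliftonPohl.D.proj '' {y | y ≠ 0 ∧ levelRel (.refl ℝ ℝ²) x y} :=
  puncturedQuotient_leaf₁ _ _ _ _ _ _ hx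

lemma cliftonPohl_leaf₂ {x : ℝ²} (hx : x ≠ 0) : cliftonPohl.str.leaf₂ (cliftonPohl.D.proj x) =
    cliftonPohl.D.proj '' {y | y ≠ 0 ∧ levelRel (.prodComm ℝ ℝ ℝ) x y} :=
  puncturedQuotient_leaf₂ _ _ _ _ _ _ hx

lemma puncturedPlane_not_compactSpace : ¬ CompactSpace puncturedPlane.D.Q := by
  refine puncturedPlane.D.not_compactSpace (f := Prod.fst) continuous_fst.continuousOn
    (fun i x _ => ?_) fun C => ⟨(C + 1, 1), ?_, lt_add_one C⟩
  · have : (x + 0).1 = x.1 := by simp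
    exact this
  · change ((C + 1, 1) : ℝ²) ≠ 0
    simp

lemma puncturedPlane_disjoint {a b y : ℝ} (ha : 0 < a) (hb : b < 0) :
    Disjoint (puncturedPlane.str.leaf₁ (puncturedPlane.D.proj (a, 0)))
      (puncturedPlane.str.leaf₂ (puncturedPlane.D.proj (b, y))) := by
  rw [puncturedPlane_leaf₁ (by simp [ha.ne']), puncturedPlane_leaf₂ (by simp [hb.ne]),
    disjoint_left]
  rintro _ ⟨z, ⟨hz, -, hz'⟩, rfl⟩ ⟨w, ⟨hw, hw' : w.1 = b, -⟩, hwz⟩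
  obtain rfl := (puncturedPlane_proj_eq_iff hw hz).1 hwz
  have : 0 < a * w.1 := hz' rfl
  rw [hw'] at this
  nlinarith

lemma exists_zpow_mul_mem {r : ℝ} (hr : 0 < r) : ∃ k : ℤ, ∃ s ∈ Icc (1 : ℝ) 2, r = 2 ^ k * s := by
  obtain ⟨k, hk, hk'⟩ := exists_mem_Ico_zpow hr one_lt_two
  have h2 : (0 : ℝ) < 2 ^ k := by positivity
  refine ⟨k, r / 2 ^ k, ⟨by rwa [le_div_iff₀ h2, one_mul], ?_⟩, by field_simp⟩
  rw [div_le_iff₀ h2]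
  rw [zpow_add₀ two_ne_zero, zpow_one] at hk'
  linarith

lemma cliftonPohl_compactSpace : CompactSpace cliftonPohl.D.Q := by
  have hK : IsCompact (Metric.closedBall (0 : ℝ²) 2 ∩ {x | 1 ≤ ‖x‖}) :=
    (isCompact_closedBall _ _).inter_right (isClosed_le continuous_const continuous_norm)
  refine cliftonPohl.D.compactSpace hK ?_ fun x hx => ?_
  · rintro x ⟨-, hx⟩
    exact norm_pos_iff.1 (one_pos.trans_le hx)
  · obtain ⟨k, s, hs, hxs⟩ := exists_zpow_mul_mem (norm_pos_iff.2 hx)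
    have h2 : (0 : ℝ) < 2 ^ k := by positivity
    have hn : ‖((2 : ℝ) ^ k)⁻¹ • x‖ = s := by
      rw [norm_smul, Real.norm_of_nonneg (by positivity), hxs]
      field_simp
    refine ⟨((2 : ℝ) ^ k)⁻¹ • x, ⟨?_, ?_⟩, cliftonPohl_rel_iff.2 ⟨k, ?_⟩⟩
    · rw [mem_closedBall_zero_iff, hn]; exact hs.2
    · show 1 ≤ ‖_‖; rw [hn]; exact hs.1
    · rw [smul_smul, mul_inv_cancel₀ h2.ne', one_smul]

lemma cliftonPohl_N_off_axis {x : ℝ²} (h : x.1 * x.2 ≠ 0) :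
    cliftonPohl.str.N (cliftonPohl.D.proj x) = ⊤ := by
  have h1 : x.1 ≠ 0 := left_ne_zero_of_mul h
  have h2 : x.2 ≠ 0 := right_ne_zero_of_mul h
  have hx : x ≠ 0 := fun h0 => h1 (congrArg Prod.fst h0)
  have hy : ∀ k : ℤ, ((2 : ℝ) ^ k * x.1, x.2) ≠ 0 := fun k h0 => h2 (congrArg Prod.snd h0)
  rw [BiLagrangianStructure.N, cliftonPohl_leaf₁ hx, cliftonPohl_leaf₂ hx, encard_eq_top_iff]
  have hinj : Function.Injective fun k : ℤ => cliftonPohl.D.proj ((2 : ℝ) ^ k * x.1, x.2) := by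
    intro k l hkl
    obtain ⟨j, hj⟩ := (cliftonPohl_proj_eq_iff (hy k) (hy l)).1 hkl
    have e2 : x.2 = 2 ^ j * x.2 := congrArg Prod.snd hj
    have e1 : (2 : ℝ) ^ l * x.1 = 2 ^ j * (2 ^ k * x.1) := congrArg Prod.fst hj
    have e3 : (2 : ℝ) ^ j = 1 := by
      have : ((2 : ℝ) ^ j - 1) * x.2 = 0 := by linarith
      linarith [(mul_eq_zero.1 this).resolve_right h2]
    rw [e3, one_mul] at e1
    exact (zpow_right_injective₀ two_pos (by norm_num) (mul_right_cancel₀ h1 e1)).symm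
  refine (infinite_range_of_injective hinj).mono ?_
  rintro _ ⟨k, rfl⟩
  have hk : (2 : ℝ) ^ k ≠ 0 := by positivity
  refine ⟨⟨_, ⟨hy k, rfl, fun h0 => absurd h0 h2⟩, rfl⟩,
    ⟨(x.1, ((2 : ℝ) ^ k)⁻¹ * x.2), ⟨fun h0 => h1 (congrArg Prod.fst h0), rfl,
      fun h0 => absurd h0 h1⟩, ?_⟩⟩
  refine (cliftonPohl_proj_eq_iff (x := (x.1, ((2 : ℝ) ^ k)⁻¹ * x.2))
    (y := ((2 : ℝ) ^ k * x.1, x.2)) (fun h0 => h1 (congrArg Prod.fst h0)) (hy k)).2 ⟨k, ?_⟩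
  ext
  · rfl
  · simp only [Prod.smul_snd, smul_eq_mul]
    field_simp

lemma cliftonPohl_isCompact_iff (m : ℝ² ≃L[ℝ] ℝ²) {x : ℝ²} (hx : x ≠ 0) :
    IsCompact (cliftonPohl.D.proj '' {y | y ≠ 0 ∧ levelRel m x y}) ↔ (m x).2 = 0 := by
  have hm : ∀ {a : ℝ²}, a ≠ 0 → m.symm a ≠ 0 := fun h h0 => h (m.symm.map_eq_zero_iff.1 h0)
  constructor
  · intro hc
    by_contra h2
    have hy : ∀ t : ℝ, m.symm (1, t) ≠ 0 := fun t => hm fun h => one_ne_zero (congrArg Prod.fst h)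
    have hmem : cliftonPohl.D.proj (m.symm (1, 0)) ∈ cliftonPohl.D.proj ''
        {y | y ≠ 0 ∧ levelRel m x y} := by
      have hlim : Tendsto (fun k : ℕ => cliftonPohl.D.proj (m.symm (1, (1 / 2 : ℝ) ^ k * (m x).2)))
          atTop (𝓝 (cliftonPohl.D.proj (m.symm (1, 0)))) := by
        refine (cliftonPohl.D.continuousOn_proj.continuousAt
          (isOpen_punctured.mem_nhds (hy 0))).tendsto.comp ((m.symm.continuous.tendsto _).comp ?_)
        rw [nhds_prod_eq]
        refine tendsto_const_nhds.prodMk ?_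
        have := (tendsto_pow_atTop_nhds_zero_of_lt_one (r := (1 / 2 : ℝ)) (by norm_num)
          (by norm_num)).mul_const (m x).2
        rwa [zero_mul] at this
      refine hc.isClosed.mem_of_tendsto hlim (Eventually.of_forall fun k => ?_)
      have hz : m.symm ((2 : ℝ) ^ k, (m x).2) ≠ 0 := hm fun h0 => h2 (congrArg Prod.snd h0)
      refine ⟨_, ⟨hz, by simp, fun h0 => absurd h0 h2⟩,
        ((cliftonPohl_proj_eq_iff (hy _) hz).2 ⟨k, ?_⟩).symm⟩
      rw [← map_smul]
      congr 1
      ext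
      · simp
      · simp only [Prod.smul_snd, smul_eq_mul, zpow_natCast, ← mul_assoc, ← mul_pow]
        norm_num
    obtain ⟨y, ⟨hy0, hy2, -⟩, h3⟩ := hmem
    obtain ⟨k, hk⟩ := (cliftonPohl_proj_eq_iff hy0 (hy 0)).1 h3
    have h4 := congrArg Prod.snd (congrArg m hk)
    rw [map_smul, m.apply_symm_apply, Prod.smul_snd, hy2, eq_comm, smul_eq_zero] at h4
    exact h2 (h4.resolve_left (by positivity))
  · intro h2
    have h1 := fst_ne_zero_of_snd_eq_zero m hx h2
    have hs0 : ∀ s ∈ Icc (1 : ℝ) 2, m.symm (s * (m x).1, 0) ≠ 0 := fun s hs => hm fun h0 =>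
      mul_ne_zero (one_pos.trans_le hs.1).ne' h1 (congrArg Prod.fst h0)
    have : cliftonPohl.D.proj '' {y | y ≠ 0 ∧ levelRel m x y} =
        cliftonPohl.D.proj '' ((fun s : ℝ => m.symm (s * (m x).1, 0)) '' Icc 1 2) := by
      apply Subset.antisymm
      · rintro _ ⟨y, ⟨hy0, hy2, hy⟩, rfl⟩
        have hpos : 0 < (m y).1 / (m x).1 := by
          rw [← mul_div_mul_left _ _ h1]
          exact div_pos (hy h2) (mul_self_pos.2 h1)
        obtain ⟨k, s, hs, hks⟩ := exists_zpow_mul_mem hpos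
        refine ⟨_, ⟨s, hs, rfl⟩, (cliftonPohl_proj_eq_iff (hs0 s hs) hy0).2 ⟨k, ?_⟩⟩
        rw [← map_smul, eq_comm, m.symm_apply_eq]
        refine Prod.ext ?_ (by simp [hy2, h2])
        simp only [Prod.smul_fst, smul_eq_mul, ← mul_assoc, ← hks]
        field_simp
      · rintro _ ⟨_, ⟨s, hs, rfl⟩, rfl⟩
        refine ⟨_, ⟨hs0 s hs, by simp [h2], fun _ => ?_⟩, rfl⟩
        rw [m.apply_symm_apply, mul_left_comm]
        exact mul_pos (one_pos.trans_le hs.1) (mul_self_pos.2 h1)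
    rw [this]
    refine (isCompact_Icc.image (by fun_prop)).image_of_continuousOn
      (cliftonPohl.D.continuousOn_proj.mono ?_)
    rintro _ ⟨s, hs, rfl⟩
    exact hs0 s hs

lemma cliftonPohl_leaf₁_isCompact_iff {x : ℝ²} (hx : x ≠ 0) :
    IsCompact (cliftonPohl.str.leaf₁ (cliftonPohl.D.proj x)) ↔ x.2 = 0 := by
  rw [cliftonPohl_leaf₁ hx]
  exact cliftonPohl_isCompact_iff _ hx

lemma cliftonPohl_leaf₂_isCompact_iff {x : ℝ²} (hx : x ≠ 0) :
    IsCompact (cliftonPohl.str.leaf₂ (cliftonPohl.D.proj x)) ↔ x.1 = 0 := by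
  rw [cliftonPohl_leaf₂ hx]
  exact cliftonPohl_isCompact_iff _ hx

lemma cliftonPohl_disjoint {a b : ℝ} (ha : a ≠ 0) (hb : b ≠ 0) :
    Disjoint (cliftonPohl.str.leaf₁ (cliftonPohl.D.proj (a, 0)))
      (cliftonPohl.str.leaf₂ (cliftonPohl.D.proj (0, b))) := by
  rw [cliftonPohl_leaf₁ (by simp [ha]), cliftonPohl_leaf₂ (by simp [hb]), disjoint_left]
  rintro _ ⟨z, ⟨hz, hz2, -⟩, rfl⟩ ⟨w, ⟨hw, hw1 : w.1 = 0, -⟩, hwz⟩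
  obtain ⟨k, rfl⟩ := (cliftonPohl_proj_eq_iff hw hz).1 hwz
  exact hz (Prod.ext (by simpa using Or.inr hw1) hz2)

end PuncturedPlane

section Induced

/-- A field of bilinear forms with two fields of subspaces. -/
structure MetricPair (I' : ModelWithCorners ℝ E' H') (M' : Type) [TopologicalSpace M']
    [ChartedSpace H' M'] where
  g : (q : M') → LinearMap.BilinForm ℝ (TangentSpace I' q)
  D₁ : (q : M') → Submodule ℝ (TangentSpace I' q)
  D₂ : (q : M') → Submodule ℝ (TangentSpace I' q)

namespace MetricPair

variable (S : MetricPair I' M') (I I') (f : M → M')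

/-- The differential of `f`, as a linear map. -/
def dmap (p : M) : TangentSpace I p →ₗ[ℝ] TangentSpace I' (f p) := (mfderiv I I' f p).toLinearMap

/-- The first distribution induced on `M` by `f`. -/
def dist₁ (p : M) : Submodule ℝ (TangentSpace I p) := (S.D₁ (f p)).comap (dmap I I' f p)

/-- The second distribution induced on `M` by `f`. -/
def dist₂ (p : M) : Submodule ℝ (TangentSpace I p) := (S.D₂ (f p)).comap (dmap I I' f p)

open Classical in
/-- The almost product structure induced on `M` by `f`. -/
def indF (p : M) : TangentSpace I p →ₗ[ℝ] TangentSpace I p :=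
  if h : IsCompl (S.dist₁ I I' f p) (S.dist₂ I I' f p) then
    LinearMap.ofIsCompl h (S.dist₁ I I' f p).subtype (-(S.dist₂ I I' f p).subtype) else 0

/-- The symplectic form induced on `M` by `f`. -/
def indForm (p : M) : LinearMap.BilinForm ℝ (TangentSpace I p) :=
  (S.g (f p)).comp (dmap I I' f p ∘ₗ S.indF I I' f p) (dmap I I' f p)

/-- The local parametrization `ψ` of `M` relates the model `A` to the fields induced by `f`. -/
structure Presents (A : AdaptedModel V) (ψ : V → M) (z : V) : Prop where
  localDiffeo : IsLocalDiffeomorphAt 𝓥 V I ∞ ψ z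
  metric : ∀ a b : V, S.g (f (ψ z)) (mfderiv I I' f (ψ z) (mfderiv 𝓥 V I ψ z a))
    (mfderiv I I' f (ψ z) (mfderiv 𝓥 V I ψ z b)) = A.metric z a b
  mem_D₁ : ∀ a : V, mfderiv I I' f (ψ z) (mfderiv 𝓥 V I ψ z a) ∈ S.D₁ (f (ψ z)) ↔ A.F a = a
  mem_D₂ : ∀ a : V, mfderiv I I' f (ψ z) (mfderiv 𝓥 V I ψ z a) ∈ S.D₂ (f (ψ z)) ↔ A.F a = -a

variable {S I I' f} {A : AdaptedModel V} {ψ : V → M} {z : V}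

lemma Presents.indF_eq (h : S.Presents I I' f A ψ z) (a : V) :
    S.indF I I' f (ψ z) (mfderiv 𝓥 V I ψ z a) = mfderiv 𝓥 V I ψ z (A.F a) := by
  let e : V ≃L[ℝ] TangentSpace I (ψ z) := h.localDiffeo.mfderivToContinuousLinearEquiv (by simp)
  have he : ∀ a, e a = mfderiv 𝓥 V I ψ z a := fun a => rfl
  have m1 : ∀ a, e a ∈ S.dist₁ I I' f (ψ z) ↔ A.F a = a := h.mem_D₁
  have m2 : ∀ a, e a ∈ S.dist₂ I I' f (ψ z) ↔ A.F a = -a := h.mem_D₂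
  have s1 : ∀ a, A.F ((1 / 2 : ℝ) • (a + A.F a)) = (1 / 2 : ℝ) • (a + A.F a) := fun a => by
    rw [map_smul, map_add, A.F_F, add_comm]
  have s2 : ∀ a, A.F ((1 / 2 : ℝ) • (a - A.F a)) = -((1 / 2 : ℝ) • (a - A.F a)) := fun a => by
    rw [map_smul, map_sub, A.F_F, ← smul_neg, neg_sub]
  have hs : ∀ a, (1 / 2 : ℝ) • (a + A.F a) + (1 / 2 : ℝ) • (a - A.F a) = a := fun a => by module
  have hc : IsCompl (S.dist₁ I I' f (ψ z)) (S.dist₂ I I' f (ψ z)) := by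
    refine ⟨Submodule.disjoint_def.2 fun v h1 h2 => ?_, codisjoint_iff.2 ?_⟩
    · obtain ⟨b, rfl⟩ := e.surjective v
      have k1 := (m1 b).1 h1
      have k2 := (m2 b).1 h2
      have k3 : (2 : ℝ) • b = 0 := by
        rw [two_smul]
        exact eq_neg_iff_add_eq_zero.1 (k1.symm.trans k2)
      have : b = 0 := (smul_eq_zero.1 k3).resolve_left two_ne_zero
      rw [this, map_zero]
    · refine Submodule.eq_top_iff'.2 fun v => ?_
      obtain ⟨b, rfl⟩ := e.surjective v
      exact Submodule.mem_sup.2 ⟨_, (m1 _).2 (s1 b), _, (m2 _).2 (s2 b), by rw [← map_add, hs]⟩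
  rw [← he, ← he, indF, dif_pos hc]
  have k1 := LinearMap.ofIsCompl_apply_left hc (φ := (S.dist₁ I I' f (ψ z)).subtype)
    (ψ := -(S.dist₂ I I' f (ψ z)).subtype) ⟨_, (m1 _).2 (s1 a)⟩
  have k2 := LinearMap.ofIsCompl_apply_right hc (φ := (S.dist₁ I I' f (ψ z)).subtype)
    (ψ := -(S.dist₂ I I' f (ψ z)).subtype) ⟨_, (m2 _).2 (s2 a)⟩
  have e1 : e a = e ((1 / 2 : ℝ) • (a + A.F a)) + e ((1 / 2 : ℝ) • (a - A.F a)) := by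
    rw [← map_add, hs]
  have e2 : e (A.F a) = e ((1 / 2 : ℝ) • (a + A.F a)) + -e ((1 / 2 : ℝ) • (a - A.F a)) := by
    rw [← map_neg, ← map_add]
    congr 1
    module
  rw [e1, map_add, e2]
  exact congrArg₂ (· + ·) k1 k2

lemma Presents.modelsAt (h : S.Presents I I' f A ψ z) :
    A.ModelsAt I (S.indForm I I' f) (S.indF I I' f) ψ z where
  localDiffeo := h.localDiffeo
  form_eq a b := by
    have h1 : S.indForm I I' f (ψ z) (mfderiv 𝓥 V I ψ z a) (mfderiv 𝓥 V I ψ z b) =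
        S.g (f (ψ z)) (mfderiv I I' f (ψ z) (S.indF I I' f (ψ z) (mfderiv 𝓥 V I ψ z a)))
          (mfderiv I I' f (ψ z) (mfderiv 𝓥 V I ψ z b)) := rfl
    rw [h1, h.indF_eq, h.metric, A.metric_apply, A.F_F]
  F_eq := h.indF_eq

variable (S I I' f) in
/-- The fields induced by `f` are locally presented by models. -/
def Presented (V : Type) [NormedAddCommGroup V] [NormedSpace ℝ V] : Prop :=
  ∀ p, ∃ (A : AdaptedModel V) (ψ : V → M) (z : V), z ∈ A.U ∧ ψ z = p ∧
    ∀ z ∈ A.U, S.Presents I I' f A ψ z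

variable [I.Boundaryless] [IsManifold I ∞ M] [FiniteDimensional ℝ V] [FiniteDimensional ℝ E]

lemma Presented.hasModels (h : S.Presented I I' f V) :
    HasModels V I (S.indForm I I' f) (S.indF I I' f) := fun p => by
  obtain ⟨A, ψ, z, hz, hp, hA⟩ := h p
  exact ⟨A, ψ, z, hz, hp, fun z hz => (hA z hz).modelsAt⟩

/-- The bi-Lagrangian structure induced by `f`. -/
def Presented.str (h : S.Presented I I' f V) : BiLagrangianStructure I M :=
  BiLagrangianStructure.ofModels (S.indForm I I' f) (S.indF I I' f) h.hasModels

lemma Presented.g_eq (h : S.Presented I I' f V) (p : M) (v w : TangentSpace I p) :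
    h.str.g p v w = S.g (f p) (mfderiv I I' f p v) (mfderiv I I' f p w) := by
  obtain ⟨A, ψ, z, hz, rfl, hA⟩ := h p
  obtain ⟨a, rfl⟩ := (hA z hz).modelsAt.equiv.surjective v
  obtain ⟨b, rfl⟩ := (hA z hz).modelsAt.equiv.surjective w
  exact (AdaptedModel.ModelsAt.g_eq (B := h.str) (hA z hz).modelsAt a b).trans
    ((hA z hz).metric a b).symm

lemma Presented.mem_D₁_iff (h : S.Presented I I' f V) (p : M) (v : TangentSpace I p) :
    v ∈ h.str.D₁ p ↔ mfderiv I I' f p v ∈ S.D₁ (f p) := by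
  obtain ⟨A, ψ, z, hz, rfl, hA⟩ := h p
  obtain ⟨a, rfl⟩ := (hA z hz).modelsAt.equiv.surjective v
  exact (AdaptedModel.ModelsAt.mem_D₁ (B := h.str) (hA z hz).modelsAt a).trans
    ((hA z hz).mem_D₁ a).symm

lemma Presented.mem_D₂_iff (h : S.Presented I I' f V) (p : M) (v : TangentSpace I p) :
    v ∈ h.str.D₂ p ↔ mfderiv I I' f p v ∈ S.D₂ (f p) := by
  obtain ⟨A, ψ, z, hz, rfl, hA⟩ := h p
  obtain ⟨a, rfl⟩ := (hA z hz).modelsAt.equiv.surjective v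
  exact (AdaptedModel.ModelsAt.mem_D₂ (B := h.str) (hA z hz).modelsAt a).trans
    ((hA z hz).mem_D₂ a).symm

end MetricPair

lemma submodule_congr (D : DistField I M) {p q : M} (h : p = q)
    {v : TangentSpace I p} {w : TangentSpace I q} (hv : (v : E) = w) : v ∈ D p ↔ w ∈ D q := by
  subst h
  obtain rfl : v = w := hv
  rfl

/-- The metric and the distributions of a bi-Lagrangian structure. -/
def BiLagrangianStructure.metricPair (B : BiLagrangianStructure I' M') : MetricPair I' M' :=
  ⟨B.g, B.D₁, B.D₂⟩

lemma AdaptedModel.ModelsAt.presents {B : BiLagrangianStructure I' M'} {A : AdaptedModel V}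
    {ψ' : V → M'} {z : V} (h : A.ModelsAt I' B.form B.F ψ' z) {f : M → M'} {ψ : V → M}
    (hψ : IsLocalDiffeomorphAt 𝓥 V I ∞ ψ z) (hf : MDifferentiableAt I I' f (ψ z))
    (he : f ∘ ψ =ᶠ[𝓝 z] ψ') : B.metricPair.Presents I I' f A ψ z := by
  have hp : ψ' z = f (ψ z) := he.eq_of_nhds.symm
  have hd : ∀ a : V, (mfderiv 𝓥 V I' ψ' z a : E') =
      mfderiv I I' f (ψ z) (mfderiv 𝓥 V I ψ z a) := fun a => by
    have h1 := he.mfderiv_eq (I := 𝓥 V) (I' := I')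
    have h2 := mfderiv_comp z hf (hψ.mdifferentiableAt (by simp))
    exact (congrArg (fun L : V →L[ℝ] E' => L a) (h1.symm.trans h2))
  exact {
    localDiffeo := hψ
    metric := fun a b => (form_congr B.g hp (hd a) (hd b)).symm.trans (h.g_eq a b)
    mem_D₁ := fun a => (submodule_congr B.D₁ hp (hd a)).symm.trans (h.mem_D₁ a)
    mem_D₂ := fun a => (submodule_congr B.D₂ hp (hd a)).symm.trans (h.mem_D₂ a) }

variable [I.Boundaryless] [IsManifold I ∞ M] [FiniteDimensional ℝ V] [FiniteDimensional ℝ E]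

lemma MetricPair.Presented.isLocalIso {B : BiLagrangianStructure I' M'} {f : M → M'}
    (h : B.metricPair.Presented I I' f V) (hf : IsLocalDiffeomorph I I' ∞ f) :
    h.str.IsLocalIso B f where
  localDiffeo := hf
  metric p v w := (h.g_eq p v w).symm
  product p v := by
    have k1 : ∀ v, v ∈ h.str.D₁ p → B.F (f p) (mfderiv I I' f p v) = mfderiv I I' f p v :=
      fun v hv => B.F_D₁ _ _ ((h.mem_D₁_iff p v).1 hv)
    have k2 : ∀ v, v ∈ h.str.D₂ p → B.F (f p) (mfderiv I I' f p v) = -mfderiv I I' f p v :=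
      fun v hv => B.F_D₂ _ _ ((h.mem_D₂_iff p v).1 hv)
    obtain ⟨v1, h1, v2, h2, rfl⟩ := Submodule.mem_sup.1
      ((h.str.transversal p).sup_eq_top ▸ Submodule.mem_top : v ∈ h.str.D₁ p ⊔ h.str.D₂ p)
    rw [map_add, map_add, map_add, k1 _ h1, k2 _ h2, h.str.F_D₁ p v1 h1, h.str.F_D₂ p v2 h2,
      map_add, map_neg]

/-- A local diffeomorphism to a bi-Lagrangian manifold induces a bi-Lagrangian structure. -/
lemma presented_of_isLocalDiffeomorph {B : BiLagrangianStructure I' M'} {f : M → M'}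
    (hf : IsLocalDiffeomorph I I' ∞ f) {A : AdaptedModel V} {ψ' : V → M'}
    (hA : ∀ z ∈ A.U, A.ModelsAt I' B.form B.F ψ' z) (p : M) {x : V} (hx : x ∈ A.U)
    (hxp : ψ' x = f p) : ∃ (W : Set V) (hW : IsOpen W) (ψ : V → M), x ∈ W ∧ ψ x = p ∧
      ∀ z ∈ (A.restrict W hW).U, B.metricPair.Presents I I' f (A.restrict W hW) ψ z := by
  obtain ⟨Φ, hpΦ, hΦ⟩ := hf p
  have hO : IsOpen (A.U ∩ ψ' ⁻¹' Φ.target) := by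
    refine ContinuousOn.isOpen_inter_preimage ?_ A.isOpen Φ.open_target
    exact fun z hz => (hA z hz).localDiffeo.contMDiffAt.continuousAt.continuousWithinAt
  have hright : ∀ q ∈ Φ.target, f (Φ.symm q) = q := fun q hq =>
    (hΦ (Φ.map_target hq)).trans (Φ.right_inv hq)
  refine ⟨_, hO, fun z => Φ.symm (ψ' z), ⟨hx, ?_⟩, ?_, ?_⟩
  · change ψ' x ∈ Φ.target
    rw [hxp, hΦ hpΦ]
    exact Φ.map_source hpΦ
  · change Φ.symm (ψ' x) = p
    rw [hxp, hΦ hpΦ]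
    exact Φ.left_inv hpΦ
  · rintro z ⟨hz, hzU, hzΦ⟩
    have hm := hA z hz
    have h1 : IsLocalDiffeomorphAt I' I ∞ Φ.symm (ψ' z) := Φ.symm.isLocalDiffeomorphAt _ _ _ hzΦ
    have hm' : (A.restrict _ hO).ModelsAt I' B.form B.F ψ' z :=
      ⟨hm.localDiffeo, hm.form_eq, hm.F_eq⟩
    refine hm'.presents (hm.localDiffeo.comp I M h1) ((hf _).mdifferentiableAt (by simp)) ?_
    filter_upwards [hO.mem_nhds ⟨hzU, hzΦ⟩] with w hw
    exact hright _ hw.2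

/-- A map whose composition with a local diffeomorphism is a local diffeomorphism. -/
lemma IsLocalDiffeomorphAt.of_comp {χ : V → M} {f : M → M'} {x : V}
    (hχ : IsLocalDiffeomorphAt 𝓥 V I ∞ χ x)
    (h : IsLocalDiffeomorphAt 𝓥 V I' ∞ (f ∘ χ) x) :
    IsLocalDiffeomorphAt I I' ∞ f (χ x) := by
  have h1 := hχ.localInverse_isLocalDiffeomorphAt
  have h2 : hχ.localInverse (χ x) = x := hχ.localInverse_left_inv hχ.localInverse_mem_target
  have h3 : IsLocalDiffeomorphAt I I' ∞ ((f ∘ χ) ∘ hχ.localInverse) (χ x) :=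
    h1.comp I' M' (by rw [h2]; exact h)
  refine h3.congr' ?_
  filter_upwards [hχ.localInverse_eventuallyEq_right] with q hq
  exact (congrArg f hq).symm

end Induced

section CliftonPohlCylinder

lemma sin_mul_sin_pos_of_le {a b s : ℝ} (hab : b - a < Real.pi)
    (hpos : 0 < sin a * sin b) (has : a ≤ s) (hsb : s ≤ b) :
    0 < sin s * sin a := by
  have ha : sin a ≠ 0 := left_ne_zero_of_mul hpos.ne'
  have ha2 : 0 < sin a * sin a := mul_self_pos.2 ha
  rcases has.eq_or_lt with rfl | has
  · exact ha2
  have h1 : 0 < sin (s - a) := Real.sin_pos_of_pos_of_lt_pi (by linarith) (by linarith)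
  have h2 : 0 ≤ sin (b - s) := Real.sin_nonneg_of_nonneg_of_le_pi (by linarith) (by linarith)
  have h3 : 0 < sin (b - a) := Real.sin_pos_of_pos_of_lt_pi (by linarith) hab
  have h4 : sin s * sin (b - a) = sin a * sin (b - s) + sin b * sin (s - a) := by
    simp only [Real.sin_sub]
    ring
  have h5 : sin s * sin a * sin (b - a) = sin a * sin a * sin (b - s) +
        sin a * sin b * sin (s - a) := by
    linear_combination sin a * h4
  refine pos_of_mul_pos_left (b := sin (b - a)) ?_ h3.le
  rw [h5]
  exact add_pos_of_nonneg_of_pos (mul_nonneg ha2.le h2) (mul_pos hpos h1)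

lemma mul_pos_of_mul_pos_of_mul_pos {a b c : ℝ} (h1 : 0 < a * b) (h2 : 0 < b * c) : 0 < a * c := by
  have h3 : 0 < a * c * (b * b) := by
    have := mul_pos h1 h2
    linarith
  exact pos_of_mul_pos_left h3 (mul_self_nonneg b)

lemma sin_mul_sin_pos {a b s : ℝ} (hab : |b - a| < Real.pi) (hpos : 0 < sin a * sin b)
    (hs : s ∈ uIcc a b) : 0 < sin s * sin a := by
  rcases le_total a b with h | h
  · rw [uIcc_of_le h] at hs
    exact sin_mul_sin_pos_of_le ((le_abs_self _).trans_lt hab) hpos hs.1 hs.2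
  · rw [uIcc_of_ge h] at hs
    rw [abs_sub_comm] at hab
    rw [mul_comm] at hpos
    exact mul_pos_of_mul_pos_of_mul_pos
      (sin_mul_sin_pos_of_le ((le_abs_self _).trans_lt hab) hpos hs.1 hs.2) hpos

/-- A linear function of `ℝ²`, in polar coordinates. -/
def polarHeight (φ : ℝ) (x : ℝ²) : ℝ := x.1 * sin (x.2 + φ)

lemma hasFDerivAt_polarHeight (φ : ℝ) (x : ℝ²) : HasFDerivAt (polarHeight φ)
    (x.1 • (cos (x.2 + φ) • snd ℝ ℝ ℝ) + sin (x.2 + φ) • fst ℝ ℝ ℝ) x :=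
  hasFDerivAt_fst.mul ((hasFDerivAt_snd.add_const φ).sin)

lemma contDiff_polarHeight (φ : ℝ) : ContDiff ℝ ∞ (polarHeight φ) := by
  unfold polarHeight
  fun_prop

/-- The cartesian coordinates of a point with given polar coordinates. -/
def polarMap (x : ℝ²) : ℝ² := (polarHeight (Real.pi / 2) x, polarHeight 0 x)

lemma polarMap_eq (x : ℝ²) : polarMap x = (x.1 * cos x.2, x.1 * sin x.2) := by
  simp [polarMap, polarHeight, Real.sin_add_pi_div_two]

lemma contDiff_polarMap : ContDiff ℝ ∞ polarMap :=
  (contDiff_polarHeight _).prodMk (contDiff_polarHeight _)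

lemma fderiv_polarMap (x a : ℝ²) : 𝐃 polarMap x a =
    (𝐃 (polarHeight (Real.pi / 2)) x a, 𝐃 (polarHeight 0) x a) := by
  have h := ((hasFDerivAt_polarHeight (Real.pi / 2) x).prodMk (hasFDerivAt_polarHeight 0 x)).fderiv
  rw [(hasFDerivAt_polarHeight (Real.pi / 2) x).fderiv, (hasFDerivAt_polarHeight 0 x).fderiv]
  exact congrArg (fun L : ℝ² →L[ℝ] ℝ² => L a) h

lemma polarMap_ne_zero {x : ℝ²} (hx : 0 < x.1) : polarMap x ≠ 0 := by
  rw [polarMap_eq]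
  intro h
  have h1 : x.1 * cos x.2 = 0 := congrArg Prod.fst h
  have h2 : x.1 * sin x.2 = 0 := congrArg Prod.snd h
  have k1 := (mul_eq_zero.1 h1).resolve_left hx.ne'
  have k2 := (mul_eq_zero.1 h2).resolve_left hx.ne'
  have := Real.sin_sq_add_cos_sq x.2
  rw [k1, k2] at this
  norm_num at this

lemma isOpen_polarDomain : IsOpen {x : ℝ² | 0 < x.1} := isOpen_lt continuous_const continuous_fst

lemma isLocalDiffeomorphAt_polarMap {x : ℝ²} (hx : 0 < x.1) :
    IsLocalDiffeomorphAt 𝓥 ℝ² 𝓥 ℝ² ∞ polarMap x := by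
  refine isLocalDiffeomorphAt_of_injective_mfderiv rfl isOpen_univ
    contDiff_polarMap.contMDiff.contMDiffOn (mem_univ x) ?_
  rw [mfderiv_eq_fderiv]
  refine (injective_iff_map_eq_zero (𝐃 polarMap x)).2 fun a ha => ?_
  rw [fderiv_polarMap, (hasFDerivAt_polarHeight _ x).fderiv,
    (hasFDerivAt_polarHeight _ x).fderiv] at ha
  have h1 : x.1 * (cos (x.2 + Real.pi / 2) * a.2) + sin (x.2 + Real.pi / 2) * a.1 = 0 :=
    congrArg Prod.fst ha
  have h2 : x.1 * (cos (x.2 + 0) * a.2) + sin (x.2 + 0) * a.1 = 0 := congrArg Prod.snd ha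
  rw [Real.cos_add_pi_div_two, Real.sin_add_pi_div_two] at h1
  rw [add_zero] at h2
  have h3 := Real.sin_sq_add_cos_sq x.2
  have k1 : a.1 = 0 := by linear_combination cos x.2 * h1 + sin x.2 * h2 - a.1 * h3
  have k2 : x.1 * a.2 = 0 := by linear_combination cos x.2 * h2 - sin x.2 * h1 - x.1 * a.2 * h3
  exact Prod.ext k1 ((mul_eq_zero.1 k2).resolve_left hx.ne')

/-- The homotheties, in polar coordinates. -/
def polarHomothety (k : ℤ) : ℝ² →L[ℝ] ℝ² := ((2 : ℝ) ^ k • fst ℝ ℝ ℝ).prod (snd ℝ ℝ ℝ)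

lemma polarHomothety_apply (k : ℤ) (x : ℝ²) : polarHomothety k x = ((2 : ℝ) ^ k * x.1, x.2) := rfl

/-- The group of the Clifton-Pohl cylinder. -/
def polarDeck : AffineDeck ℝ² :=
  .scaling {x | 0 < x.1} isOpen_polarDomain ⟨(1, 0), by simp⟩ polarHomothety
    (by ext <;> simp [polarHomothety_apply])
    (fun i j => by ext <;> simp [polarHomothety_apply, zpow_add₀])
    (fun i x (hx : 0 < x.1) => show 0 < (2 : ℝ) ^ i * x.1 from mul_pos (zpow_pos two_pos i) hx)
    Prod.fst continuous_fst (fun _ hx => hx)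
    fun i x => rfl

lemma polarDeck_rel_iff {x y : ℝ²} : polarDeck.Rel x y ↔ polarHomothetyRel x y :=
  ⟨fun ⟨k, h⟩ => ⟨k, h.trans (add_zero _)⟩, fun ⟨k, h⟩ => ⟨k, h.trans (add_zero _).symm⟩⟩

lemma polarDeck_proj_eq_iff {x y : ℝ²} (hx : 0 < x.1) (hy : 0 < y.1) :
    polarDeck.proj x = polarDeck.proj y ↔ polarHomothetyRel x y :=
  (AffineDeck.proj_eq_iff (D := polarDeck) hx hy).trans polarDeck_rel_iff

/-- The covering of the Clifton-Pohl torus by the Clifton-Pohl cylinder. -/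
def polarCover (p : polarDeck.Q) : cliftonPohl.D.Q :=
  cliftonPohl.D.proj (polarMap (polarDeck.exists_rep p).choose)

lemma polarHeight_zpow (φ : ℝ) (k : ℤ) (x : ℝ²) :
    polarHeight φ ((2 : ℝ) ^ k * x.1, x.2) = 2 ^ k * polarHeight φ x := mul_assoc _ _ _

lemma polarMap_zpow (k : ℤ) (x : ℝ²) :
    polarMap ((2 : ℝ) ^ k * x.1, x.2) = (2 : ℝ) ^ k • polarMap x :=
  Prod.ext (polarHeight_zpow _ k x) (polarHeight_zpow _ k x)

lemma polarCover_proj {x : ℝ²} (hx : 0 < x.1) :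
    polarCover (polarDeck.proj x) = cliftonPohl.D.proj (polarMap x) := by
  obtain ⟨h1, h2⟩ := (polarDeck.exists_rep (polarDeck.proj x)).choose_spec
  obtain ⟨k, hk⟩ := (polarDeck_proj_eq_iff h1 hx).1 h2
  refine (cliftonPohl_proj_eq_iff (polarMap_ne_zero h1) (polarMap_ne_zero hx)).2 ⟨k, ?_⟩
  exact (congrArg polarMap hk).trans (polarMap_zpow k _)

lemma polarCover_comp {x : ℝ²} (hx : 0 < x.1) :
    polarCover ∘ polarDeck.proj =ᶠ[𝓝 x] cliftonPohl.D.proj ∘ polarMap := by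
  filter_upwards [isOpen_polarDomain.mem_nhds hx] with y hy
  exact polarCover_proj hy

lemma polarCover_isLocalDiffeomorph : IsLocalDiffeomorph 𝓥 ℝ² 𝓥 ℝ² ∞ polarCover := fun p => by
  obtain ⟨x, hx, rfl⟩ := polarDeck.exists_rep p
  refine IsLocalDiffeomorphAt.of_comp (polarDeck.isLocalDiffeomorphOn_proj ⟨x, hx⟩) ?_
  refine IsLocalDiffeomorphAt.congr' ?_ (polarCover_comp hx)
  exact (isLocalDiffeomorphAt_polarMap hx).comp _ _
    (cliftonPohl.D.isLocalDiffeomorphOn_proj ⟨_, polarMap_ne_zero hx⟩)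

lemma polarCover_presented : cliftonPohl.str.metricPair.Presented 𝓥 ℝ² 𝓥 ℝ² polarCover ℝ² := by
  intro p
  obtain ⟨x, hx, rfl⟩ := polarDeck.exists_rep p
  obtain ⟨W, hW, ψ, hxW, hψ, h⟩ := presented_of_isLocalDiffeomorph polarCover_isLocalDiffeomorph
    cliftonPohl.modelsAt (polarDeck.proj x) (x := polarMap x) (polarMap_ne_zero hx)
    (polarCover_proj hx).symm
  exact ⟨cliftonPohl.A.restrict W hW, ψ, _, ⟨polarMap_ne_zero hx, hxW⟩, hψ, h⟩

/-- The Clifton-Pohl cylinder. -/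
def cliftonPohlCylinder : BiLagrangianStructure 𝓥 ℝ² polarDeck.Q := polarCover_presented.str

lemma cliftonPohlCylinder_not_isFlat : ¬ cliftonPohlCylinder.IsFlat := by
  intro hflat
  have hx : (0 : ℝ) < ((√2, Real.pi / 4) : ℝ²).1 := by positivity
  have h11 : polarMap (√2, Real.pi / 4) = (1, 1) := by
    have h2 : √2 * √2 = 2 := Real.mul_self_sqrt zero_le_two
    rw [polarMap_eq]
    ext
    · simp only [Real.cos_pi_div_four]
      linarith
    · simp only [Real.sin_pi_div_four]
      linarith
  have h0 := polarMap_ne_zero hx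
  obtain ⟨W, hW, ψ, hxW, hψ, h⟩ := presented_of_isLocalDiffeomorph polarCover_isLocalDiffeomorph
    cliftonPohl.modelsAt (polarDeck.proj (√2, Real.pi / 4)) h0 (polarCover_proj hx).symm
  rw [h11] at hxW h0
  exact puncturedModel_curv_ne_zero fun a b c =>
    hflat.curv_eq_zero (fun z hz => (h z hz).modelsAt) (x := (1, 1)) ⟨h0, hxW⟩ a b c

lemma cliftonPohlCylinder_not_compactSpace : ¬ CompactSpace polarDeck.Q :=
  polarDeck.not_compactSpace (f := Prod.snd) continuous_snd.continuousOn
    (fun _ _ _ => add_zero _) fun C => ⟨(1, C + 1), one_pos (α := ℝ), lt_add_one C⟩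

lemma mfderiv_polarCover {x : ℝ²} (hx : 0 < x.1) (a : ℝ²) :
    (mfderiv 𝓥 ℝ² 𝓥 ℝ² polarCover (polarDeck.proj x) (mfderiv 𝓥 ℝ² 𝓥 ℝ² polarDeck.proj x a) : ℝ²) =
    mfderiv 𝓥 ℝ² 𝓥 ℝ² cliftonPohl.D.proj (polarMap x) (𝐃 polarMap x a) := by
  have h1 := (polarCover_comp hx).mfderiv_eq (I := 𝓥 ℝ²) (I' := 𝓥 ℝ²)
  have h2 := mfderiv_comp x ((polarCover_isLocalDiffeomorph (polarDeck.proj x)).mdifferentiableAt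
    (by simp)) ((polarDeck.isLocalDiffeomorphOn_proj ⟨x, hx⟩).mdifferentiableAt (by simp))
  have h3 := mfderiv_comp x ((cliftonPohl.D.isLocalDiffeomorphOn_proj
    ⟨_, polarMap_ne_zero hx⟩).mdifferentiableAt (by simp))
    ((isLocalDiffeomorphAt_polarMap hx).mdifferentiableAt (by simp))
  rw [mfderiv_eq_fderiv] at h3
  exact congrArg (fun L : ℝ² →L[ℝ] ℝ² => L a) (h2.symm.trans (h1.trans h3))

lemma cliftonPohlCylinder_mem_D₁ {x : ℝ²} (hx : 0 < x.1) (a : ℝ²) :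
    mfderiv 𝓥 ℝ² 𝓥 ℝ² polarDeck.proj x a ∈
      cliftonPohlCylinder.D₁ (polarDeck.proj x) ↔ 𝐃 (polarHeight 0) x a = 0 := by
  refine (polarCover_presented.mem_D₁_iff _ _).trans ?_
  refine (submodule_congr cliftonPohl.str.D₁ (polarCover_proj hx) (mfderiv_polarCover hx a)).trans
      ?_
  refine ((cliftonPohl.modelsAt _ (polarMap_ne_zero hx)).mem_D₁ _).trans ?_
  rw [fderiv_polarMap]
  exact diagF_eq_self_iff _

lemma cliftonPohlCylinder_mem_D₂ {x : ℝ²} (hx : 0 < x.1) (a : ℝ²) :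
    mfderiv 𝓥 ℝ² 𝓥 ℝ² polarDeck.proj x a ∈
      cliftonPohlCylinder.D₂ (polarDeck.proj x) ↔ 𝐃 (polarHeight (Real.pi / 2)) x a = 0 := by
  refine (polarCover_presented.mem_D₂_iff _ _).trans ?_
  refine (submodule_congr cliftonPohl.str.D₂ (polarCover_proj hx) (mfderiv_polarCover hx a)).trans
      ?_
  refine ((cliftonPohl.modelsAt _ (polarMap_ne_zero hx)).mem_D₂ _).trans ?_
  rw [fderiv_polarMap]
  exact diagF_eq_neg_iff _

/-- Two points are on the same leaf of the lift of the foliation by the level lines of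
`polarHeight φ`. -/
def PolarLeafRel (φ : ℝ) (x y : ℝ²) : Prop := polarHeight φ x = polarHeight φ y ∧
    (x.2 = y.2 ∨ ∀ s ∈ uIcc x.2 y.2, 0 < sin (s + φ) * sin (x.2 + φ))

lemma PolarLeafRel.symm {φ : ℝ} {x y : ℝ²} (h : PolarLeafRel φ x y) : PolarLeafRel φ y x := by
  refine ⟨h.1.symm, h.2.imp Eq.symm fun h2 s hs => ?_⟩
  have h3 := h2 y.2 right_mem_uIcc
  rw [mul_comm] at h3
  exact mul_pos_of_mul_pos_of_mul_pos (h2 s (by rwa [uIcc_comm])) h3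

lemma PolarLeafRel.trans {φ : ℝ} {x y z : ℝ²} (h : PolarLeafRel φ x y)
    (h' : PolarLeafRel φ y z) : PolarLeafRel φ x z := by
  refine ⟨h.1.trans h'.1, ?_⟩
  rcases h.2 with h2 | h2
  · rw [h2]; exact h'.2
  rcases h'.2 with h3 | h3
  · rw [← h3]; exact Or.inr h2
  refine Or.inr fun s hs => ?_
  rcases uIcc_subset_uIcc_union_uIcc hs with hs | hs
  · exact h2 s hs
  · exact mul_pos_of_mul_pos_of_mul_pos (h3 s hs) (h2 y.2 right_mem_uIcc)

lemma eventually_polarLeafRel (φ : ℝ) {x : ℝ²} (hx : 0 < x.1) :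
    ∀ᶠ y in 𝓝 x, polarHeight φ y = polarHeight φ x → PolarLeafRel φ x y := by
  have hd : ∀ᶠ y : ℝ² in 𝓝 x, |y.2 - x.2| < Real.pi := by
    have : ContinuousAt (fun y : ℝ² => |y.2 - x.2|) x := by fun_prop
    exact this.eventually (gt_mem_nhds (by simpa using Real.pi_pos))
  by_cases h0 : sin (x.2 + φ) = 0
  · filter_upwards [hd, isOpen_polarDomain.mem_nhds hx] with y hy hy0 h
    refine ⟨h.symm, Or.inl ?_⟩
    have h1 : sin (y.2 + φ) = 0 := by
      have : y.1 * sin (y.2 + φ) = 0 := by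
        rw [show y.1 * sin (y.2 + φ) = polarHeight φ y from rfl, h, polarHeight, h0, mul_zero]
      exact (mul_eq_zero.1 this).resolve_left (ne_of_gt hy0)
    have h2 : sin (y.2 - x.2) = 0 := by
      rw [show y.2 - x.2 = y.2 + φ - (x.2 + φ) by ring, Real.sin_sub, h0, h1]
      ring
    have := (Real.sin_eq_zero_iff_of_lt_of_lt (abs_lt.1 hy).1 (abs_lt.1 hy).2).1 h2
    linarith
  · have hs : ∀ᶠ y : ℝ² in 𝓝 x, 0 < sin (x.2 + φ) * sin (y.2 + φ) := by
      have : ContinuousAt (fun y : ℝ² => sin (x.2 + φ) * sin (y.2 + φ)) x := by fun_prop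
      exact this.eventually (lt_mem_nhds (mul_self_pos.2 h0))
    filter_upwards [hd, hs] with y hy hs h
    refine ⟨h.symm, Or.inr fun s hs' => ?_⟩
    refine sin_mul_sin_pos (b := y.2 + φ) (by rwa [add_sub_add_right_eq_sub]) hs ?_
    rcases mem_uIcc.1 hs' with hs' | hs'
    · exact mem_uIcc.2 (Or.inl ⟨by linarith, by linarith⟩)
    · exact mem_uIcc.2 (Or.inr ⟨by linarith, by linarith⟩)

lemma PolarLeafRel.exists_curve {φ : ℝ} {x y : ℝ²} (h : PolarLeafRel φ x y) (hx : 0 < x.1)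
    (hy : 0 < y.1) : ∃ c : ℝ → ℝ², ContDiff ℝ ∞ c ∧ c 0 = x ∧ c 1 = y ∧
      ∀ t, c t ∈ {x : ℝ² | 0 < x.1} ∧ polarHeight φ (c t) = polarHeight φ x := by
  obtain ⟨h1, h2 | h2⟩ := h
  · obtain ⟨c, hc, h0, h1', hs⟩ := exists_curve_segment x y
    refine ⟨c, hc, h0, h1', fun t => ?_⟩
    obtain ⟨s, ⟨hs0, hs1⟩, hcs⟩ := hs t
    have k1 : (c t).1 = (1 - s) * x.1 + s * y.1 := by
      rw [hcs]
      simp only [Prod.fst_add, Prod.smul_fst, Prod.fst_sub, smul_eq_mul]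
      ring
    have k2 : (c t).2 = x.2 := by
      rw [hcs]
      simp [h2]
    refine ⟨?_, ?_⟩
    · change 0 < (c t).1
      rw [k1]
      rcases hs0.eq_or_lt with rfl | hs0
      · simpa using hx
      · exact add_pos_of_nonneg_of_pos (mul_nonneg (sub_nonneg.2 hs1) hx.le) (mul_pos hs0 hy)
    · simp only [polarHeight] at h1 ⊢
      rw [k1, k2]
      rw [← h2] at h1
      linear_combination -s * h1
  · obtain ⟨c, hc, h0, h1', hs⟩ := exists_curve_segment x.2 y.2
    have hmem : ∀ t, c t ∈ uIcc x.2 y.2 := fun t => by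
      obtain ⟨s, ⟨hs0, hs1⟩, hcs⟩ := hs t
      rw [hcs, ← segment_eq_uIcc]
      exact ⟨1 - s, s, by linarith, hs0, by ring, by simp only [smul_eq_mul]; ring⟩
    have hpos : ∀ t, 0 < sin (c t + φ) * sin (x.2 + φ) := fun t => h2 _ (hmem t)
    have hne : ∀ t, sin (c t + φ) ≠ 0 := fun t => left_ne_zero_of_mul (hpos t).ne'
    refine ⟨fun t => (polarHeight φ x / sin (c t + φ), c t), ?_, ?_, ?_, fun t => ⟨?_, ?_⟩⟩
    · exact ((contDiff_const).div (Real.contDiff_sin.comp (hc.add contDiff_const)) hne).prodMk hc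
    · refine Prod.ext ?_ h0
      simp only [polarHeight, h0]
      exact mul_div_cancel_right₀ _ (h0 ▸ hne 0)
    · refine Prod.ext ?_ h1'
      simp only [h1, h1']
      exact mul_div_cancel_right₀ _ (h1' ▸ hne 1)
    · change 0 < x.1 * sin (x.2 + φ) / sin (c t + φ)
      have := mul_pos hx (hpos t)
      have h3 : x.1 * sin (x.2 + φ) / sin (c t + φ) = x.1 * (sin (c t + φ) * sin (x.2 + φ)) /
            (sin (c t + φ) * sin (c t + φ)) := by
        have := hne t
        field_simp
      rw [h3]
      exact div_pos this (mul_self_pos.2 (hne t))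
    · exact div_mul_cancel₀ _ (hne t)

lemma polarDeck_leaf {D : (p : polarDeck.Q) → Submodule ℝ (TangentSpace 𝓥 ℝ² p)} {φ : ℝ}
    (hD : ∀ x : ℝ², 0 < x.1 → ∀ a, mfderiv 𝓥 ℝ² 𝓥 ℝ² polarDeck.proj x a ∈
      D (polarDeck.proj x) ↔ 𝐃 (polarHeight φ) x a = 0) {x : ℝ²} (hx : 0 < x.1) :
    leaf 𝓥 ℝ² D (polarDeck.proj x) =
      polarDeck.proj '' {y | y ∈ {y : ℝ² | 0 < y.1} ∧ PolarLeafRel φ x y} := by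
  refine leaf_eq_image isOpen_polarDomain polarDeck.isLocalDiffeomorphOn_proj polarDeck.image_proj
    ((contDiff_polarHeight φ).differentiable (by simp)).differentiableOn hD
    (fun x hx => eventually_polarLeafRel φ hx) (fun _ _ _ _ h => h.symm)
    (fun _ _ _ _ _ _ h h' => h.trans h') ?_ (fun _ hx _ hy h => h.exists_curve hx hy) hx
  intro x hx x' hx' y hy hxx' h
  obtain ⟨k, rfl⟩ := (polarDeck_proj_eq_iff hx hx').1 hxx'
  have hk : (0 : ℝ) < 2 ^ k := zpow_pos two_pos k
  refine ⟨((2 : ℝ) ^ k * y.1, y.2), mul_pos hk hy,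
    ((polarDeck_proj_eq_iff hy (mul_pos hk hy)).2 ⟨k, rfl⟩).symm, ?_, h.2⟩
  rw [polarHeight_zpow, polarHeight_zpow, h.1]

lemma cliftonPohlCylinder_leaf₁ {x : ℝ²} (hx : 0 < x.1) :
    cliftonPohlCylinder.leaf₁ (polarDeck.proj x) =
      polarDeck.proj '' {y | 0 < y.1 ∧ PolarLeafRel 0 x y} :=
  polarDeck_leaf (fun _ hx => cliftonPohlCylinder_mem_D₁ hx) hx

lemma cliftonPohlCylinder_leaf₂ {x : ℝ²} (hx : 0 < x.1) :
    cliftonPohlCylinder.leaf₂ (polarDeck.proj x) =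
      polarDeck.proj '' {y | 0 < y.1 ∧ PolarLeafRel (Real.pi / 2) x y} :=
  polarDeck_leaf (fun _ hx => cliftonPohlCylinder_mem_D₂ hx) hx

lemma PolarLeafRel.snd_eq {φ : ℝ} {x y : ℝ²} (h : PolarLeafRel φ x y)
    (h0 : sin (x.2 + φ) = 0) : x.2 = y.2 :=
  h.2.resolve_right fun h2 => by simpa [h0] using h2 x.2 left_mem_uIcc

lemma PolarLeafRel.eq {φ : ℝ} {x y : ℝ²} (h : PolarLeafRel φ x y)
    (h0 : sin (x.2 + φ) ≠ 0) (h2 : x.2 = y.2) : x = y := by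
  have h1 := h.1
  rw [polarHeight, polarHeight, ← h2] at h1
  exact Prod.ext (mul_right_cancel₀ h0 h1) h2

lemma cliftonPohlCylinder_N_axis {x : ℝ²} (hx : 0 < x.1)
    (h : cos x.2 * sin x.2 = 0) : cliftonPohlCylinder.N (polarDeck.proj x) = 1 := by
  rw [BiLagrangianStructure.N, cliftonPohlCylinder_leaf₁ hx, cliftonPohlCylinder_leaf₂ hx,
    encard_eq_one]
  refine ⟨polarDeck.proj x, Subset.antisymm ?_ ?_⟩
  · rintro _ ⟨⟨y, ⟨hy, hxy⟩, rfl⟩, ⟨z, ⟨hz, hxz⟩, hzy⟩⟩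
    obtain ⟨k, hk⟩ := (polarDeck_proj_eq_iff hz hy).1 hzy
    have h2 : y.2 = z.2 := by rw [hk]
    have h3 := Real.sin_sq_add_cos_sq x.2
    rcases mul_eq_zero.1 h with h0 | h0
    · have hs : sin (x.2 + 0) ≠ 0 := fun hs => by
        rw [add_zero] at hs
        rw [h0, hs] at h3
        norm_num at h3
      rw [← hxy.eq hs ((hxz.snd_eq (by rw [Real.sin_add_pi_div_two, h0])).trans h2.symm)]
      rfl
    · have hs : sin (x.2 + Real.pi / 2) ≠ 0 := fun hs => by
        rw [Real.sin_add_pi_div_two] at hs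
        rw [h0, hs] at h3
        norm_num at h3
      rw [← hzy, ← hxz.eq hs ((hxy.snd_eq (by rw [add_zero, h0])).trans h2)]
      rfl
  · rintro _ rfl
    exact ⟨⟨x, ⟨hx, rfl, Or.inl rfl⟩, rfl⟩, ⟨x, ⟨hx, rfl, Or.inl rfl⟩, rfl⟩⟩

/-- Rotating a direction `(cos t, sin t)` to the direction of `(cos t, m sin t)`. -/
lemma exists_angle (t : ℝ) {m : ℝ} (hm : 0 < m) : ∃ δ K : ℝ, |δ| < Real.pi ∧ 0 < K ∧
    sin (t + δ) = K * m * sin t ∧ cos (t + δ) = K * cos t := by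
  have h1 := Real.sin_sq_add_cos_sq t
  have hd : 0 < cos t ^ 2 + m * sin t ^ 2 := by
    rcases eq_or_ne (sin t) 0 with h0 | h0
    · rw [h0] at h1 ⊢
      nlinarith
    · have := pow_pos (abs_pos.2 h0) 2
      rw [sq_abs] at this
      have := mul_pos hm this
      nlinarith [sq_nonneg (cos t)]
  set d := cos t ^ 2 + m * sin t ^ 2 with hd'
  set w := (m - 1) * sin t * cos t / d with hw
  have hwd : w * d = (m - 1) * sin t * cos t := div_mul_cancel₀ _ hd.ne'
  have hc : 0 < cos (Real.arctan w) := Real.cos_arctan_pos w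
  have hs : sin (Real.arctan w) = w * cos (Real.arctan w) := by
    conv_rhs => rw [← Real.tan_arctan w, Real.arctan_tan (Real.neg_pi_div_two_lt_arctan w)
      (Real.arctan_lt_pi_div_two w)]
    exact (Real.tan_mul_cos hc.ne').symm
  refine ⟨Real.arctan w, cos (Real.arctan w) / d, abs_lt.2 ⟨?_, ?_⟩, div_pos hc hd, ?_, ?_⟩
  · linarith [Real.neg_pi_div_two_lt_arctan w, Real.pi_pos]
  · linarith [Real.arctan_lt_pi_div_two w, Real.pi_pos]
  · rw [Real.sin_add, hs]
    refine mul_right_cancel₀ hd.ne' ?_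
    have : cos (Real.arctan w) / d * m * sin t * d =
        cos (Real.arctan w) * m * sin t := by field_simp
    rw [this]
    linear_combination cos t * cos (Real.arctan w) * hwd + sin t * cos (Real.arctan w) * hd' +
      m * sin t * cos (Real.arctan w) * h1
  · rw [Real.cos_add, hs]
    refine mul_right_cancel₀ hd.ne' ?_
    have : cos (Real.arctan w) / d * cos t * d = cos (Real.arctan w) * cos t := by field_simp
    rw [this]
    linear_combination -sin t * cos (Real.arctan w) * hwd + cos t * cos (Real.arctan w) * hd' +
      cos t * cos (Real.arctan w) * h1

lemma polarLeafRel_of_sin {φ δ K : ℝ} {x : ℝ²} (hδ : |δ| < Real.pi) (hK : 0 < K)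
    (h0 : sin (x.2 + φ) ≠ 0) (h : sin (x.2 + δ + φ) = K * sin (x.2 + φ)) :
    PolarLeafRel φ x (x.1 / K, x.2 + δ) := by
  refine ⟨?_, Or.inr fun s hs => ?_⟩
  · simp only [polarHeight, h]
    field_simp
  · refine sin_mul_sin_pos (b := x.2 + δ + φ) ?_ ?_ ?_
    · rwa [show x.2 + δ + φ - (x.2 + φ) = δ by ring]
    · rw [h]
      have := mul_pos hK (mul_self_pos.2 h0)
      linarith
    · simp only at hs
      rcases mem_uIcc.1 hs with hs' | hs'
      · exact mem_uIcc.2 (Or.inl ⟨by linarith, by linarith⟩)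
      · exact mem_uIcc.2 (Or.inr ⟨by linarith, by linarith⟩)

lemma cliftonPohlCylinder_N_off_axis {x : ℝ²} (hx : 0 < x.1)
    (h : cos x.2 * sin x.2 ≠ 0) : cliftonPohlCylinder.N (polarDeck.proj x) = ⊤ := by
  have hc := left_ne_zero_of_mul h
  have hs := right_ne_zero_of_mul h
  have hpow : ∀ k : ℤ, (0 : ℝ) < 2 ^ k := fun k => zpow_pos two_pos k
  choose δ K hδ hK hsin hcos using fun k : ℤ => exists_angle x.2 (hpow k)
  have hy : ∀ k : ℤ, 0 < x.1 / (K k * 2 ^ k) := fun k => div_pos hx (mul_pos (hK k) (hpow k))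
  have hz : ∀ k : ℤ, 0 < x.1 / K k := fun k => div_pos hx (hK k)
  rw [BiLagrangianStructure.N, cliftonPohlCylinder_leaf₁ hx, cliftonPohlCylinder_leaf₂ hx,
    encard_eq_top_iff]
  have hinj : Function.Injective fun k : ℤ => polarDeck.proj (x.1 / (K k * 2 ^ k), x.2 + δ k) := by
    intro k l hkl
    obtain ⟨j, hj⟩ := (polarDeck_proj_eq_iff (x := (x.1 / (K k * 2 ^ k), x.2 + δ k))
      (y := (x.1 / (K l * 2 ^ l), x.2 + δ l)) (hy k) (hy l)).1 hkl
    have e2 : x.2 + δ l = x.2 + δ k := congrArg Prod.snd hj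
    have k1 := hsin l
    have k2 := hcos l
    rw [e2, hsin k] at k1
    rw [e2, hcos k] at k2
    have k3 := mul_right_cancel₀ hc k2
    have k4 := mul_right_cancel₀ hs k1
    rw [k3] at k4
    exact zpow_right_injective₀ two_pos (by norm_num) (mul_left_cancel₀ (hK l).ne' k4)
  refine (infinite_range_of_injective hinj).mono ?_
  rintro _ ⟨k, rfl⟩
  refine ⟨⟨_, ⟨hy k, polarLeafRel_of_sin (hδ k) (mul_pos (hK k) (hpow k)) ?_ ?_⟩, rfl⟩,
    ⟨(x.1 / K k, x.2 + δ k), ⟨hz k, polarLeafRel_of_sin (hδ k) (hK k) ?_ ?_⟩, ?_⟩⟩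
  · rwa [add_zero]
  · rw [add_zero, add_zero, hsin]
  · rwa [Real.sin_add_pi_div_two]
  · rw [Real.sin_add_pi_div_two, Real.sin_add_pi_div_two, hcos]
  · refine (polarDeck_proj_eq_iff (x := (x.1 / K k, x.2 + δ k))
      (y := (x.1 / (K k * 2 ^ k), x.2 + δ k)) (hz k) (hy k)).2 ⟨-k, ?_⟩
    ext
    · have := (hpow k).ne'
      have := (hK k).ne'
      simp only [zpow_neg]
      field_simp
    · rfl

/-- The Clifton-Pohl cylinder, as a bi-Lagrangian manifold. -/
def cliftonPohlCylinderManifold : BiLagrangianManifold 2 :=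
  have := polarDeck.connectedSpace ((convex_halfSpace_gt (IsLinearMap.mk (f := Prod.fst)
    (fun _ _ => rfl) fun _ _ => rfl) (0 : ℝ)).isConnected ⟨((1, 0) : ℝ²), by simp⟩)
  { E := ℝ², dim_eq := by simp, H := ℝ², I := 𝓥 ℝ², M := polarDeck.Q, str := cliftonPohlCylinder }

end CliftonPohlCylinder

section Schwarzschild

/-- The tortoise coordinate, as a function of `log (r - 2m)`. -/
def tortoiseLog (m w : ℝ) : ℝ := 2 * m + Real.exp w + 2 * m * w

variable {m : ℝ} (hm : 0 < m)

include hm in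
lemma strictMono_tortoiseLog : StrictMono (tortoiseLog m) := fun a b hab => by
  have h1 := Real.exp_lt_exp.2 hab
  have h2 := mul_lt_mul_of_pos_left hab hm
  unfold tortoiseLog
  linarith

include hm in
lemma surjective_tortoiseLog : Function.Surjective (tortoiseLog m) := by
  have h2m : 0 < 2 * m := by linarith
  refine Continuous.surjective (by unfold tortoiseLog; fun_prop) ?_ ?_
  · refine tendsto_atTop_mono (fun w => ?_) (tendsto_id.const_mul_atTop h2m)
    have := Real.exp_pos w
    simp only [tortoiseLog, id]
    linarith
  · have h1 : Tendsto (fun w : ℝ => 2 * m + Real.exp w) atBot (𝓝 (2 * m + 0)) :=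
      tendsto_const_nhds.add Real.tendsto_exp_atBot
    exact h1.add_atBot (tendsto_id.const_mul_atBot h2m)

/-- The change of coordinates between `log (r - 2m)` and the tortoise coordinate. -/
def tortoiseHomeo : ℝ ≃ₜ ℝ :=
  ((strictMono_tortoiseLog hm).orderIsoOfSurjective _ (surjective_tortoiseLog hm)).toHomeomorph

lemma tortoiseHomeo_apply (w : ℝ) : tortoiseHomeo hm w = tortoiseLog m w := rfl

lemma hasDerivAt_tortoiseLog (w : ℝ) : HasDerivAt (tortoiseHomeo hm) (Real.exp w + 2 * m) w := by
  have h1 := ((Real.hasDerivAt_exp w).const_add (2 * m)).add ((hasDerivAt_id w).const_mul (2 * m))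
  rw [mul_one] at h1
  exact h1

/-- The radius, as a function of the tortoise coordinate. -/
def radius (z : ℝ) : ℝ := 2 * m + Real.exp ((tortoiseHomeo hm).symm z)

lemma lt_radius (z : ℝ) : 2 * m < radius hm z := lt_add_of_pos_right _ (Real.exp_pos _)

lemma radius_pos (z : ℝ) : 0 < radius hm z := by
  have := lt_radius hm z
  linarith

lemma contDiff_radius : ContDiff ℝ ∞ (radius hm) := by
  have h : ContDiff ℝ ∞ (tortoiseHomeo hm).symm := (tortoiseHomeo hm).contDiff_symm_deriv
      (fun w => (add_pos (Real.exp_pos w) (by linarith : 0 < 2 * m)).ne')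
      (hasDerivAt_tortoiseLog hm) (by
        change ContDiff ℝ ∞ (tortoiseLog m)
        unfold tortoiseLog
        fun_prop)
  exact contDiff_const.add (Real.contDiff_exp.comp h)

lemma hasDerivAt_radius (z : ℝ) : HasDerivAt (radius hm) (1 - 2 * m / radius hm z) z := by
  set w := (tortoiseHomeo hm).symm z with hw
  have h0 : Real.exp w + 2 * m ≠ 0 := (add_pos (Real.exp_pos w) (by linarith : 0 < 2 * m)).ne'
  have h1 : HasDerivAt (tortoiseHomeo hm).symm (Real.exp w + 2 * m)⁻¹ z :=
    HasDerivAt.of_local_left_inverse (tortoiseHomeo hm).symm.continuous.continuousAt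
      (hasDerivAt_tortoiseLog hm w) h0
      (Eventually.of_forall fun y => (tortoiseHomeo hm).apply_symm_apply y)
  refine (h1.exp.const_add (2 * m)).congr_deriv ?_
  have hr : radius hm z = Real.exp w + 2 * m := add_comm _ _
  rw [hr, ← hw]
  field_simp
  ring

/-- The tortoise coordinate. -/
def tortoise (m r : ℝ) : ℝ := r + 2 * m * Real.log (r - 2 * m)

lemma radius_tortoise {r : ℝ} (hr : 2 * m < r) : radius hm (tortoise m r) = r := by
  have h : tortoise m r = tortoiseHomeo hm (Real.log (r - 2 * m)) := by
    rw [tortoiseHomeo_apply, tortoiseLog, Real.exp_log (by linarith), tortoise]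
    ring
  rw [radius, h, Homeomorph.symm_apply_apply, Real.exp_log (by linarith)]
  ring

lemma tortoise_radius (z : ℝ) : tortoise m (radius hm z) = z := by
  have h : tortoiseHomeo hm ((tortoiseHomeo hm).symm z) = z := Homeomorph.apply_symm_apply _ _
  rw [tortoiseHomeo_apply, tortoiseLog] at h
  rw [tortoise, radius, add_sub_cancel_left, Real.log_exp]
  exact h

include hm in
lemma hasDerivAt_tortoise {r : ℝ} (hr : 2 * m < r) :
    HasDerivAt (tortoise m) (1 - 2 * m / r)⁻¹ r := by
  have h1 : r - 2 * m ≠ 0 := by linarith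
  have h2 : r ≠ 0 := by linarith
  have h3 : 1 - 2 * m / r = (r - 2 * m) / r := by field_simp
  have h := (hasDerivAt_id r).add ((((hasDerivAt_id r).sub_const (2 * m)).log h1).const_mul (2 * m))
  refine h.congr_deriv ?_
  rw [h3]
  simp only [id]
  field_simp
  ring

lemma one_sub_div_pos {r : ℝ} (hm : 0 < m) (hr : 2 * m < r) : 0 < 1 - 2 * m / r := by
  rw [sub_pos, div_lt_one (by linarith)]
  exact hr

/-- A model without identifications. -/
def AdaptedModel.trivialQuotient (A : AdaptedModel V) (hne : A.U.Nonempty) : InvariantModel V where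
  A := A
  D := .trivial A.U A.isOpen hne
  U_eq := rfl
  form_act _ x _ a b := congrArg (fun y => A.form y a b) (add_zero x)
  F_lin _ _ := rfl

/-- The coefficient of the Schwarzschild metric in null coordinates. -/
def schwarzschildFactor (x : ℝ²) : ℝ := -(1 - 2 * m / radius hm ((x.1 - x.2) / 2)) / 2

lemma contDiff_schwarzschildFactor : ContDiff ℝ ∞ (schwarzschildFactor hm) := by
  have h := (contDiff_radius hm).comp (show ContDiff ℝ ∞ fun x : ℝ² => (x.1 - x.2) / 2 by fun_prop)
  exact (contDiff_const.sub (contDiff_const.div h fun x => (radius_pos hm _).ne')).neg.div_const 2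

lemma schwarzschildFactor_ne_zero (x : ℝ²) : schwarzschildFactor hm x ≠ 0 := by
  have := one_sub_div_pos hm (lt_radius hm ((x.1 - x.2) / 2))
  exact (div_neg_of_neg_of_pos (neg_lt_zero.2 this) two_pos).ne

/-- The Schwarzschild half-plane in null coordinates. -/
def schwarzschildModel : AdaptedModel ℝ² :=
  planeModel univ isOpen_univ (schwarzschildFactor hm) (contDiff_schwarzschildFactor hm).contDiffOn
    (fun x _ => schwarzschildFactor_ne_zero hm x) diagF diagF_diagF planeForm_diagF

/-- The Schwarzschild half-plane. -/
def schwarzschild : InvariantModel ℝ² := (schwarzschildModel hm).trivialQuotient ⟨0, trivial⟩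

lemma schwarzschild_proj_eq_iff {x y : ℝ²} :
    (schwarzschild hm).D.proj x = (schwarzschild hm).D.proj y ↔ x = y :=
  (AffineDeck.proj_eq_iff (D := (schwarzschild hm).D) (mem_univ x) (mem_univ y)).trans
    (AffineDeck.trivial_rel _ _ _ _ _)

lemma schwarzschild_leaf_inter (p q : (schwarzschild hm).D.Q) :
    ((schwarzschild hm).str.leaf₁ p ∩ (schwarzschild hm).str.leaf₂ q).encard = 1 := by
  obtain ⟨x, -, rfl⟩ := (schwarzschild hm).D.exists_rep p
  obtain ⟨y, -, rfl⟩ := (schwarzschild hm).D.exists_rep q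
  rw [(schwarzschild hm).leaf₁_univ rfl, (schwarzschild hm).leaf₂_univ rfl, encard_eq_one]
  refine ⟨(schwarzschild hm).D.proj (y.1, x.2), Subset.antisymm ?_ ?_⟩
  · rintro _ ⟨⟨v, hv, rfl⟩, ⟨w, hw, hvw⟩⟩
    have h := (schwarzschild_proj_eq_iff hm).1 hvw
    have hv := (diagF_eq_self_iff v).1 hv
    have hw := (diagF_eq_neg_iff w).1 hw
    have h1 : y.1 + w.1 = x.1 + v.1 := congrArg Prod.fst h
    refine congrArg _ (Prod.ext ?_ ?_)
    · change x.1 + v.1 = y.1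
      rw [← h1, hw, add_zero]
    · change x.2 + v.2 = x.2
      rw [hv, add_zero]
  · rintro _ rfl
    refine ⟨⟨(y.1 - x.1, 0), (diagF_eq_self_iff _).2 rfl, congrArg _ ?_⟩,
      ⟨(0, x.2 - y.2), (diagF_eq_neg_iff _).2 rfl, congrArg _ ?_⟩⟩ <;> ext <;> simp

lemma schwarzschild_not_isFlat : ¬ (schwarzschild hm).str.IsFlat := by
  intro hflat
  have hr : ∀ z, HasDerivAt (fun z => 2 * m / radius hm z)
      (-(2 * m * (1 - 2 * m / radius hm z)) / radius hm z ^ 2) z := fun z => by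
    have h := (hasDerivAt_const z (2 * m)).div (hasDerivAt_radius hm z) (radius_pos hm z).ne'
    rwa [zero_mul, zero_sub] at h
  set η' : ℝ → ℝ := fun z => -(m * (1 - 2 * m / radius hm z)) / radius hm z ^ 2 with hη'
  have hη : ∀ z, HasDerivAt (fun z => -(1 - 2 * m / radius hm z) / 2) (η' z) z := fun z => by
    refine (((hr z).const_sub 1).neg.div_const 2).congr_deriv ?_
    simp only [hη']
    ring
  set z₀ := tortoiseHomeo hm 0 with hz₀
  have hr0 : radius hm z₀ = 2 * m + 1 := by
    rw [radius, hz₀, Homeomorph.symm_apply_apply, Real.exp_zero]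
  have hη2 : HasDerivAt η' (2 * m * (1 - m) / (2 * m + 1) ^ 5) z₀ := by
    have h1 : HasDerivAt (fun z => -(m * (1 - 2 * m / radius hm z))) _ z₀ :=
      (((hr z₀).const_sub 1).const_mul m).neg
    have h2 := h1.div ((hasDerivAt_radius hm z₀).fun_pow 2) (pow_ne_zero 2 (radius_pos hm z₀).ne')
    refine h2.congr_deriv ?_
    rw [hr0]
    have : 2 * m + 1 ≠ 0 := by linarith
    simp only [Nat.cast_ofNat]
    field_simp
    ring
  have hl : ∀ c s : ℝ, HasDerivAt (fun s => (s - c) / 2) (1 / 2) s := fun c s =>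
    ((hasDerivAt_id s).sub_const c).div_const 2
  have hl' : ∀ c s : ℝ, HasDerivAt (fun s => (c - s) / 2) (-1 / 2) s := fun c s =>
    ((hasDerivAt_id s).const_sub c).div_const 2
  have hx : (2 * z₀ - 0) / 2 = z₀ := by ring
  have key := planeModel_curv_ne_zero (hU := isOpen_univ)
    (contDiff_schwarzschildFactor hm).contDiffOn
    (fun x _ => schwarzschildFactor_ne_zero hm x) diagF_diagF planeForm_diagF
    (x := (2 * z₀, 0)) (mem_univ _)
    (k := fun x => η' ((x.1 - x.2) / 2) * (1 / 2)) (n := η' z₀ * (-1 / 2))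
    (m := 2 * m * (1 - m) / (2 * m + 1) ^ 5 * (-1 / 2) * (1 / 2)) ?_ ?_ ?_ ?_
  · exact key (hflat.curv_eq_zero (schwarzschild hm).modelsAt (x := (2 * z₀, 0)) (mem_univ _))
  · exact Eventually.of_forall fun z => by
      have h := (hη ((z.1 - z.2) / 2)).comp z.1 (hl z.2 z.1)
      exact h
  · have := hη ((2 * z₀ - 0) / 2)
    have h2 := this.comp 0 (hl' (2 * z₀) 0)
    rw [hx] at h2
    exact h2
  · have h1 : HasDerivAt η' (2 * m * (1 - m) / (2 * m + 1) ^ 5) ((2 * z₀ - 0) / 2) := by rwa [hx]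
    exact (h1.comp 0 (hl' (2 * z₀) 0)).mul_const (1 / 2)
  · simp only [schwarzschildFactor, hx, hη', hr0]
    have : 2 * m + 1 ≠ 0 := by linarith
    intro h
    field_simp at h
    have hm' := hm.ne'
    ring_nf at h
    nlinarith

lemma schwarzschild_not_compactSpace : ¬ CompactSpace (schwarzschild hm).D.Q :=
  (schwarzschild hm).D.not_compactSpace (f := Prod.fst) continuous_fst.continuousOn
    (fun _ _ _ => add_zero _) fun C => ⟨(C + 1, 0), mem_univ _, lt_add_one C⟩

/-- The null coordinates of the Schwarzschild half-plane. -/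
def nullCoord (m : ℝ) (x : ℝ²) : ℝ² := (x.1 + tortoise m x.2, x.1 - tortoise m x.2)

include hm in
lemma hasFDerivAt_nullCoord {x : ℝ²} (hx : 2 * m < x.2) : HasFDerivAt (nullCoord m)
    ((fst ℝ ℝ ℝ + (1 - 2 * m / x.2)⁻¹ • snd ℝ ℝ ℝ).prod
      (fst ℝ ℝ ℝ - (1 - 2 * m / x.2)⁻¹ • snd ℝ ℝ ℝ)) x := by
  have h : HasFDerivAt (fun x : ℝ² => tortoise m x.2) ((1 - 2 * m / x.2)⁻¹ • snd ℝ ℝ ℝ) x :=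
    (hasDerivAt_tortoise hm hx).comp_hasFDerivAt x hasFDerivAt_snd
  exact (hasFDerivAt_fst.add h).prodMk (hasFDerivAt_fst.sub h)

include hm in
lemma isLocalDiffeomorphAt_nullCoord {x : ℝ²} (hx : 2 * m < x.2) :
    IsLocalDiffeomorphAt 𝓥 ℝ² 𝓥 ℝ² ∞ (nullCoord m) x := by
  have ho : IsOpen {x : ℝ² | 2 * m < x.2} := isOpen_lt continuous_const continuous_snd
  have hs : ContDiffOn ℝ ∞ (nullCoord m) {x : ℝ² | 2 * m < x.2} := by
    have h : ContDiffOn ℝ ∞ (fun x : ℝ² => tortoise m x.2) {x : ℝ² | 2 * m < x.2} := by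
      refine contDiff_snd.contDiffOn.add (contDiffOn_const.mul (ContDiffOn.log (by fun_prop) ?_))
      intro y hy
      exact (sub_pos.2 hy).ne'
    exact (contDiff_fst.contDiffOn.add h).prodMk (contDiff_fst.contDiffOn.sub h)
  refine isLocalDiffeomorphAt_of_injective_mfderiv rfl ho hs.contMDiffOn hx ?_
  rw [mfderiv_eq_fderiv, (hasFDerivAt_nullCoord hm hx).fderiv]
  have h0 := (inv_pos.2 (one_sub_div_pos hm hx)).ne'
  refine (injective_iff_map_eq_zero ((fst ℝ ℝ ℝ + (1 - 2 * m / x.2)⁻¹ • snd ℝ ℝ ℝ).prod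
      (fst ℝ ℝ ℝ - (1 - 2 * m / x.2)⁻¹ • snd ℝ ℝ ℝ))).2 fun a ha => ?_
  have h1 : a.1 + (1 - 2 * m / x.2)⁻¹ * a.2 = 0 := congrArg Prod.fst ha
  have h2 : a.1 - (1 - 2 * m / x.2)⁻¹ * a.2 = 0 := congrArg Prod.snd ha
  exact Prod.ext (show a.1 = 0 by linarith)
    ((mul_eq_zero.1 (show (1 - 2 * m / x.2)⁻¹ * a.2 = 0 by linarith)).resolve_left h0)

include hm in
lemma nullCoord_injOn {x y : ℝ²} (hx : 2 * m < x.2) (hy : 2 * m < y.2)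
    (h : nullCoord m x = nullCoord m y) : x = y := by
  have h1 : x.1 + tortoise m x.2 = y.1 + tortoise m y.2 := congrArg Prod.fst h
  have h2 : x.1 - tortoise m x.2 = y.1 - tortoise m y.2 := congrArg Prod.snd h
  refine Prod.ext (by linarith) ?_
  rw [← radius_tortoise hm hx, ← radius_tortoise hm hy]
  congr 1
  linarith

lemma schwarzschild_isQuotientOf : (schwarzschild hm).str.IsQuotientOf {x | 2 * m < x.2}
    (schwarzschildMetric m) (schwarzschildProduct m) (fun x y => x = y)
    ((schwarzschild hm).D.proj ∘ nullCoord m) := by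
  have hproj : ∀ z : ℝ², IsLocalDiffeomorphAt 𝓥 ℝ² 𝓥 ℝ² ∞ (schwarzschild hm).D.proj z :=
    fun z => (schwarzschild hm).D.isLocalDiffeomorphOn_proj ⟨z, mem_univ z⟩
  have hd : ∀ x : ℝ², 2 * m < x.2 → ∀ a : ℝ²,
      (mfderiv 𝓥 ℝ² 𝓥 ℝ² ((schwarzschild hm).D.proj ∘ nullCoord m) x a : ℝ²) =
      mfderiv 𝓥 ℝ² 𝓥 ℝ² (schwarzschild hm).D.proj (nullCoord m x)
        (a.1 + (1 - 2 * m / x.2)⁻¹ * a.2, a.1 - (1 - 2 * m / x.2)⁻¹ * a.2) := by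
    intro x hx a
    have h := mfderiv_comp x ((hproj (nullCoord m x)).mdifferentiableAt (by simp))
      ((isLocalDiffeomorphAt_nullCoord hm hx).mdifferentiableAt (by simp))
    rw [mfderiv_eq_fderiv, (hasFDerivAt_nullCoord hm hx).fderiv] at h
    exact congrArg (fun L : ℝ² →L[ℝ] ℝ² => L a) h
  have hM := fun z : ℝ² => (schwarzschild hm).modelsAt z (mem_univ z)
  refine ⟨isOpen_lt continuous_const continuous_snd, fun x => ?_, ?_, fun x hx y hy => ?_,
    fun x hx a b => ?_, fun x hx a => ?_⟩
  · exact (isLocalDiffeomorphAt_nullCoord hm x.2).comp _ _ (hproj _)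
  · refine eq_univ_of_forall fun p => ?_
    obtain ⟨z, -, rfl⟩ := (schwarzschild hm).D.exists_rep p
    refine ⟨((z.1 + z.2) / 2, radius hm ((z.1 - z.2) / 2)), lt_radius hm _, ?_⟩
    refine congrArg (schwarzschild hm).D.proj ?_
    ext <;> simp only [nullCoord, tortoise_radius] <;> ring
  · exact (schwarzschild_proj_eq_iff hm).trans ⟨nullCoord_injOn hm hx hy, fun h => by rw [h]⟩
  · refine (congrArg₂ (fun v w : ℝ² => (schwarzschild hm).str.g
      ((schwarzschild hm).D.proj (nullCoord m x)) v w) (hd x hx a) (hd x hx b)).trans ?_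
    refine ((hM (nullCoord m x)).g_eq _ _).trans ?_
    change (-(1 - 2 * m / radius hm (((nullCoord m x).1 - (nullCoord m x).2) / 2)) / 2) *
      planeForm (diagF _) _ = _
    have h1 : ((nullCoord m x).1 - (nullCoord m x).2) / 2 = tortoise m x.2 := by
      simp only [nullCoord]
      ring
    have h2 := (one_sub_div_pos hm hx).ne'
    rw [h1, radius_tortoise hm hx]
    simp only [planeForm_apply, diagF_apply, schwarzschildMetric]
    field_simp
    ring
  · refine (congrArg (fun v : ℝ² => (schwarzschild hm).str.F
      ((schwarzschild hm).D.proj (nullCoord m x)) v) (hd x hx a)).trans ?_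
    refine ((hM (nullCoord m x)).F_eq _).trans (Eq.trans ?_ (hd x hx _).symm)
    have h2 := (one_sub_div_pos hm hx).ne'
    refine congrArg (mfderiv 𝓥 ℝ² 𝓥 ℝ² (schwarzschild hm).D.proj (nullCoord m x) : ℝ² →L[ℝ] ℝ²) ?_
    change diagF _ = _
    rw [diagF_apply]
    ext <;> simp only [schwarzschildProduct] <;> field_simp <;> ring

end Schwarzschild

section Hyperboloid

namespace AffineDeck

variable (D : AffineDeck V)

/-- The restriction of a group of affine transformations to an invariant open set. -/
def restrict (U : Set V) (hU : IsOpen U) (hne : U.Nonempty) (h : U ⊆ D.U)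
    (hmaps : ∀ i, ∀ x ∈ U, D.act i x ∈ U) : AffineDeck V where
  U := U
  isOpen := hU
  nonempty := hne
  ι := D.ι
  lin := D.lin
  shift := D.shift
  one := D.one
  mul := D.mul
  inv := D.inv
  maps := hmaps
  sep x hx y hy := D.sep x (h hx) y (h hy)

/-- The map induced on the quotient by an invariant map. -/
def lift {W : Type} (f : V → W) (q : D.Q) : W := f (D.exists_rep q).choose

variable {D} {W : Type} {f : V → W} (hf : ∀ i, ∀ x ∈ D.U, f (D.act i x) = f x)

include hf in
lemma lift_proj {x : V} (hx : x ∈ D.U) : D.lift f (D.proj x) = f x := by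
  obtain ⟨h1, h2⟩ := (D.exists_rep (D.proj x)).choose_spec
  obtain ⟨i, hi⟩ := (proj_eq_iff h1 hx).1 h2
  exact ((congrArg f hi).trans (hf i _ h1)).symm

variable [NormedAddCommGroup W] [NormedSpace ℝ W]

include hf in
lemma contMDiff_lift (hs : ContDiffOn ℝ ∞ f D.U) : ContMDiff 𝓥 V 𝓥 W ∞ (D.lift f) := by
  intro q
  obtain ⟨x, hx, rfl⟩ := D.exists_rep q
  have hχ := D.isLocalDiffeomorphOn_proj ⟨x, hx⟩
  have h2 : hχ.localInverse (D.proj x) = x := hχ.localInverse_left_inv hχ.localInverse_mem_target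
  have h1 : ContMDiffAt 𝓥 V 𝓥 W ∞ (f ∘ hχ.localInverse) (D.proj x) :=
    ContMDiffAt.comp _ (by rw [h2]; exact (hs.contDiffAt (D.isOpen.mem_nhds hx)).contMDiffAt)
      hχ.localInverse_contMDiffAt
  have h3 : ∀ᶠ q in 𝓝 (D.proj x), hχ.localInverse q ∈ D.U :=
    hχ.localInverse_contMDiffAt.continuousAt.eventually (by rw [h2]; exact D.isOpen.mem_nhds hx)
  refine h1.congr_of_eventuallyEq ?_
  filter_upwards [hχ.localInverse_eventuallyEq_right, h3] with q hq hq'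
  exact (congrArg _ hq.symm).trans (lift_proj hf hq')

include hf in
lemma mfderiv_lift (hs : ContDiffOn ℝ ∞ f D.U) {x : V} (hx : x ∈ D.U) (a : V) :
    (mfderiv 𝓥 V 𝓥 W (D.lift f) (D.proj x) (mfderiv 𝓥 V 𝓥 V D.proj x a) : W) = 𝐃 f x a := by
  have h1 : D.lift f ∘ D.proj =ᶠ[𝓝 x] f := by
    filter_upwards [D.isOpen.mem_nhds hx] with z hz using lift_proj hf hz
  have h2 := mfderiv_comp x ((contMDiff_lift hf hs).mdifferentiable (by simp) (D.proj x))
    ((D.isLocalDiffeomorphOn_proj ⟨x, hx⟩).mdifferentiableAt (by simp))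
  have h3 := h1.mfderiv_eq (I := 𝓥 V) (I' := 𝓥 W)
  have h4 : mfderiv 𝓥 V 𝓥 W f x = 𝐃 f x := mfderiv_eq_fderiv
  exact congrArg (fun L : V →L[ℝ] W => L a) (h2.symm.trans (h3.trans h4))

end AffineDeck

/-- A straight line of a ruling of the hyperboloid. -/
def rulingLine (r ε θ τ : ℝ) : Fin 3 → ℝ :=
  ![r * τ, r * (cos θ - ε * τ * sin θ), r * (sin θ + ε * τ * cos θ)]

lemma rulingDirection_rulingLine {r ε θ τ : ℝ} (hε : ε * ε = 1) :
    rulingDirection r ε (rulingLine r ε θ τ) =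
      (r ^ 2 * (1 + τ ^ 2)) • ![1, -(ε * sin θ), ε * cos θ] := by
  ext i
  fin_cases i <;> simp [rulingDirection, rulingLine]
  · ring
  · linear_combination -(r ^ 2 * τ * cos θ) * hε
  · linear_combination -(r ^ 2 * τ * sin θ) * hε

lemma range_rulingLine {r ε θ τ : ℝ} (hr : 0 < r) (hε : ε * ε = 1) :
    range (rulingLine r ε θ) = range fun s : ℝ => rulingLine r ε θ τ +
      s • rulingDirection r ε (rulingLine r ε θ τ) := by
  have hτ : 0 < 1 + τ ^ 2 := by positivity
  have key : ∀ s, rulingLine r ε θ τ + s • rulingDirection r ε (rulingLine r ε θ τ) =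
      rulingLine r ε θ (τ + s * r * (1 + τ ^ 2)) := fun s => by
    rw [rulingDirection_rulingLine hε]
    ext i
    fin_cases i <;> simp [rulingLine] <;> ring
  simp only [key]
  refine Subset.antisymm ?_ ?_
  · rintro _ ⟨t, rfl⟩
    exact ⟨(t - τ) / (r * (1 + τ ^ 2)), congrArg _ (by field_simp; ring)⟩
  · rintro _ ⟨s, rfl⟩
    exact ⟨_, rfl⟩

lemma hasDerivAt_tan' {u : ℝ} (hu : cos u ≠ 0) : HasDerivAt Real.tan (1 + Real.tan u ^ 2) u := by
  refine (Real.hasDerivAt_tan hu).congr_deriv ?_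
  have := Real.inv_one_add_tan_sq hu
  rw [← this, one_div, inv_inv]

/-- The domain of the parametrization of the hyperboloid. -/
def strip : Set ℝ² := {z | |z.1 - z.2| < Real.pi}

lemma isOpen_strip : IsOpen strip := isOpen_lt (by fun_prop) continuous_const

lemma convex_strip : Convex ℝ strip := by
  have h := (convex_Ioo (-Real.pi) Real.pi).is_linear_preimage (f := fun z : ℝ² => z.1 - z.2)
    ⟨fun x y => add_sub_add_comm _ _ _ _, fun c x => (mul_sub c x.1 x.2).symm⟩
  rwa [show strip = _ from ext fun z => abs_lt (a := z.1 - z.2)]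

lemma cos_half_pos {z : ℝ²} (hz : z ∈ strip) : 0 < cos ((z.1 - z.2) / 2) := by
  have := abs_lt.1 (show |z.1 - z.2| < Real.pi from hz)
  exact Real.cos_pos_of_mem_Ioo ⟨by linarith [this.1], by linarith [this.2]⟩

/-- The stripSlope parameter of a point of the hyperboloid. -/
def stripSlope (z : ℝ²) : ℝ := Real.tan ((z.1 - z.2) / 2)

lemma hasFDerivAt_slope {z : ℝ²} (hz : z ∈ strip) : HasFDerivAt stripSlope
    (((1 + stripSlope z ^ 2) / 2) • (fst ℝ ℝ ℝ - snd ℝ ℝ ℝ)) z := by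
  have h1 : HasFDerivAt (fun z : ℝ² => (z.1 - z.2) / 2)
      ((2 : ℝ)⁻¹ • (fst ℝ ℝ ℝ - snd ℝ ℝ ℝ)) z := by
    refine ((2 : ℝ)⁻¹ • (fst ℝ ℝ ℝ - snd ℝ ℝ ℝ)).hasFDerivAt.congr_of_eventuallyEq
      (Eventually.of_forall fun w => ?_)
    simp
    ring
  refine ((hasDerivAt_tan' (cos_half_pos hz).ne').comp_hasFDerivAt z h1).congr_fderiv ?_
  rw [smul_smul]
  rfl

lemma contDiffOn_slope : ContDiffOn ℝ ∞ stripSlope strip := fun z hz =>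
  ((Real.contDiffAt_tan.2 (cos_half_pos hz).ne').comp z (by fun_prop)).contDiffWithinAt

/-- The parametrization of the hyperboloid. -/
def hyperboloidParam (r : ℝ) (z : ℝ²) : Fin 3 → ℝ := rulingLine r 1 z.2 (stripSlope z)

lemma hyperboloidParam_eq (r : ℝ) {z : ℝ²} (hz : z ∈ strip) :
    hyperboloidParam r z = rulingLine r (-1) z.1 (stripSlope z) := by
  have h := (cos_half_pos hz).ne'
  set δ := (z.1 - z.2) / 2 with hδ
  have h1 : z.1 = z.2 + δ + δ := by rw [hδ]; ring
  have h2 := Real.sin_sq_add_cos_sq δ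
  ext i
  fin_cases i <;> simp [hyperboloidParam, rulingLine, stripSlope, ← hδ, Real.tan_eq_sin_div_cos] <;>
    rw [h1] <;> simp only [Real.cos_add, Real.sin_add] <;> field_simp <;> left
  · linear_combination (-cos δ * cos z.2 + sin z.2 * sin δ) * h2
  · linear_combination (-cos δ * sin z.2 - cos z.2 * sin δ) * h2

lemma contDiffOn_hyperboloidParam (r : ℝ) : ContDiffOn ℝ ∞ (hyperboloidParam r) strip := by
  have h := contDiffOn_slope
  refine contDiffOn_pi.2 fun i => ?_
  fin_cases i <;> simp [hyperboloidParam, rulingLine] <;> fun_prop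

/-- The derivative of a family of points on moving lines. -/
lemma hasFDerivAt_rulingLine (r ε : ℝ) (ℓ : ℝ² →L[ℝ] ℝ) {z : ℝ²} (hz : z ∈ strip) :
    HasFDerivAt (fun z => rulingLine r ε (ℓ z) (stripSlope z))
      ((((1 + stripSlope z ^ 2) / 2) • (fst ℝ ℝ ℝ - snd ℝ ℝ ℝ)).smulRight
          (r • ![1, -(ε * sin (ℓ z)), ε * cos (ℓ z)]) +
        ℓ.smulRight (r • ![0, -sin (ℓ z) - ε * stripSlope z * cos (ℓ z),
          cos (ℓ z) - ε * stripSlope z * sin (ℓ z)])) z := by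
  have hs := hasFDerivAt_slope hz
  have hc := ℓ.hasFDerivAt (x := z) |>.cos
  have hn := ℓ.hasFDerivAt (x := z) |>.sin
  refine hasFDerivAt_pi'.2 fun i => ?_
  fin_cases i
  · refine (hs.const_mul r).congr_fderiv ?_
    ext <;> simp <;> ring
  · refine ((hc.sub ((hs.const_mul ε).mul hn)).const_mul r).congr_fderiv ?_
    ext <;> simp <;> ring
  · refine ((hn.add ((hs.const_mul ε).mul hc)).const_mul r).congr_fderiv ?_
    ext <;> simp <;> ring

/-- The motion of a point in the direction of the ruling. -/
lemma ruling_iff {r ε θ τ b c : ℝ} (hr : 0 < r) (hε : ε * ε = 1) :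
    (∃ s : ℝ, c • (r • ![1, -(ε * sin θ), ε * cos θ]) +
        b • (r • ![0, -sin θ - ε * τ * cos θ, cos θ - ε * τ * sin θ]) =
      s • rulingDirection r ε (rulingLine r ε θ τ)) ↔ b = 0 := by
  have hτ : 0 < 1 + τ ^ 2 := by positivity
  rw [rulingDirection_rulingLine hε]
  constructor
  · rintro ⟨s, hs⟩
    have h0 : c * (r * 1) + b * (r * 0) = s * (r ^ 2 * (1 + τ ^ 2) * 1) := congrFun hs 0
    have h1 : c * (r * -(ε * sin θ)) + b * (r * (-sin θ - ε * τ * cos θ)) =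
      s * (r ^ 2 * (1 + τ ^ 2) * -(ε * sin θ)) := congrFun hs 1
    have h2 : c * (r * (ε * cos θ)) + b * (r * (cos θ - ε * τ * sin θ)) =
      s * (r ^ 2 * (1 + τ ^ 2) * (ε * cos θ)) := congrFun hs 2
    have h3 := Real.sin_sq_add_cos_sq θ
    have h4 : b * r = 0 := by
      linear_combination cos θ * h2 - sin θ * h1 - ε * h0 - b * r * h3 -
        (c * ε * r - s * r ^ 2 * (1 + τ ^ 2) * ε) * h3
    exact (mul_eq_zero.1 h4).resolve_right hr.ne'
  · rintro rfl
    refine ⟨c / (r * (1 + τ ^ 2)), ?_⟩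
    rw [zero_smul, add_zero, smul_smul, smul_smul]
    congr 1
    field_simp

variable {r : ℝ} (hr : 0 < r)

lemma hyperboloid_mem_ruling₁ (hr : 0 < r) {z : ℝ²} (hz : z ∈ strip) (a : ℝ²) :
    (∃ s : ℝ, 𝐃 (hyperboloidParam r) z a =
      s • rulingDirection r 1 (hyperboloidParam r z)) ↔ a.2 = 0 := by
  have h : 𝐃 (hyperboloidParam r) z = _ := (hasFDerivAt_rulingLine r 1 (snd ℝ ℝ ℝ) hz).fderiv
  rw [h]
  exact ruling_iff hr (one_mul 1)

lemma hyperboloid_mem_ruling₂ (hr : 0 < r) {z : ℝ²} (hz : z ∈ strip) (a : ℝ²) :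
    (∃ s : ℝ, 𝐃 (hyperboloidParam r) z a =
      s • rulingDirection r (-1) (hyperboloidParam r z)) ↔ a.1 = 0 := by
  have h0 : hyperboloidParam r =ᶠ[𝓝 z] fun z => rulingLine r (-1) (fst ℝ ℝ ℝ z) (stripSlope z) := by
    filter_upwards [isOpen_strip.mem_nhds hz] with w hw using hyperboloidParam_eq r hw
  rw [h0.fderiv_eq, (hasFDerivAt_rulingLine r (-1) (fst ℝ ℝ ℝ) hz).fderiv, h0.eq_of_nhds]
  exact ruling_iff hr (by norm_num)

lemma lorentz3_hyperboloidParam (r : ℝ) {z : ℝ²} (hz : z ∈ strip) (a b : ℝ²) :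
    lorentz3 (𝐃 (hyperboloidParam r) z a) (𝐃 (hyperboloidParam r) z b) =
      r ^ 2 * (1 + stripSlope z ^ 2) / 2 * (a.1 * b.2 + a.2 * b.1) := by
  have h : 𝐃 (hyperboloidParam r) z = _ := (hasFDerivAt_rulingLine r 1 (snd ℝ ℝ ℝ) hz).fderiv
  have h3 := Real.sin_sq_add_cos_sq z.2
  rw [h]
  simp [lorentz3]
  linear_combination (r ^ 2 * (1 + stripSlope z ^ 2) / 2 * (a.1 * b.2 + a.2 * b.1) -
    (r * ((1 + stripSlope z ^ 2) / 2 * (a.1 - a.2))) * (-(r *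
        ((1 + stripSlope z ^ 2) / 2 * (b.1 - b.2))))) * h3

end Hyperboloid

section HyperboloidManifold

/-- The translations by the multiples of `(2π, 2π)`. -/
def angleDeck : AffineDeck ℝ² :=
  (AffineDeck.translations (AddSubgroup.zmultiples ((2 * Real.pi, 2 * Real.pi) : ℝ²)) 1 one_pos (by
      rintro _ ⟨k, rfl⟩ hk
      have hk0 : k ≠ 0 := fun h => hk (by simp [h])
      have h1 : (1 : ℝ) ≤ |(k : ℝ)| := by exact_mod_cast Int.one_le_abs hk0
      have h2 : ‖k • ((2 * Real.pi, 2 * Real.pi) : ℝ²)‖ = |(k : ℝ)| * (2 * Real.pi) := by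
        simp [Prod.norm_def, abs_of_pos Real.pi_pos]
      have := Real.pi_gt_three
      change 1 ≤ ‖k • ((2 * Real.pi, 2 * Real.pi) : ℝ²)‖
      rw [h2]
      nlinarith)).restrict strip isOpen_strip ⟨0, by simp [strip, Real.pi_pos]⟩ (subset_univ _)
    (by
      rintro ⟨_, k, rfl⟩ x hx
      have h : (x.1 + (k • ((2 * Real.pi, 2 * Real.pi) : ℝ²)).1) -
          (x.2 + (k • ((2 * Real.pi, 2 * Real.pi) : ℝ²)).2) = x.1 - x.2 := by
        simp
      exact (congrArg abs h).trans_lt hx)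

lemma angleDeck_act (i : angleDeck.ι) : ∃ k : ℤ, ∀ x,
    angleDeck.act i x = (x.1 + k * (2 * Real.pi), x.2 + k * (2 * Real.pi)) := by
  obtain ⟨_, k, rfl⟩ := i
  refine ⟨k, fun x => ?_⟩
  change x + k • ((2 * Real.pi, 2 * Real.pi) : ℝ²) = _
  ext <;> simp

lemma angleDeck_rel_iff {x y : ℝ²} : angleDeck.Rel x y ↔
    ∃ k : ℤ, y = (x.1 + k * (2 * Real.pi), x.2 + k * (2 * Real.pi)) := by
  constructor
  · rintro ⟨i, rfl⟩
    obtain ⟨k, hk⟩ := angleDeck_act i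
    exact ⟨k, hk x⟩
  · rintro ⟨k, rfl⟩
    refine ⟨(⟨_, k, rfl⟩ : AddSubgroup.zmultiples ((2 * Real.pi, 2 * Real.pi) : ℝ²)), ?_⟩
    change _ = x + k • ((2 * Real.pi, 2 * Real.pi) : ℝ²)
    ext <;> simp

variable {r : ℝ} (hr : 0 < r)

/-- The hyperboloid. -/
def hyperboloid : InvariantModel ℝ² where
  A := planeModel strip isOpen_strip (fun z => r ^ 2 * (1 + stripSlope z ^ 2) / 2)
    (by have := contDiffOn_slope; fun_prop) (fun z _ => by positivity) diagF diagF_diagF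
    planeForm_diagF
  D := angleDeck
  U_eq := rfl
  form_act i x _ a b := by
    obtain ⟨k, hk⟩ := angleDeck_act i
    change r ^ 2 * (1 + stripSlope (angleDeck.act i x) ^ 2) / 2 * planeForm a b =
      r ^ 2 * (1 + stripSlope x ^ 2) / 2 * planeForm a b
    rw [hk, stripSlope, stripSlope, add_sub_add_right_eq_sub]
  F_lin _ _ := rfl

lemma hyperboloidParam_act (r : ℝ) (i : angleDeck.ι) (x : ℝ²) :
    hyperboloidParam r (angleDeck.act i x) = hyperboloidParam r x := by
  obtain ⟨k, hk⟩ := angleDeck_act i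
  rw [hk, hyperboloidParam, hyperboloidParam, stripSlope, stripSlope, add_sub_add_right_eq_sub,
    rulingLine, rulingLine, Real.cos_add_int_mul_two_pi, Real.sin_add_int_mul_two_pi]

/-- The embedding of the hyperboloid. -/
def hyperboloidMap (r : ℝ) : angleDeck.Q → Fin 3 → ℝ := angleDeck.lift (hyperboloidParam r)

lemma hyperboloidMap_proj (r : ℝ) {x : ℝ²} (hx : x ∈ strip) :
    hyperboloidMap r (angleDeck.proj x) = hyperboloidParam r x :=
  AffineDeck.lift_proj (fun i x _ => hyperboloidParam_act r i x) hx

lemma contMDiff_hyperboloidMap (r : ℝ) : ContMDiff 𝓥 ℝ² 𝓘(ℝ, Fin 3 → ℝ) ∞ (hyperboloidMap r) :=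
  AffineDeck.contMDiff_lift (fun i x _ => hyperboloidParam_act r i x)
    (contDiffOn_hyperboloidParam r)

lemma mfderiv_hyperboloidMap (r : ℝ) {x : ℝ²} (hx : x ∈ strip) (a : ℝ²) :
    (mfderiv 𝓥 ℝ² 𝓘(ℝ, Fin 3 → ℝ) (hyperboloidMap r) (angleDeck.proj x)
      (mfderiv 𝓥 ℝ² 𝓥 ℝ² angleDeck.proj x a) : Fin 3 → ℝ) =
      𝐃 (hyperboloidParam r) x a :=
  AffineDeck.mfderiv_lift (fun i x _ => hyperboloidParam_act r i x)
    (contDiffOn_hyperboloidParam r) hx a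

lemma abs_two_mul_arctan_lt (τ : ℝ) : |2 * Real.arctan τ| < Real.pi := by
  rw [abs_lt]
  constructor <;> linarith [Real.neg_pi_div_two_lt_arctan τ, Real.arctan_lt_pi_div_two τ]

include hr

lemma rulingLine_inj {ε θ θ' τ τ' : ℝ} (h : rulingLine r ε θ τ = rulingLine r ε θ' τ')
    (hε : ε * ε = 1) :
    τ = τ' ∧ ∃ k : ℤ, θ = θ' + k * (2 * Real.pi) := by
  have h0 : r * τ = r * τ' := congrFun h 0
  have h1 : r * (cos θ - ε * τ * sin θ) = r * (cos θ' - ε * τ' * sin θ') := congrFun h 1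
  have h2 : r * (sin θ + ε * τ * cos θ) = r * (sin θ' + ε * τ' * cos θ') := congrFun h 2
  obtain rfl := mul_left_cancel₀ hr.ne' h0
  have h1 := mul_left_cancel₀ hr.ne' h1
  have h2 := mul_left_cancel₀ hr.ne' h2
  have hτ : 1 + τ ^ 2 ≠ 0 := by positivity
  have hc : cos θ = cos θ' := mul_left_cancel₀ hτ (by
    linear_combination h1 + ε * τ * h2 - τ ^ 2 * (cos θ - cos θ') * hε)
  have hs : sin θ = sin θ' := mul_left_cancel₀ hτ (by
    linear_combination h2 - ε * τ * h1 - τ ^ 2 * (sin θ - sin θ') * hε)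
  obtain ⟨k, hk⟩ := Real.Angle.angle_eq_iff_two_pi_dvd_sub.1 (Real.Angle.cos_sin_inj hc hs)
  exact ⟨rfl, k, by linarith⟩

lemma stripSlope_inj {x y : ℝ²} (hx : x ∈ strip) (hy : y ∈ strip)
    (h : stripSlope x = stripSlope y) : x.1 - x.2 = y.1 - y.2 := by
  have h1 := abs_lt.1 (show |x.1 - x.2| < Real.pi from hx)
  have h2 := abs_lt.1 (show |y.1 - y.2| < Real.pi from hy)
  have := Real.tan_inj_of_lt_of_lt_pi_div_two (by linarith) (by linarith) (by linarith)
    (by linarith) h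
  linarith

lemma hyperboloidMap_injective : Function.Injective (hyperboloidMap r) := by
  intro p q h
  obtain ⟨x, hx, rfl⟩ := angleDeck.exists_rep p
  obtain ⟨y, hy, rfl⟩ := angleDeck.exists_rep q
  rw [hyperboloidMap_proj r hx, hyperboloidMap_proj r hy] at h
  obtain ⟨h1, k, hk⟩ := rulingLine_inj hr h.symm (one_mul 1)
  have h2 := stripSlope_inj hr hx hy h1.symm
  exact (AffineDeck.proj_eq_iff hx hy).2 (angleDeck_rel_iff.2
      ⟨k, Prod.ext (by simp only; linarith) hk⟩)

lemma exists_strip_of_mem {x : Fin 3 → ℝ} (hx : lorentz3 x x = r ^ 2) :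
    ∃ z ∈ strip, stripSlope z = x 0 / r ∧ z.2 ∈ Icc (-(3 * Real.pi)) (3 * Real.pi) ∧
      hyperboloidParam r z = x := by
  set τ := x 0 / r with hτ
  have h0 : x 0 = r * τ := by rw [hτ]; field_simp
  have hτ0 : 1 + τ ^ 2 ≠ 0 := by positivity
  have hx' : x 1 * x 1 + x 2 * x 2 = r ^ 2 * (1 + τ ^ 2) := by
    simp only [lorentz3, h0] at hx
    linarith
  set w : ℂ := ⟨(x 1 + τ * x 2) / (r * (1 + τ ^ 2)), (x 2 - τ * x 1) / (r * (1 + τ ^ 2))⟩ with hw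
  have hwn : ‖w‖ = 1 := by
    rw [← sq_eq_sq₀ (norm_nonneg _) zero_le_one, one_pow, ← Complex.normSq_eq_norm_sq,
      Complex.normSq_mk]
    have := hr.ne'
    field_simp
    linear_combination (1 + τ ^ 2) * hx'
  have hc := Complex.norm_mul_cos_arg w
  have hs := Complex.norm_mul_sin_arg w
  rw [hwn, one_mul] at hc hs
  have ha := Complex.abs_arg_le_pi w
  have ha := abs_le.1 ha
  have hp := Real.pi_pos
  have hz : (w.arg + 2 * Real.arctan τ, w.arg) ∈ strip := by
    change |w.arg + 2 * Real.arctan τ - w.arg| < Real.pi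
    rw [add_sub_cancel_left]
    exact abs_two_mul_arctan_lt τ
  have hsl : stripSlope (w.arg + 2 * Real.arctan τ, w.arg) = τ := by
    rw [stripSlope, add_sub_cancel_left, mul_div_cancel_left₀ _ two_ne_zero, Real.tan_arctan]
  refine ⟨_, hz, hsl, ⟨by linarith [ha.1], by linarith [ha.2]⟩, ?_⟩
  rw [hyperboloidParam, hsl, rulingLine, hc, hs]
  ext i
  fin_cases i
  · exact h0.symm
  · simp [hw]
    field_simp
    ring
  · simp [hw]
    field_simp
    ring

lemma hyperboloidParam_mem (z : ℝ²) :
    lorentz3 (hyperboloidParam r z) (hyperboloidParam r z) = r ^ 2 := by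
  simp [lorentz3, hyperboloidParam, rulingLine]
  linear_combination r ^ 2 * (1 + stripSlope z ^ 2) * Real.sin_sq_add_cos_sq z.2

lemma hyperboloidMap_range : range (hyperboloidMap r) = {x | lorentz3 x x = r ^ 2} := by
  refine Subset.antisymm ?_ fun x hx => ?_
  · rintro _ ⟨p, rfl⟩
    obtain ⟨z, hz, rfl⟩ := angleDeck.exists_rep p
    rw [hyperboloidMap_proj r hz]
    exact hyperboloidParam_mem hr z
  · obtain ⟨z, hz, -, -, h⟩ := exists_strip_of_mem hr hx
    exact ⟨angleDeck.proj z, (hyperboloidMap_proj r hz).trans h⟩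

lemma hyperboloidMap_isClosedEmbedding : IsClosedEmbedding (hyperboloidMap r) := by
  have hc : Continuous (hyperboloidMap r) := (contMDiff_hyperboloidMap r).continuous
  have hprop : IsProperMap (hyperboloidMap r) := by
    refine isProperMap_iff_isCompact_preimage.2 ⟨hc, fun K hK => ?_⟩
    obtain ⟨C, hC⟩ := (hK.image (f := fun x : Fin 3 → ℝ => |x 0|) (by fun_prop)).bddAbove
    have hL : IsCompact ((fun z : ℝ² => (z.2 + 2 * Real.arctan z.1, z.2)) ''
        (Icc (-(C / r)) (C / r) ×ˢ Icc (-(3 * Real.pi)) (3 * Real.pi))) := by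
      refine (isCompact_Icc.prod isCompact_Icc).image ?_
      have := Real.continuous_arctan
      fun_prop
    have hLs : (fun z : ℝ² => (z.2 + 2 * Real.arctan z.1, z.2)) ''
        (Icc (-(C / r)) (C / r) ×ˢ Icc (-(3 * Real.pi)) (3 * Real.pi)) ⊆ strip := by
      rintro _ ⟨z, -, rfl⟩
      change |z.2 + 2 * Real.arctan z.1 - z.2| < Real.pi
      rw [add_sub_cancel_left]
      exact abs_two_mul_arctan_lt _
    refine (hL.image_of_continuousOn (angleDeck.continuousOn_proj.mono hLs)).of_isClosed_subset
      (hK.isClosed.preimage hc) fun p hp => ?_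
    have hm : hyperboloidMap r p ∈ {x | lorentz3 x x = r ^ 2} :=
      hyperboloidMap_range hr ▸ mem_range_self p
    obtain ⟨z, hz, h1, h2, h3⟩ := exists_strip_of_mem hr hm
    have hzp : angleDeck.proj z = p :=
      hyperboloidMap_injective hr ((hyperboloidMap_proj r hz).trans h3)
    have h4 := hC (mem_image_of_mem _ hp)
    refine ⟨z, ⟨(stripSlope z, z.2), ⟨?_, h2⟩, ?_⟩, hzp⟩
    · change stripSlope z ∈ _
      rw [h1, mem_Icc, ← abs_le, abs_div, abs_of_pos hr]
      exact div_le_div_of_nonneg_right h4 hr.le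
    · have := abs_lt.1 (show |z.1 - z.2| < Real.pi from hz)
      refine Prod.ext ?_ rfl
      change z.2 + 2 * Real.arctan (Real.tan _) = z.1
      rw [Real.arctan_tan (by linarith) (by linarith)]
      ring
  exact .of_continuous_injective_isClosedMap hc (hyperboloidMap_injective hr) hprop.isClosedMap

lemma hyperboloid_leaf {Δ : DistField 𝓥 ℝ² angleDeck.Q} {K : ℝ² →L[ℝ] ℝ²} {ℓ : ℝ² →L[ℝ] ℝ}
    (hK : ∀ v, diagF v = K v ↔ ℓ v = 0) (hD : ∀ z ∈ strip, ∀ a : ℝ²,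
      mfderiv 𝓥 ℝ² 𝓥 ℝ² angleDeck.proj z a ∈ Δ (angleDeck.proj z) ↔ diagF a = K a)
    {x : ℝ²} (hx : x ∈ strip) :
    leaf 𝓥 ℝ² Δ (angleDeck.proj x) = angleDeck.proj '' {y | y ∈ strip ∧ ℓ y = ℓ x} := by
  refine (hyperboloid hr).leaf_eq (ℓ := fun x y => ℓ y = ℓ x) hD
    (fun x _ => Eventually.of_forall fun y h => ?_) (fun _ _ _ _ h => h.symm)
    (fun _ _ _ _ _ _ h h' => h'.trans h) (fun i x _ y _ h => ?_)
    (fun x hx y hy h => ⟨(hK _).2 (by rw [map_sub, h, sub_self]), fun s hs =>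
      convex_strip.add_smul_sub_mem hx hy hs⟩) hx
  · exact sub_eq_zero.1 ((map_sub ℓ y x).symm.trans ((hK _).1 h))
  · obtain ⟨k, hk⟩ := angleDeck_act i
    have : ∀ x, angleDeck.act i x = x + (k * (2 * Real.pi), k * (2 * Real.pi)) := hk
    change ℓ (angleDeck.act i y) = ℓ (angleDeck.act i x)
    rw [this, this, map_add, map_add, h]

lemma hyperboloid_leaf₁ {x : ℝ²} (hx : x ∈ strip) : (hyperboloid hr).str.leaf₁ (angleDeck.proj x) =
    angleDeck.proj '' {y | y ∈ strip ∧ y.2 = x.2} :=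
  hyperboloid_leaf hr (ℓ := snd ℝ ℝ ℝ) diagF_eq_self_iff (hyperboloid hr).mem_D₁ hx

lemma hyperboloid_leaf₂ {x : ℝ²} (hx : x ∈ strip) : (hyperboloid hr).str.leaf₂ (angleDeck.proj x) =
    angleDeck.proj '' {y | y ∈ strip ∧ y.1 = x.1} :=
  hyperboloid_leaf hr (ℓ := fst ℝ ℝ ℝ) diagF_eq_neg_iff (hyperboloid hr).mem_D₂ hx

omit hr in
/-- The points of a ruling are parametrized by the slope. -/
lemma image_stripSlope {ε : ℝ} {ℓ : ℝ² → ℝ} {g : ℝ² → Fin 3 → ℝ} {x : ℝ²}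
    (hg : ∀ z ∈ strip, g z = rulingLine r ε (ℓ z) (stripSlope z))
    (hℓ : ∀ u : ℝ, |u| < Real.pi → ∃ z : ℝ², z.1 - z.2 = u ∧ ℓ z = ℓ x) :
    g '' {y | y ∈ strip ∧ ℓ y = ℓ x} = range (rulingLine r ε (ℓ x)) := by
  refine Subset.antisymm ?_ ?_
  · rintro _ ⟨y, ⟨hy, h⟩, rfl⟩
    exact ⟨stripSlope y, by rw [hg y hy, h]⟩
  · rintro _ ⟨τ, rfl⟩
    obtain ⟨z, hz, hzx⟩ := hℓ _ (abs_two_mul_arctan_lt τ)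
    have hzs : z ∈ strip := (congrArg abs hz).trans_lt (abs_two_mul_arctan_lt τ)
    refine ⟨z, ⟨hzs, hzx⟩, ?_⟩
    rw [hg z hzs, hzx, stripSlope, hz, mul_div_cancel_left₀ _ two_ne_zero, Real.tan_arctan]

lemma hyperboloid_image_leaf₁ (p : angleDeck.Q) :
    hyperboloidMap r '' (hyperboloid hr).str.leaf₁ p = range fun s : ℝ =>
      hyperboloidMap r p + s • rulingDirection r 1 (hyperboloidMap r p) := by
  obtain ⟨x, hx, rfl⟩ := angleDeck.exists_rep p
  rw [hyperboloid_leaf₁ hr hx, image_image, hyperboloidMap_proj r hx]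
  refine (image_stripSlope (r := r) (ε := 1) (ℓ := Prod.snd)
    (fun z hz => hyperboloidMap_proj r hz) fun u _ => ⟨(x.2 + u, x.2), by simp, rfl⟩).trans ?_
  exact range_rulingLine hr (one_mul 1)

lemma hyperboloid_image_leaf₂ (p : angleDeck.Q) :
    hyperboloidMap r '' (hyperboloid hr).str.leaf₂ p = range fun s : ℝ =>
      hyperboloidMap r p + s • rulingDirection r (-1) (hyperboloidMap r p) := by
  obtain ⟨x, hx, rfl⟩ := angleDeck.exists_rep p
  rw [hyperboloid_leaf₂ hr hx, image_image, hyperboloidMap_proj r hx]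
  refine (image_stripSlope (r := r) (ε := -1) (ℓ := Prod.fst)
    (fun z hz => (hyperboloidMap_proj r hz).trans (hyperboloidParam_eq r hz))
    fun u _ => ⟨(x.1, x.1 - u), by simp, rfl⟩).trans ?_
  rw [hyperboloidParam_eq r hx]
  exact range_rulingLine hr (by norm_num)

lemma hyperboloid_N (p : angleDeck.Q) : (hyperboloid hr).str.N p = 1 := by
  obtain ⟨x, hx, rfl⟩ := angleDeck.exists_rep p
  have h := congrArg₂ (· ∩ ·) (hyperboloid_leaf₁ hr hx) (hyperboloid_leaf₂ hr hx)
  refine (congrArg Set.encard h).trans (encard_eq_one.2 ?_)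
  refine ⟨angleDeck.proj x, Subset.antisymm ?_ ?_⟩
  · rintro _ ⟨⟨y, ⟨hy, hyx⟩, rfl⟩, ⟨z, ⟨hz, hzx⟩, hzy⟩⟩
    obtain ⟨k, hk⟩ := angleDeck_rel_iff.1 ((AffineDeck.proj_eq_iff hz hy).1 hzy)
    have k1 : y.1 = z.1 + k * (2 * Real.pi) := by rw [hk]
    have h1 := abs_lt.1 (show |x.1 - x.2| < Real.pi from hx)
    have h2 := abs_lt.1 (show |y.1 - y.2| < Real.pi from hy)
    rw [k1, hyx, hzx] at h2
    have hp := Real.pi_pos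
    have h3 : (k : ℝ) < 1 := by nlinarith
    have h4 : (-1 : ℝ) < k := by nlinarith
    have h5 : k = 0 := by
      have h3 : k < 1 := by exact_mod_cast h3
      have h4 : -1 < k := by exact_mod_cast h4
      omega
    rw [h5, Int.cast_zero, zero_mul, add_zero, hzx] at k1
    rw [show y = x from Prod.ext k1 hyx]
    rfl
  · rintro _ rfl
    exact ⟨⟨x, ⟨hx, rfl⟩, rfl⟩, ⟨x, ⟨hx, rfl⟩, rfl⟩⟩

lemma hyperboloid_antipodal {p q : angleDeck.Q} (hp : hyperboloidMap r p 0 = 0)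
    (hq : hyperboloidMap r q = -hyperboloidMap r p) :
    Disjoint ((hyperboloid hr).str.leaf₁ p) ((hyperboloid hr).str.leaf₂ q) := by
  obtain ⟨x, hx, rfl⟩ := angleDeck.exists_rep p
  obtain ⟨y, hy, rfl⟩ := angleDeck.exists_rep q
  rw [hyperboloidMap_proj r hx] at hp hq
  rw [hyperboloidMap_proj r hy] at hq
  rw [hyperboloid_leaf₁ hr hx, hyperboloid_leaf₂ hr hy]
  refine Set.disjoint_left.2 ?_
  rintro _ ⟨z, ⟨hz, hzx⟩, rfl⟩ ⟨w, ⟨hw, hwy⟩, hwz⟩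
  obtain ⟨k, hk⟩ := angleDeck_rel_iff.1 ((AffineDeck.proj_eq_iff hw hz).1 hwz)
  have h0 : stripSlope x = 0 := (mul_eq_zero.1 (show r * stripSlope x = 0 from hp)).resolve_left
      hr.ne'
  have h0' : stripSlope y = 0 := by
    have h : r * stripSlope y = -(r * stripSlope x) := congrFun hq 0
    rw [h0, mul_zero, neg_zero] at h
    exact (mul_eq_zero.1 h).resolve_left hr.ne'
  have hπ : rulingLine r 1 y.2 0 = rulingLine r 1 (x.2 + Real.pi) 0 := by
    rw [hyperboloidParam, hyperboloidParam, h0, h0'] at hq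
    rw [hq]
    ext i
    fin_cases i <;> simp [rulingLine]
  obtain ⟨-, j, hj⟩ := rulingLine_inj hr hπ (one_mul 1)
  have h00 : stripSlope (0, 0) = 0 := by simp [stripSlope]
  have e1 := stripSlope_inj hr hy (show ((0, 0) : ℝ²) ∈ strip by simp [strip, Real.pi_pos])
    (h0'.trans h00.symm)
  have k1 : z.1 = w.1 + k * (2 * Real.pi) := by rw [hk]
  have h1 := abs_lt.1 (show |z.1 - z.2| < Real.pi from hz)
  simp only [sub_zero] at e1
  have e2 : z.1 - z.2 = (2 * (k + j : ℤ) + 1) * Real.pi := by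
    push_cast
    linear_combination k1 - hzx + hwy + e1 + hj
  rw [e2] at h1
  have hpi := Real.pi_pos
  have h3 : (((k + j : ℤ)) : ℝ) < 0 := by nlinarith
  have h4 : (-1 : ℝ) < ((k + j : ℤ) : ℝ) := by nlinarith
  have h3 : k + j < 0 := by exact_mod_cast h3
  have h4 : -1 < k + j := by exact_mod_cast h4
  omega

lemma hyperboloid_not_compactSpace : ¬ CompactSpace angleDeck.Q := by
  refine angleDeck.not_compactSpace (f := stripSlope) contDiffOn_slope.continuousOn
    (fun i x _ => ?_) fun C => ⟨(2 * Real.arctan (C + 1), 0), ?_, ?_⟩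
  · obtain ⟨k, hk⟩ := angleDeck_act i
    rw [hk, stripSlope, stripSlope, add_sub_add_right_eq_sub]
  · change |2 * Real.arctan (C + 1) - 0| < Real.pi
    rw [sub_zero]
    exact abs_two_mul_arctan_lt _
  · rw [stripSlope, sub_zero, mul_div_cancel_left₀ _ two_ne_zero, Real.tan_arctan]
    exact lt_add_one C

lemma hyperboloid_not_isFlat : ¬ (hyperboloid hr).str.IsFlat := by
  intro hflat
  have h0 : ((0, 0) : ℝ²) ∈ strip := by simp [strip, Real.pi_pos]
  have h00 : stripSlope (0, 0) = 0 := by simp [stripSlope]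
  have hd : ∀ z ∈ strip, ∀ v w : ℝ², ∀ u : ℝ, v + u • w = z →
      HasDerivAt (fun s : ℝ => stripSlope (v + s • w))
        ((1 + stripSlope z ^ 2) / 2 * (w.1 - w.2)) u := by
    intro z hz v w u h
    have h1 : HasDerivAt (fun s : ℝ => v + s • w) w u := by
      simpa using ((hasDerivAt_id u).smul_const w).const_add v
    have h2 := hasFDerivAt_slope hz
    rw [← h] at h2 ⊢
    exact h2.comp_hasDerivAt u h1
  have hs : ∀ z ∈ strip, HasDerivAt (fun s => stripSlope (s, z.2)) ((1 + stripSlope z ^ 2) / 2)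
      z.1 :=
    fun z hz => by simpa using hd z hz (0, z.2) (1, 0) z.1 (by simp)
  have ht : HasDerivAt (fun s => stripSlope (0, s)) (-1 / 2) 0 := by
    simpa [h00, neg_div] using hd (0, 0) h0 (0, 0) (0, 1) 0 (by simp)
  have ht2 : HasDerivAt (fun s => 1 + stripSlope (0, s) ^ 2) 0 0 := by
    have := (ht.fun_pow 2).const_add 1
    simpa [h00] using this
  refine planeModel_curv_ne_zero (hU := isOpen_strip)
    (h := fun z => r ^ 2 * (1 + stripSlope z ^ 2) / 2) (by have := contDiffOn_slope; fun_prop)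
    (fun z _ => by positivity) diagF_diagF planeForm_diagF h0
    (k := fun z => r ^ 2 / 2 * (stripSlope z * (1 + stripSlope z ^ 2))) (n := 0)
    (m := r ^ 2 / 2 * (-1 / 2)) ?_ ?_ ?_ ?_
    (hflat.curv_eq_zero (hyperboloid hr).modelsAt (x := (0, 0)) h0)
  · filter_upwards [isOpen_strip.mem_nhds h0] with z hz
    have := ((((hs z hz).fun_pow 2).const_add 1).const_mul (r ^ 2)).div_const 2
    refine this.congr_deriv ?_
    simp only [Nat.cast_ofNat]
    ring
  · have := (ht2.const_mul (r ^ 2)).div_const 2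
    rwa [mul_zero, zero_div] at this
  · have := (ht.mul ht2).const_mul (r ^ 2 / 2)
    refine this.congr_deriv ?_
    rw [h00]
    ring
  · simp only [h00]
    have := pow_pos hr 2
    nlinarith

end HyperboloidManifold

section ParacomplexModel

lemma hasDerivAt_line {f : V → E} {x : V} (h : DifferentiableAt ℝ f x)
    (a : V) : HasDerivAt (fun t : ℝ => f (x + t • a)) (𝐃 f x a) 0 := by
  have hl : HasDerivAt (fun t : ℝ => x + t • a) a 0 := by
    simpa using ((hasDerivAt_id (0 : ℝ)).smul_const a).const_add x
  have h0 : HasFDerivAt f (𝐃 f x) (x + (0 : ℝ) • a) := by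
    rw [zero_smul, add_zero]
    exact h.hasFDerivAt
  exact h0.comp_hasDerivAt 0 hl

lemma HasDerivAt.clm_apply_const {f : ℝ → V →L[ℝ] E} {f' : V →L[ℝ] E} {t : ℝ}
    (h : HasDerivAt f f' t) (v : V) : HasDerivAt (fun t => f t v) (f' v) t := by
  simpa using h.clm_apply (hasDerivAt_const t v)

lemma hasDerivAt_clm_line {β : V → 𝔅 V} {x : V} (h : DifferentiableAt ℝ β x) (a b c : V) :
    HasDerivAt (fun t : ℝ => β (x + t • a) b c) (𝐃 β x a b c) 0 :=
  ((hasDerivAt_line h a).clm_apply_const b).clm_apply_const c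

variable {W : Type} [NormedAddCommGroup W] [InnerProductSpace ℝ W]

/-- The linear form `A ↦ ⟨A₁, z₂⟩` on `W × W`. -/
def pairLeft (z : W × W) : W × W →L[ℝ] ℝ := realInner W z.2 ∘L fst ℝ W W

/-- The linear form `A ↦ ⟨z₁, A₂⟩` on `W × W`. -/
def pairRight (z : W × W) : W × W →L[ℝ] ℝ := realInner W z.1 ∘L snd ℝ W W

lemma pairLeft_apply (z a : W × W) : pairLeft z a = inner ℝ a.1 z.2 := real_inner_comm _ _

lemma pairRight_apply (z a : W × W) : pairRight z a = inner ℝ z.1 a.2 := rfl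

/-- The function `κ + ⟨z₁, z₂⟩`, whose logarithm is the potential of the paracomplex metric. -/
def paraNorm (κ : ℝ) (z : W × W) : ℝ := κ + inner ℝ z.1 z.2

/-- The symplectic form of the paracomplex projective space in an affine chart. -/
def paraForm (k κ : ℝ) (z : W × W) : W × W →L[ℝ] W × W →L[ℝ] ℝ :=
  k • ((paraNorm κ z)⁻¹ • pairForm W - ((paraNorm κ z)⁻¹ ^ 2) •
    ((pairLeft z).smulRight (pairRight z) - (pairRight z).smulRight (pairLeft z)))

lemma paraForm_apply (k κ : ℝ) (z a b : W × W) : paraForm k κ z a b =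
    k * ((paraNorm κ z)⁻¹ * (inner ℝ a.1 b.2 - inner ℝ a.2 b.1) - (paraNorm κ z)⁻¹ ^ 2 *
      (inner ℝ a.1 z.2 * inner ℝ z.1 b.2 - inner ℝ z.1 a.2 * inner ℝ b.1 z.2)) := by
  rw [← pairLeft_apply z a, ← pairLeft_apply z b, ← pairRight_apply z a,
    ← pairRight_apply z b, ← pairForm_apply]
  rfl

lemma contDiffAt_paraForm (k : ℝ) {κ : ℝ} {z : W × W} (hz : 0 < paraNorm κ z) :
    ContDiffAt ℝ ∞ (paraForm k κ) z := by
  have h1 : ContDiff ℝ ∞ (paraNorm (W := W) κ) :=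
    contDiff_const.add (contDiff_fst.inner ℝ contDiff_snd)
  have h2 : ContDiffAt ℝ ∞ (fun z : W × W => (paraNorm κ z)⁻¹) z := h1.contDiffAt.inv hz.ne'
  have h3 : ContDiff ℝ ∞ (pairLeft (W := W)) :=
    ((realInner W).contDiff.comp contDiff_snd).clm_comp contDiff_const
  have h4 : ContDiff ℝ ∞ (pairRight (W := W)) :=
    ((realInner W).contDiff.comp contDiff_fst).clm_comp contDiff_const
  have h5 : ContDiff ℝ ∞ fun z : W × W =>
      (pairLeft z).smulRight (pairRight z) - (pairRight z).smulRight (pairLeft z) :=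
    (h3.smulRight h4).sub (h4.smulRight h3)
  exact ((h2.smul contDiffAt_const).sub ((h2.pow 2).smul h5.contDiffAt)).const_smul k

lemma paraForm_line {κ : ℝ} {z : W × W} (k : ℝ) (hz : 0 < paraNorm κ z) (e a b : W × W) :
    𝐃 (paraForm k κ) z e a b = k * (-((inner ℝ e.1 z.2 + inner ℝ z.1 e.2) / paraNorm κ z ^ 2) *
        (inner ℝ a.1 b.2 - inner ℝ a.2 b.1) +
      2 * (inner ℝ e.1 z.2 + inner ℝ z.1 e.2) / paraNorm κ z ^ 3 *
        (inner ℝ a.1 z.2 * inner ℝ z.1 b.2 - inner ℝ z.1 a.2 * inner ℝ b.1 z.2) -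
      (paraNorm κ z)⁻¹ ^ 2 * (inner ℝ a.1 e.2 * inner ℝ z.1 b.2 + inner ℝ a.1 z.2 * inner ℝ e.1 b.2
        - inner ℝ e.1 a.2 * inner ℝ b.1 z.2 - inner ℝ z.1 a.2 * inner ℝ b.1 e.2)) := by
  have h := hasDerivAt_clm_line ((contDiffAt_paraForm k hz).differentiableAt (by simp)) e a b
  simp only [paraForm_apply] at h
  refine h.unique ?_
  have hi : ∀ x y w : W, HasDerivAt (fun t : ℝ => (inner ℝ x (y + t • w) : ℝ)) (inner ℝ x w) 0 := by
    intro x y w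
    simpa [inner_add_right, inner_smul_right] using
      ((hasDerivAt_id (0 : ℝ)).mul_const (inner ℝ x w : ℝ)).const_add (inner ℝ x y : ℝ)
  have hi' : ∀ x y w : W, HasDerivAt (fun t : ℝ => (inner ℝ (y + t • w) x : ℝ)) (inner ℝ w x) 0 :=
      by
    intro x y w
    simpa only [real_inner_comm] using hi x y w
  have hq : HasDerivAt (fun t : ℝ => paraNorm κ (z + t • e))
      (inner ℝ e.1 z.2 + inner ℝ z.1 e.2) 0 := by
    have hl : ∀ y w : W, HasDerivAt (fun t : ℝ => y + t • w) w 0 := fun y w => by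
      simpa using ((hasDerivAt_id (0 : ℝ)).smul_const w).const_add y
    have := ((hl z.1 e.1).inner ℝ (hl z.2 e.2)).const_add κ
    refine this.congr_deriv ?_
    simp [add_comm]
  have h0 : paraNorm κ (z + (0 : ℝ) • e) = paraNorm κ z := by simp
  have hq' := hq.fun_inv (by rw [h0]; exact hz.ne')
  have hA := ((hi a.1 z.2 e.2).mul (hi' b.2 z.1 e.1)).sub ((hi' a.2 z.1 e.1).mul (hi b.1 z.2 e.2))
  refine ((hq'.mul_const (inner ℝ a.1 b.2 - inner ℝ a.2 b.1)).sub
    ((hq'.pow 2).mul hA)).const_mul k |>.congr_deriv ?_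
  have := hz.ne'
  simp only [Pi.pow_apply, Pi.sub_apply, Pi.mul_apply, zero_smul, add_zero, Nat.cast_ofNat,
    Nat.add_one_sub_one, pow_one]
  field_simp
  ring

/-- The paracomplex projective space in an affine chart. -/
def paraModel (W : Type) [NormedAddCommGroup W] [InnerProductSpace ℝ W] {k κ : ℝ} (hk : k ≠ 0)
    (hκ : κ ≠ 0) : AdaptedModel (W × W) where
  U := {z | 0 < paraNorm κ z}
  isOpen := isOpen_lt continuous_const (by unfold paraNorm; fun_prop)
  form := paraForm k κ
  F := pairF W
  smooth z hz := (contDiffAt_paraForm k hz).contDiffWithinAt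
  F_F a := by simp
  alt z _ a := by
    rw [paraForm_apply, real_inner_comm a.1 a.2]
    ring
  nondeg z hz v hv := by
    have hz : 0 < paraNorm κ z := hz
    have hq : paraNorm κ z = κ + inner ℝ z.1 z.2 := rfl
    have hker : ∀ x a b : W, paraNorm κ z = κ + inner ℝ a b →
        (∀ y, (paraNorm κ z) * inner ℝ x y = inner ℝ x b * inner ℝ a y) → x = 0 := by
      intro x a b h h'
      have h0 : (inner ℝ x b : ℝ) = 0 := by
        have := h' b
        rw [h] at this
        exact (mul_eq_zero.1 (show κ * (inner ℝ x b : ℝ) = 0 by linarith)).resolve_left hκ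
      have := h' x
      rw [h0, zero_mul] at this
      exact inner_self_eq_zero.1 ((mul_eq_zero.1 this).resolve_left hz.ne')
    refine Prod.ext (hker v.1 z.1 z.2 hq fun y => ?_) (hker v.2 z.2 z.1 ?_ fun y => ?_)
    · have h := (mul_eq_zero.1 ((paraForm_apply k κ z v (0, y)).symm.trans (hv _))).resolve_left hk
      simp only [inner_zero_right, inner_zero_left, sub_zero, mul_zero] at h
      field_simp at h
      linarith
    · rw [hq, real_inner_comm]
    · have h := (mul_eq_zero.1 ((paraForm_apply k κ z v (y, 0)).symm.trans (hv _))).resolve_left hk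
      simp only [inner_zero_right, zero_sub, mul_zero] at h
      rw [real_inner_comm v.2 z.1, real_inner_comm z.2 y] at h
      field_simp at h
      linarith
  anti z _ a b := by
    simp only [paraForm_apply, pairF_apply, inner_neg_left, inner_neg_right]
    ring
  closed z hz a b c := by
    have hz : 0 < paraNorm κ z := hz
    rw [paraForm_line k hz, paraForm_line k hz, paraForm_line k hz]
    simp only [real_inner_comm a.1 c.2, real_inner_comm b.1 a.2, real_inner_comm c.1 b.2]
    field_simp
    ring

lemma paraModel_metric {k κ : ℝ} (hk : k ≠ 0) (hκ : κ ≠ 0) (z a b : W × W) :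
    (paraModel W hk hκ).metric z a b = k *
      ((paraNorm κ z)⁻¹ * (inner ℝ a.1 b.2 + inner ℝ a.2 b.1) - (paraNorm κ z)⁻¹ ^ 2 *
      (inner ℝ a.1 z.2 * inner ℝ z.1 b.2 + inner ℝ z.1 a.2 * inner ℝ b.1 z.2)) := by
  refine (paraForm_apply k κ z (pairF W a) b).trans ?_
  simp only [pairF_apply, inner_neg_left, inner_neg_right]
  ring

lemma paraModel_not_isFlat [FiniteDimensional ℝ E] [FiniteDimensional ℝ W]
    [I.Boundaryless] [IsManifold I ∞ M] (B : BiLagrangianStructure I M) {k κ : ℝ} (hk : k ≠ 0)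
    (hκ : 0 < κ) {ψ : W × W → M}
    (hA : ∀ z ∈ (paraModel W hk hκ.ne').U, (paraModel W hk hκ.ne').ModelsAt I B.form B.F ψ z)
    {w : W} (hw : w ≠ 0) : ¬ B.IsFlat := by
  set A := paraModel W hk hκ.ne' with hAdef
  have hU : ∀ z : W × W, 0 < paraNorm κ z → z ∈ A.U := fun z hz => hz
  have n0 : 0 < paraNorm κ (0 : W × W) := by simpa [paraNorm] using hκ
  have n1 : ∀ s : ℝ, paraNorm κ ((0 : W × W) + s • (0, w)) = κ := fun s => by simp [paraNorm]
  have hline : ∀ z, 0 < paraNorm κ z → ∀ e a b, 𝐃 A.metric z e a b =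
      𝐃 (paraForm k κ) z e (pairF W a) b := fun z hz e a b => AdaptedModel.fderiv_metric (A := A)
          (hU z hz) e a b
  refine B.not_isFlat_of_modelsAt hA (hU 0 n0) (a := (w, 0)) (b := (0, w)) (c := (w, 0))
    (d := (0, w)) ?_ ?_ ?_ ?_ ?_
  · change pairF W _ = _
    simp
  · change pairF W _ = _
    simp
  · change pairF W _ = _
    simp
  · ext b <;> simp [hline 0 n0, paraForm_line k n0]
  · have hm : DifferentiableAt ℝ (𝐃 A.metric) 0 :=
      (AdaptedModel.contDiffAt_metric (A := A) (hU 0 n0)).smooth_fderiv.diffAt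
    have h1 := (((hasDerivAt_line hm (0, w)).clm_apply_const (w, 0)).clm_apply_const
      (w, 0)).clm_apply_const (0, w)
    have hfun : ∀ s : ℝ, 𝐃 A.metric ((0 : W × W) + s • (0, w)) (w, 0) (w, 0) (0, w) =
        s * (-2 * k * (inner ℝ w w : ℝ) ^ 2 / κ ^ 2) := fun s => by
      have hs : 0 < paraNorm κ ((0 : W × W) + s • (0, w)) := by rw [n1]; exact hκ
      rw [hline _ hs, paraForm_line k hs, n1]
      simp [inner_smul_right]
      field_simp
      ring
    have h2 := (hasDerivAt_id (0 : ℝ)).mul_const (-2 * k * (inner ℝ w w : ℝ) ^ 2 / κ ^ 2)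
    have h3 := h1.unique (h2.congr_of_eventuallyEq (Eventually.of_forall hfun))
    simp at h3
    rw [h3]
    have : ‖w‖ ≠ 0 := norm_ne_zero_iff.2 hw
    simp [hk, hκ.ne', this]

end ParacomplexModel

section ParacomplexProjective

/-- The Euclidean space `ℝⁿ⁺¹`. -/
abbrev ParaSpace (n : ℕ) := 𝔼 (n + 1)

instance (n : ℕ) : Fact (Module.finrank ℝ (ParaSpace n) = n + 1) := ⟨by simp⟩

variable {n : ℕ}

/-- The unit sphere of `ℝⁿ⁺¹`. -/
abbrev ParaSphere (n : ℕ) := Metric.sphere (0 : ParaSpace n) 1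

/-- The pairs of unit vectors with positive inner product. -/
def paraOpen (n : ℕ) : TopologicalSpace.Opens (ParaSphere n × ParaSphere n) :=
  ⟨{p | 0 < (inner ℝ (p.1 : ParaSpace n) (p.2 : ParaSpace n) : ℝ)}, isOpen_lt continuous_const
    ((continuous_subtype_val.comp continuous_fst).inner
      (continuous_subtype_val.comp continuous_snd))⟩

/-- The inner product of the two unit vectors. -/
def paraCos (p : paraOpen n) : ℝ := inner ℝ (p.1.1 : ParaSpace n) (p.1.2 : ParaSpace n)

lemma paraCos_pos (p : paraOpen n) : 0 < paraCos p := p.2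

/-- The embedding of the pairs of unit vectors onto the paracomplex projective space. -/
def paraEmb (p : paraOpen n) : ParaSpace n × ParaSpace n :=
  ((√(paraCos p))⁻¹ • (p.1.1 : ParaSpace n), (√(paraCos p))⁻¹ • (p.1.2 : ParaSpace n))

lemma contMDiff_paraEmb : ContMDiff ((𝓡 n).prod (𝓡 n)) 𝓘(ℝ, ParaSpace n × ParaSpace n) ∞
    (paraEmb (n := n)) := by
  have h1 : ContMDiff ((𝓡 n).prod (𝓡 n)) 𝓘(ℝ, ParaSpace n) ∞
      fun p : paraOpen n => (p.1.1 : ParaSpace n) :=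
    contMDiff_coe_sphere.comp (contMDiff_fst.comp contMDiff_subtype_val)
  have h2 : ContMDiff ((𝓡 n).prod (𝓡 n)) 𝓘(ℝ, ParaSpace n) ∞
      fun p : paraOpen n => (p.1.2 : ParaSpace n) :=
    contMDiff_coe_sphere.comp (contMDiff_snd.comp contMDiff_subtype_val)
  intro p
  have h3 : ContDiffAt ℝ ∞ (fun z : ParaSpace n × ParaSpace n =>
      ((√(inner ℝ z.1 z.2))⁻¹ • z.1, (√(inner ℝ z.1 z.2))⁻¹ • z.2)) (p.1.1, p.1.2) := by
    have hs : ContDiffAt ℝ ∞ (fun z : ParaSpace n × ParaSpace n => (√(inner ℝ z.1 z.2))⁻¹)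
        (p.1.1, p.1.2) :=
      ((contDiff_fst.inner ℝ contDiff_snd).contDiffAt.sqrt p.2.ne').inv (Real.sqrt_pos.2 p.2).ne'
    exact (hs.smul contDiff_fst.contDiffAt).prodMk (hs.smul contDiff_snd.contDiffAt)
  exact h3.contMDiffAt.comp p ((h1 p).prodMk_space (h2 p))

lemma norm_paraFst (p : paraOpen n) : ‖(p.1.1 : ParaSpace n)‖ = 1 := norm_eq_of_mem_sphere p.1.1

lemma norm_paraSnd (p : paraOpen n) : ‖(p.1.2 : ParaSpace n)‖ = 1 := norm_eq_of_mem_sphere p.1.2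

lemma paraCos_le_one (p : paraOpen n) : paraCos p ≤ 1 := by
  have := real_inner_le_norm (p.1.1 : ParaSpace n) p.1.2
  rwa [norm_paraFst, norm_paraSnd, mul_one] at this

lemma one_le_inv_sqrt (p : paraOpen n) : 1 ≤ (√(paraCos p))⁻¹ :=
  (one_le_inv₀ (Real.sqrt_pos.2 (paraCos_pos p))).2 (Real.sqrt_le_one.2 (paraCos_le_one p))

lemma paraEmb_isEmbedding : IsEmbedding (paraEmb (n := n)) := by
  let q : ParaSpace n × ParaSpace n → ParaSpace n × ParaSpace n :=
    fun z => ((max ‖z.1‖ 1)⁻¹ • z.1, (max ‖z.2‖ 1)⁻¹ • z.2)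
  have hm : ∀ x : ParaSpace n, max ‖x‖ 1 ≠ 0 := fun x => by positivity
  have hq : Continuous q := by
    refine Continuous.prodMk ?_ ?_
    · exact ((continuous_fst.norm.max continuous_const).inv₀ fun z => hm _).smul continuous_fst
    · exact ((continuous_snd.norm.max continuous_const).inv₀ fun z => hm _).smul continuous_snd
  refine IsEmbedding.of_comp contMDiff_paraEmb.continuous hq ?_
  have : q ∘ paraEmb = fun p : paraOpen n => ((p.1.1 : ParaSpace n), (p.1.2 : ParaSpace n)) := by
    funext p
    have h := one_le_inv_sqrt p
    have h0 : (√(paraCos p))⁻¹ ≠ 0 := by positivity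
    have hs : ∀ x : ParaSpace n, ‖x‖ = 1 → (max ‖(√(paraCos p))⁻¹ • x‖ 1)⁻¹ •
        ((√(paraCos p))⁻¹ • x) = x := fun x hx => by
      rw [norm_smul, hx, mul_one, Real.norm_of_nonneg (zero_le_one.trans h), max_eq_left h,
        inv_smul_smul₀ h0]
    exact Prod.ext (hs _ (norm_paraFst p)) (hs _ (norm_paraSnd p))
  rw [this]
  exact (IsEmbedding.subtypeVal.prodMap IsEmbedding.subtypeVal).comp IsEmbedding.subtypeVal

lemma range_paraEmb : range (paraEmb (n := n)) = paracomplexProjective n := by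
  refine Subset.antisymm ?_ fun z hz => ?_
  · rintro _ ⟨p, rfl⟩
    have h : 0 < √(paraCos p) := Real.sqrt_pos.2 (paraCos_pos p)
    have h2 : √(paraCos p) ^ 2 = paraCos p := Real.sq_sqrt (paraCos_pos p).le
    constructor <;>
      simp only [paraEmb, inner_smul_left, inner_smul_right, real_inner_self_eq_norm_sq,
        norm_paraFst, norm_paraSnd]
    change (√(paraCos p))⁻¹ * ((√(paraCos p))⁻¹ * paraCos p) = 1
    rw [← h2, Real.sqrt_sq h.le]
    field_simp
  · obtain ⟨h1, h2⟩ := hz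
    rw [real_inner_self_eq_norm_sq, real_inner_self_eq_norm_sq] at h1
    have h3 : ‖z.1‖ = ‖z.2‖ := by rwa [sq_eq_sq₀ (norm_nonneg _) (norm_nonneg _)] at h1
    have h4 : 0 < ‖z.1‖ := norm_pos_iff.2 fun h => by simp [h] at h2
    have hu : ∀ x : ParaSpace n, ‖x‖ = ‖z.1‖ → ‖z.1‖⁻¹ • x ∈ Metric.sphere (0 : ParaSpace n) 1 := by
      intro x hx
      rw [mem_sphere_zero_iff_norm, norm_smul, hx, norm_inv, norm_norm, inv_mul_cancel₀ h4.ne']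
    have h5 : (inner ℝ (‖z.1‖⁻¹ • z.1) (‖z.1‖⁻¹ • z.2) : ℝ) = (‖z.1‖⁻¹) ^ 2 := by
      rw [inner_smul_left, inner_smul_right, h2]
      simp [sq]
    refine ⟨⟨(⟨_, hu z.1 rfl⟩, ⟨_, hu z.2 h3.symm⟩), (by positivity : (0 : ℝ) < ‖z.1‖⁻¹ ^
        2).trans_eq h5.symm⟩, ?_⟩
    have h6 : ∀ x : ParaSpace n, (√(inner ℝ (‖z.1‖⁻¹ • z.1) (‖z.1‖⁻¹ • z.2)))⁻¹ • ‖z.1‖⁻¹ • x = x :=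
        by
      intro x
      rw [h5, Real.sqrt_sq (by positivity), inv_smul_smul₀ (by positivity)]
    exact Prod.ext (h6 _) (h6 _)

lemma isPreconnected_paracomplexProjective (hn : 1 ≤ n) : IsPreconnected (paracomplexProjective n) ∧
      ∀ C : ℝ, ∃ z ∈ paracomplexProjective n, C < ‖z.1‖ := by
  let m : ParaSpace n × ParaSpace n → ParaSpace n := fun x => x.2 - (inner ℝ x.1 x.2 : ℝ) • x.1
  let f : ParaSpace n × ParaSpace n → ParaSpace n := fun x => √(1 + ‖m x‖ ^ 2) • x.1
  let Φ : ParaSpace n × ParaSpace n → ParaSpace n × ParaSpace n := fun x => (f x + m x, f x - m x)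
  have hm : Continuous m := by fun_prop
  have hf : Continuous f := (Real.continuous_sqrt.comp (by fun_prop)).smul continuous_fst
  have hmem : ∀ x : ParaSpace n × ParaSpace n, ‖x.1‖ = 1 → inner ℝ (f x) (m x) = (0 : ℝ) ∧
      inner ℝ (f x) (f x) = (1 + ‖m x‖ ^ 2 : ℝ) := by
    intro x hx
    refine ⟨?_, ?_⟩
    · simp [f, m, inner_smul_left, inner_smul_right, inner_sub_right, hx]
      ring
    · have : (0 : ℝ) ≤ 1 + ‖m x‖ ^ 2 := by positivity
      simp only [f, inner_smul_left, inner_smul_right, real_inner_self_eq_norm_sq, hx]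
      simp [Real.mul_self_sqrt this]
  have hΦ : ∀ x : ParaSpace n × ParaSpace n, ‖x.1‖ = 1 → Φ x ∈ paracomplexProjective n := by
    intro x hx
    obtain ⟨h1, h2⟩ := hmem x hx
    constructor <;> simp only [Φ, inner_add_left, inner_add_right, inner_sub_left, inner_sub_right,
      real_inner_comm (f x) (m x), h1, h2, real_inner_self_eq_norm_sq] <;> ring
  have hr : 1 < Module.rank ℝ (ParaSpace n) := by
    rw [← Module.finrank_eq_rank, finrank_euclideanSpace_fin]
    exact_mod_cast Nat.lt_succ_of_le hn
  refine ⟨?_, fun C => ?_⟩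
  · have hc := (((isConnected_sphere hr (0 : ParaSpace n) zero_le_one).isPreconnected.prod
      (isPreconnected_univ (α := ParaSpace n)))).image Φ
          ((hf.add hm).prodMk (hf.sub hm)).continuousOn
    convert hc using 1
    refine Subset.antisymm (fun z hz => ?_) ?_
    · obtain ⟨h1, h2⟩ := hz
      set a := (1 / 2 : ℝ) • (z.1 + z.2) with ha
      set b := (1 / 2 : ℝ) • (z.1 - z.2) with hb
      have hab : inner ℝ a b = (0 : ℝ) := by
        simp only [ha, hb, inner_smul_left, inner_smul_right, inner_add_left, inner_sub_right, h1,
          real_inner_comm z.1 z.2]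
        simp
        ring
      have haa : ‖a‖ ^ 2 = 1 + ‖b‖ ^ 2 := by
        simp only [← real_inner_self_eq_norm_sq, ha, hb, inner_smul_left, inner_smul_right,
          inner_add_left, inner_add_right, inner_sub_left, inner_sub_right, h1, h2,
          real_inner_comm z.1 z.2]
        simp
        ring
      have ha0 : 0 < ‖a‖ := by
        refine (norm_nonneg a).lt_of_ne fun h => ?_
        rw [← h] at haa
        nlinarith [sq_nonneg ‖b‖]
      have hmb : m (‖a‖⁻¹ • a, b) = b := by simp [m, inner_smul_left, hab]
      have hfa : f (‖a‖⁻¹ • a, b) = a := by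
        simp only [f, hmb, ← haa, Real.sqrt_sq ha0.le]
        rw [smul_inv_smul₀ ha0.ne']
      refine ⟨(‖a‖⁻¹ • a, b), ⟨?_, mem_univ _⟩, ?_⟩
      · simp [norm_smul, ha0.ne']
      · simp only [Φ, hmb, hfa]
        refine Prod.ext ?_ ?_ <;> simp only [ha, hb] <;> module
    · rintro _ ⟨x, ⟨hx, -⟩, rfl⟩
      exact hΦ x (mem_sphere_zero_iff_norm.1 hx)
  · let i : Fin (n + 1) := ⟨0, by omega⟩
    let j : Fin (n + 1) := ⟨1, by omega⟩
    let x : ParaSpace n × ParaSpace n :=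
      (EuclideanSpace.single i 1, (|C| + 1) • EuclideanSpace.single j 1)
    have hx : ‖x.1‖ = 1 := by simp [x]
    obtain ⟨h1, h2⟩ := hmem x hx
    have hmx : m x = (|C| + 1) • EuclideanSpace.single j (1 : ℝ) := by
      have : (inner ℝ x.1 x.2 : ℝ) = 0 := by simp [x, EuclideanSpace.inner_single_left, i, j]
      simp only [m, this, zero_smul, sub_zero]
      rfl
    have h3 : ‖f x + m x‖ ^ 2 = 1 + 2 * ‖m x‖ ^ 2 := by
      rw [← real_inner_self_eq_norm_sq, inner_add_left, inner_add_right, inner_add_right, h2,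
        real_inner_comm (f x) (m x), h1, real_inner_self_eq_norm_sq]
      ring
    have h4 : ‖m x‖ = |C| + 1 := by
      rw [hmx, norm_smul, PiLp.norm_single, norm_one, mul_one, Real.norm_of_nonneg (by positivity)]
    refine ⟨Φ x, hΦ x hx, ?_⟩
    change C < ‖f x + m x‖
    rw [h4] at h3
    nlinarith [norm_nonneg (f x + m x), le_abs_self C, abs_nonneg C]

lemma paraOpen_connectedSpace (hn : 1 ≤ n) : ConnectedSpace (paraOpen n) := by
  obtain ⟨h1, h2⟩ := isPreconnected_paracomplexProjective hn
  rw [← range_paraEmb, ← image_univ, paraEmb_isEmbedding.isInducing.isPreconnected_image] at h1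
  obtain ⟨z, hz, -⟩ := h2 0
  obtain ⟨p, -⟩ := range_paraEmb (n := n) ▸ hz
  exact { isPreconnected_univ := h1, toNonempty := ⟨p⟩ }

lemma paraOpen_not_compactSpace (hn : 1 ≤ n) : ¬ CompactSpace (paraOpen n) := by
  intro hc
  have h1 := isCompact_range (contMDiff_paraEmb (n := n)).continuous
  obtain ⟨C, hC⟩ := h1.bddAbove_image (f := fun z => ‖z.1‖) continuous_fst.norm.continuousOn
  obtain ⟨z, hz, h⟩ := (isPreconnected_paracomplexProjective hn).2 C
  exact h.not_ge (hC (mem_image_of_mem _ (range_paraEmb (n := n) ▸ hz)))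

end ParacomplexProjective

section ParacomplexManifold

variable {n : ℕ}

/-- The paracomplex metric as a bilinear form. -/
def paraBilin (c : ℝ) (z : ParaSpace n × ParaSpace n) :
    LinearMap.BilinForm ℝ (ParaSpace n × ParaSpace n) :=
  LinearMap.mk₂ ℝ (paracomplexMetric c z)
    (fun a a' b => by simp only [paracomplexMetric, Prod.fst_add, Prod.snd_add, inner_add_left,
      inner_add_right]; ring)
    (fun s a b => by simp only [paracomplexMetric, Prod.smul_fst, Prod.smul_snd,
      real_inner_smul_left, real_inner_smul_right, smul_eq_mul]; ring)
    (fun a b b' => by simp only [paracomplexMetric, Prod.fst_add, Prod.snd_add, inner_add_left,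
      inner_add_right]; ring)
    (fun s a b => by simp only [paracomplexMetric, Prod.smul_fst, Prod.smul_snd,
      real_inner_smul_left, real_inner_smul_right, smul_eq_mul]; ring)

/-- The ambient fields inducing the structure of the paracomplex projective space. -/
def paraPair (n : ℕ) (c : ℝ) :
    MetricPair 𝓘(ℝ, ParaSpace n × ParaSpace n) (ParaSpace n × ParaSpace n) where
  g z := paraBilin c z
  D₁ z := (Submodule.span ℝ {z.2}).comap (LinearMap.snd ℝ (ParaSpace n) (ParaSpace n))
  D₂ z := (Submodule.span ℝ {z.1}).comap (LinearMap.fst ℝ (ParaSpace n) (ParaSpace n))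

/-- A vector `e ≠ 0` with an isometric parametrization of the orthogonal hyperplane. -/
structure ParaFrame (n : ℕ) where
  e : ParaSpace n
  ne_zero : e ≠ 0
  hyp : 𝔼 n →ₗᵢ[ℝ] ParaSpace n
  inner_hyp : ∀ a, (inner ℝ e (hyp a) : ℝ) = 0
  exists_hyp : ∀ w, (inner ℝ e w : ℝ) = 0 → ∃ a, hyp a = w

lemma exists_paraFrame {e : ParaSpace n} (he : e ≠ 0) : ∃ Φ : ParaFrame n, Φ.e = e := by
  let L := (OrthonormalBasis.fromOrthogonalSpanSingleton (𝕜 := ℝ) n he).repr.symm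
  refine ⟨⟨e, he, (Submodule.subtypeₗᵢ _).comp L.toLinearIsometry,
    fun a => Submodule.mem_orthogonal_singleton_iff_inner_right.1 (L a).2, fun w hw => ?_⟩, rfl⟩
  exact ⟨L.symm ⟨w, Submodule.mem_orthogonal_singleton_iff_inner_right.2 hw⟩, by simp⟩

/-- The model space of the affine charts. -/
abbrev ParaHyper (n : ℕ) := 𝔼 n

variable (Φ : ParaFrame n)

/-- The point of the affine hyperplane through `e`. -/
def affinePt (a : ParaHyper n) : ParaSpace n := Φ.e + Φ.hyp a

lemma inner_affinePt (a b : ParaHyper n) :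
    (inner ℝ (affinePt Φ a) (Φ.hyp b) : ℝ) = inner ℝ a b := by
  rw [affinePt, inner_add_left, Φ.inner_hyp, zero_add, LinearIsometry.inner_map_map]

lemma inner_affinePt' (a b : ParaHyper n) :
    (inner ℝ (Φ.hyp a) (affinePt Φ b) : ℝ) = inner ℝ a b := by
  rw [real_inner_comm, inner_affinePt, real_inner_comm]

lemma inner_affinePt_affinePt (z : ParaHyper n × ParaHyper n) :
    (inner ℝ (affinePt Φ z.1) (affinePt Φ z.2) : ℝ) = paraNorm (‖Φ.e‖ ^ 2) z := by
  rw [affinePt, inner_add_left, inner_affinePt', affinePt, inner_add_right, Φ.inner_hyp, add_zero,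
    real_inner_self_eq_norm_sq, paraNorm]

lemma affinePt_ne_zero (a : ParaHyper n) : affinePt Φ a ≠ 0 := fun h => by
  have : (inner ℝ Φ.e (affinePt Φ a) : ℝ) = ‖Φ.e‖ ^ 2 := by
    rw [affinePt, inner_add_right, Φ.inner_hyp, add_zero, real_inner_self_eq_norm_sq]
  rw [h, inner_zero_right] at this
  exact Φ.ne_zero (norm_eq_zero.1 (pow_eq_zero_iff two_ne_zero |>.1 this.symm))

lemma contDiff_affinePt : ContDiff ℝ ∞ (affinePt Φ) :=
  contDiff_const.add Φ.hyp.toContinuousLinearMap.contDiff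

lemma fderiv_affinePt (a w : ParaHyper n) : 𝐃 (affinePt Φ) a w = Φ.hyp w := by
  have h : HasFDerivAt (affinePt Φ) _ a := (Φ.hyp.toContinuousLinearMap.hasFDerivAt).const_add Φ.e
  rw [h.fderiv]
  rfl

/-- The central projection of the affine hyperplane through `e` to the sphere. -/
def unitPart (a : ParaHyper n) : ParaSphere n := ⟨‖affinePt Φ a‖⁻¹ • affinePt Φ a, by
    rw [mem_sphere_zero_iff_norm, norm_smul, norm_inv, norm_norm,
      inv_mul_cancel₀ (norm_ne_zero_iff.2 (affinePt_ne_zero Φ a))]⟩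

lemma contMDiff_unitPart : ContMDiff 𝓘(ℝ, ParaHyper n) (𝓡 n) ∞ (unitPart Φ) := by
  have h : ContDiff ℝ ∞ fun a : ParaHyper n => ‖affinePt Φ a‖⁻¹ • affinePt Φ a :=
    (((contDiff_affinePt Φ).norm ℝ (affinePt_ne_zero Φ)).inv fun a =>
      norm_ne_zero_iff.2 (affinePt_ne_zero Φ a)).smul (contDiff_affinePt Φ)
  exact h.contMDiff.codRestrict_sphere fun a => (unitPart Φ a).2

lemma inner_unitPart (z : ParaHyper n × ParaHyper n) :
    (inner ℝ (unitPart Φ z.1 : ParaSpace n) (unitPart Φ z.2 : ParaSpace n) : ℝ) =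
      ‖affinePt Φ z.1‖⁻¹ * ‖affinePt Φ z.2‖⁻¹ * paraNorm (‖Φ.e‖ ^ 2) z := by
  rw [unitPart, unitPart, real_inner_smul_left, real_inner_smul_right, inner_affinePt_affinePt,
    mul_assoc]

lemma inv_norm_affinePt_pos (a : ParaHyper n) : 0 < ‖affinePt Φ a‖⁻¹ :=
  inv_pos.2 (norm_pos_iff.2 (affinePt_ne_zero Φ a))

open Classical in
/-- An affine chart of the paracomplex projective space. -/
def paraChart (p : paraOpen n) (z : ParaHyper n × ParaHyper n) : paraOpen n :=
  if h : 0 < paraNorm (‖Φ.e‖ ^ 2) z then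
    ⟨(unitPart Φ z.1, unitPart Φ z.2), (mul_pos (mul_pos (inv_norm_affinePt_pos Φ z.1)
      (inv_norm_affinePt_pos Φ z.2)) h).trans_eq (inner_unitPart Φ z).symm⟩
  else p

variable (p : paraOpen n) {z : ParaHyper n × ParaHyper n}

lemma paraChart_val (hz : 0 < paraNorm (‖Φ.e‖ ^ 2) z) :
    (paraChart Φ p z).1 = (unitPart Φ z.1, unitPart Φ z.2) := by rw [paraChart, dif_pos hz]

lemma isOpen_paraNorm (κ : ℝ) {W : Type} [NormedAddCommGroup W] [InnerProductSpace ℝ W] :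
    IsOpen {z : W × W | 0 < paraNorm κ z} :=
  isOpen_lt continuous_const (by unfold paraNorm; fun_prop)

lemma contMDiffAt_paraChart (hz : 0 < paraNorm (‖Φ.e‖ ^ 2) z) :
    ContMDiffAt 𝓘(ℝ, ParaHyper n × ParaHyper n) ((𝓡 n).prod (𝓡 n)) ∞ (paraChart Φ p) z := by
  rw [← ContMDiffAt.subtypeVal_comp_iff]
  have h : ContMDiff 𝓘(ℝ, ParaHyper n × ParaHyper n) ((𝓡 n).prod (𝓡 n)) ∞
      fun z : ParaHyper n × ParaHyper n => (unitPart Φ z.1, unitPart Φ z.2) :=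
    ((contMDiff_unitPart Φ).comp contDiff_fst.contMDiff).prodMk
      ((contMDiff_unitPart Φ).comp contDiff_snd.contMDiff)
  refine h.contMDiffAt.congr_of_eventuallyEq ?_
  filter_upwards [(isOpen_paraNorm (‖Φ.e‖ ^ 2)).mem_nhds hz] with w hw using paraChart_val Φ p hw

lemma paraEmb_paraChart (hz : 0 < paraNorm (‖Φ.e‖ ^ 2) z) : paraEmb (paraChart Φ p z) =
    (((√(‖affinePt Φ z.1‖⁻¹ * ‖affinePt Φ z.2‖⁻¹ * paraNorm (‖Φ.e‖ ^ 2) z))⁻¹ *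
        ‖affinePt Φ z.1‖⁻¹) • affinePt Φ z.1,
      ((√(‖affinePt Φ z.1‖⁻¹ * ‖affinePt Φ z.2‖⁻¹ * paraNorm (‖Φ.e‖ ^ 2) z))⁻¹ *
        ‖affinePt Φ z.2‖⁻¹) • affinePt Φ z.2) := by
  rw [paraEmb, paraCos, paraChart_val Φ p hz, inner_unitPart, mul_smul, mul_smul]
  rfl

lemma exists_mfderiv_paraEmb (hz : 0 < paraNorm (‖Φ.e‖ ^ 2) z) : ∃ s t : ℝ,
    s * t * paraNorm (‖Φ.e‖ ^ 2) z = 1 ∧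
    paraEmb (paraChart Φ p z) = (s • affinePt Φ z.1, t • affinePt Φ z.2) ∧
    ∀ a : ParaHyper n × ParaHyper n, ∃ l m : ℝ,
      mfderiv ((𝓡 n).prod (𝓡 n)) 𝓘(ℝ, ParaSpace n × ParaSpace n) paraEmb (paraChart Φ p z)
        (mfderiv 𝓘(ℝ, ParaHyper n × ParaHyper n) ((𝓡 n).prod (𝓡 n)) (paraChart Φ p) z a) =
      (s • Φ.hyp a.1 + l • affinePt Φ z.1, t • Φ.hyp a.2 + m • affinePt Φ z.2) := by
  let r : ParaHyper n × ParaHyper n → ℝ := fun z =>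
    (√(‖affinePt Φ z.1‖⁻¹ * ‖affinePt Φ z.2‖⁻¹ * paraNorm (‖Φ.e‖ ^ 2) z))⁻¹
  let s : ParaHyper n × ParaHyper n → ℝ := fun z => r z * ‖affinePt Φ z.1‖⁻¹
  let t : ParaHyper n × ParaHyper n → ℝ := fun z => r z * ‖affinePt Φ z.2‖⁻¹
  have p1 := inv_norm_affinePt_pos Φ z.1
  have p2 := inv_norm_affinePt_pos Φ z.2
  have p3 := mul_pos (mul_pos p1 p2) hz
  refine ⟨s z, t z, ?_, paraEmb_paraChart Φ p hz, fun a => ?_⟩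
  · have h := Real.sq_sqrt p3.le
    calc s z * t z * paraNorm (‖Φ.e‖ ^ 2) z = (√(‖affinePt Φ z.1‖⁻¹ * ‖affinePt Φ z.2‖⁻¹ *
        paraNorm (‖Φ.e‖ ^ 2) z) ^ 2)⁻¹ * (‖affinePt Φ z.1‖⁻¹ * ‖affinePt Φ z.2‖⁻¹ *
        paraNorm (‖Φ.e‖ ^ 2) z) := by simp only [s, t, r]; ring
      _ = 1 := by rw [h, inv_mul_cancel₀ p3.ne']
  have dn : ∀ a, DifferentiableAt ℝ (fun a : ParaHyper n => ‖affinePt Φ a‖⁻¹) a := fun a =>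
    (((contDiff_affinePt Φ).norm ℝ (affinePt_ne_zero Φ)).contDiffAt.inv
      (norm_ne_zero_iff.2 (affinePt_ne_zero Φ a))).differentiableAt (n := ∞) (by simp)
  have d1 : DifferentiableAt ℝ (fun z : ParaHyper n × ParaHyper n => ‖affinePt Φ z.1‖⁻¹) z :=
    (dn z.1).comp z differentiableAt_fst
  have d2 : DifferentiableAt ℝ (fun z : ParaHyper n × ParaHyper n => ‖affinePt Φ z.2‖⁻¹) z :=
    (dn z.2).comp z differentiableAt_snd
  have d3 : DifferentiableAt ℝ (paraNorm (W := ParaHyper n) (‖Φ.e‖ ^ 2)) z :=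
    (differentiableAt_fst.inner ℝ differentiableAt_snd).const_add _
  have dr : DifferentiableAt ℝ r z :=
    (((d1.mul d2).mul d3).sqrt p3.ne').fun_inv (Real.sqrt_pos.2 p3).ne'
  have ds : HasFDerivAt s (𝐃 s z) z := (dr.mul d1).hasFDerivAt
  have dt : HasFDerivAt t (𝐃 t z) z := (dr.mul d2).hasFDerivAt
  have da : ∀ a, HasFDerivAt (affinePt Φ) (𝐃 (affinePt Φ) a) a := fun a =>
    ((contDiff_affinePt Φ).differentiable (by simp) a).hasFDerivAt
  have hd := (ds.smul ((da z.1).comp z hasFDerivAt_fst)).prodMk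
    (dt.smul ((da z.2).comp z hasFDerivAt_snd))
  refine ⟨𝐃 s z a, 𝐃 t z a, ?_⟩
  have hcomp := mfderiv_comp z (contMDiff_paraEmb.mdifferentiable (by simp) (paraChart Φ p z))
    ((contMDiffAt_paraChart Φ p hz).mdifferentiableAt (by simp))
  have hev : paraEmb ∘ paraChart Φ p =ᶠ[𝓝 z]
      fun z => (s z • affinePt Φ z.1, t z • affinePt Φ z.2) := by
    filter_upwards [(isOpen_paraNorm (‖Φ.e‖ ^ 2)).mem_nhds hz] with w hw
      using paraEmb_paraChart Φ p hw
  have hm : mfderiv 𝓘(ℝ, ParaHyper n × ParaHyper n) 𝓘(ℝ, ParaSpace n × ParaSpace n)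
      (paraEmb ∘ paraChart Φ p) z = 𝐃 (paraEmb ∘ paraChart Φ p) z := mfderiv_eq_fderiv
  have h2 := congrArg (fun T : ParaHyper n × ParaHyper n →L[ℝ] ParaSpace n × ParaSpace n => T a)
    (hcomp.symm.trans (hm.trans (hev.fderiv_eq.trans hd.fderiv)))
  refine h2.trans (Prod.ext ?_ ?_)
  · change s z • 𝐃 (affinePt Φ) z.1 a.1 + 𝐃 s z a • affinePt Φ z.1 = _
    rw [fderiv_affinePt]
  · change t z • 𝐃 (affinePt Φ) z.2 a.2 + 𝐃 t z a • affinePt Φ z.2 = _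
    rw [fderiv_affinePt]

lemma smul_hyper_mem_span_iff {t m : ℝ} (ht : t ≠ 0) (a b : ParaHyper n) :
    t • Φ.hyp a + m • affinePt Φ b ∈ Submodule.span ℝ {t • affinePt Φ b} ↔ a = 0 := by
  rw [Submodule.mem_span_singleton]
  constructor
  · rintro ⟨c, hc⟩
    have h := congrArg (fun x : ParaSpace n => (inner ℝ Φ.e x : ℝ)) hc
    simp only [affinePt, inner_add_right, real_inner_smul_right, Φ.inner_hyp,
      real_inner_self_eq_norm_sq, mul_zero, add_zero, zero_add] at h
    have h1 : c * t = m := by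
      have : ‖Φ.e‖ ^ 2 ≠ 0 := pow_ne_zero 2 (norm_ne_zero_iff.2 Φ.ne_zero)
      rw [← mul_assoc] at h
      exact mul_right_cancel₀ this h
    rw [← mul_smul, h1, eq_comm, add_eq_right, smul_eq_zero] at hc
    exact (map_eq_zero_iff _ Φ.hyp.injective).1 (hc.resolve_left ht)
  · rintro rfl
    exact ⟨m / t, by rw [← mul_smul, div_mul_cancel₀ _ ht]; simp⟩

variable {c : ℝ} (hc : c ≠ 0)

/-- The affine model of the paracomplex projective space around `e`. -/
def paraAffine : AdaptedModel (ParaHyper n × ParaHyper n) :=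
  paraModel (ParaHyper n) (div_ne_zero two_ne_zero hc)
    (pow_ne_zero 2 (norm_ne_zero_iff.2 Φ.ne_zero) : ‖Φ.e‖ ^ 2 ≠ 0)

lemma paraAffine_presents (hz : z ∈ (paraAffine Φ hc).U) : (paraPair n c).Presents
    ((𝓡 n).prod (𝓡 n)) 𝓘(ℝ, ParaSpace n × ParaSpace n) paraEmb (paraAffine Φ hc)
    (paraChart Φ p) z := by
  have hz' : 0 < paraNorm (‖Φ.e‖ ^ 2) z := hz
  obtain ⟨s, t, hst, hemb, hd⟩ := exists_mfderiv_paraEmb Φ p hz'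
  have ht : t ≠ 0 := by rintro rfl; simp at hst
  have hs : s ≠ 0 := by rintro rfl; simp at hst
  have hmet : ∀ a b : ParaHyper n × ParaHyper n, paracomplexMetric c (paraEmb (paraChart Φ p z))
      (mfderiv ((𝓡 n).prod (𝓡 n)) 𝓘(ℝ, ParaSpace n × ParaSpace n) paraEmb (paraChart Φ p z)
        (mfderiv 𝓘(ℝ, ParaHyper n × ParaHyper n) ((𝓡 n).prod (𝓡 n)) (paraChart Φ p) z a))
      (mfderiv ((𝓡 n).prod (𝓡 n)) 𝓘(ℝ, ParaSpace n × ParaSpace n) paraEmb (paraChart Φ p z)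
        (mfderiv 𝓘(ℝ, ParaHyper n × ParaHyper n) ((𝓡 n).prod (𝓡 n)) (paraChart Φ p) z b)) =
      (paraAffine Φ hc).metric z a b := fun a b => by
    obtain ⟨l, m, ha⟩ := hd a
    obtain ⟨l', m', hb⟩ := hd b
    refine (congrArg₂ (paracomplexMetric c _) ha hb).trans
        ((congrArg (fun w => paracomplexMetric c w
      _ _) hemb).trans (Eq.trans ?_ (paraModel_metric _ _ z a b).symm))
    simp only [paracomplexMetric, inner_add_left, inner_add_right, real_inner_smul_left,
      real_inner_smul_right, inner_affinePt, inner_affinePt', inner_affinePt_affinePt,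
      LinearIsometry.inner_map_map, real_inner_comm a.2 b.1]
    rw [show t = (s * paraNorm (‖Φ.e‖ ^ 2) z)⁻¹ from eq_inv_of_mul_eq_one_left (by linarith)]
    field_simp
    ring
  refine ⟨?_, hmet, fun a => ?_, fun a => ?_⟩
  · refine isLocalDiffeomorphAt_of_injective_mfderiv ?_ (paraAffine Φ hc).isOpen
      (fun w hw => (contMDiffAt_paraChart Φ p hw).contMDiffWithinAt) hz fun a b hab => ?_
    · rfl
    · refine (AdaptedModel.metric_nondeg hz).eq_of_forall fun w => ?_
      refine (hmet a w).symm.trans (Eq.trans ?_ (hmet b w))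
      exact congrArg (fun v => paracomplexMetric c (paraEmb (paraChart Φ p z))
        (mfderiv ((𝓡 n).prod (𝓡 n)) 𝓘(ℝ, ParaSpace n × ParaSpace n) paraEmb (paraChart Φ p z) v) _)
        hab
  · obtain ⟨l, m, ha⟩ := hd a
    change (mfderiv ((𝓡 n).prod (𝓡 n)) 𝓘(ℝ, ParaSpace n × ParaSpace n) paraEmb (paraChart Φ p z)
        (mfderiv 𝓘(ℝ, ParaHyper n × ParaHyper n) ((𝓡 n).prod (𝓡 n)) (paraChart Φ p) z a)).2 ∈
      Submodule.span ℝ {(paraEmb (paraChart Φ p z)).2} ↔ pairF _ a = a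
    rw [ha, hemb, smul_hyper_mem_span_iff Φ ht, pairF_apply, Prod.ext_iff]
    simp [neg_eq_iff_add_eq_zero, ← two_smul ℝ]
  · obtain ⟨l, m, ha⟩ := hd a
    change (mfderiv ((𝓡 n).prod (𝓡 n)) 𝓘(ℝ, ParaSpace n × ParaSpace n) paraEmb (paraChart Φ p z)
        (mfderiv 𝓘(ℝ, ParaHyper n × ParaHyper n) ((𝓡 n).prod (𝓡 n)) (paraChart Φ p) z a)).1 ∈
      Submodule.span ℝ {(paraEmb (paraChart Φ p z)).1} ↔ pairF _ a = -a
    rw [ha, hemb, smul_hyper_mem_span_iff Φ hs, pairF_apply, Prod.ext_iff]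
    simp [eq_neg_iff_add_eq_zero, ← two_smul ℝ]

lemma exists_unitPart (x : ParaSphere n) (hx : 0 < (inner ℝ Φ.e (x : ParaSpace n) : ℝ)) :
    ∃ a : ParaHyper n, unitPart Φ a = x := by
  set k := ‖Φ.e‖ ^ 2 / inner ℝ Φ.e (x : ParaSpace n) with hk
  have he' : 0 < ‖Φ.e‖ := norm_pos_iff.2 Φ.ne_zero
  have hk0 : 0 < k := by positivity
  obtain ⟨a, ha⟩ := Φ.exists_hyp (k • (x : ParaSpace n) - Φ.e) (by
    rw [inner_sub_right, real_inner_smul_right, real_inner_self_eq_norm_sq, hk,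
      div_mul_cancel₀ _ hx.ne', sub_self])
  have ha : affinePt Φ a = k • (x : ParaSpace n) := by rw [affinePt, ha, add_sub_cancel]
  refine ⟨a, Subtype.ext ?_⟩
  change ‖affinePt Φ a‖⁻¹ • affinePt Φ a = _
  rw [ha, norm_smul, norm_eq_of_mem_sphere, mul_one, Real.norm_of_nonneg hk0.le,
    inv_smul_smul₀ hk0.ne']

include hc in
lemma paraPair_presented : (paraPair n c).Presented ((𝓡 n).prod (𝓡 n))
    𝓘(ℝ, ParaSpace n × ParaSpace n) paraEmb (ParaHyper n × ParaHyper n) := by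
  intro p
  have h1 : (inner ℝ ((p.1.1 : ParaSpace n) + (p.1.2 : ParaSpace n)) (p.1.1 : ParaSpace n) : ℝ) = 1
      + paraCos p := by
    rw [inner_add_left, real_inner_self_eq_norm_sq, norm_paraFst, paraCos, real_inner_comm]
    norm_num
  have h2 : (inner ℝ ((p.1.1 : ParaSpace n) + (p.1.2 : ParaSpace n)) (p.1.2 : ParaSpace n) : ℝ) =
      paraCos p + 1 := by
    rw [inner_add_left, real_inner_self_eq_norm_sq, norm_paraSnd, paraCos]
    norm_num
  have hp := paraCos_pos p
  obtain ⟨Φ, hΦ⟩ := exists_paraFrame (e := (p.1.1 : ParaSpace n) + (p.1.2 : ParaSpace n)) fun h =>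
      by
    rw [h, inner_zero_left] at h1
    linarith
  obtain ⟨a, ha⟩ := exists_unitPart Φ p.1.1 (by rw [hΦ, h1]; linarith)
  obtain ⟨b, hb⟩ := exists_unitPart Φ p.1.2 (by rw [hΦ, h2]; linarith)
  have hz : 0 < paraNorm (‖Φ.e‖ ^ 2) (a, b) := by
    have h := inner_unitPart Φ (a, b)
    rw [ha, hb] at h
    exact pos_of_mul_pos_right (hp.trans_eq h)
      (mul_pos (inv_norm_affinePt_pos Φ a) (inv_norm_affinePt_pos Φ b)).le
  refine ⟨paraAffine Φ hc, paraChart Φ p, (a, b), hz, Subtype.ext ?_,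
    fun z hz => paraAffine_presents Φ p hc hz⟩
  rw [paraChart_val Φ p hz, ha, hb]

lemma fderiv_normalize {V : Type} [NormedAddCommGroup V] [InnerProductSpace ℝ V] {x : V}
    (hx : x ≠ 0) (s : ℝ) : HasFDerivAt (fun x : V => ‖x‖⁻¹ • x) (𝐃 (fun x : V => ‖x‖⁻¹ • x) x) x ∧
      𝐃 (fun x : V => ‖x‖⁻¹ • x) x (s • x) = 0 := by
  have hd : DifferentiableAt ℝ (fun x : V => ‖x‖⁻¹ • x) x :=
    (((contDiffAt_norm ℝ hx).inv (norm_ne_zero_iff.2 hx)).smul contDiffAt_id).differentiableAt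
      (n := ∞) (by simp)
  refine ⟨hd.hasFDerivAt, ?_⟩
  have h1 := hasDerivAt_line hd x
  have h2 : (fun t : ℝ => ‖x + t • x‖⁻¹ • (x + t • x)) =ᶠ[𝓝 0] fun _ => ‖x‖⁻¹ • x := by
    filter_upwards [lt_mem_nhds (show (-1 : ℝ) < 0 by norm_num)] with t ht
    have h : (0 : ℝ) < 1 + t := by linarith
    rw [show x + t • x = (1 + t) • x by module, norm_smul, Real.norm_of_nonneg h.le, mul_inv,
      mul_smul, smul_comm (‖x‖⁻¹), inv_smul_smul₀ h.ne']
  rw [map_smul, h1.unique ((hasDerivAt_const (0 : ℝ) (‖x‖⁻¹ • x)).congr_of_eventuallyEq h2),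
    smul_zero]

lemma normalize_const {V : Type} [NormedAddCommGroup V] [InnerProductSpace ℝ V] {v v' : ℝ → V}
    (hv : ∀ t, HasDerivAt v (v' t) t) (h0 : ∀ t, v t ≠ 0) (h : ∀ t, ∃ s : ℝ, v' t = s • v t)
    (a b : ℝ) : ‖v a‖⁻¹ • v a = ‖v b‖⁻¹ • v b := by
  have hd : ∀ t, HasDerivAt (fun t => ‖v t‖⁻¹ • v t) 0 t := fun t => by
    obtain ⟨s, hs⟩ := h t
    obtain ⟨h1, h2⟩ := fderiv_normalize (h0 t) s
    have h3 := h1.comp_hasDerivAt t (hv t)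
    rwa [hs, h2] at h3
  exact is_const_of_deriv_eq_zero (fun t => (hd t).differentiableAt) (fun t => (hd t).deriv) a b

lemma normalize_paraEmb (p : paraOpen n) :
    ‖(paraEmb p).1‖⁻¹ • (paraEmb p).1 = p.1.1 ∧ ‖(paraEmb p).2‖⁻¹ • (paraEmb p).2 = p.1.2 := by
  have h : 0 < (√(paraCos p))⁻¹ := zero_lt_one.trans_le (one_le_inv_sqrt p)
  have : ∀ x : ParaSpace n, ‖x‖ = 1 →
      ‖(√(paraCos p))⁻¹ • x‖⁻¹ • ((√(paraCos p))⁻¹ • x) = x := fun x hx => by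
    rw [norm_smul, hx, mul_one, Real.norm_of_nonneg h.le, inv_smul_smul₀ h.ne']
  exact ⟨this _ (norm_paraFst p), this _ (norm_paraSnd p)⟩

lemma paraEmb_ne_zero (p : paraOpen n) : (paraEmb p).1 ≠ 0 ∧ (paraEmb p).2 ≠ 0 := by
  have h : (√(paraCos p))⁻¹ ≠ 0 := (zero_lt_one.trans_le (one_le_inv_sqrt p)).ne'
  exact ⟨smul_ne_zero h (norm_ne_zero_iff.1 (by rw [norm_paraFst]; exact one_ne_zero)),
    smul_ne_zero h (norm_ne_zero_iff.1 (by rw [norm_paraSnd]; exact one_ne_zero))⟩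

lemma hasDerivAt_paraEmb {γ : ℝ → paraOpen n} (hγ : ContMDiff 𝓥 ℝ ((𝓡 n).prod (𝓡 n)) ∞ γ) (t : ℝ) :
    HasDerivAt (fun t => paraEmb (γ t)) (mfderiv ((𝓡 n).prod (𝓡 n)) 𝓘(ℝ, ParaSpace n × ParaSpace n)
      paraEmb (γ t) (mfderiv 𝓥 ℝ ((𝓡 n).prod (𝓡 n)) γ t (1 : ℝ))) t := by
  have hd : DifferentiableAt ℝ (paraEmb ∘ γ) t :=
    ((contMDiff_paraEmb.comp hγ).contDiff).differentiable (by simp) t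
  have h := mfderiv_comp t (contMDiff_paraEmb.mdifferentiable (by simp) (γ t))
    (hγ.mdifferentiable (by simp) t)
  have hm : mfderiv 𝓥 ℝ 𝓘(ℝ, ParaSpace n × ParaSpace n) (paraEmb ∘ γ) t =
    𝐃 (paraEmb ∘ γ) t := mfderiv_eq_fderiv
  have h2 := congrArg (fun T : ℝ →L[ℝ] ParaSpace n × ParaSpace n => T 1) (h.symm.trans hm)
  exact hd.hasDerivAt.congr_deriv ((fderiv_apply_one_eq_deriv).symm.trans h2.symm)

/-- The bi-Lagrangian structure of the paracomplex projective space. -/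
def paraStr (n : ℕ) {c : ℝ} (hc : c ≠ 0) : BiLagrangianStructure ((𝓡 n).prod (𝓡 n)) (paraOpen n) :=
  (paraPair_presented hc).str

lemma paraStr_mem_D₁ (p : paraOpen n) (v : TangentSpace ((𝓡 n).prod (𝓡 n)) p) :
    v ∈ (paraStr n hc).D₁ p ↔ ∃ s : ℝ, (mfderiv ((𝓡 n).prod (𝓡 n))
      𝓘(ℝ, ParaSpace n × ParaSpace n) paraEmb p v).2 = s • (paraEmb p).2 :=
  ((paraPair_presented hc).mem_D₁_iff p v).trans
    (Submodule.mem_span_singleton.trans (exists_congr fun _ => eq_comm))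

lemma paraStr_mem_D₂ (p : paraOpen n) (v : TangentSpace ((𝓡 n).prod (𝓡 n)) p) :
    v ∈ (paraStr n hc).D₂ p ↔ ∃ s : ℝ, (mfderiv ((𝓡 n).prod (𝓡 n))
      𝓘(ℝ, ParaSpace n × ParaSpace n) paraEmb p v).1 = s • (paraEmb p).1 :=
  ((paraPair_presented hc).mem_D₂_iff p v).trans
    (Submodule.mem_span_singleton.trans (exists_congr fun _ => eq_comm))

lemma paraStr_N (p : paraOpen n) : (paraStr n hc).N p = 1 := by
  refine encard_eq_one.2 ⟨p, Subset.antisymm ?_ ?_⟩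
  · rintro q ⟨⟨γ, hγ, h0, h1, hD⟩, ⟨δ, hδ, k0, k1, kD⟩⟩
    have e2 := normalize_const (fun t => (hasDerivAt_paraEmb hγ t).snd)
      (fun t => (paraEmb_ne_zero (γ t)).2) (fun t => (paraStr_mem_D₁ hc _ _).1 (hD t)) 1 0
    have e1 := normalize_const (fun t => (hasDerivAt_paraEmb hδ t).fst)
      (fun t => (paraEmb_ne_zero (δ t)).1) (fun t => (paraStr_mem_D₂ hc _ _).1 (kD t)) 1 0
    rw [h0, h1, (normalize_paraEmb q).2, (normalize_paraEmb p).2] at e2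
    rw [k0, k1, (normalize_paraEmb q).1, (normalize_paraEmb p).1] at e1
    exact Subtype.ext (Prod.ext (Subtype.ext e1) (Subtype.ext e2))
  · rintro _ rfl
    refine ⟨⟨fun _ => _, contMDiff_const, rfl, rfl, fun t => ?_⟩,
      ⟨fun _ => _, contMDiff_const, rfl, rfl, fun t => ?_⟩⟩ <;>
    · rw [mfderiv_const]
      exact Submodule.zero_mem _

lemma paraStr_not_isFlat (hn : 1 ≤ n) : ¬ (paraStr n hc).IsFlat := by
  obtain ⟨p⟩ := (paraOpen_connectedSpace hn).toNonempty
  obtain ⟨Φ, -⟩ := exists_paraFrame (n := n) (e := EuclideanSpace.single 0 1) (by simp)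
  exact paraModel_not_isFlat (paraStr n hc) (div_ne_zero two_ne_zero hc)
    (pow_pos (norm_pos_iff.2 Φ.ne_zero) 2) (ψ := paraChart Φ p)
    (fun z hz => (paraAffine_presents Φ p hc hz).modelsAt)
    (w := EuclideanSpace.single (⟨0, hn⟩ : Fin n) 1) (by simp)

end ParacomplexManifold

section TangentBundles

lemma contMDiff_tangentMk : ContMDiff 𝓘(ℝ, E × E) 𝓘(ℝ, E).tangent ∞
      fun z : E × E => (⟨z.1, z.2⟩ : TangentBundle 𝓥 E E) := by
  have h := contMDiff_tangentBundleModelSpaceHomeomorph_symm (I := 𝓥 E) (n := ∞)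
  rw [modelWithCornersSelf_prod]
  exact h

lemma contMDiff_tangentPair : ContMDiff 𝓘(ℝ, E).tangent 𝓘(ℝ, E × E) ∞
      fun u : TangentBundle 𝓥 E E => ((u.1, u.2) : E × E) := by
  have h := contMDiff_tangentBundleModelSpaceHomeomorph (I := 𝓥 E) (n := ∞)
  rw [modelWithCornersSelf_prod]
  exact h

lemma eq_zero_of_eq_neg {v : E} (h : v = -v) : v = 0 := by
  have h2 : (2 : ℝ) • v = 0 := by
    rw [two_smul]
    exact eq_neg_iff_add_eq_zero.1 h
  exact (smul_eq_zero.1 h2).resolve_left two_ne_zero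

variable {n : ℕ} {M : Type} [TopologicalSpace M] [ChartedSpace (𝔼 n) M]

lemma tangentBundle_ext {p q : M} (h : p = q) {v : TangentSpace (𝓡 n) p} {w : TangentSpace (𝓡 n) q}
    (hv : (v : 𝔼 n) = w) :
    (⟨p, v⟩ : TangentBundle (𝓡 n) M) = ⟨q, w⟩ := by
  subst h
  exact congrArg (Bundle.TotalSpace.mk p) hv

lemma isLocalDiffeomorph_tangentParam [IsManifold (𝓡 n) ∞ M] {π : 𝔼 n → M}
    (hπ : IsLocalDiffeomorph (𝓡 n) (𝓡 n) ∞ π) :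
    IsLocalDiffeomorph 𝓘(ℝ, 𝔼 n × 𝔼 n) (𝓡 n).tangent ∞ (tangentParam π) := by
  have hM : IsManifold (𝓡 n) 1 M := .of_le (n := ∞) (by simp)
  have hψ : ContMDiff 𝓘(ℝ, 𝔼 n × 𝔼 n) (𝓡 n).tangent ∞
      (tangentParam π) := (hπ.contMDiff.contMDiff_tangentMap (by simp)).comp contMDiff_tangentMk
  intro z
  refine isLocalDiffeomorphAt_of_injective_mfderiv rfl isOpen_univ hψ.contMDiffOn (mem_univ z) ?_
  set Φ := (hπ z.1).localInverse with hΦ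
  have hs : Φ.source ∈ 𝓝 (π z.1) :=
    (hπ z.1).localInverse_open_source.mem_nhds (hπ z.1).localInverse_mem_source
  have ht : Φ.target ∈ 𝓝 z.1 := Φ.open_target.mem_nhds (hπ z.1).localInverse_mem_target
  let g : TangentBundle (𝓡 n) M → 𝔼 n × 𝔼 n := fun u =>
    ((tangentMapWithin (𝓡 n) (𝓡 n) Φ Φ.source u).1, (tangentMapWithin (𝓡 n) (𝓡 n) Φ Φ.source u).2)
  have hg : ContMDiffAt (𝓡 n).tangent 𝓘(ℝ, 𝔼 n × 𝔼 n) ∞ g (tangentParam π z) := by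
    have h := Φ.contMDiffOn.contMDiffOn_tangentMapWithin (m := ∞) (by simp)
      Φ.open_source.uniqueMDiffOn
    exact contMDiff_tangentPair.contMDiffAt.comp _ (h.contMDiffAt
      (FiberBundle.continuous_proj (𝔼 n) (TangentSpace (𝓡 n)) |>.continuousAt
        (x := tangentParam π z) |>.preimage_mem_nhds hs))
  have hev : g ∘ tangentParam π =ᶠ[𝓝 z] id := by
    have h1 : ∀ᶠ w : 𝔼 n × 𝔼 n in 𝓝 z, w.1 ∈ Φ.target ∧ π w.1 ∈ Φ.source :=
      ((continuous_fst.tendsto z).eventually ht).and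
        (((hπ.contMDiff.continuous.comp continuous_fst).tendsto z).eventually hs)
    filter_upwards [h1] with w hw
    refine Prod.ext ((hπ z.1).localInverse_left_inv hw.1) ?_
    have h2 : Φ ∘ π =ᶠ[𝓝 w.1] id := by
      filter_upwards [Φ.open_target.mem_nhds hw.1] with y hy using (hπ z.1).localInverse_left_inv hy
    have h3 := mfderiv_comp w.1 (Φ.mdifferentiableAt (by simp) hw.2)
      (hπ.contMDiff.mdifferentiable (by simp) w.1)
    have h4 : mfderivWithin (𝓡 n) (𝓡 n) Φ Φ.source (π w.1) = mfderiv (𝓡 n) (𝓡 n) Φ (π w.1) :=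
      mfderivWithin_of_isOpen Φ.open_source hw.2
    have h5 := (h2.mfderiv_eq (I := 𝓡 n) (I' := 𝓡 n)).trans mfderiv_id
    change mfderivWithin (𝓡 n) (𝓡 n) Φ Φ.source (π w.1) (mfderiv (𝓡 n) (𝓡 n) π w.1 w.2) = w.2
    rw [h4]
    exact congrArg (fun T : 𝔼 n →L[ℝ] 𝔼 n => T w.2) (h3.symm.trans h5)
  have h1 := mfderiv_comp z (hg.mdifferentiableAt (by simp)) (hψ.mdifferentiable (by simp) z)
  have h2 := h1.symm.trans (hev.mfderiv_eq.trans mfderiv_id)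
  exact Function.LeftInverse.injective (g := mfderiv (𝓡 n).tangent
    𝓘(ℝ, 𝔼 n × 𝔼 n) g (tangentParam π z)) fun a =>
    congrArg (fun T : (𝔼 n × 𝔼 n) →L[ℝ] (𝔼 n × 𝔼 n) => T a) h2

/-- The flat model of `ℝⁿ × ℝⁿ` with horizontal and vertical foliations. -/
def horizontalModel (n : ℕ) : AdaptedModel (𝔼 n × 𝔼 n) where
  U := univ
  isOpen := isOpen_univ
  form _ := pairForm _
  F := pairF _
  smooth := contDiffOn_const
  F_F a := by simp
  alt x _ a := by rw [pairForm_apply, real_inner_comm, sub_self]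
  nondeg _ _ := nondeg_pairForm
  anti x _ a b := by simp only [pairForm_apply, pairF_apply, inner_neg_left, inner_neg_right]; ring
  closed x _ a b c := by simp

namespace IsFlatQuotient

variable {Γ : Subgroup (𝔼 n ≃ᵃⁱ[ℝ] 𝔼 n)} {π : 𝔼 n → M} (h : IsFlatQuotient Γ π)

lemma _root_.AffineIsometryEquiv.map_add_eq (γ : V ≃ᵃⁱ[ℝ] V) (x v : V) : γ (x + v) = γ x +
    γ.linearIsometryEquiv v := by
  have := γ.map_vadd x v
  simpa [add_comm] using this

include h in
lemma mfderiv_act {γ : 𝔼 n ≃ᵃⁱ[ℝ] 𝔼 n} (hγ : γ ∈ Γ) (x a : 𝔼 n) :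
    (mfderiv (𝓡 n) (𝓡 n) π (γ x) (γ.linearIsometryEquiv a) : 𝔼 n) = mfderiv (𝓡 n) (𝓡 n) π x a := by
  have h1 : π ∘ γ = π := funext fun z => ((h.fibers z (γ z)).2 ⟨γ, hγ, rfl⟩).symm
  have h0 : (γ : 𝔼 n → 𝔼 n) = fun z => γ.linearIsometryEquiv z + γ 0 := funext fun z => by
    have := γ.map_add_eq 0 z
    rwa [zero_add, add_comm] at this
  let T : 𝔼 n →L[ℝ] 𝔼 n := γ.linearIsometryEquiv
  have hd : HasFDerivAt γ T x := by
    rw [h0]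
    exact T.hasFDerivAt.add_const _
  have hm : mfderiv (𝓡 n) (𝓡 n) γ x = 𝐃 γ x := mfderiv_eq_fderiv
  have h2 := mfderiv_comp x (h.localDiffeo.contMDiff.mdifferentiable (by simp) (γ x))
    hd.differentiableAt.mdifferentiableAt
  rw [h1, hm, hd.fderiv] at h2
  exact (congrArg (fun T : 𝔼 n →L[ℝ] 𝔼 n => T a) h2).symm

include h in
lemma tangentParam_act {γ : 𝔼 n ≃ᵃⁱ[ℝ] 𝔼 n} (hγ : γ ∈ Γ) (x v : 𝔼 n) :
    tangentParam π (γ x, γ.linearIsometryEquiv v) = tangentParam π (x, v) :=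
  tangentBundle_ext ((h.fibers x (γ x)).2 ⟨γ, hγ, rfl⟩).symm (h.mfderiv_act hγ x v)

include h in
lemma tangentParam_snd_injective (x : 𝔼 n) :
    Function.Injective fun v => tangentParam π (x, v) := fun v w hvw =>
  ((h.localDiffeo x).mfderivToContinuousLinearEquiv (by simp)).injective
    (eq_of_heq (Bundle.TotalSpace.mk.inj hvw).2)

include h in
lemma tangentParam_eq_iff (z w : 𝔼 n × 𝔼 n) :
    tangentParam π z = tangentParam π w ↔ tangentRel Γ z w := by
  constructor
  · intro hzw
    obtain ⟨γ, hγ, hx⟩ := (h.fibers z.1 w.1).1 (congrArg Bundle.TotalSpace.proj hzw)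
    refine ⟨γ, hγ, hx, h.tangentParam_snd_injective w.1 ?_⟩
    have := h.tangentParam_act hγ z.1 z.2
    rw [hx] at this
    exact this.trans hzw
  · rintro ⟨γ, hγ, hx, hv⟩
    have := h.tangentParam_act hγ z.1 z.2
    rw [hx, hv] at this
    exact this.symm

include h in
lemma tangentParam_eq {u : TangentBundle (𝓡 n) M} {x : 𝔼 n}
    (hx : π x = u.proj) : ∃ v, tangentParam π (x, v) = u := by
  obtain ⟨p, u⟩ := u
  obtain rfl : π x = p := hx
  obtain ⟨v, hv⟩ := ((h.localDiffeo x).mfderivToContinuousLinearEquiv (by simp)).surjective u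
  exact ⟨v, congrArg (Bundle.TotalSpace.mk (π x)) hv⟩

include h in
lemma tangentParam_surjective : Function.Surjective (tangentParam π) := fun u => by
  obtain ⟨x, hx⟩ := h.surjective u.proj
  obtain ⟨v, hv⟩ := h.tangentParam_eq hx
  exact ⟨_, hv⟩

variable [IsManifold (𝓡 n) ∞ M]

include h in
lemma descends : (horizontalModel n).Descends (𝓡 n).tangent (tangentParam π) where
  localDiffeo := (isLocalDiffeomorph_tangentParam h.localDiffeo).isLocalDiffeomorphOn _
  surjective := by rw [show (horizontalModel n).U = univ from rfl, image_univ,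
      h.tangentParam_surjective.range_eq]
  invariant x _ y _ hxy := by
    obtain ⟨γ, hγ, h1, h2⟩ := (h.tangentParam_eq_iff x y).1 hxy
    let T : 𝔼 n →L[ℝ] 𝔼 n := γ.linearIsometryEquiv
    let L := T.prodMap T
    have hLi : ∀ a b : 𝔼 n, (inner ℝ (T a) (T b) : ℝ) = inner ℝ a b :=
      fun a b => γ.linearIsometryEquiv.inner_map_map a b
    refine ⟨L, fun a => ?_, fun a b => ?_, fun a => ?_⟩
    · let f : 𝔼 n × 𝔼 n → 𝔼 n × 𝔼 n := fun w => L w + (γ 0, 0)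
      have hfun : ∀ w : 𝔼 n × 𝔼 n, f w = (γ w.1, γ.linearIsometryEquiv w.2) := fun w => by
        have := γ.map_add_eq 0 w.1
        rw [zero_add, add_comm] at this
        exact Prod.ext this.symm (add_zero _)
      have hd : HasFDerivAt f L x := L.hasFDerivAt.add_const _
      have hf : tangentParam π ∘ f = tangentParam π := funext fun w => by
        rw [Function.comp_apply, hfun, h.tangentParam_act hγ]
      have hfx : f x = y := by rw [hfun, h1, h2]
      have hm : mfderiv 𝓘(ℝ, 𝔼 n × 𝔼 n) 𝓘(ℝ, 𝔼 n × 𝔼 n) f x = 𝐃 f x := mfderiv_eq_fderiv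
      have h3 := mfderiv_comp x ((isLocalDiffeomorph_tangentParam
          h.localDiffeo).contMDiff.mdifferentiable
        (by simp) (f x)) hd.differentiableAt.mdifferentiableAt
      rw [hf, hm, hd.fderiv, hfx] at h3
      exact (congrArg (fun T : (𝔼 n × 𝔼 n) →L[ℝ] (𝔼 n × 𝔼 n) => T a) h3).symm
    · change pairForm _ (L a) (L b) = pairForm _ a b
      rw [pairForm_apply, pairForm_apply]
      exact congrArg₂ (· - ·) (hLi _ _) (hLi _ _)
    · exact Prod.ext rfl (map_neg T _).symm

/-- The bi-Lagrangian structure of the tangent bundle of a flat Riemannian manifold. -/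
def tangentStr : BiLagrangianStructure (𝓡 n).tangent (TangentBundle (𝓡 n) M) := h.descends.str

lemma modelsAt : ∀ z ∈ (horizontalModel n).U, (horizontalModel n).ModelsAt (𝓡 n).tangent
    h.tangentStr.form h.tangentStr.F (tangentParam π) z := h.descends.str_modelsAt

lemma tangentStr_isQuotientOf : h.tangentStr.IsQuotientOf univ neutralMetric horizontalProduct
    (tangentRel Γ) (tangentParam π) := by
  refine AdaptedModel.isQuotientOf (A := horizontalModel n) h.modelsAt
    h.descends.surjective (fun x _ y _ => h.tangentParam_eq_iff x y) (fun x _ a b => ?_)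
    fun x _ a => rfl
  change pairForm _ (pairF _ a) b = _
  simp [pairForm_apply, neutralMetric]

lemma tangentStr_isFlat : h.tangentStr.IsFlat := by
  refine BiLagrangianStructure.isFlat_of_models (V := 𝔼 n × 𝔼 n) _ fun p => ?_
  obtain ⟨z, rfl⟩ := h.tangentParam_surjective p
  exact ⟨horizontalModel n, tangentParam π, z, mem_univ z, rfl, h.modelsAt,
    AdaptedModel.curv_eq_zero_of_const (A := horizontalModel n) (mem_univ z) fun _ _ => rfl⟩

include h in
lemma affineFibers : (horizontalModel n).AffineFibers (tangentParam π) := by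
  rintro x - y - hxy
  obtain ⟨γ, hγ, h1, h2⟩ := (h.tangentParam_eq_iff x y).1 hxy
  let T : 𝔼 n →L[ℝ] 𝔼 n := γ.linearIsometryEquiv
  refine ⟨T.prodMap T, fun a => Prod.ext rfl (map_neg T _).symm, fun v _ => ⟨mem_univ _, ?_⟩⟩
  refine Eq.trans (congrArg _ ?_) (h.tangentParam_act hγ (x + v).1 (x + v).2)
  refine Prod.ext ?_ ?_
  · exact ((γ.map_add_eq x.1 v.1).trans (by rw [h1]; rfl)).symm
  · exact ((map_add γ.linearIsometryEquiv x.2 v.2).trans (by rw [h2]; rfl)).symm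

lemma leaf₁_tangentParam (z : 𝔼 n × 𝔼 n) :
    h.tangentStr.leaf₁ (tangentParam π z) = range fun a => tangentParam π (z.1 + a, z.2) := by
  refine ((horizontalModel n).leaf₁_eq_univ rfl h.modelsAt h.descends.surjective
    h.affineFibers z).trans (Set.ext fun q => ⟨?_, ?_⟩)
  · rintro ⟨v, hv, rfl⟩
    have h0 : v.2 = 0 := eq_zero_of_eq_neg (congrArg Prod.snd hv).symm
    exact ⟨v.1, congrArg _ (Prod.ext rfl (by simp [h0]))⟩
  · rintro ⟨a, rfl⟩
    exact ⟨(a, 0), Prod.ext rfl neg_zero, congrArg _ (Prod.ext rfl (add_zero _))⟩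

lemma leaf₂_tangentParam (u : TangentBundle (𝓡 n) M) :
    h.tangentStr.leaf₂ u = {w | w.proj = u.proj} := by
  obtain ⟨z, rfl⟩ := h.tangentParam_surjective u
  refine ((horizontalModel n).leaf₂_eq_univ rfl h.modelsAt h.descends.surjective
    h.affineFibers z).trans (Set.ext fun q => ⟨?_, fun hq => ?_⟩)
  · rintro ⟨v, hv, rfl⟩
    have h0 : v.1 = 0 := eq_zero_of_eq_neg (congrArg Prod.fst hv)
    change π (z.1 + v.1) = π z.1
    rw [h0, add_zero]
  · obtain ⟨v, hv⟩ := h.tangentParam_eq (x := z.1) (u := q) hq.symm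
    exact ⟨(0, v - z.2), Prod.ext neg_zero.symm rfl,
      (congrArg _ (Prod.ext (add_zero _) (add_sub_cancel _ _))).trans hv⟩

lemma tangentStr_N (x v : 𝔼 n) : h.tangentStr.N (tangentParam π (x, v)) =
    {w | ∃ γ ∈ Γ, γ.linearIsometryEquiv v = w}.encard := by
  rw [BiLagrangianStructure.N, leaf₁_tangentParam, leaf₂_tangentParam,
    ← (h.tangentParam_snd_injective x).encard_image]
  congr 1
  ext q
  constructor
  · rintro ⟨⟨a, rfl⟩, hq⟩
    obtain ⟨γ, hγ, hx⟩ := (h.fibers (x + a) x).1 hq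
    refine ⟨γ.linearIsometryEquiv v, ⟨γ, hγ, rfl⟩, ?_⟩
    have h2 := h.tangentParam_act hγ (x + a) v
    rwa [hx] at h2
  · rintro ⟨_, ⟨γ, hγ, rfl⟩, rfl⟩
    refine ⟨⟨γ⁻¹ x - x, ?_⟩, rfl⟩
    have h1 : γ (γ⁻¹ x) = x := γ.apply_symm_apply x
    have h2 := h.tangentParam_act hγ (γ⁻¹ x) v
    rw [h1] at h2
    simp only [add_sub_cancel]
    exact h2.symm

include h in
lemma tangentBundle_not_compactSpace (hn : 1 ≤ n) : ¬ CompactSpace (TangentBundle (𝓡 n) M) := by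
  intro hc
  have hψ := isLocalDiffeomorph_tangentParam h.localDiffeo
  let s := Function.surjInv h.tangentParam_surjective
  have hs : ∀ z, ‖(s (tangentParam π z)).2‖ = ‖z.2‖ := fun z => by
    obtain ⟨γ, -, -, h2⟩ := (h.tangentParam_eq_iff _ z).1
      (Function.surjInv_eq h.tangentParam_surjective (tangentParam π z))
    rw [← h2, LinearIsometryEquiv.norm_map]
  have hcont : Continuous fun u => ‖(s u).2‖ := by
    rw [(hψ.isOpenMap.isQuotientMap hψ.contMDiff.continuous
        h.tangentParam_surjective).continuous_iff]
    exact (continuous_snd.norm).congr fun z => (hs z).symm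
  obtain ⟨C, hC⟩ := (isCompact_univ (X := TangentBundle (𝓡 n) M)).bddAbove_image hcont.continuousOn
  have h1 := hC (mem_image_of_mem _
    (mem_univ (tangentParam π (0, EuclideanSpace.single (⟨0, hn⟩ : Fin n) (|C| + 1)))))
  rw [hs, PiLp.norm_single, Real.norm_of_nonneg (by positivity)] at h1
  linarith [le_abs_self C]

end IsFlatQuotient

end TangentBundles

section FlatQuotients

variable {n : ℕ}

lemma linearIsometryEquiv_apply_of_affine {s : Fin n → ℝ} {t : Fin n → ℝ} {γ : 𝔼 n ≃ᵃⁱ[ℝ] 𝔼 n}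
    (h : ∀ x i, γ x i = s i * x i + t i) (v : 𝔼 n) (i : Fin n) :
    γ.linearIsometryEquiv v i = s i * v i := by
  have h1 := congrArg (fun w : 𝔼 n => w i) (γ.map_add_eq 0 v)
  simp only [zero_add, PiLp.add_apply, h, PiLp.zero_apply] at h1
  linarith

lemma exists_diagonal_isometry (s t : Fin n → ℝ) (hs : ∀ i, s i = 1 ∨ s i = -1) :
    ∃ γ : 𝔼 n ≃ᵃⁱ[ℝ] 𝔼 n, ∀ x i, γ x i = s i * x i + t i := by
  classical
  let L : 𝔼 n ≃ₗᵢ[ℝ] 𝔼 n := LinearIsometryEquiv.piLpCongrRight 2 fun i =>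
      if s i = 1 then LinearIsometryEquiv.refl ℝ ℝ else LinearIsometryEquiv.neg ℝ
  refine ⟨L.toAffineIsometryEquiv.trans (AffineIsometryEquiv.constVAdd ℝ _ (WithLp.toLp 2 t)),
    fun x i => ?_⟩
  have h : L x i = s i * x i := by
    change (if s i = 1 then LinearIsometryEquiv.refl ℝ ℝ else LinearIsometryEquiv.neg ℝ) (x i) = _
    rcases hs i with h | h
    · rw [if_pos h, h, one_mul]
      rfl
    · rw [if_neg (by rw [h]; norm_num), h, neg_one_mul]
      rfl
  change t i + L x i = _
  rw [h, add_comm]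

/-- The isometries of `ℝⁿ` in a group are separated if none but the identity moves a point by less
than `ε`. -/
lemma isometries_separated {Γ : Subgroup (𝔼 n ≃ᵃⁱ[ℝ] 𝔼 n)}
    {ε : ℝ} (h : ∀ γ ∈ Γ, γ = 1 ∨ ∃ i, ∀ x, ε ≤ |γ x i - x i|) :
    ∀ γ ∈ Γ, ∀ δ ∈ Γ, γ = δ ∨ ∀ x, ε ≤ dist (γ x) (δ x) := by
  intro γ hγ δ hδ
  refine (h (γ * δ⁻¹) (Γ.mul_mem hγ (Γ.inv_mem hδ))).imp mul_inv_eq_one.1 ?_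
  rintro ⟨i, hi⟩ x
  have h1 : (γ * δ⁻¹) (δ x) = γ x := congrArg γ (δ.symm_apply_apply x)
  have h2 := hi (δ x)
  rw [h1] at h2
  rw [dist_eq_norm]
  exact h2.trans (PiLp.norm_apply_le (γ x - δ x) i)

/-- The conclusion common to the two examples. -/
lemma exists_compact_flatQuotient (Γ : Subgroup (𝔼 n ≃ᵃⁱ[ℝ] 𝔼 n)) {ε : ℝ} (hε : 0 < ε)
    (h : ∀ γ ∈ Γ, γ = 1 ∨ ∃ i, ∀ x, ε ≤ |γ x i - x i|)
    (hlat : ∀ k : Fin n → ℤ, ∀ γ : 𝔼 n ≃ᵃⁱ[ℝ] 𝔼 n,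
      (∀ x i, γ x i = x i + k i) → γ ∈ Γ) (hn : 1 ≤ n) :
    ∃ (M : Type) (_ : TopologicalSpace M) (_ : ChartedSpace (𝔼 n) M) (_ : IsManifold (𝓡 n) ∞ M)
      (π : 𝔼 n → M)
      (B : BiLagrangianStructure (𝓡 n).tangent (TangentBundle (𝓡 n) M)),
      T2Space M ∧ CompactSpace M ∧ IsFlatQuotient Γ π ∧
      B.IsQuotientOf univ neutralMetric horizontalProduct (tangentRel Γ) (tangentParam π) ∧
      ¬ CompactSpace (TangentBundle (𝓡 n) M) ∧ B.IsFlat ∧ Function.Surjective (tangentParam π) ∧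
      ∀ x v, B.N (tangentParam π (x, v)) = {w | ∃ γ ∈ Γ, γ.linearIsometryEquiv v = w}.encard := by
  let D := AffineDeck.isometries Γ ε hε (isometries_separated h)
  have hπ : IsFlatQuotient Γ D.proj := ⟨fun x => D.isLocalDiffeomorphOn_proj ⟨x, mem_univ x⟩,
      range_eq_univ.1 (image_univ.symm.trans D.image_proj),
      fun x y => (AffineDeck.proj_eq_iff (mem_univ x) (mem_univ y)).trans AffineDeck.isometries_rel⟩
  refine ⟨D.Q, _, _, inferInstance, D.proj, hπ.tangentStr, inferInstance, ?_, hπ,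
    hπ.tangentStr_isQuotientOf, hπ.tangentBundle_not_compactSpace hn, hπ.tangentStr_isFlat,
    hπ.tangentParam_surjective, hπ.tangentStr_N⟩
  have hcube : IsCompact (univ.pi fun _ : Fin n => Icc (0 : ℝ) 1) :=
    isCompact_univ_pi fun _ => isCompact_Icc
  refine D.compactSpace (hcube.image (PiLp.continuous_toLp 2 _)) (subset_univ _) fun x _ => ?_
  obtain ⟨γ, hγ⟩ := exists_diagonal_isometry (fun _ => 1) (fun i => (⌊x i⌋ : ℝ)) fun _ => Or.inl rfl
  refine ⟨_, ⟨fun i => Int.fract (x i), fun i _ => ⟨Int.fract_nonneg _, (Int.fract_lt_one _).le⟩,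
    rfl⟩, AffineDeck.isometries_rel.2 ⟨γ, hlat (fun i => ⌊x i⌋) γ fun x i => ?_, ?_⟩⟩
  · rw [hγ, one_mul]
  · ext i
    rw [hγ, one_mul]
    exact Int.fract_add_floor _

lemma mem_latticeGroup {γ : 𝔼 n ≃ᵃⁱ[ℝ] 𝔼 n}
    (h : γ ∈ latticeGroup n) : ∃ k : Fin n → ℤ, ∀ x i, γ x i = x i + k i := by
  induction h using Subgroup.closure_induction with
  | mem γ h => exact h
  | one => exact ⟨0, fun x i => by simp⟩
  | mul γ δ _ _ hγ hδ =>
    obtain ⟨k, hk⟩ := hγ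
    obtain ⟨l, hl⟩ := hδ
    exact ⟨k + l, fun x i => (hk (δ x) i).trans (by rw [hl]; push_cast [Pi.add_apply]; ring)⟩
  | inv γ _ hγ =>
    obtain ⟨k, hk⟩ := hγ
    refine ⟨-k, fun x i => ?_⟩
    have h := hk (γ⁻¹ x) i
    rw [show γ (γ⁻¹ x) = x from γ.apply_symm_apply x] at h
    rw [h]
    simp

lemma translation_separated {k : Fin n → ℤ} {γ : 𝔼 n ≃ᵃⁱ[ℝ] 𝔼 n}
    (h : ∀ x i, γ x i = x i + k i) : γ = 1 ∨ ∃ i, ∀ x, (1 : ℝ) ≤ |γ x i - x i| := by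
  by_cases hk : k = 0
  · refine Or.inl (AffineIsometryEquiv.ext fun x => ?_)
    ext i
    rw [h, hk]
    simp
  · obtain ⟨i, hi⟩ := Function.ne_iff.1 hk
    refine Or.inr ⟨i, fun x => ?_⟩
    rw [h, add_sub_cancel_left]
    rw [← Int.cast_abs]
    exact_mod_cast Int.one_le_abs hi

/-- The sign `-1` or `1`. -/
def boolSign (b : Bool) : ℝ := if b then -1 else 1

/-- The shift `1/2` or `0`. -/
def boolHalf (b : Bool) : ℝ := if b then 1 / 2 else 0

/-- The coordinates which change sign under the element `AᵃBᵇ` of the holonomy group. -/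
def hwFlip : ℕ → Bool → Bool → Bool
  | 0, _, b => b
  | 1, a, _ => a
  | 2, a, b => a ^^ b
  | _, _, _ => false

/-- The coordinates with a half-integer shift under the element `AᵃBᵇ`. -/
def hwHalf : ℕ → Bool → Bool → Bool
  | 0, a, _ => a
  | 1, a, b => a ^^ b
  | 2, _, b => b
  | _, _, _ => false

lemma hwFlip_xor (i : ℕ) (a b a' b' : Bool) :
    hwFlip i (a ^^ a') (b ^^ b') = (hwFlip i a b ^^ hwFlip i a' b') := by
  match i with
  | 0 => rfl
  | 1 => rfl
  | 2 => simp only [hwFlip]; revert a b a' b'; decide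
  | _ + 3 => rfl

lemma hwHalf_xor (i : ℕ) (a b a' b' : Bool) :
    hwHalf i (a ^^ a') (b ^^ b') = (hwHalf i a b ^^ hwHalf i a' b') := by
  match i with
  | 0 => rfl
  | 1 => simp only [hwHalf]; revert a b a' b'; decide
  | 2 => rfl
  | _ + 3 => rfl

lemma boolSign_xor (p q : Bool) : boolSign (p ^^ q) = boolSign p * boolSign q := by
  cases p <;> cases q <;> simp [boolSign]

lemma boolSign_mul_self (p : Bool) : boolSign p * boolSign p = 1 := by cases p <;> simp [boolSign]

lemma exists_boolHalf (p q q' : Bool) (m m' : ℤ) : ∃ k : ℤ,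
    boolSign p * (boolHalf q + m) + (boolHalf q' + m') = boolHalf (q' ^^ q) + k := by
  have h : ∃ k : ℤ, boolSign p * boolHalf q + boolHalf q' = boolHalf (q' ^^ q) + k := by
    cases p <;> cases q <;> cases q' <;> simp only [boolSign, boolHalf, Bool.xor_true,
      Bool.xor_false, Bool.not_true, Bool.not_false, if_true, Bool.false_eq_true, if_false]
    exacts [⟨0, by norm_num⟩, ⟨0, by norm_num⟩, ⟨0, by norm_num⟩, ⟨1, by norm_num⟩,
      ⟨0, by norm_num⟩, ⟨0, by norm_num⟩, ⟨-1, by norm_num⟩, ⟨0, by norm_num⟩]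
  obtain ⟨k, hk⟩ := h
  refine ⟨k + (if p then -m else m) + m', ?_⟩
  push_cast
  have : boolSign p * m = ((if p then -m else m : ℤ) : ℝ) := by cases p <;> simp [boolSign]
  push_cast at this
  linarith [mul_add (boolSign p) (boolHalf q) m]

/-- The elements of the Hantzsche–Wendt group over the element `AᵃBᵇ` of the holonomy group. -/
def IsHW (γ : 𝔼 n ≃ᵃⁱ[ℝ] 𝔼 n) (a b : Bool) : Prop :=
  ∃ m : Fin n → ℤ, ∀ x i, γ x i = boolSign (hwFlip i a b) * x i + (boolHalf (hwHalf i a b) + m i)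

lemma IsHW.mul {γ δ : 𝔼 n ≃ᵃⁱ[ℝ] 𝔼 n} {a b a' b' : Bool}
    (hγ : IsHW γ a b) (hδ : IsHW δ a' b') : IsHW (γ * δ) (a ^^ a') (b ^^ b') := by
  obtain ⟨m, hm⟩ := hγ
  obtain ⟨l, hl⟩ := hδ
  choose k hk using fun i : Fin n =>
    exists_boolHalf (hwFlip i a b) (hwHalf i a' b') (hwHalf i a b) (l i) (m i)
  refine ⟨k, fun x i => (hm (δ x) i).trans ?_⟩
  rw [hl, hwFlip_xor, hwHalf_xor, ← hk, boolSign_xor]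
  ring

lemma IsHW.inv {γ : 𝔼 n ≃ᵃⁱ[ℝ] 𝔼 n} {a b : Bool} (hγ : IsHW γ a b) : IsHW γ⁻¹ a b := by
  obtain ⟨m, hm⟩ := hγ
  choose k hk using fun i : Fin n =>
    exists_boolHalf (hwFlip i a b) (hwHalf i a b) (hwHalf i a b) (m i) 0
  refine ⟨fun i => -k i, fun x i => ?_⟩
  have h := hm (γ⁻¹ x) i
  rw [show γ (γ⁻¹ x) = x from γ.apply_symm_apply x] at h
  have h1 := hk i
  have h2 := boolSign_mul_self (hwFlip i a b)
  rw [Bool.xor_self, Int.cast_zero, add_zero] at h1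
  have h3 : boolHalf false = 0 := rfl
  push_cast
  linear_combination (-boolSign (hwFlip i a b)) * h - h1 - h3 - (γ⁻¹ x i) * h2

lemma exists_isHW {γ : 𝔼 n ≃ᵃⁱ[ℝ] 𝔼 n} (hγ : γ ∈ hantzscheWendtGroup n) : ∃ a b, IsHW γ a b := by
  induction hγ using Subgroup.closure_induction with
  | mem γ h =>
    rcases h with (⟨k, hk⟩ | hA) | hB
    · refine ⟨false, false, k, fun x i => ?_⟩
      rw [hk]
      match i with
      | ⟨0, _⟩ | ⟨1, _⟩ | ⟨2, _⟩ | ⟨_ + 3, _⟩ => simp [hwFlip, hwHalf, boolSign, boolHalf]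
    · refine ⟨true, false, 0, fun x i => ?_⟩
      rw [hA]
      match i with
      | ⟨0, _⟩ | ⟨1, _⟩ | ⟨2, _⟩ | ⟨_ + 3, _⟩ =>
        simp [hwFlip, hwHalf, boolSign, boolHalf, hwSignA, hwShiftA]
    · refine ⟨false, true, 0, fun x i => ?_⟩
      rw [hB]
      match i with
      | ⟨0, _⟩ | ⟨1, _⟩ | ⟨2, _⟩ | ⟨_ + 3, _⟩ =>
        simp [hwFlip, hwHalf, boolSign, boolHalf, hwSignB, hwShiftB]
  | one =>
    refine ⟨false, false, 0, fun x i => ?_⟩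
    match i with
    | ⟨0, _⟩ | ⟨1, _⟩ | ⟨2, _⟩ | ⟨_ + 3, _⟩ => simp [hwFlip, hwHalf, boolSign, boolHalf]
  | mul γ δ _ _ hγ hδ =>
    obtain ⟨a, b, h⟩ := hγ
    obtain ⟨a', b', h'⟩ := hδ
    exact ⟨_, _, h.mul h'⟩
  | inv γ _ hγ =>
    obtain ⟨a, b, h⟩ := hγ
    exact ⟨a, b, h.inv⟩

lemma IsHW.separated {γ : 𝔼 n ≃ᵃⁱ[ℝ] 𝔼 n} {a b : Bool}
    (hγ : IsHW γ a b) (hn : 3 ≤ n) : γ = 1 ∨ ∃ i, ∀ x, (1 / 2 : ℝ) ≤ |γ x i - x i| := by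
  obtain ⟨m, hm⟩ := hγ
  by_cases hab : a = false ∧ b = false
  · obtain ⟨rfl, rfl⟩ := hab
    refine (translation_separated (k := m) fun x i => ?_).imp_right fun ⟨i, hi⟩ =>
      ⟨i, fun x => le_trans (by norm_num) (hi x)⟩
    rw [hm]
    match i with
    | ⟨0, _⟩ | ⟨1, _⟩ | ⟨2, _⟩ | ⟨_ + 3, _⟩ => simp [hwFlip, hwHalf, boolSign, boolHalf]
  · obtain ⟨i, h1, h2⟩ : ∃ i : Fin n, hwFlip i a b = false ∧ hwHalf i a b = true := by
      cases a <;> cases b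
      · exact absurd ⟨rfl, rfl⟩ hab
      · exact ⟨⟨1, by omega⟩, rfl, rfl⟩
      · exact ⟨⟨0, by omega⟩, rfl, rfl⟩
      · exact ⟨⟨2, by omega⟩, rfl, rfl⟩
    refine Or.inr ⟨i, fun x => ?_⟩
    rw [hm, h1, h2, show boolSign false = 1 from rfl, show boolHalf true = 1 / 2 from rfl, one_mul,
      add_sub_cancel_left]
    rcases le_or_gt 0 (m i) with h | h
    · have : (0 : ℝ) ≤ m i := by exact_mod_cast h
      exact le_abs.2 (Or.inl (by linarith))
    · have : (m i : ℝ) ≤ -1 := by exact_mod_cast Int.le_sub_one_of_lt h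
      exact le_abs.2 (Or.inr (by linarith))

lemma exists_mem_hantzscheWendt (n : ℕ) (a b : Bool) : ∃ γ ∈ hantzscheWendtGroup n, IsHW γ a b := by
  have hsign : ∀ (i : ℕ) (a b : Bool), boolSign (hwFlip i a b) = 1 ∨ boolSign (hwFlip i a b) = -1 :=
    fun i a b => by cases hwFlip i a b <;> simp [boolSign]
  obtain ⟨A, hA⟩ := exists_diagonal_isometry (n := n) (fun i => boolSign (hwFlip i true false))
    (fun i => boolHalf (hwHalf i true false)) fun i => hsign i _ _
  obtain ⟨B, hB⟩ := exists_diagonal_isometry (n := n) (fun i => boolSign (hwFlip i false true))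
    (fun i => boolHalf (hwHalf i false true)) fun i => hsign i _ _
  have mA : A ∈ hantzscheWendtGroup n := Subgroup.subset_closure (Or.inl (Or.inr fun x i => by
    rw [hA]
    match i with
    | ⟨0, _⟩ | ⟨1, _⟩ | ⟨2, _⟩ | ⟨_ + 3, _⟩ =>
      simp [hwFlip, hwHalf, boolSign, boolHalf, hwSignA, hwShiftA]))
  have mB : B ∈ hantzscheWendtGroup n := Subgroup.subset_closure (Or.inr fun x i => by
    rw [hB]
    match i with
    | ⟨0, _⟩ | ⟨1, _⟩ | ⟨2, _⟩ | ⟨_ + 3, _⟩ =>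
      simp [hwFlip, hwHalf, boolSign, boolHalf, hwSignB, hwShiftB])
  have kA : IsHW A true false := ⟨0, fun x i => (hA x i).trans (by simp)⟩
  have kB : IsHW B false true := ⟨0, fun x i => (hB x i).trans (by simp)⟩
  cases a <;> cases b
  · exact ⟨A * A⁻¹, mul_mem mA (inv_mem mA), kA.mul kA.inv⟩
  · exact ⟨B, mB, kB⟩
  · exact ⟨A, mA, kA⟩
  · exact ⟨A * B, mul_mem mA mB, kA.mul kB⟩

end FlatQuotients

section Independence

lemma exists_of_surface (S : BiLagrangianManifold 2) {n : ℕ} (hn : 1 ≤ n)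
    (hN : ∃ p, S.str.N p ≠ 1) : ∃ X : BiLagrangianManifold (2 * n),
      (CompactSpace X.M ↔ CompactSpace S.M) ∧ (X.str.IsFlat ↔ S.str.IsFlat) ∧
        ¬ ∀ p, X.str.N p = 1 := by
  obtain ⟨p, hp⟩ := hN
  obtain _ | _ | m := n
  · omega
  · exact ⟨S, Iff.rfl, Iff.rfl, fun h => hp (h p)⟩
  · obtain ⟨⟨Y, -, -, hc, hf, h1⟩, -⟩ := exists_square (m + 1) (m + 1) le_rfl (by omega)
    have hY : CompactSpace Y.M := hc.2 rfl
    have := S.connected.toNonempty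
    have := Y.connected.toNonempty
    obtain ⟨q⟩ := Y.connected.toNonempty
    rw [show 2 * (m + 1 + 1) = 2 + 2 * (m + 1) by ring]
    refine ⟨S.prod Y, ⟨fun h => ?_, fun h => ?_⟩, (BiLagrangianStructure.prod_isFlat_iff S.str
        Y.str).trans
      (and_iff_left hf), fun h => hp ?_⟩
    · have h : CompactSpace (S.M × Y.M) := h
      exact (Prod.fst_surjective (α := S.M) (β := Y.M)).compactSpace continuous_fst
    · exact inferInstanceAs (CompactSpace (S.M × Y.M))
    · have := (BiLagrangianStructure.prod_N S.str Y.str (p, q)).symm.trans (h (p, q))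
      rwa [h1, mul_one] at this

theorem exists_independent (hs : ∀ c f : Prop, ∃ S : BiLagrangianManifold 2,
      (CompactSpace S.M ↔ c) ∧ (S.str.IsFlat ↔ f) ∧ ∃ p, S.str.N p ≠ 1)
    (n : ℕ) (hn : 1 ≤ n) (c f t : Prop) :
    ∃ X : BiLagrangianManifold (2 * n),
      (CompactSpace X.M ↔ c) ∧ (X.str.IsFlat ↔ f) ∧ ((∀ p, X.str.N p = 1) ↔ t) := by
  have key : ∀ {X : BiLagrangianManifold (2 * n)} {a b : Prop},
      (CompactSpace X.M ↔ a) → (X.str.IsFlat ↔ b) → ((∀ p, X.str.N p = 1) ↔ t) →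
      (a ↔ c) → (b ↔ f) → ∃ X : BiLagrangianManifold (2 * n),
      (CompactSpace X.M ↔ c) ∧ (X.str.IsFlat ↔ f) ∧ ((∀ p, X.str.N p = 1) ↔ t) :=
    fun h1 h2 h3 ha hb => ⟨_, h1.trans ha, h2.trans hb, h3⟩
  by_cases ht : t
  · have hk : ∃ k ≤ n, (k = n ↔ c) := by
      by_cases hc : c
      · exact ⟨n, le_rfl, by simp [hc]⟩
      · exact ⟨0, by omega, by simp only [hc, iff_false]; omega⟩
    obtain ⟨k, hkn, hk⟩ := hk
    obtain ⟨⟨X, -, -, h1, h2, h3⟩, ⟨X', -, -, -, h1', h2', h3'⟩⟩ := exists_square k n hkn hn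
    by_cases hf : f
    · exact key h1 (iff_true_intro h2) (iff_of_true h3 ht) hk (iff_of_true trivial hf)
    · exact key h1' (iff_false_intro h2') (iff_of_true h3' ht) hk (iff_of_false id hf)
  · obtain ⟨S, h1, h2, h3⟩ := hs c f
    obtain ⟨X, k1, k2, k3⟩ := exists_of_surface S hn h3
    exact key k1 k2 (iff_of_false k3 ht) h1 h2

end Independence

theorem mainTheorem2 :
    -- every combination of the three properties, in every even dimension
    (∀ n : ℕ, 1 ≤ n → ∀ c f t : Prop, ∃ X : BiLagrangianManifold (2 * n),
      (CompactSpace X.M ↔ c) ∧ (X.str.IsFlat ↔ f) ∧ ((∀ p, X.str.N p = 1) ↔ t)) ∧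
    -- the Minkowski plane
    (∃ X : BiLagrangianManifold 2, ∃ ψ : ℝ × ℝ → X.M,
      X.str.IsQuotientOf univ minkowskiMetric minkowskiProduct (fun x y => x = y) ψ ∧
      ¬ CompactSpace X.M ∧ X.str.IsFlat ∧ ∀ p, X.str.N p = 1) ∧
    -- flat tori
    (∀ α : ℝ, ∃ X : BiLagrangianManifold 2, ∃ ψ : ℝ × ℝ → X.M,
      X.str.IsQuotientOf univ minkowskiMetric minkowskiProduct (rotatedLatticeRel α) ψ ∧
      CompactSpace X.M ∧ X.str.IsFlat ∧
      (α = Real.pi / 4 → ∀ p, X.str.N p = 1) ∧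
      (α = 0 → ∀ p, X.str.N p = 2) ∧
      (∀ p, X.str.N p ≠ ⊤ ↔ ∃ m k : ℤ, (m ≠ 0 ∨ k ≠ 0) ∧
        m * (Real.cos α - Real.sin α) = k * (Real.cos α + Real.sin α))) ∧
    -- the Lorentz cylinder
    (∃ X : BiLagrangianManifold 2, ∃ ψ : ℝ × ℝ → X.M,
      X.str.IsQuotientOf univ minkowskiMetric minkowskiProduct cylinderRel ψ ∧
      ¬ CompactSpace X.M ∧ X.str.IsFlat ∧ ∀ p, X.str.N p = ⊤) ∧
    -- the ruled hyperboloid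
    (∀ r : ℝ, 0 < r → ∃ X : BiLagrangianManifold 2, ∃ ι : X.M → Fin 3 → ℝ,
      IsEmbeddedOnto X.I {x | lorentz3 x x = r ^ 2} ι ∧
      (∀ p v w, X.str.g p v w =
        lorentz3 (mfderiv X.I 𝓘(ℝ, Fin 3 → ℝ) ι p v) (mfderiv X.I 𝓘(ℝ, Fin 3 → ℝ) ι p w)) ∧
      (∀ p v, v ∈ X.str.D₁ p ↔
        ∃ s : ℝ, mfderiv X.I 𝓘(ℝ, Fin 3 → ℝ) ι p v = s • rulingDirection r 1 (ι p)) ∧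
      (∀ p v, v ∈ X.str.D₂ p ↔
        ∃ s : ℝ, mfderiv X.I 𝓘(ℝ, Fin 3 → ℝ) ι p v = s • rulingDirection r (-1) (ι p)) ∧
      ¬ CompactSpace X.M ∧ ¬ X.str.IsFlat ∧ (∀ p, X.str.N p = 1) ∧
      (∀ p, ι '' X.str.leaf₁ p = range fun s : ℝ => ι p + s • rulingDirection r 1 (ι p)) ∧
      (∀ p, ι '' X.str.leaf₂ p = range fun s : ℝ => ι p + s • rulingDirection r (-1) (ι p)) ∧
      (∀ p q, ι p 0 = 0 → ι q = -ι p → Disjoint (X.str.leaf₁ p) (X.str.leaf₂ q))) ∧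
    -- the punctured plane, the Clifton-Pohl torus and the Clifton-Pohl cylinder
    (∃ P T C : BiLagrangianManifold 2,
      ∃ φ : ℝ × ℝ → P.M, ∃ ψ : ℝ × ℝ → T.M, ∃ χ : ℝ × ℝ → C.M, ∃ q : C.M → T.M,
      P.str.IsQuotientOf {x | x ≠ 0} puncturedMetric puncturedProduct (fun x y => x = y) φ ∧
      ¬ CompactSpace P.M ∧ ¬ P.str.IsFlat ∧ (∀ p, P.str.N p = 1) ∧
      (∀ a b y : ℝ, 0 < a → b < 0 →
        Disjoint (P.str.leaf₁ (φ (a, 0))) (P.str.leaf₂ (φ (b, y)))) ∧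
      T.str.IsQuotientOf {x | x ≠ 0} puncturedMetric puncturedProduct homothetyRel ψ ∧
      CompactSpace T.M ∧ ¬ T.str.IsFlat ∧
      (∀ x : ℝ × ℝ, x ≠ 0 → x.1 * x.2 = 0 → T.str.N (ψ x) = 1) ∧
      (∀ x : ℝ × ℝ, x.1 * x.2 ≠ 0 → T.str.N (ψ x) = ⊤) ∧
      (∀ x : ℝ × ℝ, x ≠ 0 → (IsCompact (T.str.leaf₁ (ψ x)) ↔ x.2 = 0)) ∧
      (∀ x : ℝ × ℝ, x ≠ 0 → (IsCompact (T.str.leaf₂ (ψ x)) ↔ x.1 = 0)) ∧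
      (∀ a b : ℝ, a ≠ 0 → b ≠ 0 →
        Disjoint (T.str.leaf₁ (ψ (a, 0))) (T.str.leaf₂ (ψ (0, b)))) ∧
      IsLocalDiffeomorphOn 𝓘(ℝ, ℝ × ℝ) C.I ∞ χ {x | 0 < x.1} ∧ χ '' {x | 0 < x.1} = univ ∧
      (∀ x y : ℝ × ℝ, 0 < x.1 → 0 < y.1 → (χ x = χ y ↔ polarHomothetyRel x y)) ∧
      C.str.IsLocalIso T.str q ∧
      (∀ x : ℝ × ℝ, 0 < x.1 → q (χ x) = ψ (x.1 * Real.cos x.2, x.1 * Real.sin x.2)) ∧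
      ¬ CompactSpace C.M ∧ ¬ C.str.IsFlat ∧
      (∀ x : ℝ × ℝ, 0 < x.1 → Real.cos x.2 * Real.sin x.2 = 0 → C.str.N (χ x) = 1) ∧
      (∀ x : ℝ × ℝ, 0 < x.1 → Real.cos x.2 * Real.sin x.2 ≠ 0 → C.str.N (χ x) = ⊤)) ∧
    -- the Schwarzschild half-plane
    (∀ m : ℝ, 0 < m → ∃ X : BiLagrangianManifold 2, ∃ ψ : ℝ × ℝ → X.M,
      X.str.IsQuotientOf {x | 2 * m < x.2} (schwarzschildMetric m) (schwarzschildProduct m)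
        (fun x y => x = y) ψ ∧
      ¬ CompactSpace X.M ∧ ¬ X.str.IsFlat ∧ (∀ p, X.str.N p = 1) ∧
      ∀ p q, (X.str.leaf₁ p ∩ X.str.leaf₂ q).encard = 1) ∧
    -- `G × G` for `G = 𝕋ⁿ × ℝᵈ⁻ⁿ`: a flat and a non-flat structure
    (∀ n d : ℕ, n ≤ d → 1 ≤ d →
      (∃ X : BiLagrangianManifold (2 * d),
        ∃ ψ : EuclideanSpace ℝ (Fin d) × EuclideanSpace ℝ (Fin d) → X.M,
        X.str.IsQuotientOf univ neutralMetric squareProduct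
          (fun z w => torusCylinderRel n z.1 w.1 ∧ torusCylinderRel n z.2 w.2) ψ ∧
        (CompactSpace X.M ↔ n = d) ∧ X.str.IsFlat ∧ ∀ p, X.str.N p = 1) ∧
      (∃ X : BiLagrangianManifold (2 * d),
        ∃ ψ : EuclideanSpace ℝ (Fin d) × EuclideanSpace ℝ (Fin d) → X.M, ∃ G,
        X.str.IsQuotientOf univ G squareProduct
          (fun z w => torusCylinderRel n z.1 w.1 ∧ torusCylinderRel n z.2 w.2) ψ ∧
        (CompactSpace X.M ↔ n = d) ∧ ¬ X.str.IsFlat ∧ ∀ p, X.str.N p = 1)) ∧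
    -- products
    (∀ {d d' : ℕ} (X : BiLagrangianManifold d) (Y : BiLagrangianManifold d'),
      ∃ B : BiLagrangianStructure (X.I.prod Y.I) (X.M × Y.M),
      (∀ p v w, B.g p v w = X.str.g p.1 v.1 w.1 + Y.str.g p.2 v.2 w.2) ∧
      (∀ p v, B.F p v = (X.str.F p.1 v.1, Y.str.F p.2 v.2)) ∧
      (B.IsFlat ↔ X.str.IsFlat ∧ Y.str.IsFlat) ∧
      ∀ p, B.N p = X.str.N p.1 * Y.str.N p.2) ∧
    -- tangent bundles of flat Riemannian manifolds
    (∀ (n : ℕ) (Γ : Subgroup (EuclideanSpace ℝ (Fin n) ≃ᵃⁱ[ℝ] EuclideanSpace ℝ (Fin n)))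
      (M : Type) [TopologicalSpace M] [ChartedSpace (EuclideanSpace ℝ (Fin n)) M]
      [IsManifold (𝓡 n) ∞ M] [T2Space M] (π : EuclideanSpace ℝ (Fin n) → M),
      IsFlatQuotient Γ π →
      ∃ B : BiLagrangianStructure (𝓡 n).tangent (TangentBundle (𝓡 n) M),
      B.IsQuotientOf univ neutralMetric horizontalProduct (tangentRel Γ) (tangentParam π) ∧
      (∀ u, B.leaf₂ u = {w | w.proj = u.proj}) ∧
      (1 ≤ n → ¬ CompactSpace (TangentBundle (𝓡 n) M)) ∧ B.IsFlat ∧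
      ∀ x v, B.N (tangentParam π (x, v)) = {w | ∃ γ ∈ Γ, γ.linearIsometryEquiv v = w}.encard) ∧
    -- the tangent bundle of the flat torus
    (∀ n : ℕ, 1 ≤ n → ∃ (M : Type) (_ : TopologicalSpace M)
      (_ : ChartedSpace (EuclideanSpace ℝ (Fin n)) M) (_ : IsManifold (𝓡 n) ∞ M)
      (π : EuclideanSpace ℝ (Fin n) → M)
      (B : BiLagrangianStructure (𝓡 n).tangent (TangentBundle (𝓡 n) M)),
      T2Space M ∧ CompactSpace M ∧ IsFlatQuotient (latticeGroup n) π ∧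
      B.IsQuotientOf univ neutralMetric horizontalProduct (tangentRel (latticeGroup n))
        (tangentParam π) ∧
      ¬ CompactSpace (TangentBundle (𝓡 n) M) ∧ B.IsFlat ∧ ∀ u, B.N u = 1) ∧
    -- the tangent bundle of the Hantzsche-Wendt manifold and of its products with flat tori
    (∀ n : ℕ, 3 ≤ n → ∃ (M : Type) (_ : TopologicalSpace M)
      (_ : ChartedSpace (EuclideanSpace ℝ (Fin n)) M) (_ : IsManifold (𝓡 n) ∞ M)
      (π : EuclideanSpace ℝ (Fin n) → M)
      (B : BiLagrangianStructure (𝓡 n).tangent (TangentBundle (𝓡 n) M)),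
      T2Space M ∧ CompactSpace M ∧ IsFlatQuotient (hantzscheWendtGroup n) π ∧
      B.IsQuotientOf univ neutralMetric horizontalProduct (tangentRel (hantzscheWendtGroup n))
        (tangentParam π) ∧
      ¬ CompactSpace (TangentBundle (𝓡 n) M) ∧ B.IsFlat ∧
      (∀ x v, (∃ i j : Fin n, i < j ∧ j.val < 3 ∧ v i ≠ 0 ∧ v j ≠ 0) →
        B.N (tangentParam π (x, v)) = 4)) ∧
    -- the paracomplex projective space
    (∀ (n : ℕ) (c : ℝ), 1 ≤ n → c ≠ 0 → ∃ X : BiLagrangianManifold (2 * n),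
      ∃ ι : X.M → EuclideanSpace ℝ (Fin (n + 1)) × EuclideanSpace ℝ (Fin (n + 1)),
      IsEmbeddedOnto X.I (paracomplexProjective n) ι ∧
      (∀ p v w, X.str.g p v w = paracomplexMetric c (ι p)
        (mfderiv X.I 𝓘(ℝ, EuclideanSpace ℝ (Fin (n + 1)) × EuclideanSpace ℝ (Fin (n + 1))) ι p v)
        (mfderiv X.I 𝓘(ℝ, EuclideanSpace ℝ (Fin (n + 1)) × EuclideanSpace ℝ (Fin (n + 1))) ι p w)) ∧
      (∀ p v, v ∈ X.str.D₁ p ↔ ∃ s : ℝ, (mfderiv X.I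
        𝓘(ℝ, EuclideanSpace ℝ (Fin (n + 1)) × EuclideanSpace ℝ (Fin (n + 1))) ι p v).2
          = s • (ι p).2) ∧
      (∀ p v, v ∈ X.str.D₂ p ↔ ∃ s : ℝ, (mfderiv X.I
        𝓘(ℝ, EuclideanSpace ℝ (Fin (n + 1)) × EuclideanSpace ℝ (Fin (n + 1))) ι p v).1
          = s • (ι p).1) ∧
      ¬ CompactSpace X.M ∧ ¬ X.str.IsFlat ∧ ∀ p, X.str.N p = 1) := by
  refine (fun {P Q : Prop} (hq : Q) (h : Q → P) => (⟨h hq, hq⟩ : P ∧ Q))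
    ⟨?_, fun α => ?_, ?_, fun r hr => ?_, ?_, fun m hm => ?_, exists_square,
      fun X Y => have := X.connected.toNonempty; have := Y.connected.toNonempty
        ⟨X.str.prod Y.str, fun _ _ _ => rfl, fun _ _ => rfl,
          X.str.prod_isFlat_iff Y.str, X.str.prod_N Y.str⟩,
      fun n Γ M _ _ _ _ π h => ⟨h.tangentStr, h.tangentStr_isQuotientOf, h.leaf₂_tangentParam,
        h.tangentBundle_not_compactSpace, h.tangentStr_isFlat, h.tangentStr_N⟩,
      fun n hn => ?_, fun n hn => ?_, fun n c hn hc => ?_⟩ ?_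
  · have hL : ∀ v ∈ (⊥ : AddSubgroup (ℝ²)), v ≠ 0 → (1 : ℝ) ≤ ‖v‖ := by simp
    refine ⟨minkowskiManifold ⊥ 1 one_pos hL, minkowskiProj _ _ _ _,
      minkowski_isQuotientOf _ _ _ _ (by simp [eq_comm]), minkowski_not_compactSpace _ _ _ _
        (by simp), minkowski_isFlat _ _ _ _, fun p => ?_⟩
    obtain ⟨x, rfl⟩ := exists_minkowskiProj _ _ _ _ p
    rw [minkowski_N]
    have : {s : ℝ | ∃ v ∈ (⊥ : AddSubgroup (ℝ²)), v.1 + v.2 = 2 * s} = {0} := by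
      ext s
      simp
    rw [this, image_singleton, encard_singleton]
  · have hsurj : ∀ p, ∃ x, rotatedTorusProj α x = p := exists_minkowskiProj _ _ _ _
    refine ⟨rotatedTorus α, rotatedTorusProj α, minkowski_isQuotientOf _ _ _ _ fun x y => ⟨?_, ?_⟩,
      compactSpace_rotatedTorus α, minkowski_isFlat _ _ _ _, ?_, ?_, fun p => ?_⟩
    · rintro ⟨_, ⟨m, k, rfl⟩, rfl⟩
      exact ⟨m, k, rfl⟩
    · rintro ⟨m, k, rfl⟩
      exact ⟨_, ⟨m, k, rfl⟩, rfl⟩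
    · rintro rfl p
      obtain ⟨x, rfl⟩ := hsurj p
      exact rotatedTorus_N_pi_div_four x
    · rintro rfl p
      obtain ⟨x, rfl⟩ := hsurj p
      exact rotatedTorus_N_zero x
    · obtain ⟨x, rfl⟩ := hsurj p
      exact rotatedTorus_N_ne_top_iff α x
  · refine ⟨minkowskiManifold cylinderLattice 1 one_pos cylinderLattice_sep, minkowskiProj _ _ _ _,
      minkowski_isQuotientOf _ _ _ _ fun x y => ⟨?_, ?_⟩, minkowski_not_compactSpace _ _ _ _
        ?_, minkowski_isFlat _ _ _ _, fun p => ?_⟩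
    · rintro ⟨_, ⟨k, rfl⟩, rfl⟩
      exact ⟨k, rfl⟩
    · rintro ⟨k, rfl⟩
      exact ⟨_, ⟨k, rfl⟩, rfl⟩
    · rintro _ ⟨k, rfl⟩
      rfl
    · obtain ⟨x, rfl⟩ := exists_minkowskiProj _ _ _ _ p
      rw [minkowski_N, encard_eq_top_iff]
      have : {s : ℝ | ∃ v ∈ cylinderLattice, v.1 + v.2 = 2 * s} = range fun k : ℤ => Real.pi * k :=
          by
        ext s
        constructor
        · rintro ⟨_, ⟨k, rfl⟩, h⟩
          exact ⟨k, by simp only [add_zero] at h; linarith⟩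
        · rintro ⟨k, rfl⟩
          exact ⟨_, ⟨k, rfl⟩, by simp only [add_zero]; ring⟩
      rw [this, ← range_comp]
      refine infinite_range_of_injective fun k l hkl => ?_
      obtain ⟨j, hj⟩ := (minkowskiProj_eq_iff _ _ _ _ _ _).1 hkl
      have h2 := congrArg Prod.snd hj
      simp only [Prod.snd_sub, Prod.snd_add] at h2
      have : (k : ℝ) = l := by
        have : Real.pi * ((l : ℝ) - k) = 0 := by linarith
        rcases mul_eq_zero.1 this with h | h
        · exact absurd h Real.pi_ne_zero
        · linarith
      exact_mod_cast this
  · have key : ∀ {Δ : DistField 𝓥 ℝ² angleDeck.Q} {ε : ℝ}, (∀ x ∈ strip, ∀ a : ℝ²,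
        mfderiv 𝓥 ℝ² 𝓥 ℝ² angleDeck.proj x a ∈ Δ (angleDeck.proj x) ↔ ∃ s : ℝ,
          𝐃 (hyperboloidParam r) x a = s • rulingDirection r ε (hyperboloidParam r x)) →
        ∀ p v, v ∈ Δ p ↔ ∃ s : ℝ, mfderiv 𝓥 ℝ² 𝓘(ℝ, Fin 3 → ℝ) (hyperboloidMap r) p v =
          s • rulingDirection r ε (hyperboloidMap r p) := by
      intro Δ ε h p v
      obtain ⟨x, hx, rfl⟩ := angleDeck.exists_rep p
      obtain ⟨a, rfl⟩ := ((hyperboloid hr).modelsAt x hx).equiv.surjective v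
      refine (h x hx a).trans ?_
      rw [hyperboloidMap_proj r hx]
      exact exists_congr fun s => ⟨(mfderiv_hyperboloidMap r hx a).trans,
        (mfderiv_hyperboloidMap r hx a).symm.trans⟩
    refine ⟨(hyperboloid hr).manifold (by simp) (convex_strip.isConnected ⟨0, by
      simp [strip, Real.pi_pos]⟩), hyperboloidMap r, ⟨contMDiff_hyperboloidMap r, fun p => ?_,
      (hyperboloidMap_isClosedEmbedding hr).isEmbedding, hyperboloidMap_range hr⟩,
      fun p v w => ?_, key fun x hx a => ((hyperboloid hr).mem_D₁ x hx a).trans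
        ((diagF_eq_self_iff a).trans (hyperboloid_mem_ruling₁ hr hx a).symm),
      key fun x hx a => ((hyperboloid hr).mem_D₂ x hx a).trans
        ((diagF_eq_neg_iff a).trans (hyperboloid_mem_ruling₂ hr hx a).symm),
      hyperboloid_not_compactSpace hr,
      hyperboloid_not_isFlat hr, hyperboloid_N hr, hyperboloid_image_leaf₁ hr,
      hyperboloid_image_leaf₂ hr, fun p q => hyperboloid_antipodal hr⟩
    · intro v w hvw
      obtain ⟨x, hx, rfl⟩ := angleDeck.exists_rep p
      obtain ⟨a, rfl⟩ := ((hyperboloid hr).modelsAt x hx).equiv.surjective v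
      obtain ⟨b, rfl⟩ := ((hyperboloid hr).modelsAt x hx).equiv.surjective w
      have h : 𝐃 (hyperboloidParam r) x a = 𝐃 (hyperboloidParam r) x b :=
        (mfderiv_hyperboloidMap r hx a).symm.trans (hvw.trans (mfderiv_hyperboloidMap r hx b))
      have h0 : 𝐃 (hyperboloidParam r) x (a - b) = 0 := by rw [map_sub, h, sub_self]
      have h1 := (hyperboloid_mem_ruling₁ hr hx (a - b)).1 ⟨0, by rw [h0, zero_smul]⟩
      have h2 := (hyperboloid_mem_ruling₂ hr hx (a - b)).1 ⟨0, by rw [h0, zero_smul]⟩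
      rw [sub_eq_zero.1 (show a - b = 0 from Prod.ext h2 h1)]
    · obtain ⟨x, hx, rfl⟩ := angleDeck.exists_rep p
      obtain ⟨a, rfl⟩ := ((hyperboloid hr).modelsAt x hx).equiv.surjective v
      obtain ⟨b, rfl⟩ := ((hyperboloid hr).modelsAt x hx).equiv.surjective w
      refine (((hyperboloid hr).modelsAt x hx).g_eq a b).trans ?_
      refine Eq.trans ?_ (congrArg₂ lorentz3 (mfderiv_hyperboloidMap r hx a)
        (mfderiv_hyperboloidMap r hx b)).symm
      rw [lorentz3_hyperboloidParam r hx]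
      change r ^ 2 * (1 + stripSlope x ^ 2) / 2 * planeForm (diagF a) b = _
      simp only [planeForm_apply, diagF_apply]
      ring
  · refine ⟨puncturedPlane.manifold (by simp) isConnected_punctured,
      cliftonPohl.manifold (by simp) isConnected_punctured, cliftonPohlCylinderManifold,
      puncturedPlane.D.proj, cliftonPohl.D.proj, polarDeck.proj, polarCover, ?_,
      puncturedPlane_not_compactSpace, puncturedQuotient_not_isFlat _ _ _ _ _ _, fun p => ?_,
      fun a b y ha hb => puncturedPlane_disjoint ha hb, ?_, cliftonPohl_compactSpace,
      puncturedQuotient_not_isFlat _ _ _ _ _ _, fun x hx h => puncturedQuotient_N _ _ _ _ _ _ hx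
          (.inr h), fun x => cliftonPohl_N_off_axis,
      fun x => cliftonPohl_leaf₁_isCompact_iff, fun x => cliftonPohl_leaf₂_isCompact_iff,
      fun a b => cliftonPohl_disjoint, polarDeck.isLocalDiffeomorphOn_proj, polarDeck.image_proj,
      fun x y => polarDeck_proj_eq_iff, polarCover_presented.isLocalIso
          polarCover_isLocalDiffeomorph,
      fun x hx => (polarCover_proj hx).trans (by rw [polarMap_eq]),
      cliftonPohlCylinder_not_compactSpace, cliftonPohlCylinder_not_isFlat,
      fun x => cliftonPohlCylinder_N_axis, fun x => cliftonPohlCylinder_N_off_axis⟩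
    · exact puncturedPlane.isQuotientOf rfl
        (fun x hx y hy => (AffineDeck.proj_eq_iff (D := puncturedPlane.D) hx hy).symm.trans
          (puncturedPlane_proj_eq_iff hx hy))
        (fun x _ a b => puncturedQuotient_metric _ _ _ _ _ _ x a b) fun _ _ _ => rfl
    · obtain ⟨x, hx, rfl⟩ := AffineDeck.exists_rep _ p
      exact puncturedQuotient_N _ _ _ _ _ _ hx (.inl fun _ => rfl)
    · exact cliftonPohl.isQuotientOf rfl (fun x hx y hy => cliftonPohl_rel_iff)
        (fun x _ a b => puncturedQuotient_metric _ _ _ _ _ _ x a b) fun _ _ _ => rfl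
  · exact ⟨(schwarzschild hm).manifold (by simp) ⟨⟨0, mem_univ _⟩, isPreconnected_univ⟩, _,
      schwarzschild_isQuotientOf hm, schwarzschild_not_compactSpace hm, schwarzschild_not_isFlat hm,
      fun p => schwarzschild_leaf_inter hm p p, schwarzschild_leaf_inter hm⟩
  · obtain ⟨M, i1, i2, i3, π, B, h1, h2, h3, h4, h5, h6, h7, h8⟩ :=
      exists_compact_flatQuotient (latticeGroup n) one_pos
        (fun γ hγ => translation_separated (mem_latticeGroup hγ).choose_spec)
        (fun k γ hγ => Subgroup.subset_closure ⟨k, hγ⟩) hn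
    refine ⟨M, i1, i2, i3, π, B, h1, h2, h3, h4, h5, h6, fun u => ?_⟩
    obtain ⟨⟨x, v⟩, rfl⟩ := h7 u
    rw [h8, encard_eq_one]
    refine ⟨v, Subset.antisymm ?_ ?_⟩
    · rintro _ ⟨γ, hγ, rfl⟩
      obtain ⟨k, hk⟩ := mem_latticeGroup hγ
      ext i
      rw [linearIsometryEquiv_apply_of_affine (s := fun _ => 1) (t := fun i => k i)
        (fun x i => by rw [hk, one_mul]), one_mul]
    · rintro _ rfl
      exact ⟨1, one_mem _, rfl⟩
  · obtain ⟨M, i1, i2, i3, π, B, h1, h2, h3, h4, h5, h6, -, h8⟩ :=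
      exists_compact_flatQuotient (hantzscheWendtGroup n) (ε := 1 / 2) (by norm_num) (fun γ hγ => by
          obtain ⟨a, b, h⟩ := exists_isHW hγ
          exact h.separated hn)
        (fun k γ hγ => Subgroup.subset_closure (Or.inl (Or.inl ⟨k, hγ⟩))) (by omega)
    refine ⟨M, i1, i2, i3, π, B, h1, h2, h3, h4, h5, h6, fun x v hv => ?_⟩
    obtain ⟨i, j, hij, hj, hvi, hvj⟩ := hv
    let f : Bool × Bool → 𝔼 n := fun c =>
      WithLp.toLp 2 fun i => boolSign (hwFlip i c.1 c.2) * v i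
    have hlin : ∀ {γ : 𝔼 n ≃ᵃⁱ[ℝ] 𝔼 n} {a b : Bool},
        IsHW γ a b → γ.linearIsometryEquiv v = f (a, b) := fun ⟨m, hm⟩ => by
      ext i
      exact linearIsometryEquiv_apply_of_affine hm v i
    have hrange : {w | ∃ γ ∈ hantzscheWendtGroup n, γ.linearIsometryEquiv v = w} = f '' univ := by
      refine Subset.antisymm ?_ ?_
      · rintro _ ⟨γ, hγ, rfl⟩
        obtain ⟨a, b, h⟩ := exists_isHW hγ
        exact ⟨(a, b), mem_univ _, (hlin h).symm⟩
      · rintro _ ⟨⟨a, b⟩, -, rfl⟩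
        obtain ⟨γ, hγ, h⟩ := exists_mem_hantzscheWendt n a b
        exact ⟨γ, hγ, hlin h⟩
    have hinj : Function.Injective f := by
      rintro ⟨a, b⟩ ⟨a', b'⟩ hab
      have hs : ∀ i : Fin n, v i ≠ 0 → hwFlip i a b = hwFlip i a' b' := fun i hi => by
        have h : boolSign (hwFlip i a b) * v i = boolSign (hwFlip i a' b') * v i :=
          congrArg (fun w : 𝔼 n => w i) hab
        have h := mul_right_cancel₀ hi h
        generalize hwFlip i a b = p at h
        generalize hwFlip i a' b' = q at h
        cases p <;> cases q <;> simp [boolSign] at h ⊢ <;> norm_num at h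
      have hi := hs i hvi
      have hj' := hs j hvj
      have hij : (i : ℕ) < j := hij
      obtain ⟨e1, e2⟩ | ⟨e1, e2⟩ | ⟨e1, e2⟩ : ((i : ℕ) = 0 ∧ (j : ℕ) = 1) ∨
          ((i : ℕ) = 0 ∧ (j : ℕ) = 2) ∨ ((i : ℕ) = 1 ∧ (j : ℕ) = 2) := by omega
      all_goals
        rw [e1] at hi
        rw [e2] at hj'
        simp only [hwFlip] at hi hj'
        revert hi hj'
        clear hs hab
        revert a b a' b'
        decide
    rw [h8, hrange, hinj.encard_image, encard_univ, ENat.card_eq_coe_fintype_card]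
    rfl
  · have := paraOpen_connectedSpace hn
    refine ⟨{ E := ParaHyper n × ParaHyper n
              dim_eq := by rw [Module.finrank_prod, finrank_euclideanSpace_fin, two_mul]
              H := _
              I := (𝓡 n).prod (𝓡 n)
              M := paraOpen n
              str := paraStr n hc }, paraEmb,
      ⟨contMDiff_paraEmb, fun p v w hvw => ?_, paraEmb_isEmbedding, range_paraEmb⟩,
      (paraPair_presented hc).g_eq, paraStr_mem_D₁ hc, paraStr_mem_D₂ hc,
      paraOpen_not_compactSpace hn, paraStr_not_isFlat hc hn, paraStr_N hc⟩
    obtain ⟨A, ψ, z, hz, rfl, hA⟩ := paraPair_presented hc p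
    obtain ⟨a, rfl⟩ := (hA z hz).modelsAt.equiv.surjective v
    obtain ⟨b, rfl⟩ := (hA z hz).modelsAt.equiv.surjective w
    refine congrArg _ ((AdaptedModel.metric_nondeg hz).eq_of_forall fun d => ?_)
    refine ((hA z hz).metric a d).symm.trans (Eq.trans ?_ ((hA z hz).metric b d))
    exact congrArg (fun v => paracomplexMetric c (paraEmb (ψ z)) v _) hvw
  · rintro ⟨-, htor, hlor, -, ⟨P, T, C, -, ψ, χ, -, -, -, -, -, -, -, hTc, hTf, -, hTN, -, -, -, -,
        -,
      -, -, -, hCc, hCf, -, hCN⟩, -⟩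
    refine exists_independent fun c f => ?_
    by_cases hc : c <;> by_cases hf : f
    · obtain ⟨S, ψ, -, h1, h2, -, h3, -⟩ := htor 0
      refine ⟨S, iff_of_true h1 hc, iff_of_true h2 hf, ψ 0, ?_⟩
      rw [h3 rfl]
      norm_num
    · refine ⟨T, iff_of_true hTc hc, iff_of_false hTf hf, ψ (1, 1), ?_⟩
      rw [hTN _ (by norm_num)]
      exact ENat.top_ne_one
    · obtain ⟨S, ψ, -, h1, h2, h3⟩ := hlor
      refine ⟨S, iff_of_false h1 hc, iff_of_true h2 hf, ψ 0, ?_⟩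
      rw [h3]
      exact ENat.top_ne_one
    · refine ⟨C, iff_of_false hCc hc, iff_of_false hCf hf, χ (1, Real.pi / 4), ?_⟩
      rw [hCN _ one_pos (by
        rw [Real.cos_pi_div_four, Real.sin_pi_div_four]
        positivity)]
      exact ENat.top_ne_one

end
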